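/- **Classical algorithm for noisy quantum circuits with spatial disorder.** *Circuits.* A noisy circuit on $n\ge 1$ qubits of depth $d$ is $\mathcal C\{\rho\}=\mathcal D_0\{U_1\,\mathcal D_1\{\cdots U_d\,\mathcal D_d\{\rho\}\,U_d^\dagger\cdots\}U_1^\dagger\}$, where each $U_t$ is a layer of two-qubit gates on disjoint pairs of qubits and $\mathcal D_t$ is a product of single-qubit depolarizing channels $\mathcal D_j\{\rho\}=e^{-\gamma}\rho+(1-e^{-\gamma})\tfrac{\mathbb 1_j}{2}\otimes\operatorname{tr}_j\rho$ with $\gamma>0$. For *uniform noise* every $\mathcal D_t$ acts on all qubits. For *gate-based noise* $\mathcal D_t$ ($t\ge 1$) acts on the qubits on which $U_t$ has a gate, and the read-out noise $\mathcal D_0$ acts on all qubits. *Disorder.* For a Pauli operator $P$, the circuit $\mathcal C^P$ is obtained from $\mathcal C$ by $U_t\mapsto P^\dagger U_tP$ in every layer, with the noise unchanged. An ensemble of circuits (a random circuit with fixed $n,d,\gamma$) has *spatial disorder* if $\mathcal C^P$ and $\mathcal C$ have the same law, as sequences of layer unitaries and noise positions, for every single-qubit Pauli operator $P$. It has *spatial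 disorder on a state $\rho$* if this holds for all $P$ in a set $\mathcal E_P$ of $n$-qubit Pauli operators with $\frac1{|\mathcal E_P|}\sum_{P\in\mathcal E_P}P\rho P^\dagger=\mathbb 1/2^n$. *Computation.* Write $O=\sum_Q c_QQ$ in the Pauli basis and $\|O\|_{\mathrm{Pauli},1}=\sum_Q|c_Q|$. Algorithms are uniform programs (one program for all inputs) on a random-access machine with exact real arithmetic at unit cost. They have unit-cost access to $n$, $d$, $e^{-\gamma}$, $\varepsilon$, the positions and matrix entries of the gates, and the Pauli coefficients $\operatorname{tr}(\rho P)$ and $c_P$ of $\rho$ and $O$ ("efficiently computable Pauli coefficients"). **Statement.** Let $\rho$ be a fixed state, $O$ an observable, and let an ensemble of noisy circuits have spatial disorder, or spatial disorder on $\rho$. Put $\gamma_0=\min(\gamma,\tfrac12)$. There are classical algorithms and an absolute constant $K$ with the following properties. On every circuit $\mathcal C$ of the ensemble the algorithm halts within the stated time, and its output approximates $\operatorname{tr}(\mathcal C\{\rho\}O)$ with root-mean-square error at most $\varepsilon\,\|O\|_{\mathrm{Pauli},1}$ over the ensemble. 1. Uniform noise, $0<\varepsilon\le1$, and $O$ supplied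 as a list of $m$ real multiples of Pauli operators whose sum is $O$: time $$K\,(n+m)^{K}\,(1/\varepsilon)^{K\log(1/\gamma_0)/\gamma_0^2}$$ (hence $\mathrm{poly}(n)\cdot(1/\varepsilon)^{O(\log(1/\gamma_0)/\gamma_0^2)}$ if $m=\mathrm{poly}(n)$). 2. Uniform noise, $0<\varepsilon\le1$, any $O$: time $$K\,n^{K\frac{\log(1/\gamma_0)}{\gamma_0}+K\frac{\log(1/\varepsilon)}{\gamma_0(d+1)}}\,(1/\varepsilon)^{K\log(1/\gamma_0)/\gamma_0^2}.$$ 3. Gate-based noise, $\varepsilon>0$, any $O$: time $$K\,(d+1)\,n^{\ell},\qquad \ell=\max\left(0,\ \left\lceil \tfrac1\gamma\log\tfrac{\sqrt{d+1}}{\varepsilon}\right\rceil-1\right).$$ -/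

import Mathlib

open MeasureTheory

namespace NoisyCircuits

noncomputable section

/-! ### Pauli strings, operators on `n` qubits -/

/-- Operators on `n` qubits, in the computational basis. -/
abbrev Op (n : ℕ) : Type := Matrix (Fin n → Fin 2) (Fin n → Fin 2) ℂ

/-- The Borel structure, entry by entry. -/
instance (n : ℕ) : MeasurableSpace (Op n) :=
  inferInstanceAs (MeasurableSpace ((Fin n → Fin 2) → (Fin n → Fin 2) → ℂ))

/-- The single-qubit operators `1, X, Y, Z`, numbered `0, 1, 2, 3`. -/
def pauliMatrix : Fin 4 → Matrix (Fin 2) (Fin 2) ℂ :=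
  ![1, !![0, 1; 1, 0], !![0, -Complex.I; Complex.I, 0], !![1, 0; 0, -1]]

/-- A Pauli string, one letter in `{0, 1, 2, 3}` for each qubit. -/
abbrev PauliString (n : ℕ) : Type := Fin n → Fin 4

/-- The tensor product of the letters of a Pauli string. -/
def PauliString.op {n : ℕ} (P : PauliString n) : Op n :=
  fun x y => ∏ j, pauliMatrix (P j) (x j) (y j)

/-- The string with letter `a` on qubit `i` and the identity elsewhere. -/
def PauliString.single {n : ℕ} (i : Fin n) (a : Fin 4) : PauliString n :=
  Function.update (fun _ => 0) i a

/-- The coefficient `c_Q = tr(Q O) / 2^n` of `Q` in `O = ∑_Q c_Q Q`. -/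
def pauliCoeff {n : ℕ} (O : Op n) (Q : PauliString n) : ℂ :=
  (Q.op * O).trace / 2 ^ n

/-- The Pauli 1-norm `∑_Q |c_Q|`. -/
def pauliOneNorm {n : ℕ} (O : Op n) : ℝ := ∑ Q : PauliString n, ‖pauliCoeff O Q‖

open scoped ComplexOrder in
/-- Density operators. -/
def IsState {n : ℕ} (ρ : Op n) : Prop := ρ.PosSemidef ∧ ρ.trace = 1

/-! ### Noisy circuits -/

/-- A depth-one layer of two-qubit gates. Qubit `i` shares a gate with `partner i`, and is idle if
`partner i = i`. For `i < partner i`, the gate on this pair is `gate i`, where the first tensor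
factor is qubit `i`; the other values of `gate` are not used. -/
structure Layer (n : ℕ) where
  partner : Fin n → Fin n
  partner_partner : ∀ i, partner (partner i) = i
  gate : Fin n → Matrix.unitaryGroup (Fin 2 × Fin 2) ℂ

/-- The unitary of a layer: the tensor product of its gates, and of identities on idle qubits. -/
def Layer.unitary {n : ℕ} (L : Layer n) : Op n := fun x y =>
  ∏ i, if i < L.partner i then
      (L.gate i).1 (x i, x (L.partner i)) (y i, y (L.partner i))
    else if L.partner i = i then (if x i = y i then 1 else 0)
    else 1

/-- A circuit with `d` layers; `C 0` is the last layer that is applied. -/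
abbrev Circuit (n d : ℕ) : Type := Fin d → Layer n

/-- The two noise models. -/
inductive NoiseModel where
  | uniform
  | gateBased

/-- The qubits on which the noise that accompanies a layer acts. -/
def NoiseModel.noisyQubits (N : NoiseModel) {n : ℕ} (L : Layer n) : Fin n → Bool :=
  match N with
  | .uniform => fun _ => true
  | .gateBased => fun i => decide (L.partner i ≠ i)

/-- The depolarizing channel `ρ ↦ q ρ + (1 - q) (1/2)_j ⊗ tr_j ρ` on qubit `j`. -/
def depolarize {n : ℕ} (q : ℝ) (j : Fin n) (ρ : Op n) : Op n := fun x y =>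
  (q : ℂ) * ρ x y + (1 - (q : ℂ)) *
    (if x j = y j then
      (∑ b : Fin 2, ρ (Function.update x j b) (Function.update y j b)) / 2 else 0)

/-- The depolarizing channel on all qubits of the set `S`. -/
def depolarizeOn {n : ℕ} (q : ℝ) (S : Fin n → Bool) (ρ : Op n) : Op n :=
  ((List.finRange n).filter S).foldr (depolarize q) ρ

/-- `D_0 { U_1 D_1 { ⋯ U_d D_d { ρ } U_d† ⋯ } U_1† }`, with depolarizing noise of strength `γ`. -/
def Circuit.apply {n d : ℕ} (N : NoiseModel) (γ : ℝ) (C : Circuit n d) (ρ : Op n) : Op n :=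
  depolarizeOn (Real.exp (-γ)) (fun _ => true)
    ((List.ofFn C).foldr
      (fun L σ =>
        L.unitary * depolarizeOn (Real.exp (-γ)) (N.noisyQubits L) σ * L.unitary.conjTranspose) ρ)

/-! ### Ensembles with spatial disorder -/

/-- The unitaries `U_t` of a circuit, together with the positions of the noise. -/
def Circuit.layers {n d : ℕ} (N : NoiseModel) (C : Circuit n d) :
    Fin d → Op n × (Fin n → Bool) :=
  fun t => ((C t).unitary, N.noisyQubits (C t))

/-- Conjugation by a Pauli string, `U_t ↦ P† U_t P` in every layer. -/
def conjLayers {n d : ℕ} (P : PauliString n) (c : Fin d → Op n × (Fin n → Bool)) :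
    Fin d → Op n × (Fin n → Bool) :=
  fun t => (P.op.conjTranspose * (c t).1 * P.op, (c t).2)

section Ensembles

variable {Ω : Type*} [MeasurableSpace Ω] {n d : ℕ}

/-- The random circuit `C` and its conjugate by `P` have the same law. -/
def InvariantUnder (N : NoiseModel) (μ : Measure Ω) (C : Ω → Circuit n d)
    (P : PauliString n) : Prop :=
  μ.map (fun ω => conjLayers P ((C ω).layers N)) = μ.map (fun ω => (C ω).layers N)

/-- Spatial disorder: invariance under conjugation by all single-qubit Pauli operators. -/
def HasSpatialDisorder (N : NoiseModel) (μ : Measure Ω) (C : Ω → Circuit n d) : Prop :=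
  ∀ (i : Fin n) (a : Fin 4), InvariantUnder N μ C (PauliString.single i a)

/-- Spatial disorder on a state: invariance under conjugation by a set of Pauli operators that
averages `ρ` to the maximally mixed state. -/
def HasSpatialDisorderOn (N : NoiseModel) (μ : Measure Ω) (C : Ω → Circuit n d)
    (ρ : Op n) : Prop :=
  ∃ S : Finset (PauliString n),
    (∀ P ∈ S, InvariantUnder N μ C P) ∧
    (S.card : ℂ)⁻¹ • ∑ P ∈ S, P.op * ρ * P.op.conjTranspose = ((2 : ℂ) ^ n)⁻¹ • (1 : Op n)

end Ensembles

/-! ### The machine model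

A real random-access machine. Its memory consists of named arrays of natural numbers and of named
arrays of real numbers, all unbounded and initially zero; a program can only name finitely many of
them. On natural numbers it can add, subtract and compare, and on real numbers it has exact
arithmetic and comparison. It has random access to the description of the circuit and to the Pauli
coefficients of the state and of the observable. Each assignment and each test is one step. -/

/-- What the machine has access to. -/
structure Input (n d : ℕ) where
  circuit : Circuit n d
  /-- the noise factor `e^{-γ}` -/
  damping : ℝ
  /-- the target accuracy -/
  accuracy : ℝ
  stateCoeff : PauliString n → ℝ
  obsCoeff : PauliString n → ℝ
  /-- an explicit list of Pauli terms of the observable (empty if none is supplied) -/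
  terms : List (PauliString n × ℝ)

/-- Expressions for natural numbers. -/
inductive NExp where
  | const (k : ℕ)
  /-- cell `i` of the array of natural numbers with name `a` -/
  | read (a : ℕ) (i : NExp)
  | add (e f : NExp)
  /-- truncated subtraction -/
  | sub (e f : NExp)
  | numQubits
  | depth
  | numTerms
  /-- the partner of qubit `i` in layer `t` -/
  | partner (t i : NExp)
  /-- the letter of the `k`-th term on qubit `i` -/
  | termLetter (k i : NExp)

/-- Expressions for real numbers. -/
inductive RExp where
  | const (k : ℚ)
  /-- cell `i` of the array of real numbers with name `a` -/
  | read (a : ℕ) (i : NExp)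
  | cast (e : NExp)
  | add (e f : RExp)
  | sub (e f : RExp)
  | mul (e f : RExp)
  | div (e f : RExp)
  | damping
  | accuracy
  /-- real part of an entry of gate `i` of layer `t` -/
  | gateRe (t i row col : NExp)
  /-- imaginary part of an entry of gate `i` of layer `t` -/
  | gateIm (t i row col : NExp)
  | termCoeff (k : NExp)
  /-- the coefficient `tr(ρ P)`, where `P` is the Pauli string written in array `a` -/
  | stateCoeff (a : ℕ)
  /-- the coefficient `tr(O P)/2^n`, where `P` is the Pauli string written in array `a` -/
  | obsCoeff (a : ℕ)

/-- Tests. -/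
inductive Test where
  | natLt (e f : NExp)
  | realLt (e f : RExp)
  | not (b : Test)

/-- Programs. -/
inductive Cmd where
  | skip
  /-- write `e` into cell `i` of the array of natural numbers with name `a` -/
  | setNat (a : ℕ) (i : NExp) (e : NExp)
  /-- write `e` into cell `i` of the array of real numbers with name `a` -/
  | setReal (a : ℕ) (i : NExp) (e : RExp)
  | seq (c c' : Cmd)
  | ite (b : Test) (c c' : Cmd)
  | while (b : Test) (c : Cmd)

/-- The contents of the memory: name of the array, then index of the cell. -/
structure Memory where
  nat : ℕ → ℕ → ℕ
  real : ℕ → ℕ → ℝ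

/-- The Pauli string whose letters (modulo 4) are the first `n` cells of an array. -/
def readPauli (n : ℕ) (v : ℕ → ℕ) : PauliString n := fun j => Fin.ofNat 4 (v j)

section Semantics

variable {n d : ℕ}

/-- Entry of a gate; rows and columns `0, 1, 2, 3` stand for the basis states `00, 01, 10, 11`.
Out of range, the value is `0`. -/
def gateEntry (C : Circuit n d) (t i row col : ℕ) : ℂ :=
  if h : t < d ∧ i < n then
    ((C ⟨t, h.1⟩).gate ⟨i, h.2⟩).1
      (Fin.ofNat 2 (row / 2), Fin.ofNat 2 row) (Fin.ofNat 2 (col / 2), Fin.ofNat 2 col)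
  else 0

/-- Value of an expression for natural numbers. -/
def NExp.eval (x : Input n d) (s : Memory) : NExp → ℕ
  | .const k => k
  | .read a i => s.nat a (i.eval x s)
  | .add e f => e.eval x s + f.eval x s
  | .sub e f => e.eval x s - f.eval x s
  | .numQubits => n
  | .depth => d
  | .numTerms => x.terms.length
  | .partner t i =>
      if h : t.eval x s < d ∧ i.eval x s < n then
        ((x.circuit ⟨t.eval x s, h.1⟩).partner ⟨i.eval x s, h.2⟩ : ℕ)
      else 0
  | .termLetter k i =>
      if h : k.eval x s < x.terms.length ∧ i.eval x s < n then
        ((x.terms.get ⟨k.eval x s, h.1⟩).1 ⟨i.eval x s, h.2⟩ : ℕ)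
      else 0

/-- Value of an expression for real numbers. -/
def RExp.eval (x : Input n d) (s : Memory) : RExp → ℝ
  | .const k => (k : ℝ)
  | .read a i => s.real a (i.eval x s)
  | .cast e => (e.eval x s : ℝ)
  | .add e f => e.eval x s + f.eval x s
  | .sub e f => e.eval x s - f.eval x s
  | .mul e f => e.eval x s * f.eval x s
  | .div e f => e.eval x s / f.eval x s
  | .damping => x.damping
  | .accuracy => x.accuracy
  | .gateRe t i r c =>
      (gateEntry x.circuit (t.eval x s) (i.eval x s) (r.eval x s) (c.eval x s)).re
  | .gateIm t i r c =>
      (gateEntry x.circuit (t.eval x s) (i.eval x s) (r.eval x s) (c.eval x s)).im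
  | .termCoeff k =>
      if h : k.eval x s < x.terms.length then (x.terms.get ⟨k.eval x s, h⟩).2 else 0
  | .stateCoeff a => x.stateCoeff (readPauli n (s.nat a))
  | .obsCoeff a => x.obsCoeff (readPauli n (s.nat a))

/-- Truth of a test. -/
def Test.holds (x : Input n d) (s : Memory) : Test → Prop
  | .natLt e f => e.eval x s < f.eval x s
  | .realLt e f => e.eval x s < f.eval x s
  | .not b => ¬ b.holds x s

/-- `Exec x c s k s'`: started in memory `s`, program `c` halts after `k` steps in memory `s'`. -/
inductive Exec (x : Input n d) : Cmd → Memory → ℕ → Memory → Prop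
  | skip (s : Memory) : Exec x .skip s 1 s
  | setNat (a : ℕ) (i e : NExp) (s : Memory) :
      Exec x (.setNat a i e) s 1
        ⟨Function.update s.nat a (Function.update (s.nat a) (i.eval x s) (e.eval x s)), s.real⟩
  | setReal (a : ℕ) (i : NExp) (e : RExp) (s : Memory) :
      Exec x (.setReal a i e) s 1
        ⟨s.nat, Function.update s.real a (Function.update (s.real a) (i.eval x s) (e.eval x s))⟩
  | seq {c c' : Cmd} {s s' s'' : Memory} {k k' : ℕ} (h : Exec x c s k s')
      (h' : Exec x c' s' k' s'') : Exec x (.seq c c') s (k + k') s''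
  | iteTrue {b : Test} {c c' : Cmd} {s s' : Memory} {k : ℕ} (hb : b.holds x s)
      (h : Exec x c s k s') : Exec x (.ite b c c') s (k + 1) s'
  | iteFalse {b : Test} {c c' : Cmd} {s s' : Memory} {k : ℕ} (hb : ¬ b.holds x s)
      (h : Exec x c' s k s') : Exec x (.ite b c c') s (k + 1) s'
  | whileTrue {b : Test} {c : Cmd} {s s' s'' : Memory} {k k' : ℕ} (hb : b.holds x s)
      (h : Exec x c s k s') (h' : Exec x (.while b c) s' k' s'') :
      Exec x (.while b c) s (k + k' + 1) s''
  | whileFalse {b : Test} {c : Cmd} {s : Memory} (hb : ¬ b.holds x s) :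
      Exec x (.while b c) s 1 s

/-- On input `x`, the program halts after `k` steps with output `v`, which is read off cell `0` of
the array of real numbers with name `0`. -/
def Computes (x : Input n d) (c : Cmd) (k : ℕ) (v : ℝ) : Prop :=
  ∃ s : Memory, Exec x c ⟨fun _ _ => 0, fun _ _ => 0⟩ k s ∧ s.real 0 0 = v

end Semantics

/-! ### Simulation of an ensemble -/

/-- The input for the circuit `C`, the state `ρ` and the observable `O`. -/
def mkInput {n d : ℕ} (C : Circuit n d) (γ ε : ℝ) (ρ O : Op n)
    (terms : List (PauliString n × ℝ)) : Input n d where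
  circuit := C
  damping := Real.exp (-γ)
  accuracy := ε
  stateCoeff := fun P => (ρ * P.op).trace.re
  obsCoeff := fun P => (pauliCoeff O P).re
  terms := terms

/-- On every circuit of the ensemble the program halts within time `T`, and over the ensemble its
output has root-mean-square distance at most `ε ‖O‖_{Pauli,1}` to the expectation value
`tr(C{ρ} O)`. -/
def Simulates {Ω : Type*} [MeasurableSpace Ω] {n d : ℕ} (c : Cmd) (N : NoiseModel)
    (μ : Measure Ω) (C : Ω → Circuit n d) (γ ε : ℝ) (ρ O : Op n)
    (terms : List (PauliString n × ℝ)) (T : ℝ) : Prop :=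
  ∃ out : Ω → ℝ, Measurable out ∧
    (∀ ω, ∃ k : ℕ, (k : ℝ) ≤ T ∧ Computes (mkInput (C ω) γ ε ρ O terms) c k (out ω)) ∧
    eLpNorm (fun ω => (out ω : ℂ) - ((C ω).apply N γ ρ * O).trace) 2 μ ≤
      ENNReal.ofReal (ε * pauliOneNorm O)

end

end NoisyCircuits

open NoisyCircuits

/-! Work in the Heisenberg picture and in the Pauli basis, with q = e^(-γ). Depolarizing noise is
diagonal there: it multiplies a string by q to the number of its nontrivial letters on noisy qubits
(`trace_depolarizeOn`). A layer of gates is a real orthogonal matrix `heis` that factorizes over the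
gates (`Layer.heis_unitary`, `sum_heis_sq`) and fixes the identity string. Hence tr(C{ρ}O) is a sum
over Pauli paths (`trace_apply`), and the algorithms compute truncations of this sum.

Disorder reduces the mean-square error to an operator norm. For a fixed circuit and a fixed output
string, the error of a truncation is a linear functional tr(ρA) of the state. Conjugating the
circuit by P only inserts signs and amounts, up to an overall sign, to replacing ρ by PρP†.
Averaging |tr(σA)|² ≤ tr(σA†A) over the set of Pauli operators that mixes ρ gives at most
tr(A†A)/2^n, the squared Euclidean norm of the Pauli coefficients of A. So `eLpNorm_le_of_disorder`
asks only for a bound error² ≤ ε²·|r|² for arbitrary vectors r in place of the coefficients of ρ.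
Minkowski's inequality over the strings of O then produces the Pauli 1-norm
(`eLpNorm_sum_le_of_disorder`).

These bounds use that orthogonal layers do not increase norms. For uniform noise, paths of total
weight above a budget ℓ are dropped. Sorting paths by total weight gives one vector per degree, with
total squared norm at most one (`exists_graded`), so the tail is a geometric series and the error is
at most q^(ℓ+1)/(1-q) (`sq_budget_error_le`). If q^(d+1) is already at most ε, the identity string
alone suffices (`sq_budget_error_zero_le`); otherwise d + 1 is at most log(1/ε)/γ₀. For gate-based
noise, strings of weight above w are dropped at each of the d + 1 positions. The read-out noise can
be pushed through the layers, so every dropped part is damped by q^(w+1); Cauchy–Schwarz over the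
positions costs a factor √(d+1) (`sq_sum_cut_error_le`).

Running times. A string of weight k has at most 16^k successors through a layer, because each letter
brings in at most one block with at most 16 replacements. With a budget, the sum of 16^(remaining
budget) over all paths therefore never grows (`Layer.size_extendPaths_le`), and there are at most
16^ℓ paths per start, whatever the depth. If the terms of O are not listed, one uses that a path of
total weight at most ℓ has a string of weight at most ℓ/(d+1): starting from all such light strings
at all positions and following the layers towards the observable finds every string of O that can
contribute (`exists_mem_backPaths`). For gate-based noise a table over all strings of weight at most
w is propagated from the state through the layers. The sum of 16^weight over these strings is at
most e^48·n^w (`stringCount_le`). They are kept in a tree in which adding a lowest letter gives a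
child, so that a string is loaded in time proportional to its weight and no further factor n
appears.

The programs are verified by a small calculus of total correctness with step counts (`Runs`), in
which the arrays that a program leaves alone are read off its syntax (`Exec.frame`). -/

namespace NoisyCircuits

noncomputable section

/-! ### Pauli algebra -/

/-- Tensor product of single-qubit operators. -/
def tens {n : ℕ} (M : Fin n → Matrix (Fin 2) (Fin 2) ℂ) : Op n := fun x y => ∏ j, M j (x j) (y j)

theorem sum_pi_prod {ι β R : Type*} [Fintype ι] [DecidableEq ι] [Fintype β] [CommSemiring R]
    (f : ι → β → R) : ∑ u : ι → β, ∏ i, f i (u i) = ∏ i, ∑ b, f i b := by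
  rw [Finset.prod_univ_sum, Fintype.piFinset_univ]

theorem tens_mul {n : ℕ} (M N : Fin n → Matrix (Fin 2) (Fin 2) ℂ) :
    tens M * tens N = tens fun j => M j * N j := by
  ext x y
  simp only [Matrix.mul_apply, tens, ← Finset.prod_mul_distrib]
  exact sum_pi_prod fun j b => M j (x j) b * N j b (y j)

theorem trace_tens {n : ℕ} (M : Fin n → Matrix (Fin 2) (Fin 2) ℂ) :
    (tens M).trace = ∏ j, (M j).trace := by
  simp only [Matrix.trace, Matrix.diag, tens]
  exact sum_pi_prod fun j b => M j b b

theorem tens_conjTranspose {n : ℕ} (M : Fin n → Matrix (Fin 2) (Fin 2) ℂ) :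
    (tens M).conjTranspose = tens fun j => (M j).conjTranspose := by
  ext x y
  simp [tens, Matrix.conjTranspose_apply]

theorem tens_one {n : ℕ} : tens (fun _ : Fin n => 1) = 1 := by
  ext x y
  simp only [tens, Matrix.one_apply]
  rw [Finset.prod_ite_zero]
  simp [funext_iff]

theorem tens_smul {n : ℕ} (c : Fin n → ℂ) (M : Fin n → Matrix (Fin 2) (Fin 2) ℂ) :
    tens (fun j => c j • M j) = (∏ j, c j) • tens M := by
  ext x y
  simp [tens, Finset.prod_mul_distrib]

theorem PauliString.op_eq_tens {n : ℕ} (P : PauliString n) :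
    P.op = tens fun j => pauliMatrix (P j) := rfl

/-- The sign of the commutation relation of two letters. -/
def letterSign (a b : Fin 4) : ℝ := if a = 0 ∨ b = 0 ∨ a = b then 1 else -1

/-- The sign of the commutation relation of two Pauli strings. -/
def PauliString.sign {n : ℕ} (P Q : PauliString n) : ℝ := ∏ j, letterSign (P j) (Q j)

/-- The number of letters that are not the identity. -/
def PauliString.weight {n : ℕ} (P : PauliString n) : ℕ :=
  (Finset.univ.filter fun j => P j ≠ 0).card

theorem letterSign_mul_self (a b : Fin 4) : letterSign a b * letterSign a b = 1 := by
  unfold letterSign; split <;> norm_num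

theorem PauliString.sign_mul_self {n : ℕ} (P Q : PauliString n) : P.sign Q * P.sign Q = 1 := by
  simp [sign, ← Finset.prod_mul_distrib, letterSign_mul_self]

theorem pauliMatrix_hermitian (a : Fin 4) : (pauliMatrix a).conjTranspose = pauliMatrix a := by
  ext x y
  fin_cases a <;> fin_cases x <;> fin_cases y <;> simp [pauliMatrix]

theorem pauliMatrix_mul_self (a : Fin 4) : pauliMatrix a * pauliMatrix a = 1 := by
  ext x y
  fin_cases a <;> fin_cases x <;> fin_cases y <;> simp [pauliMatrix]

theorem pauliMatrix_conj (a b : Fin 4) :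
    pauliMatrix a * pauliMatrix b * pauliMatrix a = (letterSign a b : ℂ) • pauliMatrix b := by
  ext x y
  fin_cases a <;> fin_cases b <;> fin_cases x <;> fin_cases y <;>
    simp [pauliMatrix, letterSign]

theorem trace_pauliMatrix_mul (a b : Fin 4) :
    (pauliMatrix a * pauliMatrix b).trace = if a = b then 2 else 0 := by
  fin_cases a <;> fin_cases b <;>
    norm_num [pauliMatrix, Matrix.trace, Fin.sum_univ_two, Matrix.mul_apply]

theorem pauliMatrix_two : pauliMatrix 2 = !![0, -Complex.I; Complex.I, 0] := rfl

theorem pauliMatrix_three : pauliMatrix 3 = !![1, 0; 0, -1] := rfl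

/-- The letters form an orthogonal basis of the 2×2 matrices, so the sum of σ_a ⊗ σ_a is twice the
swap. Over all qubits, this identity gives both the Pauli expansion and the Pauli twirl. -/
theorem pauliMatrix_complete (x y z w : Fin 2) :
    ∑ a, pauliMatrix a x y * pauliMatrix a z w = if x = w ∧ y = z then 2 else 0 := by
  rw [Fin.sum_univ_four, pauliMatrix_two, pauliMatrix_three]
  fin_cases x <;> fin_cases y <;> fin_cases z <;> fin_cases w <;>
    norm_num [pauliMatrix]

/-! ### Pauli strings as an orthogonal basis of the operators -/

section
variable {n : ℕ}

theorem PauliString.op_conjTranspose (P : PauliString n) : P.op.conjTranspose = P.op := by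
  simp [op_eq_tens, tens_conjTranspose, pauliMatrix_hermitian]

theorem PauliString.op_mul_self (P : PauliString n) : P.op * P.op = 1 := by
  simp [op_eq_tens, tens_mul, pauliMatrix_mul_self, tens_one]

theorem PauliString.op_conj (P Q : PauliString n) :
    P.op * Q.op * P.op = (P.sign Q : ℂ) • Q.op := by
  simp only [op_eq_tens, tens_mul, pauliMatrix_conj, sign, Complex.ofReal_prod]
  exact tens_smul _ _

theorem PauliString.op_zero : PauliString.op (0 : PauliString n) = 1 := by
  rw [op_eq_tens, ← tens_one]; rfl

theorem PauliString.trace_op_mul (P Q : PauliString n) :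
    (P.op * Q.op).trace = if P = Q then 2 ^ n else 0 := by
  simp only [op_eq_tens, tens_mul, trace_tens, trace_pauliMatrix_mul]
  rw [Finset.prod_ite_zero]
  simp [funext_iff]

theorem PauliString.complete (x y z w : Fin n → Fin 2) :
    ∑ P : PauliString n, P.op x y * P.op z w = if x = w ∧ y = z then 2 ^ n else 0 := by
  simp only [op, ← Finset.prod_mul_distrib]
  rw [sum_pi_prod fun j a => pauliMatrix a (x j) (y j) * pauliMatrix a (z j) (w j)]
  simp only [pauliMatrix_complete]
  rw [Finset.prod_ite_zero]
  simp [funext_iff, forall_and]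

theorem pauliCoeff_op (P Q : PauliString n) : pauliCoeff P.op Q = if P = Q then 1 else 0 := by
  rw [pauliCoeff, PauliString.trace_op_mul]
  by_cases h : P = Q
  · simp [h]
  · simp [h, Ne.symm h]

theorem pauliCoeff_sum {ι : Type*} (s : Finset ι) (A : ι → Op n) (Q : PauliString n) :
    pauliCoeff (∑ i ∈ s, A i) Q = ∑ i ∈ s, pauliCoeff (A i) Q := by
  simp [pauliCoeff, Finset.mul_sum, Matrix.trace_sum, Finset.sum_div]

theorem pauliCoeff_smul (c : ℂ) (A : Op n) (Q : PauliString n) :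
    pauliCoeff (c • A) Q = c * pauliCoeff A Q := by
  simp [pauliCoeff, mul_div_assoc]

theorem sum_pauliCoeff (A : Op n) : ∑ Q, pauliCoeff A Q • Q.op = A := by
  ext x y
  simp only [Matrix.sum_apply, Matrix.smul_apply, smul_eq_mul, pauliCoeff, Matrix.trace,
    Matrix.diag, Matrix.mul_apply, Finset.sum_div, Finset.sum_mul]
  have h2 : (2 : ℂ) ^ n ≠ 0 := pow_ne_zero _ two_ne_zero
  rw [Finset.sum_comm]
  simp_rw [Finset.sum_comm (γ := PauliString n)]
  have : ∀ z w : Fin n → Fin 2, ∑ Q : PauliString n, Q.op z w * A w z / 2 ^ n * Q.op x y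
      = if z = y ∧ w = x then A x y else 0 := by
    intro z w
    rw [show ∑ Q : PauliString n, Q.op z w * A w z / 2 ^ n * Q.op x y
      = (∑ Q : PauliString n, Q.op z w * Q.op x y) * (A w z / 2 ^ n) by
        rw [Finset.sum_mul]; refine Finset.sum_congr rfl fun Q _ => by ring]
    rw [PauliString.complete]
    split_ifs with h
    · rw [h.1, h.2]; field_simp
    · simp
  simp [this, ite_and]

theorem trace_mul_eq_sum (A B : Op n) :
    (A * B).trace = ∑ Q, pauliCoeff B Q * (A * Q.op).trace := by
  conv_lhs => rw [← sum_pauliCoeff B]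
  simp [Finset.mul_sum, Matrix.trace_sum]

/-- Parseval: the strings are orthogonal with squared Hilbert–Schmidt norm 2^n. Expanding only the
second factor of A†A leaves the conjugate coefficients of A. -/
theorem sum_normSq_pauliCoeff (A : Op n) :
    (∑ Q, (‖pauliCoeff A Q‖ : ℂ) ^ 2) = (A.conjTranspose * A).trace / 2 ^ n := by
  rw [trace_mul_eq_sum, Finset.sum_div]
  refine Finset.sum_congr rfl fun Q _ => ?_
  rw [← Complex.mul_conj', mul_div_assoc]
  congr 1
  simp only [pauliCoeff, map_div₀, map_pow, Complex.conj_ofNat]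
  congr 1
  rw [← Complex.star_def, ← Matrix.trace_conjTranspose, Matrix.conjTranspose_mul,
    PauliString.op_conjTranspose]

theorem pauliCoeff_real {A : Op n} (hA : A.IsHermitian) (Q : PauliString n) :
    pauliCoeff A Q = ((pauliCoeff A Q).re : ℂ) := by
  symm
  rw [← Complex.conj_eq_iff_re]
  simp only [pauliCoeff, map_div₀, map_pow, Complex.conj_ofNat]
  congr 1
  rw [← Complex.star_def, ← Matrix.trace_conjTranspose, Matrix.conjTranspose_mul,
    PauliString.op_conjTranspose, hA.eq, Matrix.trace_mul_comm]

/-- By the completeness relation, the twirl over all strings leaves only the trace. Hence the set of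
all strings is admissible in `HasSpatialDisorderOn`, for every state. -/
theorem sum_conj_op (ρ : Op n) :
    ∑ P : PauliString n, P.op * ρ * P.op.conjTranspose = (2 ^ n * ρ.trace) • (1 : Op n) := by
  ext x y
  simp only [Matrix.sum_apply, PauliString.op_conjTranspose, Matrix.mul_apply, Matrix.smul_apply,
    smul_eq_mul, Finset.sum_mul]
  rw [Finset.sum_comm]
  simp_rw [Finset.sum_comm (γ := PauliString n)]
  have : ∀ w z : Fin n → Fin 2, ∑ P : PauliString n, P.op x z * ρ z w * P.op w y
      = if x = y ∧ z = w then 2 ^ n * ρ z z else 0 := by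
    intro w z
    rw [show ∑ Q : PauliString n, Q.op x z * ρ z w * Q.op w y
      = (∑ Q : PauliString n, Q.op x z * Q.op w y) * ρ z w by
        rw [Finset.sum_mul]; refine Finset.sum_congr rfl fun Q _ => by ring]
    rw [PauliString.complete]
    split_ifs with h
    · rw [h.2]
    · simp
  simp only [this, ite_and]
  by_cases h : x = y
  · subst h; simp [Matrix.trace, Finset.mul_sum]
  · simp [h]

/-! ### Depolarizing noise in the Pauli basis -/

/-- The triples (x, y, b) with x j = y j carry an involution that exchanges b with the common value
at j; it identifies the two sums. For the depolarizing channel it moves the replaced bits from the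
operator to the Pauli string. -/
theorem sum_update_swap {ι β M : Type*} [Fintype ι] [DecidableEq ι] [Fintype β] [DecidableEq β]
    [AddCommMonoid M] (j : ι) (F : (ι → β) → (ι → β) → β → M) :
    (∑ x : ι → β, ∑ y : ι → β, if x j = y j then
      ∑ b, F (Function.update x j b) (Function.update y j b) (x j) else 0) =
    ∑ x : ι → β, ∑ y : ι → β, if x j = y j then ∑ b, F x y b else 0 := by
  have h : ∀ G : (ι → β) → (ι → β) → β → M,
      (∑ x : ι → β, ∑ y : ι → β, if x j = y j then ∑ b, G x y b else 0) =
      ∑ p ∈ Finset.univ.filter (fun p : (ι → β) × (ι → β) × β => p.1 j = p.2.1 j),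
        G p.1 p.2.1 p.2.2 := by
    intro G
    rw [Finset.sum_filter, Fintype.sum_prod_type]
    refine Finset.sum_congr rfl fun x _ => ?_
    rw [Fintype.sum_prod_type]
    refine Finset.sum_congr rfl fun y _ => ?_
    by_cases hx : x j = y j <;> simp [hx]
  rw [h F, h fun x y b => F (Function.update x j b) (Function.update y j b) (x j)]
  refine Finset.sum_bij'
    (fun p _ => (Function.update p.1 j p.2.2, Function.update p.2.1 j p.2.2, p.1 j))
    (fun p _ => (Function.update p.1 j p.2.2, Function.update p.2.1 j p.2.2, p.1 j))
    ?_ ?_ ?_ ?_ ?_ <;> simp +contextual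

/-- A partial trace over qubit j: X, Y, Z are traceless and the identity has trace 2. -/
theorem sum_op_update (R : PauliString n) (j : Fin n) (x y : Fin n → Fin 2) (h : x j = y j) :
    ∑ b, R.op (Function.update y j b) (Function.update x j b) =
      if R j = 0 then 2 * R.op y x else 0 := by
  have h1 : ∀ b, R.op (Function.update y j b) (Function.update x j b) =
      pauliMatrix (R j) b b * ∏ i ∈ Finset.univ.erase j, pauliMatrix (R i) (y i) (x i) := by
    intro b
    rw [PauliString.op, ← Finset.mul_prod_erase _ _ (Finset.mem_univ j)]
    congr 1
    · simp
    · refine Finset.prod_congr rfl fun i hi => ?_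
      simp [Finset.ne_of_mem_erase hi]
  have h2 : R.op y x = pauliMatrix (R j) (y j) (x j) *
      ∏ i ∈ Finset.univ.erase j, pauliMatrix (R i) (y i) (x i) := by
    rw [PauliString.op, ← Finset.mul_prod_erase _ _ (Finset.mem_univ j)]
  have h3 : ∀ a : Fin 4, ∑ b, pauliMatrix a b b = if a = 0 then 2 else 0 := by
    intro a
    fin_cases a <;> norm_num [pauliMatrix, Fin.sum_univ_two]
  rw [h2]
  simp only [h1, ← Finset.sum_mul, h3]
  split_ifs with h0
  · simp [h0, h, pauliMatrix]
  · simp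

/-- The channel is self-adjoint and diagonal in the Pauli basis. Its replacement part keeps strings
with the identity at j and kills the others, so the factor is q + (1 - q) or q. -/
theorem trace_depolarize (q : ℝ) (j : Fin n) (σ : Op n) (R : PauliString n) :
    (depolarize q j σ * R.op).trace =
      ((if R j = 0 then 1 else q : ℝ) : ℂ) * (σ * R.op).trace := by
  have key : (∑ x, ∑ y, if x j = y j then
      ∑ b : Fin 2, σ (Function.update x j b) (Function.update y j b) * R.op y x else 0)
      = (if R j = 0 then 2 else 0) * ∑ x, ∑ y, σ x y * R.op y x := by
    have h1 := sum_update_swap j fun (x y : Fin n → Fin 2) (b : Fin 2) =>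
      σ x y * R.op (Function.update y j b) (Function.update x j b)
    refine Eq.trans ?_ (h1.trans ?_)
    · refine Finset.sum_congr rfl fun x _ => Finset.sum_congr rfl fun y _ => ?_
      split_ifs with h
      · refine Finset.sum_congr rfl fun b _ => ?_
        simp only [Function.update_idem]
        conv_rhs => rw [show Function.update y j (x j) = y by rw [h]; simp]
        simp
      · rfl
    · simp only [Finset.mul_sum]
      refine Finset.sum_congr rfl fun x _ => Finset.sum_congr rfl fun y _ => ?_
      rw [← Finset.mul_sum]
      split_ifs with h h0 h0
      · rw [sum_op_update R j x y h, if_pos h0]; ring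
      · rw [sum_op_update R j x y h, if_neg h0]; ring
      -- If x j ≠ y j, a string with the identity at j has the factor 0 at j, so both sides vanish.
      · rw [PauliString.op, Finset.prod_eq_zero (Finset.mem_univ j)]
        · simp
        · simp [h0, pauliMatrix, Ne.symm h]
      · simp
  simp only [Matrix.trace, Matrix.diag, Matrix.mul_apply, depolarize]
  have e : ∀ x y : Fin n → Fin 2, (↑q * σ x y + (1 - ↑q) * (if x j = y j then
        (∑ b, σ (Function.update x j b) (Function.update y j b)) / 2 else 0)) * R.op y x
      = (q : ℂ) * (σ x y * R.op y x) + ((1 - q) / 2) * (if x j = y j then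
        ∑ b, σ (Function.update x j b) (Function.update y j b) * R.op y x else 0) := by
    intro x y
    split_ifs
    · rw [← Finset.sum_mul]; ring
    · ring
  simp only [e, Finset.sum_add_distrib, ← Finset.mul_sum, key]
  split_ifs <;> push_cast <;> ring

/-- The number of letters on `S` that are not the identity. -/
def PauliString.weightOn (S : Fin n → Bool) (P : PauliString n) : ℕ :=
  (Finset.univ.filter fun j => S j = true ∧ P j ≠ 0).card

theorem PauliString.weightOn_true (P : PauliString n) : P.weightOn (fun _ => true) = P.weight := by
  simp [weightOn, weight]

theorem PauliString.weight_le (P : PauliString n) : P.weight ≤ n :=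
  (Finset.card_le_univ _).trans (by simp)

theorem PauliString.weight_eq_zero {P : PauliString n} : P.weight = 0 ↔ P = 0 := by
  simp [weight, Finset.filter_eq_empty_iff, funext_iff]

theorem trace_depolarizeOn (q : ℝ) (S : Fin n → Bool) (σ : Op n) (R : PauliString n) :
    (depolarizeOn q S σ * R.op).trace = ((q ^ R.weightOn S : ℝ) : ℂ) * (σ * R.op).trace := by
  have h : ∀ l : List (Fin n), (l.foldr (depolarize q) σ * R.op).trace =
      (((l.map fun j => if R j = 0 then 1 else q).prod : ℝ) : ℂ) * (σ * R.op).trace := by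
    intro l
    induction l with
    | nil => simp
    | cons j l ih =>
      rw [List.foldr_cons, trace_depolarize, ih, List.map_cons, List.prod_cons]
      push_cast
      ring
  rw [depolarizeOn, h]
  congr 2
  have h2 : ((List.finRange n).filter S).Nodup := (List.nodup_finRange n).filter _
  rw [← List.prod_toFinset _ h2]
  have h3 : ((List.finRange n).filter S).toFinset = Finset.univ.filter fun j => S j = true := by
    ext j; simp
  rw [h3, Finset.prod_ite, Finset.prod_const_one, one_mul, Finset.prod_const,
    Finset.filter_filter]
  rfl

end

end

noncomputable section

/-! ### Sums of products over the blocks of a pairing -/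

section Pairing

variable {n : ℕ} {β R : Type*} [CommSemiring R] {p : Fin n → Fin n}

/-- The contribution of qubit `i` to a product over the blocks of the pairing `p`. -/
def blockTerm {M : Type*} [One M] (p : Fin n → Fin n) (pair idle : Fin n → M) (i : Fin n) : M :=
  if i < p i then pair i else if p i = i then idle i else 1

/-- A block {i, p i} is represented by its smaller element; reindexing by the involution p moves the
factor of the larger element there. -/
theorem prod_eq_prod_blockTerm {M : Type*} [CommMonoid M] (hp : ∀ i, p (p i) = i) (f : Fin n → M) :
    ∏ i, f i = ∏ i, blockTerm p (fun i => f i * f (p i)) f i := by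
  have h1 : ∀ i, f i = (if i < p i then f i else 1) * (if p i = i then f i else 1) *
      (if p i < i then f i else 1) := by
    intro i
    rcases lt_trichotomy i (p i) with h | h | h
    · simp [h, h.ne', h.not_gt]
    · simp [← h]
    · simp [h, h.ne, h.not_gt]
  have h2 : ∏ i, (if p i < i then f i else 1) = ∏ i, (if i < p i then f (p i) else 1) := by
    have := Equiv.prod_comp (Function.Involutive.toPerm p hp) fun i => if p i < i then f i else 1
    rw [← this]
    refine Finset.prod_congr rfl fun i _ => ?_
    change (if p (p i) < p i then f (p i) else 1) = _
    rw [hp]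
  rw [Finset.prod_congr rfl fun i _ => h1 i, Finset.prod_mul_distrib, h2, ← Finset.prod_mul_distrib]
  refine Finset.prod_congr rfl fun i _ => ?_
  unfold blockTerm
  rcases lt_trichotomy i (p i) with h | h | h
  · simp [h, h.ne']
  · simp [← h]
  · simp [h.ne, h.not_gt]

/-- The blocks are the fibres of i ↦ min i (p i), and each factor depends on the values of u on one
fibre only, so the sum of products is a product of sums. The fibre over y has two elements, one or
none, according to whether y < p y, y = p y or p y < y. -/
theorem sum_prod_blockTerm [Fintype β] (hp : ∀ i, p (p i) = i) (pair : Fin n → β → β → R)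
    (idle : Fin n → β → R) :
    ∑ u : Fin n → β, ∏ i, blockTerm p (fun i => pair i (u i) (u (p i))) (fun i => idle i (u i)) i =
      ∏ i, blockTerm p (fun i => ∑ a, ∑ b, pair i a b) (fun i => ∑ a, idle i a) i := by
  classical
  let e := Equiv.sigmaFiberEquiv fun i => min i (p i)
  let E : (Fin n → β) ≃ ((y : Fin n) → ({x // min x (p x) = y} → β)) :=
    (Equiv.arrowCongr e.symm (Equiv.refl β)).trans (Equiv.piCurry fun _ _ => β)
  have hE : ∀ u y x, E u y x = u x.1 := fun u y x => rfl
  let F : (y : Fin n) → ({x // min x (p x) = y} → β) → R := fun y v =>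
    if h : y < p y then pair y (v ⟨y, min_eq_left h.le⟩) (v ⟨p y, by
      rw [hp]; exact min_eq_right h.le⟩) else if h : p y = y then idle y (v ⟨y, by simp [h]⟩) else 1
  have h1 : ∀ u : Fin n → β, (∏ i, blockTerm p (fun i => pair i (u i) (u (p i)))
      (fun i => idle i (u i)) i) = ∏ y, F y (E u y) := by
    intro u
    refine Finset.prod_congr rfl fun y _ => ?_
    simp only [blockTerm, F, hE]
    split_ifs <;> rfl
  simp only [h1]
  rw [Equiv.sum_comp E fun w => ∏ y, F y (w y), ← Fintype.prod_sum]
  refine Finset.prod_congr rfl fun y _ => ?_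
  unfold blockTerm
  rcases lt_trichotomy y (p y) with h | h | h
  · simp only [F, h, dite_true, if_true]
    let e2 : {x // min x (p x) = y} ≃ Fin 2 :=
      { toFun := fun x => if x.1 = y then 0 else 1
        invFun := fun k => if k = 0 then ⟨y, min_eq_left h.le⟩ else
          ⟨p y, by rw [hp]; exact min_eq_right h.le⟩
        left_inv := by
          rintro ⟨x, hx⟩
          by_cases hxy : x = y
          · simp [hxy]
          · have : p x = y := by
              rcases min_choice x (p x) with h' | h' <;> [exact absurd (h'.symm.trans hx) hxy;
                exact h'.symm.trans hx]
            have h4 : p y = x := by rw [← this, hp]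
            simp [hxy, h4]
        right_inv := by
          intro k
          fin_cases k
          · simp
          · simp [h.ne'] }
    let e3 : ({x // min x (p x) = y} → β) ≃ β × β :=
      (Equiv.arrowCongr e2 (Equiv.refl β)).trans (finTwoArrowEquiv β)
    rw [← Fintype.sum_prod_type' (f := pair y), ← Equiv.sum_comp e3]
    refine Finset.sum_congr rfl fun v _ => ?_
    simp [e3, e2, Equiv.arrowCongr]
  · have hy : ¬ y < p y := by rw [← h]; exact lt_irrefl _
    simp only [F, dif_neg hy, if_neg hy, dif_pos h.symm, if_pos h.symm]
    have : Unique {x // min x (p x) = y} :=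
      { default := ⟨y, by simp [← h]⟩
        uniq := by
          rintro ⟨x, hx⟩
          rcases min_choice x (p x) with h' | h'
          · exact Subtype.ext (h'.symm.trans hx)
          · refine Subtype.ext ?_
            have h2 : p x = y := h'.symm.trans hx
            change x = y
            rw [← hp x, h2, ← h] }
    rw [← Equiv.sum_comp (Equiv.funUnique {x // min x (p x) = y} β)]
    refine Finset.sum_congr rfl fun v _ => ?_
    rw [Equiv.funUnique_apply, Subsingleton.elim (⟨y, _⟩ : {x // min x (p x) = y}) default]
  · have hy : ¬ y < p y := h.not_gt
    simp only [F, dif_neg hy, if_neg hy, dif_neg h.ne, if_neg h.ne]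
    have : IsEmpty {x // min x (p x) = y} := by
      refine ⟨?_⟩
      rintro ⟨x, hx⟩
      rcases min_choice x (p x) with h' | h'
      · have h2 : x = y := h'.symm.trans hx
        subst h2
        rw [min_eq_right h.le] at hx
        exact h.ne hx
      · have h2 : p x = y := h'.symm.trans hx
        rw [h2] at hx
        have h3 : x = p y := by rw [← h2, hp]
        rw [h3, min_eq_left h.le] at hx
        exact h.ne hx
    simp

theorem blockTerm_mul {M : Type*} [MulOneClass M] (p : Fin n → Fin n) (a b c e : Fin n → M)
    (i : Fin n) : blockTerm p a b i * blockTerm p c e i =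
      blockTerm p (fun i => a i * c i) (fun i => b i * e i) i := by
  unfold blockTerm; split_ifs <;> simp

theorem blockTerm_congr {M : Type*} [One M] {p : Fin n → Fin n} {a b c e : Fin n → M} {i : Fin n}
    (h1 : i < p i → a i = c i) (h2 : p i = i → b i = e i) :
    blockTerm p a b i = blockTerm p c e i := by
  unfold blockTerm; split_ifs with h h' <;> [exact h1 h; exact h2 h'; rfl]

theorem map_blockTerm {M N F : Type*} [One M] [One N] [FunLike F M N] [OneHomClass F M N] (f : F)
    (p : Fin n → Fin n) (a b : Fin n → M) (i : Fin n) :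
    f (blockTerm p a b i) = blockTerm p (fun i => f (a i)) (fun i => f (b i)) i := by
  unfold blockTerm; split_ifs <;> simp

theorem prod_blockTerm_indicator {γ : Type*} [DecidableEq γ] (hp : ∀ i, p (p i) = i)
    (x y : Fin n → γ) :
    ∏ i, blockTerm p (fun i => if x i = y i ∧ x (p i) = y (p i) then (1 : R) else 0)
      (fun i => if x i = y i then 1 else 0) i = if x = y then 1 else 0 := by
  have h1 := prod_eq_prod_blockTerm hp fun i => if x i = y i then (1 : R) else 0
  have h2 : ∏ i, (if x i = y i then (1 : R) else 0) = if x = y then 1 else 0 := by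
    rw [Finset.prod_ite_zero]; simp [funext_iff]
  rw [← h2, h1]
  refine Finset.prod_congr rfl fun i _ => blockTerm_congr (fun _ => ?_) fun _ => rfl
  by_cases h : x i = y i <;> simp [h]

end Pairing

/-! ### Layers in the Pauli basis -/

theorem sum_arrow_prod {ι α β M : Type*} [Fintype ι] [DecidableEq ι] [Fintype α] [Fintype β]
    [AddCommMonoid M] (f : (ι → α) → (ι → β) → M) :
    ∑ x, ∑ y, f x y = ∑ u : ι → α × β, f (fun i => (u i).1) fun i => (u i).2 := by
  rw [← Fintype.sum_prod_type', ← Equiv.sum_comp (Equiv.arrowProdEquivProdArrow ι _ _)]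
  rfl

/-- The two-qubit operator with letters `a` and `b`. -/
def pauliPair (a b : Fin 4) : Matrix (Fin 2 × Fin 2) (Fin 2 × Fin 2) ℂ :=
  fun x y => pauliMatrix a x.1 y.1 * pauliMatrix b x.2 y.2

/-- The matrix of conjugation by a two-qubit gate, in the Pauli basis. -/
def gateCoeff (G : Matrix (Fin 2 × Fin 2) (Fin 2 × Fin 2) ℂ) (a b a' b' : Fin 4) : ℂ :=
  (pauliPair a' b' * (G.conjTranspose * pauliPair a b * G)).trace / 4

theorem pauliPair_conjTranspose (a b : Fin 4) :
    (pauliPair a b).conjTranspose = pauliPair a b := by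
  ext x y
  have h1 := congrFun₂ (pauliMatrix_hermitian a) x.1 y.1
  have h2 := congrFun₂ (pauliMatrix_hermitian b) x.2 y.2
  rw [Matrix.conjTranspose_apply] at h1 h2
  simp [Matrix.conjTranspose_apply, pauliPair, ← h1, ← h2]

theorem trace_pauliPair_mul (a b a' b' : Fin 4) :
    (pauliPair a b * pauliPair a' b').trace = if a = a' ∧ b = b' then 4 else 0 := by
  have h : (pauliPair a b * pauliPair a' b').trace =
      (pauliMatrix a * pauliMatrix a').trace * (pauliMatrix b * pauliMatrix b').trace := by
    simp only [Matrix.trace, Matrix.diag, Matrix.mul_apply, pauliPair, Fintype.sum_prod_type,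
      Fin.sum_univ_two]
    ring
  rw [h, trace_pauliMatrix_mul, trace_pauliMatrix_mul]
  split_ifs <;> simp_all
  norm_num

theorem pauliPair_zero : pauliPair 0 0 = 1 := by
  ext x y
  simp only [pauliPair, pauliMatrix, Matrix.cons_val_zero, Matrix.one_apply, Prod.ext_iff]
  split_ifs <;> simp_all

theorem gateCoeff_re (G : Matrix (Fin 2 × Fin 2) (Fin 2 × Fin 2) ℂ) (a b a' b' : Fin 4) :
    gateCoeff G a b a' b' = ((gateCoeff G a b a' b').re : ℂ) := by
  symm
  rw [← Complex.conj_eq_iff_re]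
  simp only [gateCoeff, map_div₀, Complex.conj_ofNat]
  congr 1
  rw [← Complex.star_def, ← Matrix.trace_conjTranspose]
  simp only [Matrix.conjTranspose_mul, pauliPair_conjTranspose, Matrix.conjTranspose_conjTranspose]
  rw [Matrix.trace_mul_comm, Matrix.mul_assoc]

/-- Conjugation by a unitary is unital; the companion `gateCoeff_zero_right` says that it preserves
the trace. Together: a gate fixes the empty pair of letters and mixes only the fifteen other pairs.
-/
theorem gateCoeff_zero_left (G : Matrix.unitaryGroup (Fin 2 × Fin 2) ℂ) (a' b' : Fin 4) :
    gateCoeff G.1 0 0 a' b' = if a' = 0 ∧ b' = 0 then 1 else 0 := by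
  have h : G.1.conjTranspose * G.1 = 1 := Matrix.mem_unitaryGroup_iff'.1 G.2
  rw [gateCoeff, pauliPair_zero, mul_one, h, ← pauliPair_zero, trace_pauliPair_mul]
  split_ifs <;> simp

theorem gateCoeff_zero_right (G : Matrix.unitaryGroup (Fin 2 × Fin 2) ℂ) (a b : Fin 4) :
    gateCoeff G.1 a b 0 0 = if a = 0 ∧ b = 0 then 1 else 0 := by
  have h : G.1 * G.1.conjTranspose = 1 := Matrix.mem_unitaryGroup_iff.1 G.2
  rw [gateCoeff, pauliPair_zero, one_mul, Matrix.trace_mul_comm, ← Matrix.mul_assoc, h, one_mul,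
    ← one_mul (pauliPair a b), ← pauliPair_zero, trace_pauliPair_mul]
  simp only [eq_comm (a := (0 : Fin 4))]
  split_ifs <;> simp

theorem trace_conj_eq_sum {κ : Type*} [Fintype κ] (A B U : Matrix κ κ ℂ) :
    (A * (U.conjTranspose * B * U)).trace =
      ∑ x, ∑ y, ∑ z, ∑ w, A x y * star (U z y) * B z w * U w x := by
  simp only [Matrix.trace, Matrix.diag, Matrix.mul_apply, Matrix.conjTranspose_apply,
    Finset.mul_sum, Finset.sum_mul]
  refine Finset.sum_congr rfl fun x _ => Finset.sum_congr rfl fun y _ => ?_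
  rw [Finset.sum_comm]
  refine Finset.sum_congr rfl fun z _ => Finset.sum_congr rfl fun w _ => by ring

section Layer

variable {n : ℕ} (L : Layer n)

theorem Layer.unitary_apply (x y : Fin n → Fin 2) : L.unitary x y =
    ∏ i, blockTerm L.partner
      (fun i => (L.gate i).1 (x i, x (L.partner i)) (y i, y (L.partner i)))
      (fun i => if x i = y i then 1 else 0) i := rfl

theorem Layer.conjTranspose_mul_unitary : L.unitary.conjTranspose * L.unitary = 1 := by
  ext x y
  simp only [Matrix.mul_apply, Matrix.conjTranspose_apply, Layer.unitary_apply, star_prod]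
  rw [Matrix.one_apply, ← prod_blockTerm_indicator (R := ℂ) L.partner_partner]
  simp only [Complex.star_def, map_blockTerm (starRingEnd ℂ), ← Finset.prod_mul_distrib,
    blockTerm_mul]
  rw [sum_prod_blockTerm L.partner_partner (fun i a b =>
    (starRingEnd ℂ) ((L.gate i).1 (a, b) (x i, x (L.partner i))) *
      (L.gate i).1 (a, b) (y i, y (L.partner i)))
    fun i a => (starRingEnd ℂ) (if a = x i then 1 else 0) * if a = y i then 1 else 0]
  refine Finset.prod_congr rfl fun i _ => blockTerm_congr (fun _ => ?_) fun _ => ?_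
  · have h : (L.gate i).1.conjTranspose * (L.gate i).1 = 1 :=
      Matrix.mem_unitaryGroup_iff'.1 (L.gate i).2
    have h2 := congrFun₂ h (x i, x (L.partner i)) (y i, y (L.partner i))
    simp only [Matrix.mul_apply, Matrix.conjTranspose_apply, Fintype.sum_prod_type,
      Matrix.one_apply, Prod.mk.injEq, Complex.star_def] at h2
    exact h2
  · simp [eq_comm]

/-- The trace is a sum over four bit strings of products over the blocks, hence a product of traces,
one for each gate or idle qubit. The normalization 2^n splits into 4 for each pair and 2 for each
idle qubit. -/
theorem Layer.pauliCoeff_conj (P Q : PauliString n) :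
    pauliCoeff (L.unitary.conjTranspose * P.op * L.unitary) Q =
      ∏ i, blockTerm L.partner
        (fun i => gateCoeff (L.gate i).1 (P i) (P (L.partner i)) (Q i) (Q (L.partner i)))
        (fun i => if P i = Q i then 1 else 0) i := by
  have h2 : (2 : ℂ) ^ n ≠ 0 := pow_ne_zero _ two_ne_zero
  rw [pauliCoeff, div_eq_iff h2]
  have h3 : (2 : ℂ) ^ n = ∏ i, blockTerm L.partner (fun _ => (4 : ℂ)) (fun _ => 2) i := by
    have := prod_eq_prod_blockTerm L.partner_partner fun _ => (2 : ℂ)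
    rw [Finset.prod_const, Finset.card_univ, Fintype.card_fin] at this
    rw [this]
    norm_num
  rw [h3, ← Finset.prod_mul_distrib]
  simp only [blockTerm_mul]
  rw [trace_conj_eq_sum]
  -- The four bit strings are bundled into one function with values in quadruples of bits, to which
  -- `sum_prod_blockTerm` applies.
  have e2 : ∀ x y z w : Fin n → Fin 2,
      Q.op x y * star (L.unitary z y) * P.op z w * L.unitary w x = ∏ i, blockTerm L.partner
        (fun i => (fun a b : Fin 2 × Fin 2 × Fin 2 × Fin 2 =>
          pauliMatrix (Q i) a.1 a.2.1 * pauliMatrix (Q (L.partner i)) b.1 b.2.1 *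
          star ((L.gate i).1 (a.2.2.1, b.2.2.1) (a.2.1, b.2.1)) *
          (pauliMatrix (P i) a.2.2.1 a.2.2.2 * pauliMatrix (P (L.partner i)) b.2.2.1 b.2.2.2) *
          (L.gate i).1 (a.2.2.2, b.2.2.2) (a.1, b.1)) (x i, y i, z i, w i)
            (x (L.partner i), y (L.partner i), z (L.partner i), w (L.partner i)))
        (fun i => (fun a : Fin 2 × Fin 2 × Fin 2 × Fin 2 =>
          pauliMatrix (Q i) a.1 a.2.1 * (if a.2.2.1 = a.2.1 then 1 else 0) *
          pauliMatrix (P i) a.2.2.1 a.2.2.2 * if a.2.2.2 = a.1 then 1 else 0)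
            (x i, y i, z i, w i)) i := by
    intro x y z w
    rw [PauliString.op, PauliString.op, prod_eq_prod_blockTerm L.partner_partner,
      prod_eq_prod_blockTerm L.partner_partner fun j => pauliMatrix (P j) (z j) (w j)]
    simp only [Layer.unitary_apply, star_prod, ← Finset.prod_mul_distrib, Complex.star_def,
      map_blockTerm (starRingEnd ℂ), blockTerm_mul]
    refine Finset.prod_congr rfl fun i _ => blockTerm_congr (fun _ => rfl) fun _ => ?_
    simp
  simp only [e2, sum_arrow_prod]
  rw [sum_prod_blockTerm L.partner_partner (fun i (a b : Fin 2 × Fin 2 × Fin 2 × Fin 2) =>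
          pauliMatrix (Q i) a.1 a.2.1 * pauliMatrix (Q (L.partner i)) b.1 b.2.1 *
          star ((L.gate i).1 (a.2.2.1, b.2.2.1) (a.2.1, b.2.1)) *
          (pauliMatrix (P i) a.2.2.1 a.2.2.2 * pauliMatrix (P (L.partner i)) b.2.2.1 b.2.2.2) *
          (L.gate i).1 (a.2.2.2, b.2.2.2) (a.1, b.1))
        (fun i (a : Fin 2 × Fin 2 × Fin 2 × Fin 2) =>
          pauliMatrix (Q i) a.1 a.2.1 * (if a.2.2.1 = a.2.1 then 1 else 0) *
          pauliMatrix (P i) a.2.2.1 a.2.2.2 * if a.2.2.2 = a.1 then 1 else 0)]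
  refine Finset.prod_congr rfl fun i _ => blockTerm_congr (fun _ => ?_) fun _ => ?_
  · rw [gateCoeff, div_mul_cancel₀ _ (by norm_num)]
    rw [trace_conj_eq_sum]
    simp only [← Fintype.sum_prod_type']
    refine Fintype.sum_equiv
      { toFun := fun p => ((p.1.1, p.2.1), (p.1.2.1, p.2.2.1), (p.1.2.2.1, p.2.2.2.1),
          (p.1.2.2.2, p.2.2.2.2))
        invFun := fun r => ((r.1.1, r.2.1.1, r.2.2.1.1, r.2.2.2.1),
          (r.1.2, r.2.1.2, r.2.2.1.2, r.2.2.2.2))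
        left_inv := fun _ => rfl
        right_inv := fun _ => rfl } _ _ fun p => ?_
    rfl
  · have h := trace_pauliMatrix_mul (Q i) (P i)
    simp only [Matrix.trace, Matrix.diag, Matrix.mul_apply] at h
    simp only [Fintype.sum_prod_type, mul_ite, ite_mul, mul_one, mul_zero, zero_mul,
      Finset.sum_ite_eq', Finset.mem_univ, if_true]
    simpa [eq_comm] using h

/-- The matrix of conjugation by `U`, in the Pauli basis. -/
def heis (U : Op n) (P Q : PauliString n) : ℝ := (pauliCoeff (U.conjTranspose * P.op * U) Q).re

theorem heis_eq (U : Op n) (P Q : PauliString n) :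
    pauliCoeff (U.conjTranspose * P.op * U) Q = heis U P Q := by
  refine pauliCoeff_real ?_ Q
  rw [Matrix.IsHermitian, Matrix.conjTranspose_mul, Matrix.conjTranspose_mul,
    Matrix.conjTranspose_conjTranspose, P.op_conjTranspose, Matrix.mul_assoc]

theorem Layer.heis_unitary (P Q : PauliString n) :
    heis L.unitary P Q = ∏ i, blockTerm L.partner
        (fun i => (gateCoeff (L.gate i).1 (P i) (P (L.partner i)) (Q i) (Q (L.partner i))).re)
        (fun i => if P i = Q i then 1 else 0) i := by
  have h := L.pauliCoeff_conj P Q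
  rw [heis_eq] at h
  apply Complex.ofReal_injective
  rw [h, Complex.ofReal_prod]
  refine Finset.prod_congr rfl fun i _ => ?_
  rw [← Complex.ofRealHom_eq_coe, map_blockTerm]
  refine blockTerm_congr (fun _ => gateCoeff_re _ _ _ _ _) fun _ => ?_
  split_ifs <;> simp

/-- Conjugation by a unitary preserves the Hilbert–Schmidt norm, which is up to a constant the
Euclidean norm of the Pauli coefficients. -/
theorem sum_heis_sq (U : Op n) (hU : U.conjTranspose * U = 1) (v : PauliString n → ℝ) :
    ∑ Q, (∑ P, v P * heis U P Q) ^ 2 = ∑ P, v P ^ 2 := by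
  have hU' : U * U.conjTranspose = 1 := mul_eq_one_comm.1 hU
  let A : Op n := ∑ P, (v P : ℂ) • P.op
  have hA : ∀ Q, pauliCoeff A Q = v Q := by
    intro Q
    simp only [A, pauliCoeff_sum, pauliCoeff_smul, pauliCoeff_op]
    simp
  have hB : ∀ Q, pauliCoeff (U.conjTranspose * A * U) Q = ((∑ P, v P * heis U P Q : ℝ) : ℂ) := by
    intro Q
    simp only [A, Finset.mul_sum, Finset.sum_mul, Matrix.mul_smul, Matrix.smul_mul,
      pauliCoeff_sum, pauliCoeff_smul, heis_eq]
    push_cast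
    rfl
  have h1 := sum_normSq_pauliCoeff A
  have h2 := sum_normSq_pauliCoeff (U.conjTranspose * A * U)
  have h3 : ((U.conjTranspose * A * U).conjTranspose * (U.conjTranspose * A * U)).trace =
      (A.conjTranspose * A).trace := by
    rw [show (U.conjTranspose * A * U).conjTranspose * (U.conjTranspose * A * U) =
      U.conjTranspose * (A.conjTranspose * (U * U.conjTranspose) * A * U) by
        simp only [Matrix.conjTranspose_mul, Matrix.conjTranspose_conjTranspose, Matrix.mul_assoc],
      hU', mul_one, Matrix.trace_mul_comm, Matrix.mul_assoc, hU', mul_one]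
  rw [h3, ← h1] at h2
  simp only [hA, hB, Complex.norm_real] at h2
  have h4 : ∑ Q, ‖∑ P, v P * heis U P Q‖ ^ 2 = ∑ P, ‖v P‖ ^ 2 := by exact_mod_cast h2
  simpa using h4

theorem Layer.heis_zero_left (Q : PauliString n) :
    heis L.unitary 0 Q = if Q = 0 then 1 else 0 := by
  rw [Layer.heis_unitary]
  have h := prod_blockTerm_indicator (R := ℝ) L.partner_partner Q 0
  rw [← h]
  refine Finset.prod_congr rfl fun i _ => blockTerm_congr (fun _ => ?_) fun _ => ?_
  · simp only [Pi.zero_apply, gateCoeff_zero_left]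
    split_ifs <;> simp
  · simp [eq_comm]

theorem Layer.heis_zero_right (P : PauliString n) :
    heis L.unitary P 0 = if P = 0 then 1 else 0 := by
  rw [Layer.heis_unitary]
  have h := prod_blockTerm_indicator (R := ℝ) L.partner_partner P 0
  rw [← h]
  refine Finset.prod_congr rfl fun i _ => blockTerm_congr (fun _ => ?_) fun _ => ?_
  · simp only [Pi.zero_apply, gateCoeff_zero_right]
    split_ifs <;> simp
  · simp

/-- Whether two Pauli strings may be connected by conjugation with a layer of gates. -/
def Layer.Compatible (P Q : PauliString n) : Prop :=
  (∀ i, i < L.partner i → (P i = 0 ∧ P (L.partner i) = 0 ↔ Q i = 0 ∧ Q (L.partner i) = 0)) ∧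
  ∀ i, L.partner i = i → P i = Q i

/-- A gate neither creates letters on an empty pair nor removes all letters of a pair, and idle
qubits are untouched. Compatibility is weaker than a nonzero matrix element, but it is symmetric, so
paths can be followed through it in both directions. -/
theorem Layer.compatible_of_heis_ne_zero {P Q : PauliString n} (h : heis L.unitary P Q ≠ 0) :
    L.Compatible P Q := by
  rw [Layer.heis_unitary, Finset.prod_ne_zero_iff] at h
  refine ⟨fun i hi => ?_, fun i hi => ?_⟩
  · have h2 := h i (Finset.mem_univ i)
    rw [blockTerm, if_pos hi] at h2
    constructor
    · rintro ⟨h3, h4⟩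
      by_contra h5
      rw [h3, h4, gateCoeff_zero_left, if_neg h5] at h2
      simp at h2
    · rintro ⟨h3, h4⟩
      by_contra h5
      rw [h3, h4, gateCoeff_zero_right, if_neg h5] at h2
      simp at h2
  · have h2 := h i (Finset.mem_univ i)
    by_contra h3
    simp [blockTerm, hi, h3] at h2

end Layer

end

noncomputable section

variable {n : ℕ}

/-! ### Expectation values in the Heisenberg picture -/

/-- The expectation value of a Pauli string that passes backwards through the layers, where `r`
are the expectation values in the initial state. -/
def exactVal (q : ℝ) (r : PauliString n → ℝ) :
    List (Op n × (Fin n → Bool)) → PauliString n → ℝ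
  | [], Q => r Q
  | l :: ls, Q => ∑ R, heis l.1 Q R * (q ^ R.weightOn l.2 * exactVal q r ls R)

/-- The same, where strings of weight above `m` are dropped after every layer. -/
def cutVal (q : ℝ) (r : PauliString n → ℝ) (m : ℕ) :
    List (Op n × (Fin n → Bool)) → PauliString n → ℝ
  | [], Q => if Q.weight ≤ m then r Q else 0
  | l :: ls, Q => if Q.weight ≤ m then
      ∑ R, heis l.1 Q R * (q ^ R.weightOn l.2 * cutVal q r m ls R) else 0

/-- The same for uniform noise, where Pauli paths of total weight above `b` are dropped. -/
def budgetVal (q : ℝ) (r : PauliString n → ℝ) :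
    List (Op n × (Fin n → Bool)) → ℕ → PauliString n → ℝ
  | [], b, Q => if Q.weight ≤ b then q ^ Q.weight * r Q else 0
  | l :: ls, b, Q => if Q.weight ≤ b then
      q ^ Q.weight * ∑ R, heis l.1 Q R * budgetVal q r ls (b - Q.weight) R else 0

/-- A layer as a unitary together with the positions of the noise. -/
def Layer.data (N : NoiseModel) (L : Layer n) : Op n × (Fin n → Bool) :=
  (L.unitary, N.noisyQubits L)

/-- Cyclicity of the trace moves a layer from the state to the observable; expanding the result in
the Pauli basis makes the noise diagonal. -/
theorem trace_fold (N : NoiseModel) (γ : ℝ) (ρ : Op n) (r : PauliString n → ℝ)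
    (hr : ∀ Q, (ρ * Q.op).trace = r Q) (ls : List (Layer n)) (Q : PauliString n) :
    (ls.foldr (fun L σ => L.unitary * depolarizeOn (Real.exp (-γ)) (N.noisyQubits L) σ *
      L.unitary.conjTranspose) ρ * Q.op).trace =
      exactVal (Real.exp (-γ)) r (ls.map (Layer.data N)) Q := by
  induction ls generalizing Q with
  | nil => simp [exactVal, hr]
  | cons L ls ih =>
    rw [List.foldr_cons, Matrix.mul_assoc, Matrix.mul_assoc, Matrix.trace_mul_comm,
      Matrix.mul_assoc, trace_mul_eq_sum]
    simp only [heis_eq, trace_depolarizeOn, ih]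
    simp only [List.map_cons, exactVal, Layer.data]
    push_cast
    rfl

/-- The Pauli path expansion. Since ρ is Hermitian its coefficients are real, and so are all path
amplitudes; only the coefficients of O are left complex here. -/
theorem trace_apply {d : ℕ} (N : NoiseModel) (γ : ℝ) (ρ O : Op n) (hρ : ρ.IsHermitian)
    (C : Circuit n d) :
    (C.apply N γ ρ * O).trace = ∑ Q, pauliCoeff O Q * ((Real.exp (-γ) ^ Q.weight *
      exactVal (Real.exp (-γ)) (fun P => (ρ * P.op).trace.re) (List.ofFn (C.layers N)) Q : ℝ) :
        ℂ) := by
  have h2 : (2 : ℂ) ^ n ≠ 0 := pow_ne_zero _ two_ne_zero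
  have hr : ∀ Q : PauliString n, (ρ * Q.op).trace = (((ρ * Q.op).trace.re : ℝ) : ℂ) := by
    intro Q
    have h := pauliCoeff_real hρ Q
    have h3 : (ρ * Q.op).trace = pauliCoeff ρ Q * ((2 ^ n : ℝ) : ℂ) := by
      rw [pauliCoeff, Matrix.trace_mul_comm]; push_cast; field_simp
    rw [h3, h, ← Complex.ofReal_mul, Complex.ofReal_re]
  have hl : List.ofFn (C.layers N) = (List.ofFn C).map (Layer.data N) := by
    rw [List.map_ofFn]; rfl
  rw [trace_mul_eq_sum]
  refine Finset.sum_congr rfl fun Q _ => ?_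
  rw [Circuit.apply, trace_depolarizeOn, trace_fold N γ ρ _ hr, PauliString.weightOn_true, hl]
  push_cast
  rfl

/-! ### Rows -/

/-- The square of the Euclidean norm. -/
def normSq {κ : Type*} [Fintype κ] (v : κ → ℝ) : ℝ := ∑ i, v i ^ 2

theorem normSq_nonneg {κ : Type*} [Fintype κ] (v : κ → ℝ) : 0 ≤ normSq v :=
  Finset.sum_nonneg fun _ _ => sq_nonneg _

/-- A row vector passes through a layer. -/
def rowStep (U : Op n) (v : PauliString n → ℝ) : PauliString n → ℝ :=
  fun R => ∑ Q, v Q * heis U Q R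

theorem Layer.normSq_rowStep (L : Layer n) (v : PauliString n → ℝ) :
    normSq (rowStep L.unitary v) = normSq v :=
  sum_heis_sq L.unitary L.conjTranspose_mul_unitary v

theorem sum_mul_heis (U : Op n) (v f : PauliString n → ℝ) :
    ∑ Q, v Q * ∑ R, heis U Q R * f R = ∑ R, rowStep U v R * f R := by
  simp only [rowStep, Finset.mul_sum, Finset.sum_mul]
  rw [Finset.sum_comm]
  refine Finset.sum_congr rfl fun Q _ => Finset.sum_congr rfl fun R _ => by ring

/-- The multiplier has to be small on the support of v only; this is how "all strings are heavy" or
"the identity is absent" enters the estimates. -/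
theorem normSq_mul_le {κ : Type*} [Fintype κ] {q : ℝ} (v z : κ → ℝ)
    (hz : ∀ i, v i ≠ 0 → |z i| ≤ q) : normSq (fun i => v i * z i) ≤ q ^ 2 * normSq v := by
  rw [normSq, normSq, Finset.mul_sum]
  refine Finset.sum_le_sum fun i _ => ?_
  by_cases h : v i = 0
  · simp [h]
  · have := sq_le_sq.2 ((hz i h).trans (le_abs_self q))
    rw [mul_pow]
    nlinarith [sq_nonneg (v i)]

theorem abs_pow_le_of_le {q : ℝ} (h0 : 0 ≤ q) (h1 : q ≤ 1) {k m : ℕ} (h : k ≤ m) :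
    |q ^ m| ≤ q ^ k := by
  rw [abs_of_nonneg (pow_nonneg h0 _)]
  exact pow_le_pow_of_le_one h0 h1 h

/-- Each layer is an orthogonal matrix followed by a diagonal contraction, so a row vector does not
grow on its way; at the end comes Cauchy–Schwarz against r. -/
theorem sq_sum_exactVal_le {q : ℝ} (h0 : 0 ≤ q) (h1 : q ≤ 1) (N : NoiseModel)
    (r : PauliString n → ℝ) (ls : List (Layer n)) (v : PauliString n → ℝ) :
    (∑ Q, v Q * exactVal q r (ls.map (Layer.data N)) Q) ^ 2 ≤ normSq v * normSq r := by
  induction ls generalizing v with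
  | nil => exact Finset.sum_mul_sq_le_sq_mul_sq _ _ _
  | cons L ls ih =>
    simp only [List.map_cons, exactVal, sum_mul_heis]
    simp only [← mul_assoc]
    refine (ih _).trans (mul_le_mul_of_nonneg_right ?_ (normSq_nonneg r))
    refine (normSq_mul_le (q := 1) _ _ fun R _ => ?_).trans ?_
    · exact abs_pow_le_of_le h0 h1 (Nat.zero_le _)
    · rw [Layer.data, L.normSq_rowStep, one_pow, one_mul]

/-! ### Dropping heavy strings -/

/-- P and Q agree on the idle qubits. In powers of q: full noise on P and gate noise on Q together
equal gate noise on P and full noise on Q, so a full round of noise can be pushed through the layer.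
-/
theorem Layer.weight_eq_of_heis_ne_zero (L : Layer n) {P Q : PauliString n}
    (h : heis L.unitary P Q ≠ 0) :
    P.weight + Q.weightOn (NoiseModel.gateBased.noisyQubits L) =
      P.weightOn (NoiseModel.gateBased.noisyQubits L) + Q.weight := by
  have hc := (L.compatible_of_heis_ne_zero h).2
  have hsplit : ∀ R : PauliString n, R.weight = R.weightOn (NoiseModel.gateBased.noisyQubits L) +
      (Finset.univ.filter fun j => L.partner j = j ∧ R j ≠ 0).card := by
    intro R
    rw [PauliString.weight, PauliString.weightOn,
      ← Finset.card_filter_add_card_filter_not (s := Finset.univ.filter fun j => R j ≠ 0)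
        fun j => L.partner j ≠ j]
    simp only [Finset.filter_filter, NoiseModel.noisyQubits, decide_eq_true_eq, not_not]
    congr 2 <;> ext j <;> simp [and_comm]
  have he : (Finset.univ.filter fun j => L.partner j = j ∧ P j ≠ 0) =
      Finset.univ.filter fun j => L.partner j = j ∧ Q j ≠ 0 := by
    ext j
    simp only [Finset.mem_filter, Finset.mem_univ, true_and]
    constructor <;> rintro ⟨h1, h2⟩
    · exact ⟨h1, hc j h1 ▸ h2⟩
    · exact ⟨h1, (hc j h1).symm ▸ h2⟩
  rw [hsplit P, hsplit Q, he]
  ring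

theorem normSq_split (m : ℕ) (v : PauliString n → ℝ) :
    normSq v = normSq (fun Q => if Q.weight ≤ m then v Q else 0) +
      normSq (fun Q => if Q.weight ≤ m then 0 else v Q) := by
  rw [normSq, normSq, normSq, ← Finset.sum_add_distrib]
  refine Finset.sum_congr rfl fun Q _ => ?_
  split_ifs <;> simp

/-- The factor q^weight of the read-out is carried along through the layers, so a string has its
full damping, at most q^(m+1), at the moment it is dropped. The parts dropped at the different
positions come from orthogonal splittings of a row vector whose norm does not grow, so their squared
norms add up to at most that of b. Cauchy–Schwarz over the positions gives the factor `ls.length +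
1`. -/
theorem sq_sum_cut_error_le {q : ℝ} (h0 : 0 ≤ q) (h1 : q ≤ 1) (m : ℕ)
    (r : PauliString n → ℝ) (ls : List (Layer n)) (b : PauliString n → ℝ) :
    (∑ Q, b Q * q ^ Q.weight * (exactVal q r (ls.map (Layer.data .gateBased)) Q -
      cutVal q r m (ls.map (Layer.data .gateBased)) Q)) ^ 2 ≤
      (q ^ (m + 1)) ^ 2 * (ls.length + 1) * normSq b * normSq r := by
  have hhigh : ∀ b : PauliString n → ℝ,
      normSq (fun Q => (if Q.weight ≤ m then 0 else b Q) * q ^ Q.weight) ≤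
        (q ^ (m + 1)) ^ 2 * normSq fun Q => if Q.weight ≤ m then 0 else b Q := by
    intro b
    refine normSq_mul_le _ _ fun Q hQ => abs_pow_le_of_le h0 h1 ?_
    by_contra h
    exact hQ (if_pos (by omega))
  induction ls generalizing b with
  | nil =>
    have e : ∀ Q : PauliString n, b Q * q ^ Q.weight * (exactVal q r (([] : List (Layer n)).map
        (Layer.data .gateBased)) Q - cutVal q r m (([] : List (Layer n)).map
        (Layer.data .gateBased)) Q) =
        ((if Q.weight ≤ m then 0 else b Q) * q ^ Q.weight) * r Q := by
      intro Q
      simp only [List.map_nil, exactVal, cutVal]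
      split_ifs <;> ring
    simp only [e]
    refine (Finset.sum_mul_sq_le_sq_mul_sq _ _ _).trans ?_
    refine mul_le_mul_of_nonneg_right ?_ (normSq_nonneg r)
    refine (hhigh b).trans ?_
    have := normSq_split m b
    have h3 := normSq_nonneg fun Q : PauliString n => if Q.weight ≤ m then b Q else 0
    simp only [List.length_nil, Nat.cast_zero, zero_add, mul_one]
    exact mul_le_mul_of_nonneg_left (by linarith) (sq_nonneg _)
  | cons L ls ih =>
    set S := NoiseModel.gateBased.noisyQubits L with hS
    let lo : PauliString n → ℝ := fun Q => if Q.weight ≤ m then b Q else 0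
    let hi : PauliString n → ℝ := fun Q => if Q.weight ≤ m then 0 else b Q
    -- The light part behind the layer. Only the gate noise on Q has been spent; the noise on all
    -- qubits reappears behind the layer as q^weight.
    let b' : PauliString n → ℝ := rowStep L.unitary fun Q => lo Q * q ^ Q.weightOn S
    let D : PauliString n → ℝ := fun Q => exactVal q r (ls.map (Layer.data .gateBased)) Q -
      cutVal q r m (ls.map (Layer.data .gateBased)) Q
    have e : (∑ Q, b Q * q ^ Q.weight * (exactVal q r ((L :: ls).map (Layer.data .gateBased)) Q -
        cutVal q r m ((L :: ls).map (Layer.data .gateBased)) Q)) =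
        (∑ Q, (hi Q * q ^ Q.weight) * exactVal q r ((L :: ls).map (Layer.data .gateBased)) Q) +
        ∑ Q, b' Q * q ^ Q.weight * D Q := by
      have e1 : ∀ Q : PauliString n, b Q * q ^ Q.weight *
          (exactVal q r ((L :: ls).map (Layer.data .gateBased)) Q -
          cutVal q r m ((L :: ls).map (Layer.data .gateBased)) Q) =
          (hi Q * q ^ Q.weight) * exactVal q r ((L :: ls).map (Layer.data .gateBased)) Q +
          (lo Q * q ^ Q.weight) * ∑ R, heis L.unitary Q R * (q ^ R.weightOn S * D R) := by
        intro Q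
        simp only [List.map_cons, exactVal, cutVal, Layer.data, hi, lo, D, mul_sub,
          Finset.sum_sub_distrib, hS]
        split_ifs <;> ring
      simp only [e1, Finset.sum_add_distrib]
      congr 1
      rw [sum_mul_heis]
      refine Finset.sum_congr rfl fun R _ => ?_
      rw [← mul_assoc]
      congr 1
      simp only [rowStep, b', Finset.sum_mul]
      refine Finset.sum_congr rfl fun Q _ => ?_
      by_cases h : heis L.unitary Q R = 0
      · simp [h]
      · have h2 := L.weight_eq_of_heis_ne_zero h
        have h3 : q ^ Q.weight * q ^ R.weightOn S = q ^ Q.weightOn S * q ^ R.weight := by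
          rw [← pow_add, ← pow_add, hS, h2]
        linear_combination (lo Q * heis L.unitary Q R) * h3
    rw [e]
    set X := ∑ Q, (hi Q * q ^ Q.weight) * exactVal q r ((L :: ls).map (Layer.data .gateBased)) Q
    set Y := ∑ Q, b' Q * q ^ Q.weight * D Q
    set κ := (q ^ (m + 1)) ^ 2
    have hκ : 0 ≤ κ := sq_nonneg _
    have hX : X ^ 2 ≤ κ * normSq hi * normSq r :=
      (sq_sum_exactVal_le h0 h1 _ r _ _).trans
        (mul_le_mul_of_nonneg_right (hhigh b) (normSq_nonneg r))
    have hb' : normSq b' ≤ normSq lo := by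
      rw [L.normSq_rowStep]
      refine (normSq_mul_le (q := 1) _ _ fun R _ => ?_).trans (by rw [one_pow, one_mul])
      exact abs_pow_le_of_le h0 h1 (Nat.zero_le _)
    have hY : Y ^ 2 ≤ κ * (ls.length + 1) * normSq lo * normSq r := by
      refine (ih b').trans (mul_le_mul_of_nonneg_right ?_ (normSq_nonneg r))
      exact mul_le_mul_of_nonneg_left hb' (by positivity)
    have hsplit : normSq b = normSq lo + normSq hi := normSq_split m b
    rw [hsplit]
    push_cast [List.length_cons]
    set k : ℝ := (ls.length : ℝ) + 1 with hk
    have hk1 : 0 < k := by positivity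
    set A := κ * normSq hi * normSq r
    set B := κ * normSq lo * normSq r
    have hY' : Y ^ 2 ≤ k * B := by
      refine hY.trans (le_of_eq ?_); simp only [B]; ring
    -- This is (X + Y)² ≤ (k + 1)X² + ((k + 1)/k)Y², multiplied by k. With this weighting, one
    -- dropped part after k others raises the factor from k to k + 1 only.
    have h5 : k * (X + Y) ^ 2 ≤ k * ((k + 1) * X ^ 2) + (k + 1) * Y ^ 2 := by
      nlinarith [sq_nonneg (k * X - Y)]
    have h6 : k * (X + Y) ^ 2 ≤ k * ((k + 1) * (A + B)) := by
      nlinarith [mul_le_mul_of_nonneg_left hX (by positivity : 0 ≤ k * (k + 1)),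
        mul_le_mul_of_nonneg_left hY' (by positivity : 0 ≤ k + 1)]
    refine (le_of_mul_le_mul_left h6 hk1).trans (le_of_eq ?_)
    simp only [A, B]; ring

end

noncomputable section

variable {n : ℕ}

/-! ### Dropping paths of large total weight -/

theorem exactVal_eq_cutVal (q : ℝ) (r : PauliString n → ℝ) {m : ℕ} (hm : n ≤ m)
    (ls : List (Op n × (Fin n → Bool))) (Q : PauliString n) :
    cutVal q r m ls Q = exactVal q r ls Q := by
  induction ls generalizing Q with
  | nil => simp [cutVal, exactVal, Q.weight_le.trans hm]
  | cons l ls ih => simp [cutVal, exactVal, Q.weight_le.trans hm, ih]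

/-- A path consists of `ls.length + 1` strings of weight at most n, so with this budget nothing is
dropped. -/
theorem budgetVal_eq_exactVal (q : ℝ) (r : PauliString n → ℝ)
    (ls : List (Layer n)) (b : ℕ) (hb : n * (ls.length + 1) ≤ b) (Q : PauliString n) :
    budgetVal q r (ls.map (Layer.data .uniform)) b Q =
      q ^ Q.weight * exactVal q r (ls.map (Layer.data .uniform)) Q := by
  induction ls generalizing b Q with
  | nil =>
    have : Q.weight ≤ b := Q.weight_le.trans (by simpa using hb)
    simp [budgetVal, exactVal, this]
  | cons L ls ih =>
    have hn := Q.weight_le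
    rw [List.length_cons, Nat.mul_succ] at hb
    have h1 : Q.weight ≤ b := by omega
    simp only [List.map_cons, budgetVal, exactVal, h1, if_true]
    congr 1
    refine Finset.sum_congr rfl fun R _ => ?_
    rw [ih _ (by omega)]
    congr 2
    exact congrArg (q ^ ·) R.weightOn_true.symm

/-- Graded row vectors: the weight of the string is added to the degree. -/
def gradeShift (φ : ℕ → PauliString n → ℝ) : ℕ → PauliString n → ℝ :=
  fun w R => if R.weight ≤ w then φ (w - R.weight) R else 0

theorem sum_range_shift {M : Type*} [AddCommMonoid M] (N k : ℕ) (f : ℕ → ℕ → M) :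
    ∑ w ∈ Finset.range N, (if k ≤ w then f w (w - k) else 0) =
      ∑ w ∈ Finset.range N, if w + k < N then f (w + k) w else 0 := by
  rw [← Finset.sum_filter, ← Finset.sum_filter]
  refine Finset.sum_bij' (fun w _ => w - k) (fun w _ => w + k) ?_ ?_ ?_ ?_ ?_ <;>
    simp only [Finset.mem_filter, Finset.mem_range]
  · intro w h; constructor <;> omega
  · intro w h; constructor <;> omega
  · intro w h; omega
  · intro w h; omega
  · intro w h; congr 1; omega

/-- The entry at degree w and string R moves to degree w + R.weight. This is injective, so no norm
is gained; entries that leave the range are lost. -/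
theorem sum_normSq_gradeShift_le (φ : ℕ → PauliString n → ℝ) (N : ℕ) :
    ∑ w ∈ Finset.range N, normSq (gradeShift φ w) ≤ ∑ w ∈ Finset.range N, normSq (φ w) := by
  simp only [normSq]
  rw [Finset.sum_comm, Finset.sum_comm (s := Finset.range N)]
  refine Finset.sum_le_sum fun R _ => ?_
  have : ∀ w, gradeShift φ w R ^ 2 = if R.weight ≤ w then φ (w - R.weight) R ^ 2 else 0 := by
    intro w
    rw [gradeShift]
    split_ifs <;> simp
  simp only [this]
  rw [sum_range_shift N R.weight fun _ w => φ w R ^ 2]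
  refine Finset.sum_le_sum fun w _ => ?_
  split_ifs
  · exact le_rfl
  · exact sq_nonneg _

/-- Sort paths by total weight: ψ w R collects the noiseless amplitudes of the paths of degree w
that end in R. It does not depend on the budget, which only selects the degrees w ≤ b. A layer acts
on each degree by an orthogonal matrix, and a string shifts the degree by its weight, so the squared
norm over the degrees below any N does not grow. No counting of paths enters: paths of equal degree
and end point interfere inside one entry of ψ. -/
theorem exists_graded (q : ℝ) (ls : List (Layer n)) (φ : ℕ → PauliString n → ℝ) :
    ∃ ψ : ℕ → PauliString n → ℝ,
      (∀ N, ∑ w ∈ Finset.range N, normSq (ψ w) ≤ ∑ w ∈ Finset.range N, normSq (φ w)) ∧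
      ∀ (r : PauliString n → ℝ) (b : ℕ),
        ∑ w ∈ Finset.range (b + 1), ∑ R, q ^ w * φ w R *
          budgetVal q r (ls.map (Layer.data .uniform)) (b - w) R =
        ∑ w ∈ Finset.range (b + 1), ∑ R, q ^ w * ψ w R * r R := by
  -- One position of the path: the weight of R is moved from the remaining budget to the degree.
  have key : ∀ (φ : ℕ → PauliString n → ℝ) (b : ℕ) (F : ℕ → PauliString n → ℝ),
      ∑ w ∈ Finset.range (b + 1), ∑ R, q ^ w * φ w R *
          (if R.weight ≤ b - w then q ^ R.weight * F (b - w - R.weight) R else 0) =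
      ∑ w ∈ Finset.range (b + 1), ∑ R, q ^ w * gradeShift φ w R * F (b - w) R := by
    intro φ b F
    rw [Finset.sum_comm, Finset.sum_comm (s := Finset.range (b + 1))]
    refine Finset.sum_congr rfl fun R _ => ?_
    have : ∀ w, q ^ w * gradeShift φ w R * F (b - w) R =
        if R.weight ≤ w then q ^ w * φ (w - R.weight) R * F (b - w) R else 0 := by
      intro w
      rw [gradeShift]
      split_ifs <;> simp
    simp only [this]
    rw [sum_range_shift (b + 1) R.weight fun w w' => q ^ w * φ w' R * F (b - w) R]
    refine Finset.sum_congr rfl fun w hw => ?_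
    have hw' := Finset.mem_range.1 hw
    by_cases h : R.weight ≤ b - w
    · rw [if_pos h, if_pos (by omega), pow_add, Nat.sub_sub]
      ring
    · rw [if_neg h, if_neg (by omega), mul_zero]
  induction ls generalizing φ with
  | nil =>
    refine ⟨gradeShift φ, sum_normSq_gradeShift_le φ, fun r b => ?_⟩
    exact key φ b fun _ => r
  | cons L ls ih =>
    obtain ⟨ψ, h1, h2⟩ := ih fun w => rowStep L.unitary (gradeShift φ w)
    refine ⟨ψ, fun N => (h1 N).trans ?_, fun r b => ?_⟩
    · simp only [L.normSq_rowStep]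
      exact sum_normSq_gradeShift_le φ N
    · rw [← h2 r b]
      have := key φ b fun b' R => ∑ R', heis L.unitary R R' *
        budgetVal q r (ls.map (Layer.data .uniform)) b' R'
      simp only [List.map_cons, budgetVal, Layer.data] at this ⊢
      rw [this]
      refine Finset.sum_congr rfl fun w _ => ?_
      simp only [mul_assoc, ← Finset.mul_sum, sum_mul_heis]

/-- The exact and the truncated value are partial sums of one graded series; their difference
consists of the degrees above b. Cauchy–Schwarz over pairs of a degree and a string leaves the
geometric series of q^(2w). -/
theorem sq_budget_error_le {q : ℝ} (h0 : 0 ≤ q) (h1 : q < 1) (r : PauliString n → ℝ)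
    (ls : List (Layer n)) (b : ℕ) (Q : PauliString n) :
    (q ^ Q.weight * exactVal q r (ls.map (Layer.data .uniform)) Q -
      budgetVal q r (ls.map (Layer.data .uniform)) b Q) ^ 2 ≤
      (q ^ (b + 1) / (1 - q)) ^ 2 * normSq r := by
  obtain ⟨ψ, h2, h3⟩ := exists_graded q ls fun w R =>
    if w = 0 then (Pi.single Q 1 : PauliString n → ℝ) R else 0
  have hφ : ∀ N, ∑ w ∈ Finset.range (N + 1), normSq (fun R : PauliString n =>
      if w = 0 then (Pi.single Q 1 : PauliString n → ℝ) R else 0) = 1 := by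
    intro N
    rw [Finset.sum_range_succ']
    simp [normSq, Pi.single_apply]
  have h4 : ∀ N, budgetVal q r (ls.map (Layer.data .uniform)) N Q =
      ∑ w ∈ Finset.range (N + 1), ∑ R, q ^ w * ψ w R * r R := by
    intro N
    rw [← h3 r N, Finset.sum_range_succ']
    simp [Pi.single_apply]
  -- A budget that is at least b and drops nothing, so that the exact value is a partial sum of the
  -- same series.
  let N := n * (ls.length + 1) + b
  rw [← budgetVal_eq_exactVal q r ls N (by omega), h4, h4,
    ← Finset.sum_Ico_eq_sub _ (by omega : b + 1 ≤ N + 1)]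
  have h5 : (∑ w ∈ Finset.Ico (b + 1) (N + 1), ∑ R, q ^ w * ψ w R * r R) =
      ∑ x ∈ Finset.Ico (b + 1) (N + 1) ×ˢ Finset.univ, ψ x.1 x.2 * (q ^ x.1 * r x.2) := by
    rw [Finset.sum_product]
    refine Finset.sum_congr rfl fun w _ => Finset.sum_congr rfl fun R _ => by ring
  rw [h5]
  refine (Finset.sum_mul_sq_le_sq_mul_sq _ _ _).trans ?_
  rw [Finset.sum_product, Finset.sum_product]
  have h6 : ∑ w ∈ Finset.Ico (b + 1) (N + 1), ∑ R, ψ w R ^ 2 ≤ 1 := by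
    rw [← hφ N]
    refine le_trans ?_ (h2 (N + 1))
    refine Finset.sum_le_sum_of_subset_of_nonneg ?_ fun w _ _ => normSq_nonneg _
    intro w
    simp
  have h7 : ∑ w ∈ Finset.Ico (b + 1) (N + 1), ∑ R, (q ^ w * r R) ^ 2 =
      (∑ w ∈ Finset.Ico (b + 1) (N + 1), (q ^ 2) ^ w) * normSq r := by
    rw [Finset.sum_mul]
    refine Finset.sum_congr rfl fun w _ => ?_
    rw [normSq, Finset.mul_sum]
    refine Finset.sum_congr rfl fun R _ => by rw [mul_pow, ← pow_mul, ← pow_mul, mul_comm w]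
  have hq2 : q ^ 2 < 1 := by nlinarith
  -- The series is at most q^(2(b+1)) / (1 - q²), and (1 - q)² ≤ 1 - q².
  have h8 : ∑ w ∈ Finset.Ico (b + 1) (N + 1), (q ^ 2) ^ w ≤ (q ^ (b + 1) / (1 - q)) ^ 2 := by
    refine (geom_sum_Ico_le_of_lt_one (sq_nonneg q) hq2).trans ?_
    rw [div_pow, ← pow_mul, ← pow_mul, mul_comm]
    refine div_le_div_of_nonneg_left (by positivity) (by nlinarith) ?_
    nlinarith
  calc _ ≤ 1 * ((∑ w ∈ Finset.Ico (b + 1) (N + 1), (q ^ 2) ^ w) * normSq r) := by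
        rw [← h7]
        refine mul_le_mul_of_nonneg_right h6 ?_
        exact Finset.sum_nonneg fun _ _ => Finset.sum_nonneg fun _ _ => sq_nonneg _
    _ ≤ _ := by
        rw [one_mul]
        exact mul_le_mul_of_nonneg_right h8 (normSq_nonneg r)

/-- Layers map the nonidentity strings among themselves, and each of these has weight at least one;
so each of the `ls.length + 1` rounds of noise contributes a factor q. -/
theorem sq_sum_exactVal_le_of_zero {q : ℝ} (h0 : 0 ≤ q) (h1 : q ≤ 1)
    (r : PauliString n → ℝ) (ls : List (Layer n)) (v : PauliString n → ℝ) (hv : v 0 = 0) :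
    (∑ Q, v Q * q ^ Q.weight * exactVal q r (ls.map (Layer.data .uniform)) Q) ^ 2 ≤
      (q ^ (ls.length + 1)) ^ 2 * normSq v * normSq r := by
  have hz : normSq (fun Q => v Q * q ^ Q.weight) ≤ q ^ 2 * normSq v := by
    refine normSq_mul_le _ _ fun Q hQ => ?_
    refine (abs_pow_le_of_le h0 h1 (k := 1) ?_).trans (by simp)
    refine Nat.one_le_iff_ne_zero.2 fun h => hQ ?_
    rw [PauliString.weight_eq_zero.1 h, hv]
  induction ls generalizing v with
  | nil =>
    refine (Finset.sum_mul_sq_le_sq_mul_sq _ _ _).trans ?_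
    refine mul_le_mul_of_nonneg_right ?_ (normSq_nonneg r)
    exact hz.trans (by simp)
  | cons L ls ih =>
    simp only [List.map_cons, exactVal, Layer.data, sum_mul_heis]
    have h3 : rowStep L.unitary (fun Q => v Q * q ^ Q.weight) 0 = 0 := by
      simp [rowStep, L.heis_zero_right, hv]
    have h2 := ih _ h3 ?_
    · have e : ∀ R : PauliString n, q ^ R.weightOn (NoiseModel.uniform.noisyQubits L) =
        q ^ R.weight := fun R => congrArg (q ^ ·) R.weightOn_true
      simp only [e, ← mul_assoc]
      refine h2.trans (mul_le_mul_of_nonneg_right ?_ (normSq_nonneg r))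
      rw [L.normSq_rowStep]
      refine (mul_le_mul_of_nonneg_left hz (sq_nonneg _)).trans (le_of_eq ?_)
      rw [List.length_cons]
      ring
    · refine normSq_mul_le _ _ fun Q hQ => ?_
      refine (abs_pow_le_of_le h0 h1 (k := 1) ?_).trans (by simp)
      refine Nat.one_le_iff_ne_zero.2 fun h => hQ ?_
      rw [PauliString.weight_eq_zero.1 h, h3]

theorem exactVal_zero (q : ℝ) (N : NoiseModel) (r : PauliString n → ℝ) (ls : List (Layer n)) :
    exactVal q r (ls.map (Layer.data N)) 0 = r 0 := by
  induction ls with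
  | nil => rfl
  | cons L ls ih =>
    simp [exactVal, Layer.data, L.heis_zero_left, PauliString.weightOn]
    exact ih

theorem cutVal_zero (q : ℝ) (N : NoiseModel) (r : PauliString n → ℝ) (m : ℕ)
    (ls : List (Layer n)) : cutVal q r m (ls.map (Layer.data N)) 0 = r 0 := by
  induction ls with
  | nil => simp [cutVal, PauliString.weight]
  | cons L ls ih =>
    simp [cutVal, Layer.data, L.heis_zero_left, PauliString.weight, PauliString.weightOn]
    exact ih

theorem budgetVal_zero (q : ℝ) (r : PauliString n → ℝ) (b : ℕ) (ls : List (Layer n)) :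
    budgetVal q r (ls.map (Layer.data .uniform)) b 0 = r 0 := by
  induction ls with
  | nil => simp [budgetVal, PauliString.weight]
  | cons L ls ih =>
    simp [budgetVal, Layer.data, L.heis_zero_left, PauliString.weight]
    exact ih

theorem budgetVal_of_lt (q : ℝ) (r : PauliString n → ℝ) {b : ℕ}
    (ls : List (Op n × (Fin n → Bool))) {Q : PauliString n} (h : b < Q.weight) :
    budgetVal q r ls b Q = 0 := by
  cases ls <;> simp [budgetVal, h.not_ge]

/-- Budget zero keeps exactly the identity string, whose value is exact; every other string is
damped in each round. -/
theorem sq_budget_error_zero_le {q : ℝ} (h0 : 0 ≤ q) (h1 : q ≤ 1) (r : PauliString n → ℝ)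
    (ls : List (Layer n)) (Q : PauliString n) :
    (q ^ Q.weight * exactVal q r (ls.map (Layer.data .uniform)) Q -
      budgetVal q r (ls.map (Layer.data .uniform)) 0 Q) ^ 2 ≤
      (q ^ (ls.length + 1)) ^ 2 * normSq r := by
  by_cases hQ : Q = 0
  · subst hQ
    rw [exactVal_zero, budgetVal_zero]
    simpa [PauliString.weight] using mul_nonneg (sq_nonneg (q ^ (ls.length + 1))) (normSq_nonneg r)
  · rw [budgetVal_of_lt, sub_zero]
    · have := sq_sum_exactVal_le_of_zero h0 h1 r ls (Pi.single Q 1) (by simp [Ne.symm hQ])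
      simpa [Pi.single_apply, normSq] using this
    · exact Nat.pos_of_ne_zero fun h => hQ (PauliString.weight_eq_zero.1 h)

end

noncomputable section

variable {n : ℕ}

/-! ### Linearity, covariance and measurability -/

theorem eq_sum_mul_single (r : PauliString n → ℝ) (Q : PauliString n) :
    r Q = ∑ R, r R * (Pi.single R 1 : PauliString n → ℝ) Q := by
  simp [Pi.single_apply]

theorem exactVal_eq_sum (q : ℝ) (r : PauliString n → ℝ) (ls : List (Op n × (Fin n → Bool)))
    (Q : PauliString n) :
    exactVal q r ls Q = ∑ R, r R * exactVal q (Pi.single R 1) ls Q := by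
  induction ls generalizing Q with
  | nil => exact eq_sum_mul_single r Q
  | cons l ls ih =>
    simp only [exactVal, Finset.mul_sum]
    rw [Finset.sum_comm]
    refine Finset.sum_congr rfl fun R' _ => ?_
    rw [ih R', Finset.mul_sum, Finset.mul_sum]
    exact Finset.sum_congr rfl fun R _ => by ring

theorem cutVal_eq_sum (q : ℝ) (m : ℕ) (r : PauliString n → ℝ)
    (ls : List (Op n × (Fin n → Bool))) (Q : PauliString n) :
    cutVal q r m ls Q = ∑ R, r R * cutVal q (Pi.single R 1) m ls Q := by
  induction ls generalizing Q with
  | nil =>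
    simp only [cutVal]
    split_ifs
    · exact eq_sum_mul_single r Q
    · simp
  | cons l ls ih =>
    simp only [cutVal]
    split_ifs
    · simp only [Finset.mul_sum]
      rw [Finset.sum_comm]
      refine Finset.sum_congr rfl fun R' _ => ?_
      rw [ih R', Finset.mul_sum, Finset.mul_sum]
      exact Finset.sum_congr rfl fun R _ => by ring
    · simp

theorem budgetVal_eq_sum (q : ℝ) (b : ℕ) (r : PauliString n → ℝ)
    (ls : List (Op n × (Fin n → Bool))) (Q : PauliString n) :
    budgetVal q r ls b Q = ∑ R, r R * budgetVal q (Pi.single R 1) ls b Q := by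
  induction ls generalizing Q b with
  | nil =>
    simp only [budgetVal]
    split_ifs
    · rw [eq_sum_mul_single r Q, Finset.mul_sum]
      exact Finset.sum_congr rfl fun R _ => by ring
    · simp
  | cons l ls ih =>
    simp only [budgetVal]
    split_ifs
    · simp only [Finset.mul_sum]
      rw [Finset.sum_comm]
      refine Finset.sum_congr rfl fun R' _ => ?_
      rw [ih _ R', Finset.mul_sum, Finset.mul_sum]
      exact Finset.sum_congr rfl fun R _ => by ring
    · simp

/-- Since P Q P = ±Q, conjugating the unitary by P conjugates `heis` by a diagonal matrix of signs.
-/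
theorem heis_conj (U : Op n) (P Q R : PauliString n) :
    heis (P.op.conjTranspose * U * P.op) Q R = P.sign Q * P.sign R * heis U Q R := by
  apply Complex.ofReal_injective
  have h1 : (P.op.conjTranspose * U * P.op).conjTranspose * Q.op * (P.op.conjTranspose * U * P.op) =
      P.op * (U.conjTranspose * (P.op * Q.op * P.op) * U) * P.op := by
    simp only [Matrix.conjTranspose_mul, P.op_conjTranspose, Matrix.mul_assoc]
  rw [← heis_eq, h1, P.op_conj, pauliCoeff, ← Matrix.mul_assoc, Matrix.trace_mul_comm,
    ← Matrix.mul_assoc, ← Matrix.mul_assoc, P.op_conj]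
  simp only [Matrix.smul_mul, Matrix.mul_smul, Matrix.trace_smul, smul_eq_mul]
  push_cast
  rw [← heis_eq, pauliCoeff]
  ring

/-- Conjugation of a layer by a Pauli string. -/
def conjData (P : PauliString n) (l : Op n × (Fin n → Bool)) : Op n × (Fin n → Bool) :=
  (P.op.conjTranspose * l.1 * P.op, l.2)

theorem ofFn_conjLayers {d : ℕ} (P : PauliString n) (c : Fin d → Op n × (Fin n → Bool)) :
    List.ofFn (conjLayers P c) = (List.ofFn c).map (conjData P) := by
  rw [List.map_ofFn]; rfl

/-- The noise is diagonal, so the signs of consecutive layers cancel. What remains is the sign of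
the first string and the signs on r, that is, the passage from ρ to PρP†. Truncations by weight do
not see signs, which gives the same covariance for `cutVal` and `budgetVal`. -/
theorem exactVal_conj (q : ℝ) (r : PauliString n → ℝ) (P : PauliString n)
    (ls : List (Op n × (Fin n → Bool))) (Q : PauliString n) :
    exactVal q r (ls.map (conjData P)) Q =
      P.sign Q * exactVal q (fun R => P.sign R * r R) ls Q := by
  induction ls generalizing Q with
  | nil => simp [exactVal, ← mul_assoc, PauliString.sign_mul_self]
  | cons l ls ih =>
    simp only [List.map_cons, exactVal, conjData, heis_conj, ih, Finset.mul_sum]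
    refine Finset.sum_congr rfl fun R _ => ?_
    linear_combination (P.sign Q * heis l.1 Q R * q ^ R.weightOn l.2 *
      exactVal q (fun R => P.sign R * r R) ls R) * P.sign_mul_self R

theorem cutVal_conj (q : ℝ) (m : ℕ) (r : PauliString n → ℝ) (P : PauliString n)
    (ls : List (Op n × (Fin n → Bool))) (Q : PauliString n) :
    cutVal q r m (ls.map (conjData P)) Q =
      P.sign Q * cutVal q (fun R => P.sign R * r R) m ls Q := by
  induction ls generalizing Q with
  | nil => simp [cutVal, ← mul_assoc, PauliString.sign_mul_self]
  | cons l ls ih =>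
    simp only [List.map_cons, cutVal, conjData, heis_conj, ih]
    split_ifs
    · rw [Finset.mul_sum]
      refine Finset.sum_congr rfl fun R _ => ?_
      linear_combination (P.sign Q * heis l.1 Q R * q ^ R.weightOn l.2 *
        cutVal q (fun R => P.sign R * r R) m ls R) * P.sign_mul_self R
    · simp

theorem budgetVal_conj (q : ℝ) (b : ℕ) (r : PauliString n → ℝ) (P : PauliString n)
    (ls : List (Op n × (Fin n → Bool))) (Q : PauliString n) :
    budgetVal q r (ls.map (conjData P)) b Q =
      P.sign Q * budgetVal q (fun R => P.sign R * r R) ls b Q := by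
  induction ls generalizing Q b with
  | nil =>
    simp only [List.map_nil, budgetVal]
    split_ifs
    · linear_combination (-(q ^ Q.weight * r Q)) * P.sign_mul_self Q
    · simp
  | cons l ls ih =>
    simp only [List.map_cons, budgetVal, conjData, heis_conj, ih]
    split_ifs
    · simp only [Finset.mul_sum]
      refine Finset.sum_congr rfl fun R _ => ?_
      linear_combination (P.sign Q * heis l.1 Q R * q ^ Q.weight *
        budgetVal q (fun R => P.sign R * r R) ls (b - Q.weight) R) * P.sign_mul_self R
    · simp

theorem measurable_op_mk {α : Type*} [MeasurableSpace α] {f : α → Op n}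
    (h : ∀ x y, Measurable fun a => f a x y) : Measurable f :=
  measurable_pi_iff.2 fun x => measurable_pi_iff.2 fun y => h x y

theorem measurable_op_apply {α : Type*} [MeasurableSpace α] {f : α → Op n} (h : Measurable f)
    (x y : Fin n → Fin 2) : Measurable fun a => f a x y :=
  measurable_pi_iff.1 (measurable_pi_iff.1 h x) y

theorem Measurable.op_mul {α : Type*} [MeasurableSpace α] {f g : α → Op n} (hf : Measurable f)
    (hg : Measurable g) : Measurable fun a => f a * g a := by
  refine measurable_op_mk fun x y => ?_
  simp only [Matrix.mul_apply]
  exact Finset.measurable_sum _ fun z _ =>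
    (measurable_op_apply hf x z).mul (measurable_op_apply hg z y)

theorem Measurable.op_conjTranspose {α : Type*} [MeasurableSpace α] {f : α → Op n}
    (hf : Measurable f) : Measurable fun a => (f a).conjTranspose := by
  refine measurable_op_mk fun x y => ?_
  simp only [Matrix.conjTranspose_apply]
  exact Complex.continuous_conj.measurable.comp (measurable_op_apply hf y x)

theorem measurable_heis (P Q : PauliString n) : Measurable fun U : Op n => heis U P Q := by
  refine Complex.measurable_re.comp ?_
  simp only [pauliCoeff, Matrix.trace, Matrix.diag]
  refine Measurable.div_const (Finset.measurable_sum _ fun x _ => ?_) _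
  refine measurable_op_apply ?_ x x
  exact Measurable.op_mul measurable_const (Measurable.op_mul
    (Measurable.op_mul (Measurable.op_conjTranspose measurable_id) measurable_const) measurable_id)

theorem measurable_pow_weightOn (q : ℝ) (R : PauliString n) :
    Measurable fun S : Fin n → Bool => q ^ R.weightOn S :=
  measurable_of_finite _

theorem measurable_exactVal {d : ℕ} (q : ℝ) (r : PauliString n → ℝ) (Q : PauliString n) :
    Measurable fun c : Fin d → Op n × (Fin n → Bool) => exactVal q r (List.ofFn c) Q := by
  induction d generalizing Q with
  | zero => simp only [List.ofFn_zero]; exact measurable_const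
  | succ d ih =>
    simp only [List.ofFn_succ, exactVal]
    refine Finset.measurable_sum _ fun R _ => ((measurable_heis Q R).comp
      (measurable_fst.comp (measurable_pi_apply 0))).mul (((measurable_pow_weightOn q R).comp
      (measurable_snd.comp (measurable_pi_apply 0))).mul ((ih R).comp ?_))
    exact measurable_pi_lambda _ fun i => measurable_pi_apply i.succ

theorem measurable_cutVal {d : ℕ} (q : ℝ) (m : ℕ) (r : PauliString n → ℝ) (Q : PauliString n) :
    Measurable fun c : Fin d → Op n × (Fin n → Bool) => cutVal q r m (List.ofFn c) Q := by
  induction d generalizing Q with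
  | zero => simp only [List.ofFn_zero]; exact measurable_const
  | succ d ih =>
    simp only [List.ofFn_succ, cutVal]
    split_ifs
    · refine Finset.measurable_sum _ fun R _ => ((measurable_heis Q R).comp
        (measurable_fst.comp (measurable_pi_apply 0))).mul (((measurable_pow_weightOn q R).comp
        (measurable_snd.comp (measurable_pi_apply 0))).mul ((ih R).comp ?_))
      exact measurable_pi_lambda _ fun i => measurable_pi_apply i.succ
    · exact measurable_const

theorem measurable_budgetVal {d : ℕ} (q : ℝ) (b : ℕ) (r : PauliString n → ℝ)
    (Q : PauliString n) :
    Measurable fun c : Fin d → Op n × (Fin n → Bool) => budgetVal q r (List.ofFn c) b Q := by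
  induction d generalizing Q b with
  | zero => simp only [List.ofFn_zero]; exact measurable_const
  | succ d ih =>
    simp only [List.ofFn_succ, budgetVal]
    split_ifs
    · refine (Finset.measurable_sum _ fun R _ => ((measurable_heis Q R).comp
        (measurable_fst.comp (measurable_pi_apply 0))).mul ((ih _ R).comp ?_)).const_mul _
      exact measurable_pi_lambda _ fun i => measurable_pi_apply i.succ
    · exact measurable_const

theorem measurable_conjLayers {d : ℕ} (P : PauliString n) :
    Measurable (conjLayers P : (Fin d → Op n × (Fin n → Bool)) → _) := by
  refine measurable_pi_lambda _ fun t => ?_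
  have h : Measurable fun c : Fin d → Op n × (Fin n → Bool) => c t := measurable_pi_apply t
  exact (Measurable.op_mul (Measurable.op_mul measurable_const (measurable_fst.comp h))
    measurable_const).prodMk (measurable_snd.comp h)

/-! ### Second moments under disorder -/

section Disorder

variable {Ω : Type*} [MeasurableSpace Ω] {d : ℕ} {N : NoiseModel} {μ : Measure Ω}
  {C : Ω → Circuit n d}

theorem InvariantUnder.trans_mul (hC : Measurable fun ω => (C ω).layers N)
    {P P' P'' : PauliString n} (h : InvariantUnder N μ C P) (h' : InvariantUnder N μ C P')
    (hP : P''.op = P.op * P'.op) : InvariantUnder N μ C P'' := by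
  have e : (fun ω => conjLayers P'' ((C ω).layers N)) =
      conjLayers P' ∘ fun ω => conjLayers P ((C ω).layers N) := by
    funext ω t
    simp only [conjLayers, Function.comp, hP, Matrix.conjTranspose_mul, Matrix.mul_assoc]
  have h1 : Measurable fun ω => conjLayers P ((C ω).layers N) := (measurable_conjLayers P).comp hC
  unfold InvariantUnder at h h' ⊢
  rw [e, ← Measure.map_map (measurable_conjLayers P') h1, h,
    Measure.map_map (measurable_conjLayers P') hC]
  exact h'

/-- A string is a product of single-qubit Pauli operators on distinct qubits, and invariance passes
to products; build P up letter by letter. -/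
theorem HasSpatialDisorder.invariantUnder (hC : Measurable fun ω => (C ω).layers N)
    (h : HasSpatialDisorder N μ C) (P : PauliString n) : InvariantUnder N μ C P := by
  have key : ∀ s : Finset (Fin n), InvariantUnder N μ C fun j => if j ∈ s then P j else 0 := by
    intro s
    induction s using Finset.induction_on with
    | empty =>
      rw [InvariantUnder]
      congr 1
      funext ω t
      have : (PauliString.op fun _ : Fin n => (0 : Fin 4)) = 1 := PauliString.op_zero
      simp [conjLayers, this]
    | insert i s hi ih =>
      refine InvariantUnder.trans_mul hC ih (h i (P i)) ?_
      simp only [PauliString.op_eq_tens, tens_mul]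
      congr 1
      funext j
      by_cases hj : j = i
      · subst hj
        simp [PauliString.single, hi, pauliMatrix]
      · simp [PauliString.single, hj, pauliMatrix]
  simpa using key Finset.univ

theorem HasSpatialDisorder.hasSpatialDisorderOn (hC : Measurable fun ω => (C ω).layers N)
    (h : HasSpatialDisorder N μ C) {ρ : Op n} (hρ : ρ.trace = 1) :
    HasSpatialDisorderOn N μ C ρ := by
  refine ⟨Finset.univ, fun P _ => h.invariantUnder hC P, ?_⟩
  rw [sum_conj_op, hρ, mul_one, Finset.card_univ, smul_smul]
  congr 1
  have h2 : (2 : ℂ) ^ n ≠ 0 := pow_ne_zero _ two_ne_zero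
  have h4 : ((4 : ℂ)) ^ n = 2 ^ n * 2 ^ n := by rw [← mul_pow]; norm_num
  simp only [Fintype.card_pi, Fintype.card_fin, Finset.prod_const, Finset.card_univ]
  push_cast
  rw [h4]
  field_simp

open scoped ComplexOrder in
-- Nonnegativity of a variance: expand 0 ≤ tr((A - t)σ(A - t)†) at t = tr(σA).
theorem normSq_trace_le {σ : Op n} (hσ : IsState σ) (A : Op n) :
    ‖(σ * A).trace‖ ^ 2 ≤ (σ * (A.conjTranspose * A)).trace.re := by
  set t := (σ * A).trace with ht
  have h1 := (hσ.1.mul_mul_conjTranspose_same (A - t • 1)).trace_nonneg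
  have h2 : (σ * A.conjTranspose).trace = star t := by
    rw [ht, ← Matrix.trace_conjTranspose, Matrix.conjTranspose_mul, hσ.1.isHermitian.eq,
      Matrix.trace_mul_comm]
  have h3 : ((A - t • 1) * σ * (A - t • 1).conjTranspose).trace =
      (σ * (A.conjTranspose * A)).trace - star t * t := by
    simp only [Matrix.conjTranspose_sub, Matrix.conjTranspose_smul, Matrix.conjTranspose_one,
      sub_mul, mul_sub, Matrix.trace_sub, Matrix.smul_mul, Matrix.mul_smul, one_mul, mul_one,
      Matrix.trace_smul, smul_eq_mul]
    rw [hσ.2, h2, Matrix.trace_mul_comm A σ, ← ht, Matrix.mul_assoc, Matrix.trace_mul_comm A,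
      Matrix.mul_assoc]
    ring
  rw [h3] at h1
  have h4 := (Complex.le_def.1 h1).1
  have h5 : (star t * t).re = ‖t‖ ^ 2 := by
    rw [Complex.star_def, Complex.conj_mul', ← Complex.ofReal_pow, Complex.ofReal_re]
  rw [Complex.sub_re, h5] at h4
  simpa using h4

theorem eLpNorm_two_le {f : Ω → ℝ} {ε : ℝ} [IsProbabilityMeasure μ]
    (h : ∫⁻ ω, ENNReal.ofReal (f ω ^ 2) ∂μ ≤ ENNReal.ofReal (ε ^ 2)) (hε : 0 ≤ ε) :
    eLpNorm f 2 μ ≤ ENNReal.ofReal ε := by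
  have h1 := eLpNorm_nnreal_pow_eq_lintegral (μ := μ) (f := f) (p := 2) two_ne_zero
  have h2 : ∀ ω, ‖f ω‖ₑ ^ ((2 : NNReal) : ℝ) = ENNReal.ofReal (f ω ^ 2) := by
    intro ω
    rw [← ofReal_norm, ENNReal.ofReal_rpow_of_nonneg (norm_nonneg _) (by simp)]
    congr 1
    simp
  simp only [h2] at h1
  rw [← h1] at h
  have h3 : ENNReal.ofReal (ε ^ 2) = ENNReal.ofReal ε ^ ((2 : NNReal) : ℝ) := by
    rw [ENNReal.ofReal_rpow_of_nonneg hε (by simp)]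
    simp
  rw [h3] at h
  exact (ENNReal.rpow_le_rpow_iff (by simp)).1 h

open scoped ComplexOrder in
-- For a fixed circuit the functional is ρ ↦ tr(ρA), with A having the Pauli coefficients a R = f c
-- (Pi.single R 1). By invariance of the law, the second moment equals its average over ρ ↦ PρP†. By
-- `normSq_trace_le` that average is at most tr(A†A)/2^n = normSq a, because PρP† averages to the
-- maximally mixed state. So a bound on the Euclidean norm of the functional is enough; only squares
-- occur in `hcov`, which disposes of the overall sign.
theorem eLpNorm_le_of_disorder [IsProbabilityMeasure μ]
    (hC : Measurable fun ω => (C ω).layers N) {ρ : Op n} (hρ : IsState ρ)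
    (hdis : HasSpatialDisorderOn N μ C ρ) {ε : ℝ} (hε : 0 ≤ ε)
    (f : (Fin d → Op n × (Fin n → Bool)) → (PauliString n → ℝ) → ℝ)
    (hlin : ∀ c r, f c r = ∑ R, r R * f c (Pi.single R 1))
    (hmeas : ∀ r, Measurable fun c => f c r)
    (hcov : ∀ P c r, (f (conjLayers P c) r) ^ 2 = (f c fun R => P.sign R * r R) ^ 2)
    (hbound : ∀ ω r, (f ((C ω).layers N) r) ^ 2 ≤ ε ^ 2 * normSq r) :
    eLpNorm (fun ω => f ((C ω).layers N) fun P => (ρ * P.op).trace.re) 2 μ ≤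
      ENNReal.ofReal ε := by
  obtain ⟨S, hS, hav⟩ := hdis
  set r : PauliString n → ℝ := fun P => (ρ * P.op).trace.re with hr
  have h2n : (2 : ℂ) ^ n ≠ 0 := pow_ne_zero _ two_ne_zero
  -- The set is nonempty: with 0⁻¹ = 0 an empty average would be 0, which is not 1/2^n.
  have hcard : (S.card : ℂ) ≠ 0 := by
    intro h0
    rw [h0, inv_zero, zero_smul] at hav
    have := congrFun₂ hav 0 0
    simp only [Matrix.smul_apply, Matrix.one_apply_eq, smul_eq_mul, mul_one] at this
    exact inv_ne_zero h2n (this.symm.trans (by simp))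
  refine eLpNorm_two_le ?_ hε
  have hinv : ∀ P ∈ S, ∫⁻ ω, ENNReal.ofReal (f ((C ω).layers N) r ^ 2) ∂μ =
      ∫⁻ ω, ENNReal.ofReal ((f ((C ω).layers N) fun R => P.sign R * r R) ^ 2) ∂μ := by
    intro P hP
    have hm : Measurable fun c => ENNReal.ofReal (f c r ^ 2) :=
      ((hmeas r).pow_const 2).ennreal_ofReal
    have h1 := lintegral_map (μ := μ) hm hC
    have h2 := lintegral_map (μ := μ) hm ((measurable_conjLayers P).comp hC)
    have h3 : μ.map (conjLayers P ∘ fun ω => (C ω).layers N) = μ.map fun ω => (C ω).layers N :=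
      hS P hP
    rw [h3, h1] at h2
    rw [h2]
    simp only [Function.comp, hcov]
  have hpoint : ∀ ω, ∑ P ∈ S, (f ((C ω).layers N) fun R => P.sign R * r R) ^ 2 ≤
      S.card * ε ^ 2 := by
    intro ω
    set c := (C ω).layers N
    let a : PauliString n → ℝ := fun R => f c (Pi.single R 1)
    let A : Op n := ∑ R, (a R : ℂ) • R.op
    -- Test the hypothesis on r = a. There the functional takes the value normSq a, so (normSq a)² ≤
    -- ε² · normSq a.
    have ha : normSq a ≤ ε ^ 2 := by
      have h1 : f c a = normSq a := by
        rw [hlin, normSq]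
        exact Finset.sum_congr rfl fun R _ => (sq (a R)).symm
      have h2 := hbound ω a
      rw [h1] at h2
      rcases (normSq_nonneg a).eq_or_lt with h0 | h0
      · rw [← h0]; positivity
      · nlinarith
    have hA : ((A.conjTranspose * A).trace : ℂ) = 2 ^ n * (normSq a : ℝ) := by
      have h1 := sum_normSq_pauliCoeff A
      have h2 : ∀ Q, pauliCoeff A Q = a Q := by
        intro Q
        simp only [A, pauliCoeff_sum, pauliCoeff_smul, pauliCoeff_op]
        simp
      simp only [h2, Complex.norm_real] at h1
      rw [eq_div_iff h2n] at h1
      rw [← h1, normSq, mul_comm]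
      congr 1
      push_cast
      refine Finset.sum_congr rfl fun R _ => ?_
      norm_cast
      rw [Real.norm_eq_abs, sq_abs]
    have hf : ∀ P : PauliString n, (f c fun R => P.sign R * r R) =
        (P.op * ρ * P.op.conjTranspose * A).trace.re := by
      intro P
      rw [hlin]
      simp only [A, Finset.mul_sum, Matrix.mul_smul, Matrix.trace_sum, Matrix.trace_smul,
        Complex.re_sum]
      refine Finset.sum_congr rfl fun R _ => ?_
      rw [P.op_conjTranspose, Matrix.mul_assoc, Matrix.mul_assoc, Matrix.trace_mul_comm,
        Matrix.mul_assoc, P.op_conj, Matrix.mul_smul, Matrix.trace_smul]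
      simp only [smul_eq_mul, Complex.re_ofReal_mul]
      simp only [hr, a]
      ring
    have hstate : ∀ P : PauliString n, IsState (P.op * ρ * P.op.conjTranspose) := by
      intro P
      refine ⟨hρ.1.mul_mul_conjTranspose_same _, ?_⟩
      rw [P.op_conjTranspose, Matrix.trace_mul_comm, ← Matrix.mul_assoc, P.op_mul_self, one_mul,
        hρ.2]
    calc _ ≤ ∑ P ∈ S, (P.op * ρ * P.op.conjTranspose * (A.conjTranspose * A)).trace.re := by
          refine Finset.sum_le_sum fun P _ => ?_
          refine le_trans ?_ (normSq_trace_le (hstate P) A)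
          rw [hf P, ← sq_abs]
          exact pow_le_pow_left₀ (abs_nonneg _) (Complex.abs_re_le_norm _) 2
      _ = S.card * normSq a := by
          rw [← Complex.re_sum, ← Matrix.trace_sum, ← Finset.sum_mul]
          have h3 : ∑ P ∈ S, P.op * ρ * P.op.conjTranspose =
              ((S.card : ℂ) * ((2 : ℂ) ^ n)⁻¹) • (1 : Op n) := by
            rw [mul_smul, ← hav, smul_smul, mul_inv_cancel₀ hcard, one_smul]
          rw [h3, Matrix.smul_mul, one_mul, Matrix.trace_smul, hA, smul_eq_mul, mul_assoc,
            inv_mul_cancel_left₀ h2n]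
          norm_cast
      _ ≤ _ := mul_le_mul_of_nonneg_left ha (Nat.cast_nonneg _)
  have hpos : (S.card : ENNReal) ≠ 0 := by
    have : S.card ≠ 0 := by exact_mod_cast hcard
    exact_mod_cast this
  have hsum : (S.card : ENNReal) * ∫⁻ ω, ENNReal.ofReal (f ((C ω).layers N) r ^ 2) ∂μ ≤
      S.card * ENNReal.ofReal (ε ^ 2) := by
    calc _ = ∑ P ∈ S, ∫⁻ ω, ENNReal.ofReal ((f ((C ω).layers N) fun R => P.sign R * r R) ^ 2)
          ∂μ := by
          rw [← nsmul_eq_mul, ← Finset.sum_const]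
          exact Finset.sum_congr rfl hinv
      _ = ∫⁻ ω, ∑ P ∈ S, ENNReal.ofReal ((f ((C ω).layers N) fun R => P.sign R * r R) ^ 2) ∂μ := by
          rw [lintegral_finsetSum]
          exact fun P _ => (((hmeas _).comp hC).pow_const 2).ennreal_ofReal
      _ ≤ ∫⁻ _, ENNReal.ofReal (S.card * ε ^ 2) ∂μ := by
          refine lintegral_mono fun ω => ?_
          rw [← ENNReal.ofReal_sum_of_nonneg fun _ _ => sq_nonneg _]
          exact ENNReal.ofReal_le_ofReal (hpoint ω)
      _ = _ := by
          rw [lintegral_const, measure_univ, mul_one, ENNReal.ofReal_mul (Nat.cast_nonneg _),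
            ENNReal.ofReal_natCast]
  exact (ENNReal.mul_le_mul_iff_right hpos (ENNReal.natCast_ne_top _)).1 hsum

/-- Minkowski's inequality. Nothing is known about correlations between the f i; this is where the
1-norm of the coefficients comes from. -/
theorem eLpNorm_weighted_sum_le {ι : Type*} [Fintype ι] {ε : ℝ} (hε : 0 ≤ ε) (c : ι → ℂ)
    (f : ι → Ω → ℝ) (hf : ∀ i, Measurable (f i))
    (h : ∀ i, eLpNorm (f i) 2 μ ≤ ENNReal.ofReal ε) :
    eLpNorm (fun ω => ∑ i, c i * (f i ω : ℂ)) 2 μ ≤ ENNReal.ofReal (ε * ∑ i, ‖c i‖) := by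
  have h3 : ∀ i, Measurable fun ω => c i * (f i ω : ℂ) := fun i =>
    (Complex.measurable_ofReal.comp (hf i)).const_mul _
  have h2 : (fun ω => ∑ i, c i * (f i ω : ℂ)) = ∑ i, fun ω => c i * (f i ω : ℂ) := by
    funext ω
    rw [Finset.sum_apply]
  rw [h2]
  refine (eLpNorm_sum_le (fun i _ => (h3 i).aestronglyMeasurable) (by norm_num)).trans ?_
  rw [Finset.mul_sum, ENNReal.ofReal_sum_of_nonneg fun i _ => by positivity]
  refine Finset.sum_le_sum fun i _ => ?_
  have h4 : eLpNorm (fun ω => c i * (f i ω : ℂ)) 2 μ =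
      ‖c i‖ₑ * eLpNorm (fun ω => (f i ω : ℂ)) 2 μ :=
    eLpNorm_const_smul (c i) (fun ω => (f i ω : ℂ)) 2 μ
  have h5 : eLpNorm (fun ω => (f i ω : ℂ)) 2 μ = eLpNorm (f i) 2 μ :=
    eLpNorm_congr_norm_ae (Filter.Eventually.of_forall fun ω => by simp)
  rw [h4, h5, mul_comm ε, ENNReal.ofReal_mul (norm_nonneg _), ofReal_norm]
  exact mul_le_mul_right (h i) _

open scoped ComplexOrder in
theorem IsState.isHermitian {σ : Op n} (hσ : IsState σ) : σ.IsHermitian := hσ.1.isHermitian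

/-- The root-mean-square error of a sum over Pauli strings. -/
theorem eLpNorm_sum_le_of_disorder [IsProbabilityMeasure μ]
    (hC : Measurable fun ω => (C ω).layers N) {ρ O : Op n} (hρ : IsState ρ) (hO : O.IsHermitian)
    (hdis : HasSpatialDisorder N μ C ∨ HasSpatialDisorderOn N μ C ρ) {γ ε : ℝ} (hε : 0 ≤ ε)
    (g : (Fin d → Op n × (Fin n → Bool)) → (PauliString n → ℝ) → PauliString n → ℝ)
    (hlin : ∀ c r Q, g c r Q = ∑ R, r R * g c (Pi.single R 1) Q)
    (hmeas : ∀ r Q, Measurable fun c => g c r Q)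
    (hcov : ∀ P c r Q, g (conjLayers P c) r Q = P.sign Q * g c (fun R => P.sign R * r R) Q)
    (hbound : ∀ ω r Q, (Real.exp (-γ) ^ Q.weight * exactVal (Real.exp (-γ)) r
      (List.ofFn ((C ω).layers N)) Q - g ((C ω).layers N) r Q) ^ 2 ≤ ε ^ 2 * normSq r) :
    Measurable (fun ω => ∑ Q, (pauliCoeff O Q).re *
      g ((C ω).layers N) (fun P => (ρ * P.op).trace.re) Q) ∧
    eLpNorm (fun ω => ((∑ Q, (pauliCoeff O Q).re *
      g ((C ω).layers N) (fun P => (ρ * P.op).trace.re) Q : ℝ) : ℂ) -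
        ((C ω).apply N γ ρ * O).trace) 2 μ ≤ ENNReal.ofReal (ε * pauliOneNorm O) := by
  have hdis' : HasSpatialDisorderOn N μ C ρ :=
    hdis.elim (fun h => h.hasSpatialDisorderOn hC hρ.2) id
  set q := Real.exp (-γ)
  set r : PauliString n → ℝ := fun P => (ρ * P.op).trace.re
  refine ⟨Finset.measurable_sum _ fun Q _ => ((hmeas r Q).comp hC).const_mul _, ?_⟩
  let f : PauliString n → (Fin d → Op n × (Fin n → Bool)) → (PauliString n → ℝ) → ℝ :=
    fun Q c r => g c r Q - q ^ Q.weight * exactVal q r (List.ofFn c) Q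
  have hfm : ∀ Q r, Measurable fun c => f Q c r := fun Q r =>
    (hmeas r Q).sub ((measurable_exactVal q r Q).const_mul _)
  have h1 : ∀ Q, eLpNorm (fun ω => f Q ((C ω).layers N) r) 2 μ ≤ ENNReal.ofReal ε := by
    intro Q
    refine eLpNorm_le_of_disorder hC hρ hdis' hε (f Q) ?_ (hfm Q) ?_ ?_
    · intro c r
      simp only [f]
      rw [hlin, exactVal_eq_sum, Finset.mul_sum, ← Finset.sum_sub_distrib]
      exact Finset.sum_congr rfl fun R _ => by ring
    · intro P c r
      simp only [f, hcov, ofFn_conjLayers, exactVal_conj]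
      have := P.sign_mul_self Q
      generalize g c _ Q = u
      generalize exactVal q _ _ Q = v
      -- Squaring removes the sign of Q, which both terms carry.
      linear_combination (u - q ^ Q.weight * v) ^ 2 * this
    · intro ω r
      refine le_trans (le_of_eq ?_) (hbound ω r Q)
      simp only [f]
      ring
  have h2 : (fun ω => ((∑ Q, (pauliCoeff O Q).re * g ((C ω).layers N) r Q : ℝ) : ℂ) -
        ((C ω).apply N γ ρ * O).trace) =
      fun ω => ∑ Q, pauliCoeff O Q * ((f Q ((C ω).layers N) r : ℝ) : ℂ) := by
    funext ω
    rw [trace_apply N γ ρ O hρ.isHermitian]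
    rw [Complex.ofReal_sum, ← Finset.sum_sub_distrib]
    refine Finset.sum_congr rfl fun Q _ => ?_
    rw [pauliCoeff_real hO Q]
    simp only [f, q, r, Complex.ofReal_re, Complex.ofReal_sub, Complex.ofReal_mul]
    ring
  rw [h2]
  exact eLpNorm_weighted_sum_le hε _ _ (fun Q => (hfm Q r).comp hC) h1

end Disorder

end

noncomputable section

/-! ### Reasoning about programs -/

/-- Whether a program may write into the array `a` of natural numbers. -/
def Cmd.writesNat (a : ℕ) : Cmd → Bool
  | .skip => false
  | .setNat b _ _ => a == b
  | .setReal _ _ _ => false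
  | .seq c c' => c.writesNat a || c'.writesNat a
  | .ite _ c c' => c.writesNat a || c'.writesNat a
  | .while _ c => c.writesNat a

/-- Whether a program may write into the array `a` of real numbers. -/
def Cmd.writesReal (a : ℕ) : Cmd → Bool
  | .skip => false
  | .setNat _ _ _ => false
  | .setReal b _ _ => a == b
  | .seq c c' => c.writesReal a || c'.writesReal a
  | .ite _ c c' => c.writesReal a || c'.writesReal a
  | .while _ c => c.writesReal a

/-- The memory after an assignment to a natural number. -/
def Memory.setN (s : Memory) (a i v : ℕ) : Memory :=
  ⟨Function.update s.nat a (Function.update (s.nat a) i v), s.real⟩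

/-- The memory after an assignment to a real number. -/
def Memory.setR (s : Memory) (a i : ℕ) (v : ℝ) : Memory :=
  ⟨s.nat, Function.update s.real a (Function.update (s.real a) i v)⟩

namespace Memory

variable (s : Memory) (a b i j v : ℕ) (w : ℝ)

@[simp] theorem setN_real : (s.setN a i v).real = s.real := rfl

@[simp] theorem setR_nat : (s.setR a i w).nat = s.nat := rfl

@[simp] theorem setN_nat_self : (s.setN a i v).nat a = Function.update (s.nat a) i v := by
  simp [setN]

@[simp] theorem setR_real_self : (s.setR a i w).real a = Function.update (s.real a) i w := by
  simp [setR]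

variable {a b}

@[simp] theorem setN_nat_of_ne (h : b ≠ a) : (s.setN a i v).nat b = s.nat b := by
  simp [setN, h]

@[simp] theorem setR_real_of_ne (h : b ≠ a) : (s.setR a i w).real b = s.real b := by
  simp [setR, h]

end Memory

/-- `c` does not distinguish the arrays of `s` and `s'` that it does not write. -/
def Frame (c : Cmd) (s s' : Memory) : Prop :=
  (∀ a, c.writesNat a = false → s'.nat a = s.nat a) ∧
    ∀ a, c.writesReal a = false → s'.real a = s.real a

theorem Frame.refl (c : Cmd) (s : Memory) : Frame c s s := ⟨fun _ _ => rfl, fun _ _ => rfl⟩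

theorem Frame.trans {c : Cmd} {s s' s'' : Memory} (h : Frame c s s') (h' : Frame c s' s'') :
    Frame c s s'' :=
  ⟨fun a ha => (h'.1 a ha).trans (h.1 a ha), fun a ha => (h'.2 a ha).trans (h.2 a ha)⟩

theorem Frame.mono {c c' : Cmd} {s s' : Memory} (h : Frame c s s')
    (hn : ∀ a, c'.writesNat a = false → c.writesNat a = false)
    (hr : ∀ a, c'.writesReal a = false → c.writesReal a = false) : Frame c' s s' :=
  ⟨fun a ha => h.1 a (hn a ha), fun a ha => h.2 a (hr a ha)⟩

section

variable {n d : ℕ} {x : Input n d}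

/-- The arrays that can be written are read off the syntax, so the many facts of the form "this
variable is untouched" reduce to evaluating `writesNat` and `writesReal`. -/
theorem Exec.frame {c : Cmd} {s s' : Memory} {k : ℕ} (h : Exec x c s k s') : Frame c s s' := by
  induction h with
  | skip s => exact Frame.refl _ _
  | setNat a i e s =>
    refine ⟨fun b hb => ?_, fun _ _ => rfl⟩
    have : b ≠ a := by simpa [Cmd.writesNat] using hb
    simp [this]
  | setReal a i e s =>
    refine ⟨fun _ _ => rfl, fun b hb => ?_⟩
    have : b ≠ a := by simpa [Cmd.writesReal] using hb
    simp [this]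
  | seq h h' ih ih' =>
    refine Frame.trans (ih.mono ?_ ?_) (ih'.mono ?_ ?_) <;> intro a ha <;>
      simp only [Cmd.writesNat, Cmd.writesReal, Bool.or_eq_false_iff] at ha <;> simp [ha]
  | iteTrue hb h ih =>
    refine ih.mono ?_ ?_ <;> intro a ha <;>
      simp only [Cmd.writesNat, Cmd.writesReal, Bool.or_eq_false_iff] at ha <;> simp [ha]
  | iteFalse hb h ih =>
    refine ih.mono ?_ ?_ <;> intro a ha <;>
      simp only [Cmd.writesNat, Cmd.writesReal, Bool.or_eq_false_iff] at ha <;> simp [ha]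
  | whileTrue hb h h' ih ih' =>
    exact Frame.trans (ih.mono (fun a ha => by simpa [Cmd.writesNat] using ha)
      (fun a ha => by simpa [Cmd.writesReal] using ha)) ih'
  | whileFalse hb => exact Frame.refl _ _

/-- The program halts, and the number of steps and the final memory satisfy `Q`. -/
def Runs (x : Input n d) (c : Cmd) (s : Memory) (Q : ℕ → Memory → Prop) : Prop :=
  ∃ k s', Exec x c s k s' ∧ Q k s'

variable {c c' : Cmd} {s : Memory} {Q Q' : ℕ → Memory → Prop} {b : Test}

theorem Runs.mono (h : Runs x c s Q) (hQ : ∀ k s', Q k s' → Q' k s') : Runs x c s Q' := by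
  obtain ⟨k, s', h1, h2⟩ := h
  exact ⟨k, s', h1, hQ k s' h2⟩

theorem Runs.frame (h : Runs x c s Q) : Runs x c s fun k s' => Q k s' ∧ Frame c s s' := by
  obtain ⟨k, s', h1, h2⟩ := h
  exact ⟨k, s', h1, h2, h1.frame⟩

/-- Consequence rule that also yields the frame. -/
theorem Runs.imp (h : Runs x c s Q) (hQ : ∀ k s', Q k s' → Frame c s s' → Q' k s') :
    Runs x c s Q' :=
  h.frame.mono fun k s' h' => hQ k s' h'.1 h'.2

@[simp] theorem runs_skip : Runs x .skip s Q ↔ Q 1 s := by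
  constructor
  · rintro ⟨k, s', h1, h2⟩; cases h1; exact h2
  · exact fun h => ⟨_, _, Exec.skip s, h⟩

@[simp] theorem runs_setNat {a : ℕ} {i e : NExp} : Runs x (.setNat a i e) s Q ↔
    Q 1 (s.setN a (i.eval x s) (e.eval x s)) := by
  constructor
  · rintro ⟨k, s', h1, h2⟩; cases h1; exact h2
  · exact fun h => ⟨_, _, Exec.setNat a i e s, h⟩

@[simp] theorem runs_setReal {a : ℕ} {i : NExp} {e : RExp} : Runs x (.setReal a i e) s Q ↔
    Q 1 (s.setR a (i.eval x s) (e.eval x s)) := by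
  constructor
  · rintro ⟨k, s', h1, h2⟩; cases h1; exact h2
  · exact fun h => ⟨_, _, Exec.setReal a i e s, h⟩

@[simp] theorem runs_seq : Runs x (.seq c c') s Q ↔
    Runs x c s fun k s' => Runs x c' s' fun k' s'' => Q (k + k') s'' := by
  constructor
  · rintro ⟨k, s', h1, h2⟩
    cases h1 with
    | seq h h' => exact ⟨_, _, h, _, _, h', h2⟩
  · rintro ⟨k, s', h, k', s'', h', h2⟩
    exact ⟨_, _, Exec.seq h h', h2⟩

theorem runs_ite_of_pos (hb : b.holds x s) : Runs x (.ite b c c') s Q ↔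
    Runs x c s fun k s' => Q (k + 1) s' := by
  constructor
  · rintro ⟨k, s', h1, h2⟩
    cases h1 with
    | iteTrue _ h => exact ⟨_, _, h, h2⟩
    | iteFalse h => exact absurd hb h
  · rintro ⟨k, s', h, h2⟩
    exact ⟨_, _, Exec.iteTrue hb h, h2⟩

theorem runs_ite_of_neg (hb : ¬ b.holds x s) : Runs x (.ite b c c') s Q ↔
    Runs x c' s fun k s' => Q (k + 1) s' := by
  constructor
  · rintro ⟨k, s', h1, h2⟩
    cases h1 with
    | iteTrue h => exact absurd h hb
    | iteFalse _ h => exact ⟨_, _, h, h2⟩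
  · rintro ⟨k, s', h, h2⟩
    exact ⟨_, _, Exec.iteFalse hb h, h2⟩

/-- Rule for a loop whose number of iterations is known. -/
theorem Runs.while (m : ℕ) (I : ℕ → Memory → Prop) (T : ℕ → ℕ) (h0 : I 0 s)
    (hstep : ∀ i t, i < m → Frame c s t → I i t → b.holds x t ∧
      Runs x c t fun k t' => k ≤ T i ∧ I (i + 1) t')
    (hend : ∀ t, Frame c s t → I m t → ¬ b.holds x t) :
    Runs x (.while b c) s fun k t => k ≤ ∑ i ∈ Finset.range m, (T i + 1) + 1 ∧ I m t := by
  have key : ∀ j i t, i + j = m → Frame c s t → I i t → Runs x (.while b c) t fun k t' =>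
      k ≤ ∑ l ∈ Finset.Ico i m, (T l + 1) + 1 ∧ I m t' := by
    intro j
    induction j with
    | zero =>
      intro i t hi hf h
      obtain rfl : i = m := by omega
      exact ⟨1, t, Exec.whileFalse (hend t hf h), by omega, h⟩
    | succ j ih =>
      intro i t hi hf h
      obtain ⟨hb, k, t', hx, hk, h'⟩ := hstep i t (by omega) hf h
      obtain ⟨k', t'', hx', hk', h''⟩ := ih (i + 1) t' (by omega) (hf.trans hx.frame) h'
      refine ⟨_, _, Exec.whileTrue hb hx hx', ?_, h''⟩
      rw [Finset.sum_eq_sum_Ico_succ_bot (by omega)]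
      omega
  have := key m 0 s (by omega) (Frame.refl _ _) h0
  simpa using this

/-- `for v < e do c`, starting from the present value of `v`. -/
def Cmd.forLoop (v : ℕ) (e : NExp) (c : Cmd) : Cmd :=
  .while (.natLt (.read v (.const 0)) e)
    (.seq c (.setNat v (.const 0) (.add (.read v (.const 0)) (.const 1))))

/-- The invariant is indexed by the number of finished rounds and must be insensitive to the counter
(`hI`), which the body may not write (`hv`). The bound may be any expression that is constant on the
frame of the loop. The 2 in each round pays for the test and the increment. -/
theorem Runs.forLoop {v : ℕ} {e : NExp} (lo m : ℕ) (I : ℕ → Memory → Prop) (T : ℕ → ℕ)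
    (hlo : s.nat v 0 = lo) (hv : c.writesNat v = false) (h0 : I 0 s)
    (he : ∀ t, Frame (Cmd.forLoop v e c) s t → e.eval x t = lo + m)
    (hI : ∀ i t w, I i t → I i (t.setN v 0 w))
    (hstep : ∀ i t, i < m → Frame (Cmd.forLoop v e c) s t → t.nat v 0 = lo + i → I i t →
      Runs x c t fun k t' => k ≤ T i ∧ I (i + 1) t') :
    Runs x (Cmd.forLoop v e c) s fun k t => k ≤ ∑ i ∈ Finset.range m, (T i + 2) + 1 ∧
      t.nat v 0 = lo + m ∧ I m t := by
  refine (Runs.while m (fun i t => t.nat v 0 = lo + i ∧ I i t) (fun i => T i + 1)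
    ⟨hlo, h0⟩ ?_ ?_).mono ?_
  · intro i t hi hf ⟨h1, h2⟩
    refine ⟨?_, ?_⟩
    · simp only [Test.holds, NExp.eval, h1, he t hf]
      omega
    · rw [runs_seq]
      refine (hstep i t hi hf h1 h2).imp fun k t' h hf' => ?_
      rw [runs_setNat]
      have h3 : t'.nat v 0 = lo + i := by rw [hf'.1 v hv, h1]
      refine ⟨by omega, ?_, hI _ _ _ h.2⟩
      simp [NExp.eval, h3, add_assoc]
  · intro t hf ⟨h1, _⟩
    simp [Test.holds, NExp.eval, h1, he t hf]
  · intro k t h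
    exact h

/-- A segment of an array that contains the list `l`. -/
def Seg {α : Type*} (f : ℕ → α) (lo : ℕ) (l : List α) : Prop :=
  ∀ i (h : i < l.length), f (lo + i) = l[i]

theorem Seg.nil {α : Type*} (f : ℕ → α) (lo : ℕ) : Seg f lo [] := fun i h => by simp at h

theorem Seg.congr {α : Type*} {f g : ℕ → α} {lo : ℕ} {l : List α} (h : Seg f lo l)
    (hfg : ∀ i, lo ≤ i → i < lo + l.length → g i = f i) : Seg g lo l := fun i hi => by
  rw [hfg _ (by omega) (by omega), h i hi]

theorem Seg.append {α : Type*} {f g : ℕ → α} {lo : ℕ} {l : List α} {y : α} (h : Seg f lo l)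
    (hfg : ∀ i, i < lo + l.length → g i = f i) (hg : g (lo + l.length) = y) :
    Seg g lo (l ++ [y]) := by
  intro i hi
  rw [List.length_append, List.length_singleton] at hi
  rcases Nat.lt_succ_iff_lt_or_eq.1 hi with h1 | rfl
  · rw [hfg _ (by omega), h i h1, List.getElem_append_left h1]
  · rw [hg]; simp

end

end

noncomputable section

/-! ### Numbers that encode Pauli strings -/

variable {n : ℕ}

/-- The letter at a position, as a number. -/
def PauliString.letter (Q : PauliString n) (j : ℕ) : ℕ := if h : j < n then (Q ⟨j, h⟩ : ℕ) else 0

/-- The number whose base 4 digits are the letters. -/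
def PauliString.code (Q : PauliString n) : ℕ := ∑ j : Fin n, (Q j : ℕ) * 4 ^ (j : ℕ)

theorem PauliString.letter_lt (Q : PauliString n) (j : ℕ) : Q.letter j < 4 := by
  unfold letter; split_ifs <;> omega

@[simp] theorem PauliString.letter_fin (Q : PauliString n) (j : Fin n) : Q.letter j = Q j := by
  simp [letter]

theorem PauliString.code_eq (Q : PauliString n) :
    Q.code = ∑ j ∈ Finset.range n, Q.letter j * 4 ^ j := by
  rw [← Fin.sum_univ_eq_sum_range (fun j => Q.letter j * 4 ^ j), code]
  simp

theorem sum_digits_lt (f : ℕ → ℕ) (hf : ∀ j, f j < 4) (m : ℕ) :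
    ∑ j ∈ Finset.range m, f j * 4 ^ j < 4 ^ m := by
  induction m with
  | zero => simp
  | succ m ih =>
    rw [Finset.sum_range_succ, pow_succ]
    have := Nat.mul_le_mul_right (4 ^ m) (Nat.le_of_lt_succ (hf m))
    omega

/-- The top digit is the quotient by 4^m, because the lower digits sum to less than 4^m; then
descend. -/
theorem sum_digits_injective (f g : ℕ → ℕ) (hf : ∀ j, f j < 4) (hg : ∀ j, g j < 4) (m : ℕ)
    (h : ∑ j ∈ Finset.range m, f j * 4 ^ j = ∑ j ∈ Finset.range m, g j * 4 ^ j) :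
    ∀ j < m, f j = g j := by
  induction m with
  | zero => simp
  | succ m ih =>
    rw [Finset.sum_range_succ, Finset.sum_range_succ] at h
    have h1 := sum_digits_lt f hf m
    have h2 := sum_digits_lt g hg m
    have h3 : f m = g m := by
      have e1 : (∑ j ∈ Finset.range m, f j * 4 ^ j + f m * 4 ^ m) / 4 ^ m = f m := by
        rw [Nat.add_mul_div_right _ _ (by positivity), Nat.div_eq_of_lt h1, zero_add]
      have e2 : (∑ j ∈ Finset.range m, g j * 4 ^ j + g m * 4 ^ m) / 4 ^ m = g m := by
        rw [Nat.add_mul_div_right _ _ (by positivity), Nat.div_eq_of_lt h2, zero_add]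
      rw [← e1, ← e2, h]
    rw [h3] at h
    intro j hj
    rcases Nat.lt_succ_iff_lt_or_eq.1 hj with h4 | rfl
    · exact ih (by omega) j h4
    · exact h3

theorem PauliString.code_injective : Function.Injective (PauliString.code (n := n)) := by
  intro P Q h
  rw [code_eq, code_eq] at h
  funext j
  have := sum_digits_injective _ _ P.letter_lt Q.letter_lt n h j j.2
  simpa [Fin.ext_iff] using this

/-! ### Lists of encoded strings with coefficients -/

section Lists

variable {S : Type*} [CommSemiring S]

/-- All products of an entry of `l` and an entry of `t`. -/
def convList (l t : List (ℕ × S)) : List (ℕ × S) :=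
  l.flatMap fun x => t.map fun y => (x.1 + y.1, x.2 * y.2)

/-- The sixteen pairs of letters on the qubits `i` and `j`. -/
def pairList (i j : ℕ) (w : Fin 4 → Fin 4 → S) : List (ℕ × S) :=
  (List.range 16).map fun k => ((Fin.ofNat 4 (k / 4) : ℕ) * 4 ^ i + (Fin.ofNat 4 k : ℕ) * 4 ^ j,
    w (Fin.ofNat 4 (k / 4)) (Fin.ofNat 4 k))

/-- The four letters on the qubit `i`. -/
def idleList (i : ℕ) (w : Fin 4 → S) : List (ℕ × S) :=
  (List.range 4).map fun k => ((Fin.ofNat 4 k : ℕ) * 4 ^ i, w (Fin.ofNat 4 k))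

/-- Replace the letters of `R` on the block of `j`, unless this has been done before. -/
def expandStep (p : Fin n → Fin n) (R : PauliString n) (pw : Fin n → Fin 4 → Fin 4 → S)
    (iw : Fin n → Fin 4 → S) (l : List (ℕ × S)) (j : Fin n) : List (ℕ × S) :=
  if j < p j then convList l (pairList j (p j) (pw j))
  else if p j < j then
    if R (p j) = 0 then convList l (pairList (p j) j (pw (p j))) else l
  else convList l (idleList j (iw j))

/-- Replace the letters of `R` on all blocks that meet `sup`. -/
def expandList (p : Fin n → Fin n) (R : PauliString n) (pw : Fin n → Fin 4 → Fin 4 → S)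
    (iw : Fin n → Fin 4 → S) (sup : List (Fin n)) : List (ℕ × S) :=
  sup.foldl (expandStep p R pw iw) [(0, 1)]

theorem length_convList (l t : List (ℕ × S)) :
    (convList l t).length = l.length * t.length := by
  simp [convList, List.length_flatMap]

theorem length_expandStep_le (p : Fin n → Fin n) (R : PauliString n)
    (pw : Fin n → Fin 4 → Fin 4 → S) (iw : Fin n → Fin 4 → S) (l : List (ℕ × S)) (j : Fin n) :
    (expandStep p R pw iw l j).length ≤ 16 * l.length := by
  unfold expandStep
  split_ifs <;> (try simp only [length_convList, pairList, idleList, List.length_map,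
    List.length_range]) <;> omega

theorem length_foldl_expandStep_le (p : Fin n → Fin n) (R : PauliString n)
    (pw : Fin n → Fin 4 → Fin 4 → S) (iw : Fin n → Fin 4 → S) (sup : List (Fin n))
    (l : List (ℕ × S)) :
    (sup.foldl (expandStep p R pw iw) l).length ≤ 16 ^ sup.length * l.length := by
  induction sup generalizing l with
  | nil => simp
  | cons j sup ih =>
    refine (ih _).trans ?_
    rw [List.length_cons, pow_succ, mul_assoc]
    exact Nat.mul_le_mul_left _ (length_expandStep_le p R pw iw l j)

theorem map_fst_convList {S' : Type*} [CommSemiring S'] {l t : List (ℕ × S)}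
    {l' t' : List (ℕ × S')} (hl : l.map Prod.fst = l'.map Prod.fst)
    (ht : t.map Prod.fst = t'.map Prod.fst) :
    (convList l t).map Prod.fst = (convList l' t').map Prod.fst := by
  have h : ∀ {S : Type _} [CommSemiring S] (l t : List (ℕ × S)), (convList l t).map Prod.fst =
      (l.map Prod.fst).flatMap fun a => (t.map Prod.fst).map fun b => a + b := by
    intro S _ l t
    simp [convList, List.map_flatMap, List.flatMap_map, Function.comp_def]
  have h' : ∀ {S : Type _} [CommSemiring S] (l t : List (ℕ × S)), (convList l t).map Prod.fst =
      (l.map Prod.fst).flatMap fun a => (t.map Prod.fst).map fun b => a + b := by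
    intro S _ l t
    simp [convList, List.map_flatMap, List.flatMap_map, Function.comp_def]
  rw [h, h', hl, ht]

/-- The codes do not depend on the weights. Membership can therefore be studied with all weights
equal to 1 in ℕ, where nothing cancels. -/
theorem map_fst_foldl_expandStep {S' : Type*} [CommSemiring S'] (p : Fin n → Fin n)
    (R : PauliString n) (pw : Fin n → Fin 4 → Fin 4 → S) (iw : Fin n → Fin 4 → S)
    (pw' : Fin n → Fin 4 → Fin 4 → S') (iw' : Fin n → Fin 4 → S') (sup : List (Fin n))
    (l : List (ℕ × S)) (l' : List (ℕ × S')) (hl : l.map Prod.fst = l'.map Prod.fst) :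
    (sup.foldl (expandStep p R pw iw) l).map Prod.fst =
      (sup.foldl (expandStep p R pw' iw') l').map Prod.fst := by
  induction sup generalizing l l' with
  | nil => exact hl
  | cons j sup ih =>
    refine ih _ _ ?_
    unfold expandStep
    split_ifs
    · exact map_fst_convList hl (by simp [pairList])
    · exact map_fst_convList hl (by simp [pairList])
    · exact hl
    · exact map_fst_convList hl (by simp [idleList])

/-- The generating polynomial of a list. -/
def listPoly (l : List (ℕ × S)) : Polynomial S :=
  (l.map fun x => Polynomial.monomial x.1 x.2).sum

/-- Codes add and weights multiply, like exponents and coefficients of monomials. This turns the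
iterated product of tables into a product of polynomials over the blocks. -/
theorem listPoly_convList (l t : List (ℕ × S)) :
    listPoly (convList l t) = listPoly l * listPoly t := by
  induction l with
  | nil => simp [convList, listPoly]
  | cons x l ih =>
    have h1 : convList (x :: l) t = (t.map fun y => (x.1 + y.1, x.2 * y.2)) ++ convList l t := rfl
    have h2 : ∀ l l' : List (ℕ × S), listPoly (l ++ l') = listPoly l + listPoly l' := by
      intro l l'; simp [listPoly]
    have h3 : listPoly (t.map fun y => (x.1 + y.1, x.2 * y.2)) =
        Polynomial.monomial x.1 x.2 * listPoly t := by
      rw [listPoly, listPoly, List.map_map, ← List.sum_map_mul_left]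
      congr 1
      refine List.map_congr_left fun y _ => ?_
      simp [Polynomial.monomial_mul_monomial]
    rw [h1, h2, ih, h3]
    simp [listPoly, add_mul]

theorem sum_range_sixteen {M : Type*} [AddCommMonoid M] (F : Fin 4 → Fin 4 → M) :
    ∑ k ∈ Finset.range 16, F (Fin.ofNat 4 (k / 4)) (Fin.ofNat 4 k) = ∑ a, ∑ b, F a b := by
  simp only [Finset.sum_range_succ, Finset.sum_range_zero, Fin.sum_univ_four]
  change 0 + F 0 0 + F 0 1 + F 0 2 + F 0 3 + F 1 0 + F 1 1 + F 1 2 + F 1 3 + F 2 0 + F 2 1 +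
      F 2 2 + F 2 3 + F 3 0 + F 3 1 + F 3 2 + F 3 3 = _
  abel

theorem sum_range_four {M : Type*} [AddCommMonoid M] (F : Fin 4 → M) :
    ∑ k ∈ Finset.range 4, F (Fin.ofNat 4 k) = ∑ a, F a := by
  simp only [Finset.sum_range_succ, Finset.sum_range_zero, Fin.sum_univ_four]
  change 0 + F 0 + F 1 + F 2 + F 3 = _
  abel

theorem listPoly_pairList (i j : ℕ) (w : Fin 4 → Fin 4 → S) :
    listPoly (pairList i j w) = ∑ a : Fin 4, ∑ b : Fin 4,
      Polynomial.C (w a b) * (Polynomial.X ^ ((a : ℕ) * 4 ^ i) * Polynomial.X ^ ((b : ℕ) * 4 ^ j))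
      := by
  simp only [← pow_add, Polynomial.C_mul_X_pow_eq_monomial]
  rw [← sum_range_sixteen fun a b => Polynomial.monomial ((a : ℕ) * 4 ^ i + (b : ℕ) * 4 ^ j) (w a b),
    listPoly, pairList, List.map_map, Finset.sum_range]
  rfl

theorem listPoly_idleList (i : ℕ) (w : Fin 4 → S) :
    listPoly (idleList i w) = ∑ a : Fin 4,
      Polynomial.C (w a) * Polynomial.X ^ ((a : ℕ) * 4 ^ i) := by
  simp only [Polynomial.C_mul_X_pow_eq_monomial]
  rw [← sum_range_four fun a => Polynomial.monomial ((a : ℕ) * 4 ^ i) (w a),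
    listPoly, idleList, List.map_map, Finset.sum_range]
  rfl

/-- The weight of `Q` among the strings that replace `R`. -/
def expandWeight (p : Fin n → Fin n) (R : PauliString n) (pw : Fin n → Fin 4 → Fin 4 → S)
    (iw : Fin n → Fin 4 → S) (Q : PauliString n) : S :=
  ∏ i, blockTerm p
    (fun i => if R i = 0 ∧ R (p i) = 0 then (if Q i = 0 ∧ Q (p i) = 0 then 1 else 0) else
      pw i (Q i) (Q (p i)))
    (fun i => if R i = 0 then (if Q i = 0 then 1 else 0) else iw i (Q i)) i

/-- Each block that meets the support contributes its table exactly once: at its smaller qubit if R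
has a letter there, otherwise at its larger one. The product over the blocks is expanded by
`sum_prod_blockTerm` into a sum over strings, since the code of a string is the sum of the codes on
its blocks. -/
theorem listPoly_expandList {p : Fin n → Fin n} (hp : ∀ i, p (p i) = i) (R : PauliString n)
    (pw : Fin n → Fin 4 → Fin 4 → S) (iw : Fin n → Fin 4 → S) (sup : List (Fin n))
    (hsup : sup.Nodup) (hR : ∀ j, j ∈ sup ↔ R j ≠ 0) :
    listPoly (expandList p R pw iw sup) =
      ∑ Q : PauliString n, Polynomial.C (expandWeight p R pw iw Q) * Polynomial.X ^ Q.code := by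
  let PP : Fin n → Polynomial S := fun i => listPoly (pairList i (p i) (pw i))
  let IP : Fin n → Polynomial S := fun i => listPoly (idleList i (iw i))
  -- The factor contributed when qubit j is visited. It does not depend on the order of the visits,
  -- because the test looks at R and not at the list built so far.
  let sp : Fin n → Polynomial S := fun j => if j < p j then PP j else if p j < j then
    if R (p j) = 0 then PP (p j) else 1 else IP j
  have h1 : ∀ l : List (ℕ × S), listPoly (sup.foldl (expandStep p R pw iw) l) =
      listPoly l * (sup.map sp).prod := by
    clear hsup hR
    induction sup with
    | nil => simp
    | cons j sup ih =>
      intro l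
      rw [List.foldl_cons, ih, List.map_cons, List.prod_cons, ← mul_assoc]
      congr 1
      simp only [expandStep, sp, PP, IP, hp]
      split_ifs <;> simp [listPoly_convList]
  have h2 : (sup.map sp).prod = ∏ j, if R j ≠ 0 then sp j else 1 := by
    rw [← List.prod_toFinset _ hsup, ← Finset.prod_filter]
    refine Finset.prod_congr ?_ fun _ _ => rfl
    ext j
    simp [hR]
  rw [expandList, h1, h2, prod_eq_prod_blockTerm hp]
  have h3 : listPoly [((0 : ℕ), (1 : S))] = 1 := by simp [listPoly]
  rw [h3, one_mul]
  have h4 : ∀ Q : PauliString n, (Polynomial.X : Polynomial S) ^ Q.code =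
      ∏ i, blockTerm p (fun i => (Polynomial.X : Polynomial S) ^ ((Q i : ℕ) * 4 ^ (i : ℕ)) *
        Polynomial.X ^ ((Q (p i) : ℕ) * 4 ^ (p i : ℕ)))
        (fun i => Polynomial.X ^ ((Q i : ℕ) * 4 ^ (i : ℕ))) i := by
    intro Q
    rw [PauliString.code, ← Finset.prod_pow_eq_pow_sum, prod_eq_prod_blockTerm hp]
  simp only [h4, expandWeight, map_prod, map_blockTerm Polynomial.C, ← Finset.prod_mul_distrib,
    blockTerm_mul]
  rw [sum_prod_blockTerm hp (fun i a b => Polynomial.C (if R i = 0 ∧ R (p i) = 0 then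
      (if a = 0 ∧ b = 0 then 1 else 0) else pw i a b) *
      ((Polynomial.X : Polynomial S) ^ ((a : ℕ) * 4 ^ (i : ℕ)) *
        Polynomial.X ^ ((b : ℕ) * 4 ^ (p i : ℕ))))
    fun i a => Polynomial.C (if R i = 0 then (if a = 0 then 1 else 0) else iw i a) *
      Polynomial.X ^ ((a : ℕ) * 4 ^ (i : ℕ))]
  refine Finset.prod_congr rfl fun i _ => blockTerm_congr (fun hi => ?_) fun hi => ?_
  · have hni : ¬ p i < i := hi.not_gt
    by_cases h5 : R i = 0 <;> by_cases h6 : R (p i) = 0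
    · simp [h5, h6, Fin.sum_univ_four]
    · simp [h5, h6, sp, hp, hni, hi, PP, listPoly_pairList]
    · simp [h5, h6, sp, hi, PP, listPoly_pairList]
    · simp [h5, h6, sp, hp, hni, hi, PP, listPoly_pairList]
  · by_cases h5 : R i = 0
    · simp [h5]
    · simp [h5, sp, hi, IP, listPoly_idleList]

theorem sum_listPoly (l : List (ℕ × ℝ)) (φ : ℕ → ℝ) :
    (l.map fun x => x.2 * φ x.1).sum = (listPoly l).sum fun c a => a * φ c := by
  induction l with
  | nil => simp [listPoly]
  | cons x l ih =>
    have h : listPoly (x :: l) = Polynomial.monomial x.1 x.2 + listPoly l := by simp [listPoly]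
    rw [h, Polynomial.sum_add_index _ _ _ (by simp) (by intros; ring), List.map_cons,
      List.sum_cons, ih, Polynomial.sum_monomial_index _ _ (by simp)]

theorem sum_expandList {p : Fin n → Fin n} (hp : ∀ i, p (p i) = i) (R : PauliString n)
    (pw : Fin n → Fin 4 → Fin 4 → ℝ) (iw : Fin n → Fin 4 → ℝ) (sup : List (Fin n))
    (hsup : sup.Nodup) (hR : ∀ j, j ∈ sup ↔ R j ≠ 0) (φ : ℕ → ℝ) :
    ((expandList p R pw iw sup).map fun x => x.2 * φ x.1).sum =
      ∑ Q : PauliString n, expandWeight p R pw iw Q * φ Q.code := by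
  rw [sum_listPoly, listPoly_expandList hp R pw iw sup hsup hR]
  have h : ∀ s : Finset (PauliString n), (∑ Q ∈ s, Polynomial.C (expandWeight p R pw iw Q) *
      Polynomial.X ^ Q.code).sum (fun c a => a * φ c) =
      ∑ Q ∈ s, expandWeight p R pw iw Q * φ Q.code := by
    intro s
    induction s using Finset.induction_on with
    | empty => simp
    | insert Q s hQ ih =>
      rw [Finset.sum_insert hQ, Finset.sum_insert hQ,
        Polynomial.sum_add_index _ _ _ (by simp) (by intros; ring), ih,
        Polynomial.C_mul_X_pow_eq_monomial, Polynomial.sum_monomial_index _ _ (by simp)]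
  exact h _

theorem coeff_listPoly_ne_zero (l : List (ℕ × ℕ)) (hl : ∀ x ∈ l, x.2 ≠ 0) (c : ℕ) :
    (listPoly l).coeff c ≠ 0 ↔ c ∈ l.map Prod.fst := by
  induction l with
  | nil => simp [listPoly]
  | cons x l ih =>
    have h : listPoly (x :: l) = Polynomial.monomial x.1 x.2 + listPoly l := by simp [listPoly]
    rw [h, Polynomial.coeff_add, Polynomial.coeff_monomial, List.map_cons, List.mem_cons,
      ← ih fun y hy => hl y (List.mem_cons_of_mem _ hy)]
    have := hl x List.mem_cons_self
    by_cases hc : x.1 = c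
    · simp [hc, this]
    · simp [hc, Ne.symm hc]

theorem expandList_ne_zero (p : Fin n → Fin n) (R : PauliString n) (sup : List (Fin n)) :
    ∀ x ∈ expandList p R (fun _ _ _ => (1 : ℕ)) (fun _ _ => 1) sup, x.2 ≠ 0 := by
  have hconv : ∀ l t : List (ℕ × ℕ), (∀ x ∈ l, x.2 ≠ 0) → (∀ x ∈ t, x.2 ≠ 0) →
      ∀ x ∈ convList l t, x.2 ≠ 0 := by
    intro l t hl ht x hx
    simp only [convList, List.mem_flatMap, List.mem_map] at hx
    obtain ⟨y, hy, z, hz, rfl⟩ := hx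
    exact mul_ne_zero (hl y hy) (ht z hz)
  have key : ∀ l : List (ℕ × ℕ), (∀ x ∈ l, x.2 ≠ 0) → ∀ x ∈ sup.foldl
      (expandStep p R (fun _ _ _ => (1 : ℕ)) (fun _ _ => 1)) l, x.2 ≠ 0 := by
    induction sup with
    | nil => exact fun l hl => hl
    | cons j sup ih =>
      intro l hl
      refine ih _ ?_
      unfold expandStep
      split_ifs
      · exact hconv _ _ hl (by simp [pairList])
      · exact hconv _ _ hl (by simp [pairList])
      · exact hl
      · exact hconv _ _ hl (by simp [idleList])
  exact key _ (by simp)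

theorem mem_expandList {p : Fin n → Fin n} (hp : ∀ i, p (p i) = i) (R : PauliString n)
    (pw : Fin n → Fin 4 → Fin 4 → S) (iw : Fin n → Fin 4 → S) (sup : List (Fin n))
    (hsup : sup.Nodup) (hR : ∀ j, j ∈ sup ↔ R j ≠ 0) (c : ℕ) :
    c ∈ (expandList p R pw iw sup).map Prod.fst ↔ ∃ Q : PauliString n, Q.code = c ∧
      (∀ i, i < p i → R i = 0 ∧ R (p i) = 0 → Q i = 0 ∧ Q (p i) = 0) ∧
      ∀ i, p i = i → R i = 0 → Q i = 0 := by
  rw [expandList, map_fst_foldl_expandStep p R pw iw (fun _ _ _ => (1 : ℕ)) (fun _ _ => 1) sup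
    [(0, 1)] [(0, 1)] rfl, ← expandList,
    ← coeff_listPoly_ne_zero _ (expandList_ne_zero p R sup), listPoly_expandList hp R _ _ sup hsup hR,
    Polynomial.finsetSum_coeff, ne_eq, Finset.sum_eq_zero_iff]
  simp only [Polynomial.coeff_C_mul_X_pow, Finset.mem_univ, true_imp_iff, not_forall]
  refine exists_congr fun Q => ?_
  rw [← ne_eq, ite_ne_right_iff, eq_comm, and_congr_right_iff]
  intro _
  rw [expandWeight, Finset.prod_ne_zero_iff, ← forall_and]
  simp only [Finset.mem_univ, true_imp_iff]
  refine forall_congr' fun i => ?_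
  unfold blockTerm
  rcases lt_trichotomy i (p i) with h | h | h
  · simp only [h, if_true, h.ne', false_imp_iff, and_true, true_imp_iff]
    split_ifs <;> simp_all
  · have h' : p i = i := h.symm
    simp only [h', lt_irrefl, if_false, if_true, false_imp_iff, true_and, true_imp_iff]
    split_ifs <;> simp_all
  · simp [h.not_gt, h.ne]

end Lists

/-! ### The list of successors of a string in a layer -/

section Layer

variable (L : Layer n) (z : ℝ) (R : PauliString n) (sup : List (Fin n))

/-- The weight of a pair of letters on the block of qubit `i`. -/
def Layer.pairWeight (i : Fin n) (a b : Fin 4) : ℝ :=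
  (gateCoeff (L.gate i).1 (R i) (R (L.partner i)) a b).re *
    ((if a = 0 then 1 else z) * if b = 0 then 1 else z)

/-- The weight of a letter on an idle qubit. -/
def idleWeight (i : Fin n) (a : Fin 4) : ℝ := if R i = a then 1 else 0

/-- The strings that may arise from `R` in a layer, with the matrix elements; each qubit on which
a gate acts contributes a damping factor `z`. -/
def Layer.expand : List (ℕ × ℝ) :=
  expandList L.partner R (L.pairWeight z R) (idleWeight R) sup

/-- On blocks where R is empty, `gateCoeff_zero_left` forces Q to be empty, so nothing is lost by
visiting only the blocks that meet the support. The damping splits over the blocks as well. -/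
theorem Layer.expandWeight_eq (Q : PauliString n) :
    expandWeight L.partner R (L.pairWeight z R) (idleWeight R) Q =
      heis L.unitary R Q * z ^ Q.weightOn (NoiseModel.gateBased.noisyQubits L) := by
  have h1 : z ^ Q.weightOn (NoiseModel.gateBased.noisyQubits L) =
      ∏ i, if L.partner i ≠ i ∧ Q i ≠ 0 then z else 1 := by
    rw [Finset.prod_ite, Finset.prod_const_one, mul_one, Finset.prod_const, PauliString.weightOn]
    simp [NoiseModel.noisyQubits]
  rw [h1, prod_eq_prod_blockTerm L.partner_partner, L.heis_unitary, ← Finset.prod_mul_distrib,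
    expandWeight]
  simp only [blockTerm_mul]
  refine Finset.prod_congr rfl fun i _ => blockTerm_congr (fun hi => ?_) fun hi => ?_
  · have h3 : L.partner i ≠ i := hi.ne'
    have h4 : i ≠ L.partner i := hi.ne
    simp only [L.partner_partner, h3, h4, Layer.pairWeight, ne_eq, not_false_eq_true, true_and]
    by_cases h2 : R i = 0 ∧ R (L.partner i) = 0
    · rw [if_pos h2, h2.1, h2.2, gateCoeff_zero_left]
      by_cases h5 : Q i = 0 ∧ Q (L.partner i) = 0
      · simp [h5]
      · simp [h5]
    · rw [if_neg h2]
      simp only [ite_not]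
  · simp only [idleWeight, hi, ne_eq, not_true, false_and, if_false, mul_one]
    by_cases h5 : R i = 0
    · simp [h5, eq_comm]
    · simp [h5]

variable {R sup}

theorem Layer.sum_expand (hsup : sup.Nodup) (hR : ∀ j, j ∈ sup ↔ R j ≠ 0) (φ : ℕ → ℝ) :
    ((L.expand z R sup).map fun x => x.2 * φ x.1).sum = ∑ Q : PauliString n,
      heis L.unitary R Q * (z ^ Q.weightOn (NoiseModel.gateBased.noisyQubits L) * φ Q.code) := by
  rw [Layer.expand, sum_expandList L.partner_partner R _ _ sup hsup hR]
  refine Finset.sum_congr rfl fun Q _ => ?_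
  rw [L.expandWeight_eq, mul_assoc]

theorem Layer.exists_code_of_mem_expand (hsup : sup.Nodup) (hR : ∀ j, j ∈ sup ↔ R j ≠ 0)
    {x : ℕ × ℝ} (hx : x ∈ L.expand z R sup) : ∃ Q : PauliString n, Q.code = x.1 := by
  obtain ⟨Q, hQ, -⟩ := (mem_expandList L.partner_partner R _ _ sup hsup hR x.1).1
    (List.mem_map_of_mem hx)
  exact ⟨Q, hQ⟩

/-- The list contains whatever the block structure allows, even where the matrix element vanishes.
As compatibility is symmetric, expanding R also finds every Q from which R can be reached; this is
used to follow paths towards the observable. -/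
theorem Layer.mem_expand_of_compatible (hsup : sup.Nodup) (hR : ∀ j, j ∈ sup ↔ R j ≠ 0)
    {Q : PauliString n} (h : L.Compatible Q R) : ∃ a, (Q.code, a) ∈ L.expand z R sup := by
  have h1 := (mem_expandList L.partner_partner R (L.pairWeight z R) (idleWeight R) sup hsup hR
    Q.code).2 ⟨Q, rfl, fun i hi => (h.1 i hi).2, fun i hi h0 => (h.2 i hi).trans h0⟩
  obtain ⟨x, hx, hx'⟩ := List.mem_map.1 h1
  exact ⟨x.2, by rw [← hx']; exact hx⟩

theorem Layer.length_expand_le : (L.expand z R sup).length ≤ 16 ^ sup.length := by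
  exact (length_foldl_expandStep_le _ _ _ _ sup [(0, 1)]).trans (by simp)

end Layer

end

noncomputable section

/-! ### Names of arrays -/

/-- Letters of the present Pauli string. -/
@[simp] abbrev aStr : ℕ := 1
/-- Positions of the letters that are not the identity, and their number. -/
@[simp] abbrev aSup : ℕ := 2
@[simp] abbrev vSup : ℕ := 3
/-- Powers of four. -/
@[simp] abbrev aPow : ℕ := 4
/-- List of the strings that arise in a layer, in the cells from `vLo` to `vHi`. -/
@[simp] abbrev aCode : ℕ := 5
@[simp] abbrev vLo : ℕ := 6
@[simp] abbrev vHi : ℕ := 7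
/-- The present layer. -/
@[simp] abbrev vLayer : ℕ := 8
@[simp] abbrev vU : ℕ := 9
@[simp] abbrev vI : ℕ := 10
@[simp] abbrev vP : ℕ := 11
@[simp] abbrev vE : ℕ := 12
@[simp] abbrev vC : ℕ := 13
/-- Table of replacements of the letters on a block. -/
@[simp] abbrev aTab : ℕ := 14
@[simp] abbrev vTab : ℕ := 15
@[simp] abbrev vH : ℕ := 16
/-- Real arrays: output, coefficients of the list, coefficients of the table. -/
@[simp] abbrev rOut : ℕ := 0
@[simp] abbrev rCoeff : ℕ := 1
@[simp] abbrev rTab : ℕ := 2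

/-- Cell `0` of an array, used as a variable. -/
def NExp.var (a : ℕ) : NExp := .read a (.const 0)

@[simp] theorem NExp.eval_var {n d : ℕ} (x : Input n d) (s : Memory) (a : ℕ) :
    (NExp.var a).eval x s = s.nat a 0 := rfl

/-- Assignment to a variable. -/
def Cmd.assign (a : ℕ) (e : NExp) : Cmd := .setNat a (.const 0) e

/-- A multiple of a number. -/
def NExp.mulConst : ℕ → NExp → NExp
  | 0, _ => .const 0
  | k + 1, e => .add (NExp.mulConst k e) e

@[simp] theorem NExp.eval_mulConst {n d : ℕ} (x : Input n d) (s : Memory) (k : ℕ) (e : NExp) :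
    (NExp.mulConst k e).eval x s = k * e.eval x s := by
  induction k with
  | zero => simp [mulConst, NExp.eval]
  | succ k ih => simp [mulConst, NExp.eval, ih, add_mul]

section

variable {n d : ℕ} {x : Input n d}

@[simp] theorem runs_assign {a : ℕ} {e : NExp} {s : Memory} {Q : ℕ → Memory → Prop} :
    Runs x (.assign a e) s Q ↔ Q 1 (s.setN a 0 (e.eval x s)) := runs_setNat

/-! ### Products of lists -/

/-- The body of the inner loop of `convCmd`. -/
def convBody : Cmd :=
  .seq (.setNat aCode (.var vHi) (.add (.read aCode (.var vE)) (.read aTab (.var vC))))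
  (.seq (.setReal rCoeff (.var vHi) (.mul (.read rCoeff (.var vE)) (.read rTab (.var vC))))
  (.assign vHi (.add (.var vHi) (.const 1))))

/-- Replace the list by its product with the table. -/
def convCmd : Cmd :=
  .seq (.assign vH (.var vHi)) <|
  .seq (.assign vE (.var vLo)) <|
  .seq (.forLoop vE (.var vH)
    (.seq (.assign vC (.const 0)) (.forLoop vC (.var vTab) convBody))) <|
  .assign vLo (.var vH)

/-- The list in the memory, entry by entry. -/
def Memory.entry (s : Memory) (i : ℕ) : ℕ × ℝ := (s.nat aCode i, s.real rCoeff i)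

/-- The table in the memory, entry by entry. -/
def Memory.table (s : Memory) (i : ℕ) : ℕ × ℝ := (s.nat aTab i, s.real rTab i)

/-- The memory holds the list `l`. -/
def HoldsList (s : Memory) (l : List (ℕ × ℝ)) : Prop :=
  s.nat vHi 0 = s.nat vLo 0 + l.length ∧ Seg s.entry (s.nat vLo 0) l

/-- The memory holds the table `t`. -/
def HoldsTable (s : Memory) (t : List (ℕ × ℝ)) : Prop :=
  s.nat vTab 0 = t.length ∧ Seg s.table 0 t

@[simp] theorem Memory.entry_setN (s : Memory) {a : ℕ} (i v : ℕ) (h : aCode ≠ a) :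
    (s.setN a i v).entry = s.entry := by
  funext j; simp only [Memory.entry, Memory.setN_nat_of_ne _ _ _ h, Memory.setN_real]

@[simp] theorem Memory.table_setN (s : Memory) {a : ℕ} (i v : ℕ) (h : aTab ≠ a) :
    (s.setN a i v).table = s.table := by
  funext j; simp only [Memory.table, Memory.setN_nat_of_ne _ _ _ h, Memory.setN_real]

theorem Memory.entry_congr {s s' : Memory} (h : s'.nat aCode = s.nat aCode)
    (h' : s'.real rCoeff = s.real rCoeff) : s'.entry = s.entry := by
  funext j; simp only [Memory.entry, h, h']

theorem Seg.append_entry {s s' : Memory} {lo : ℕ} {l : List (ℕ × ℝ)} {y : ℕ × ℝ}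
    (h : Seg s.entry lo l)
    (h1 : s'.nat aCode = Function.update (s.nat aCode) (lo + l.length) y.1)
    (h2 : s'.real rCoeff = Function.update (s.real rCoeff) (lo + l.length) y.2) :
    Seg s'.entry lo (l ++ [y]) := by
  refine h.append (fun i hi => ?_) ?_
  · simp only [Memory.entry, h1, h2]
    rw [Function.update_of_ne hi.ne, Function.update_of_ne hi.ne]
  · simp only [Memory.entry, h1, h2, Function.update_self]

theorem runs_convInner {s : Memory} {lo e : ℕ} {y : ℕ × ℝ} {l t : List (ℕ × ℝ)}
    (hHi : s.nat vHi 0 = lo + l.length) (hl : Seg s.entry lo l) (ht : HoldsTable s t)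
    (he : s.nat vE 0 = e) (hlt : e < lo) (hy : s.entry e = y) :
    Runs x (.seq (.assign vC (.const 0)) (.forLoop vC (.var vTab) convBody)) s fun k s' =>
      k ≤ 5 * t.length + 2 ∧
      s'.nat vHi 0 = lo + (l ++ t.map fun b => (y.1 + b.1, y.2 * b.2)).length ∧
      Seg s'.entry lo (l ++ t.map fun b => (y.1 + b.1, y.2 * b.2)) ∧
      ∀ i < lo, s'.entry i = s.entry i := by
  simp only [runs_seq, runs_assign]
  have := Runs.forLoop (x := x) (v := vC) (e := .var vTab) (c := convBody)
    (s := s.setN vC 0 ((NExp.const 0).eval x s)) 0 t.length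
    (fun j s' => s'.nat vHi 0 = lo + (l ++ (t.take j).map fun b => (y.1 + b.1, y.2 * b.2)).length ∧
      Seg s'.entry lo (l ++ (t.take j).map fun b => (y.1 + b.1, y.2 * b.2)) ∧
      ∀ i < lo, s'.entry i = s.entry i) (fun _ => 3) ?_ rfl ?_ ?_ ?_ ?_
  · refine this.mono fun k s' h => ⟨?_, ?_⟩
    · have := h.1
      simp at this
      omega
    · simpa using h.2.2
  · simp [NExp.eval]
  · simpa [Memory.entry] using ⟨hHi, hl⟩
  · intro s' hf
    have h1 := hf.1 vTab rfl
    simp only [NExp.eval_var, h1]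
    simpa using ht.1
  · intro i s' w h
    simpa using h
  · intro i s' hi hf hv ⟨h1, h2, h3⟩
    have hE : s'.nat vE 0 = e := by rw [hf.1 vE rfl]; simpa using he
    have hT : s'.table i = t[i] := by
      have h4 := ht.2 i hi
      rw [zero_add] at h4
      rw [← h4]
      simp only [Memory.table, hf.1 aTab rfl, hf.2 rTab rfl]
      simp
    have hY := (h3 e hlt).trans hy
    rw [zero_add] at hv
    simp only [convBody, runs_seq, runs_setNat, runs_setReal, runs_assign]
    refine ⟨le_rfl, ?_, ?_, ?_⟩
    · simp only [List.take_add_one, List.getElem?_eq_getElem hi]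
      simp [NExp.eval] at h1 ⊢
      omega
    · rw [List.take_add_one, List.getElem?_eq_getElem hi, List.map_append, ← List.append_assoc]
      refine h2.append_entry ?_ ?_
      · simp only [Memory.entry, Memory.table] at hY hT
        simp [NExp.eval, hv, hE, h1, ← hY, ← hT]
      · simp only [Memory.entry, Memory.table] at hY hT
        simp [NExp.eval, RExp.eval, hv, hE, h1, ← hY, ← hT]
    · intro j hj
      rw [← h3 j hj]
      have : j ≠ s'.nat vHi 0 := by omega
      simp only [vHi] at this
      simp [Memory.entry, NExp.eval, this]

/-- The products are appended behind the old list, which stays readable during the loops; then the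
start of the list moves to the end of the old one, so nothing has to be copied back. -/
theorem runs_convCmd {s : Memory} {l t : List (ℕ × ℝ)} (hl : HoldsList s l)
    (ht : HoldsTable s t) :
    Runs x convCmd s fun k s' => k ≤ l.length * (5 * t.length + 4) + 4 ∧
      HoldsList s' (convList l t) := by
  simp only [convCmd, runs_seq, runs_assign, NExp.eval_var]
  obtain ⟨hHi, hl⟩ := hl
  set lo := s.nat vLo 0 with hlo
  have := Runs.forLoop (x := x) (v := vE) (e := .var vH)
    (c := .seq (.assign vC (.const 0)) (.forLoop vC (.var vTab) convBody))
    (s := (s.setN vH 0 (s.nat vHi 0)).setN vE 0 ((s.setN vH 0 (s.nat vHi 0)).nat vLo 0)) lo l.length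
    (fun j s' => s'.nat vHi 0 = lo + l.length + (convList (l.take j) t).length ∧
      Seg s'.entry (lo + l.length) (convList (l.take j) t) ∧
      ∀ i < lo + l.length, s'.entry i = s.entry i) (fun _ => 5 * t.length + 2) ?_ rfl ?_ ?_ ?_ ?_
  · refine this.imp fun k s' h hf => ⟨?_, ?_⟩
    · have := h.1
      rw [Finset.sum_const, Finset.card_range, smul_eq_mul, show 5 * t.length + 2 + 2 =
        5 * t.length + 4 by ring] at this
      omega
    · have hH : s'.nat vH 0 = lo + l.length := by rw [hf.1 vH rfl]; simpa using hHi
      obtain ⟨-, -, h1, h2, -⟩ := h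
      rw [List.take_length] at h1 h2
      refine ⟨?_, ?_⟩
      · simp at hH h1 ⊢
        omega
      · simpa [hH] using h2
  · simpa using hlo.symm
  · simpa [convList, Memory.entry] using ⟨hHi, Seg.nil _ _⟩
  · intro s' hf
    simp only [NExp.eval_var, hf.1 vH rfl]
    simpa using hHi
  · intro i s' w h
    simpa using h
  · intro i s' hi hf hv ⟨h1, h2, h3⟩
    refine (runs_convInner (y := l[i]) h1 h2 (t := t) ?_ hv (by omega) ?_).mono ?_
    · refine ⟨?_, ?_⟩
      · rw [hf.1 vTab rfl]; simpa using ht.1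
      · refine ht.2.congr fun i _ _ => ?_
        simp only [Memory.table, hf.1 aTab rfl, hf.2 rTab rfl]
        simp
    · rw [h3 _ (by omega), hl i hi]
    · intro k s'' ⟨hk, g1, g2, g3⟩
      have e : convList (l.take (i + 1)) t = convList (l.take i) t ++
          t.map fun b => (l[i].1 + b.1, l[i].2 * b.2) := by
        rw [List.take_add_one, List.getElem?_eq_getElem hi]
        rw [convList, convList, List.flatMap_append]
        simp
      rw [e]
      exact ⟨hk, g1, g2, fun j hj => (g3 j hj).trans (h3 j hj)⟩

end

end

noncomputable section

/-! ### Expressions for complex numbers -/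

/-- Expressions for complex numbers: real and imaginary part. -/
abbrev CExp : Type := RExp × RExp

namespace CExp

/-- Value of an expression for complex numbers. -/
def eval {n d : ℕ} (x : Input n d) (s : Memory) (c : CExp) : ℂ := ⟨c.1.eval x s, c.2.eval x s⟩

def const (a b : ℚ) : CExp := (.const a, .const b)

def add (c e : CExp) : CExp := (.add c.1 e.1, .add c.2 e.2)

def mul (c e : CExp) : CExp :=
  (.sub (.mul c.1 e.1) (.mul c.2 e.2), .add (.mul c.1 e.2) (.mul c.2 e.1))

def conj (c : CExp) : CExp := (c.1, .sub (.const 0) c.2)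

/-- Sum over a finite type. -/
def sum {κ : Type*} [Fintype κ] (f : κ → CExp) : CExp :=
  (Finset.univ.toList.map f).foldr add (const 0 0)

variable {n d : ℕ} (x : Input n d) (s : Memory)

@[simp] theorem eval_const (a b : ℚ) : (const a b).eval x s = ⟨a, b⟩ := rfl

@[simp] theorem eval_add (c e : CExp) : (c.add e).eval x s = c.eval x s + e.eval x s := rfl

@[simp] theorem eval_mul (c e : CExp) : (c.mul e).eval x s = c.eval x s * e.eval x s := rfl

@[simp] theorem eval_conj (c : CExp) : c.conj.eval x s = star (c.eval x s) := by
  apply Complex.ext <;> simp [conj, eval, RExp.eval]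

@[simp] theorem eval_sum {κ : Type*} [Fintype κ] (f : κ → CExp) :
    (sum f).eval x s = ∑ k, (f k).eval x s := by
  rw [sum, ← Finset.sum_map_toList]
  induction (Finset.univ : Finset κ).toList with
  | nil => simp [Complex.ext_iff]
  | cons a l ih => simp [ih]

end CExp

/-- The indicator of an equality of numbers. -/
def RExp.indicator (e : NExp) (k : ℕ) : RExp :=
  .cast (.sub (.const 1) (.add (.sub e (.const k)) (.sub (.const k) e)))

@[simp] theorem RExp.eval_indicator {n d : ℕ} (x : Input n d) (s : Memory) (e : NExp) (k : ℕ) :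
    (RExp.indicator e k).eval x s = if e.eval x s = k then 1 else 0 := by
  have : 1 - (e.eval x s - k + (k - e.eval x s)) = if e.eval x s = k then 1 else 0 := by
    split_ifs <;> omega
  simp [indicator, RExp.eval, NExp.eval, this]

/-- The entries of the Pauli matrices. -/
def pauliConst (a : Fin 4) (x y : Fin 2) : CExp :=
  if a = 0 then (if x = y then .const 1 0 else .const 0 0)
  else if a = 1 then (if x = y then .const 0 0 else .const 1 0)
  else if a = 2 then
    (if x = y then .const 0 0 else if x = 0 then .const 0 (-1) else .const 0 1)
  else if x = y then (if x = 0 then .const 1 0 else .const (-1) 0) else .const 0 0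

/-- The entries of the Pauli matrix with number `e`. -/
def pauliAt (e : NExp) (x y : Fin 2) : CExp :=
  .sum fun a : Fin 4 => CExp.mul (.indicator e a, .const 0) (pauliConst a x y)

/-- The entries of the gate on qubit `vI` of the present layer. -/
def gateExp (z y : Fin 2 × Fin 2) : CExp :=
  (.gateRe (.var vLayer) (.var vI) (.const (2 * z.1 + z.2)) (.const (2 * y.1 + y.2)),
    .gateIm (.var vLayer) (.var vI) (.const (2 * z.1 + z.2)) (.const (2 * y.1 + y.2)))

/-- The matrix element of the gate between the present letters on `vI`, `vP` and `a`, `b`. -/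
def gateCoeffExp (a b : Fin 4) : RExp :=
  .div (CExp.sum fun x : Fin 2 × Fin 2 => .sum fun y : Fin 2 × Fin 2 =>
    .sum fun z : Fin 2 × Fin 2 => .sum fun w : Fin 2 × Fin 2 =>
      ((((pauliConst a x.1 y.1).mul (pauliConst b x.2 y.2)).mul (gateExp z y).conj).mul
        ((pauliAt (.read aStr (.var vI)) z.1 w.1).mul
          (pauliAt (.read aStr (.var vP)) z.2 w.2))).mul (gateExp w x)).1 (.const 4)

section

variable {n d : ℕ} {x : Input n d} {s : Memory}

theorem eval_pauliConst (a : Fin 4) (p q : Fin 2) :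
    (pauliConst a p q).eval x s = pauliMatrix a p q := by
  fin_cases a <;> fin_cases p <;> fin_cases q <;>
    simp [pauliConst, pauliMatrix, Complex.ext_iff]

theorem eval_pauliAt {e : NExp} {a : Fin 4} (he : e.eval x s = a) (p q : Fin 2) :
    (pauliAt e p q).eval x s = pauliMatrix a p q := by
  simp only [pauliAt, CExp.eval_sum, CExp.eval_mul, eval_pauliConst]
  rw [Finset.sum_eq_single a]
  · rw [CExp.eval, RExp.eval_indicator, he, if_pos rfl]
    have : (⟨1, RExp.eval x s (.const 0)⟩ : ℂ) = 1 := by simp [RExp.eval, Complex.ext_iff]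
    rw [this, one_mul]
  · intro b _ hb
    rw [CExp.eval, RExp.eval_indicator, he, if_neg (fun h => hb (Fin.ext h).symm)]
    have : (⟨0, RExp.eval x s (.const 0)⟩ : ℂ) = 0 := by simp [RExp.eval, Complex.ext_iff]
    rw [this, zero_mul]
  · simp

theorem eval_gateExp {t : Fin d} {i : Fin n} (ht : s.nat vLayer 0 = t) (hi : s.nat vI 0 = i)
    (z y : Fin 2 × Fin 2) : (gateExp z y).eval x s = ((x.circuit t).gate i).1 z y := by
  have h : ∀ z : Fin 2 × Fin 2, ((Fin.ofNat 2 ((2 * z.1 + z.2 : ℕ) / 2) : Fin 2),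
      (Fin.ofNat 2 (2 * z.1 + z.2 : ℕ) : Fin 2)) = z := by decide
  have h' : gateEntry x.circuit (s.nat vLayer 0) (s.nat vI 0) (2 * z.1 + z.2) (2 * y.1 + y.2) =
      ((x.circuit t).gate i).1 z y := by
    rw [ht, hi, gateEntry, dif_pos ⟨t.2, i.2⟩, h, h]
  rw [← h']
  rfl

/-- The trace is written out as one arithmetic expression over the 4^4 index tuples. Its size does
not depend on the input, so evaluating it within a single step of the machine is legitimate. -/
theorem eval_gateCoeffExp {t : Fin d} {i j : Fin n} {a' b' : Fin 4} (ht : s.nat vLayer 0 = t)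
    (hi : s.nat vI 0 = i) (hj : s.nat vP 0 = j) (ha : s.nat aStr i = a') (hb : s.nat aStr j = b')
    (a b : Fin 4) :
    (gateCoeffExp a b).eval x s = (gateCoeff ((x.circuit t).gate i).1 a' b' a b).re := by
  rw [gateCoeff, trace_conj_eq_sum]
  have h : ∀ c : CExp, RExp.eval x s (.div c.1 (.const 4)) = (c.eval x s / 4).re := by
    intro c
    have e : (4 : ℂ) = ((4 : ℝ) : ℂ) := by norm_num
    rw [e, Complex.div_ofReal_re]
    simp [RExp.eval, CExp.eval]
  rw [gateCoeffExp, h]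
  simp only [CExp.eval_sum, CExp.eval_mul, CExp.eval_conj, eval_pauliConst, eval_gateExp ht hi]
  have h1 : (NExp.read aStr (.var vI)).eval x s = a' := by simp only [NExp.eval, NExp.eval_var, hi, ha]
  have h2 : (NExp.read aStr (.var vP)).eval x s = b' := by simp only [NExp.eval, NExp.eval_var, hj, hb]
  simp only [eval_pauliAt h1, eval_pauliAt h2, pauliPair]

/-! ### Tables -/

/-- Write a table, from cell `k` on. -/
def fillTable : ℕ → List (NExp × RExp) → Cmd
  | k, [] => .assign vTab (.const k)
  | k, e :: es => .seq (.setNat aTab (.const k) e.1)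
      (.seq (.setReal rTab (.const k) e.2) (fillTable (k + 1) es))

theorem fillTable_writesNat (k : ℕ) (es : List (NExp × RExp)) (a : ℕ) (h : aTab ≠ a)
    (h' : vTab ≠ a) : (fillTable k es).writesNat a = false := by
  induction es generalizing k with
  | nil => simpa [fillTable, Cmd.assign, Cmd.writesNat] using h'.symm
  | cons e es ih => simpa [fillTable, Cmd.writesNat, ih] using h.symm

theorem fillTable_writesReal (k : ℕ) (es : List (NExp × RExp)) (a : ℕ) (h : rTab ≠ a) :
    (fillTable k es).writesReal a = false := by
  induction es generalizing k with
  | nil => rfl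
  | cons e es ih => simpa [fillTable, Cmd.writesReal, ih] using h.symm

/-- The expressions must not be disturbed by the table under construction: `hval` says that their
values depend only on the remaining arrays of natural numbers and on no real array. -/
theorem runs_fillTable_aux (es : List (NExp × RExp)) (val : NExp × RExp → ℕ × ℝ)
    (s₀ : Memory) (hval : ∀ e ∈ es, ∀ t : Memory,
      (∀ a, aTab ≠ a → vTab ≠ a → t.nat a = s₀.nat a) → (e.1.eval x t, e.2.eval x t) = val e)
    (l : List (ℕ × ℝ)) (hs : ∀ a, aTab ≠ a → vTab ≠ a → s.nat a = s₀.nat a)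
    (hl : Seg s.table 0 l) :
    Runs x (fillTable l.length es) s fun k s' => k = 2 * es.length + 1 ∧
      HoldsTable s' (l ++ es.map val) := by
  induction es generalizing l s with
  | nil =>
    simp only [fillTable, runs_assign]
    refine ⟨rfl, ?_⟩
    rw [List.map_nil, List.append_nil]
    refine ⟨?_, ?_⟩
    · simp [NExp.eval]
    · rwa [Memory.table_setN _ _ _ (by decide)]
  | cons e es ih =>
    simp only [fillTable, runs_seq, runs_setNat, runs_setReal]
    have h1 : e.1.eval x s = (val e).1 := congrArg Prod.fst (hval e (by simp) s hs)
    set s1 := s.setN aTab ((NExp.const l.length).eval x s) (e.1.eval x s) with hs1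
    have hs1' : ∀ a, aTab ≠ a → vTab ≠ a → s1.nat a = s₀.nat a := by
      intro a ha ha'
      rw [hs1, Memory.setN_nat_of_ne _ _ _ ha.symm, hs a ha ha']
    have h2 : e.2.eval x s1 = (val e).2 := congrArg Prod.snd (hval e (by simp) s1 hs1')
    rw [h2]
    have h3 : Seg (s1.setR rTab ((NExp.const l.length).eval x s1) (val e).2).table 0
        (l ++ [val e]) := by
      refine hl.append (fun i hi => ?_) ?_
      · rw [zero_add] at hi
        simp [Memory.table, hs1, NExp.eval, hi.ne]
      · simp [Memory.table, hs1, NExp.eval, h1]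
    have h4 := ih (fun e' he' => hval e' (by simp [he']))
      (s := s1.setR rTab ((NExp.const l.length).eval x s1) (val e).2) (l ++ [val e]) hs1' h3
    rw [List.length_append, List.length_singleton] at h4
    refine h4.mono fun k s' h => ⟨?_, ?_⟩
    · rw [h.1, List.length_cons]; ring
    · simpa using h.2

/-- Evaluating a list of expressions into the table. -/
theorem runs_fillTable (es : List (NExp × RExp)) (val : NExp × RExp → ℕ × ℝ)
    (hval : ∀ e ∈ es, ∀ t : Memory,
      (∀ a, aTab ≠ a → vTab ≠ a → t.nat a = s.nat a) → (e.1.eval x t, e.2.eval x t) = val e) :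
    Runs x (fillTable 0 es) s fun k s' => k = 2 * es.length + 1 ∧ HoldsTable s' (es.map val) := by
  simpa using runs_fillTable_aux es val s hval [] (fun _ _ _ => rfl) (Seg.nil _ _)

/-- The table of the block of `vI` and `vP`. -/
def pairTable (z : RExp) : List (NExp × RExp) :=
  (List.range 16).map fun k =>
    (.add (.mulConst (Fin.ofNat 4 (k / 4) : Fin 4) (.read aPow (.var vI)))
      (.mulConst (Fin.ofNat 4 k : Fin 4) (.read aPow (.var vP))),
    .mul (gateCoeffExp (Fin.ofNat 4 (k / 4)) (Fin.ofNat 4 k))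
      (.mul (if Fin.ofNat 4 (k / 4) = (0 : Fin 4) then .const 1 else z)
        (if Fin.ofNat 4 k = (0 : Fin 4) then .const 1 else z)))

/-- The table of the idle qubit `vI`. -/
def idleTable : List (NExp × RExp) :=
  (List.range 4).map fun k => (.mulConst (Fin.ofNat 4 k : Fin 4) (.read aPow (.var vI)),
    .indicator (.read aStr (.var vI)) (Fin.ofNat 4 k : Fin 4))

/-- The memory contains the powers of four. -/
def HoldsPow (n : ℕ) (s : Memory) : Prop := ∀ j ≤ n, s.nat aPow j = 4 ^ j

/-- The memory contains the letters of a Pauli string. -/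
def HoldsString (s : Memory) (R : PauliString n) : Prop := ∀ j : Fin n, s.nat aStr j = R j

theorem runs_pairTable {t : Fin d} {i : Fin n} {R : PauliString n} {z : RExp} {w : ℝ}
    (hz : ∀ s, z.eval x s = w) (ht : s.nat vLayer 0 = t) (hi : s.nat vI 0 = i)
    (hj : s.nat vP 0 = (x.circuit t).partner i) (hR : HoldsString s R) (hpow : HoldsPow n s) :
    Runs x (fillTable 0 (pairTable z)) s fun k s' => k = 33 ∧
      HoldsTable s' (pairList i ((x.circuit t).partner i) ((x.circuit t).pairWeight w R i)) := by
  have h := runs_fillTable (x := x) (s := s) (pairTable z) (fun e => (e.1.eval x s, e.2.eval x s))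
  have hone : ∀ s, (RExp.const 1).eval x s = 1 := fun s => by simp [RExp.eval]
  have key : ∀ k : ℕ, ∀ t' : Memory, (∀ a, aTab ≠ a → vTab ≠ a → t'.nat a = s.nat a) →
      ((NExp.add (.mulConst (Fin.ofNat 4 (k / 4) : Fin 4) (.read aPow (.var vI)))
        (.mulConst (Fin.ofNat 4 k : Fin 4) (.read aPow (.var vP)))).eval x t',
      (RExp.mul (gateCoeffExp (Fin.ofNat 4 (k / 4)) (Fin.ofNat 4 k))
        (.mul (if Fin.ofNat 4 (k / 4) = (0 : Fin 4) then .const 1 else z)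
        (if Fin.ofNat 4 k = (0 : Fin 4) then .const 1 else z))).eval x t') =
      ((Fin.ofNat 4 (k / 4) : ℕ) * 4 ^ (i : ℕ) + (Fin.ofNat 4 k : ℕ) *
        4 ^ ((x.circuit t).partner i : ℕ),
        (x.circuit t).pairWeight w R i (Fin.ofNat 4 (k / 4)) (Fin.ofNat 4 k)) := by
    intro k t' h'
    have hi' : t'.nat vI 0 = i := by rw [h' _ (by decide) (by decide), hi]
    have hj' : t'.nat vP 0 = (x.circuit t).partner i := by rw [h' _ (by decide) (by decide), hj]
    have ht' : t'.nat vLayer 0 = t := by rw [h' _ (by decide) (by decide), ht]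
    have e1 : t'.nat aStr i = R i := by rw [h' _ (by decide) (by decide), hR]
    have e2 : t'.nat aStr ((x.circuit t).partner i) = R ((x.circuit t).partner i) := by
      rw [h' _ (by decide) (by decide), hR]
    have e3 := eval_gateCoeffExp (x := x) ht' hi' hj' e1 e2
    have hp := h' aPow (by decide) (by decide)
    refine Prod.ext ?_ ?_
    · simp only [NExp.eval, NExp.eval_mulConst, NExp.eval_var, hi', hj', hp]
      rw [hpow _ i.2.le, hpow _ ((x.circuit t).partner i).2.le]
    · simp only [RExp.eval, e3, Layer.pairWeight]
      split_ifs <;> simp only [hz, hone]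
  refine (h ?_).mono fun k s' hk => ?_
  · intro e he t' h'
    rw [pairTable, List.mem_map] at he
    obtain ⟨k, -, rfl⟩ := he
    exact (key k t' h').trans (key k s fun _ _ _ => rfl).symm
  · refine ⟨by rw [hk.1]; simp [pairTable], ?_⟩
    have := hk.2
    rw [pairTable, List.map_map] at this
    convert this using 1
    refine List.map_congr_left fun k _ => ?_
    exact (key k s fun _ _ _ => rfl).symm

theorem runs_idleTable {i : Fin n} {R : PauliString n} (hi : s.nat vI 0 = i)
    (hR : HoldsString s R) (hpow : HoldsPow n s) :
    Runs x (fillTable 0 idleTable) s fun k s' => k = 9 ∧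
      HoldsTable s' (idleList i (idleWeight R i)) := by
  have h := runs_fillTable (x := x) (s := s) idleTable (fun e => (e.1.eval x s, e.2.eval x s))
  have key : ∀ k : ℕ, ∀ t' : Memory, (∀ a, aTab ≠ a → vTab ≠ a → t'.nat a = s.nat a) →
      ((NExp.mulConst (Fin.ofNat 4 k : Fin 4) (.read aPow (.var vI))).eval x t',
      (RExp.indicator (.read aStr (.var vI)) (Fin.ofNat 4 k : Fin 4)).eval x t') =
      ((Fin.ofNat 4 k : ℕ) * 4 ^ (i : ℕ), idleWeight R i (Fin.ofNat 4 k)) := by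
    intro k t' h'
    have hi' : t'.nat vI 0 = i := by rw [h' _ (by decide) (by decide), hi]
    have e1 : t'.nat aStr i = R i := by rw [h' _ (by decide) (by decide), hR]
    have hp := h' aPow (by decide) (by decide)
    refine Prod.ext ?_ ?_
    · simp only [NExp.eval, NExp.eval_mulConst, NExp.eval_var, hi', hp]
      rw [hpow _ i.2.le]
    · simp only [RExp.eval_indicator, NExp.eval, NExp.eval_var, hi', e1, idleWeight, Fin.ext_iff]
  refine (h ?_).mono fun k s' hk => ?_
  · intro e he t' h'
    rw [idleTable, List.mem_map] at he
    obtain ⟨k, -, rfl⟩ := he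
    exact (key k t' h').trans (key k s fun _ _ _ => rfl).symm
  · refine ⟨by rw [hk.1]; simp [idleTable], ?_⟩
    have := hk.2
    rw [idleTable, List.map_map] at this
    convert this using 1
    refine List.map_congr_left fun k _ => ?_
    exact (key k s fun _ _ _ => rfl).symm

/-! ### Expansion of a string in a layer -/

/-- Take the block of the letter `vU` of the present string into account. -/
def expandStepCmd (z : RExp) : Cmd :=
  .seq (.assign vI (.read aSup (.var vU))) <|
  .seq (.assign vP (.partner (.var vLayer) (.var vI))) <|
  .ite (.natLt (.var vI) (.var vP)) (.seq (fillTable 0 (pairTable z)) convCmd) <|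
  .ite (.natLt (.var vP) (.var vI))
    (.ite (.natLt (.read aStr (.var vP)) (.const 1))
      (.seq (.assign vI (.var vP)) <| .seq (.assign vP (.read aSup (.var vU))) <|
        .seq (fillTable 0 (pairTable z)) convCmd)
      .skip)
    (.seq (fillTable 0 idleTable) convCmd)

/-- List the strings that arise from the present string in the present layer. -/
def expandCmd (z : RExp) : Cmd :=
  .seq (.assign vLo (.const 0)) <|
  .seq (.setNat aCode (.const 0) (.const 0)) <|
  .seq (.setReal rCoeff (.const 0) (.const 1)) <|
  .seq (.assign vHi (.const 1)) <|
  .seq (.assign vU (.const 0)) <|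
  .forLoop vU (.var vSup) (expandStepCmd z)

/-- The memory contains the letters of a Pauli string and the list of their positions. -/
structure Loaded (s : Memory) (R : PauliString n) (sup : List (Fin n)) : Prop where
  string : HoldsString s R
  card : s.nat vSup 0 = sup.length
  seg : Seg (s.nat aSup) 0 (sup.map fun j : Fin n => (j : ℕ))
  nodup : sup.Nodup
  mem : ∀ j, j ∈ sup ↔ R j ≠ 0

theorem HoldsList.congr {s s' : Memory} {l : List (ℕ × ℝ)} (h : HoldsList s l)
    (h1 : s'.nat vHi = s.nat vHi) (h2 : s'.nat vLo = s.nat vLo)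
    (h3 : s'.entry = s.entry) : HoldsList s' l := by
  rw [HoldsList, h1, h2, h3]; exact h

theorem expandStepCmd_writesNat (z : RExp) (a : ℕ) (ha : a ∉ [5, 6, 7, 10, 11, 12, 13, 14, 15, 16]) :
    (expandStepCmd z).writesNat a = false := by
  simp only [List.mem_cons, List.not_mem_nil, not_or] at ha
  simp [expandStepCmd, Cmd.writesNat, Cmd.assign, convCmd, convBody, Cmd.forLoop,
    fillTable_writesNat, ha, Ne.symm ha.2.2.2.2.2.2.2.1, Ne.symm ha.2.2.2.2.2.2.2.2.1]

theorem expandStepCmd_writesReal (z : RExp) (a : ℕ) (ha : a ∉ [1, 2]) :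
    (expandStepCmd z).writesReal a = false := by
  simp only [List.mem_cons, List.not_mem_nil, not_or] at ha
  simp [expandStepCmd, Cmd.writesReal, Cmd.assign, convCmd, convBody, Cmd.forLoop,
    fillTable_writesReal, ha, Ne.symm ha.2.1]

theorem runs_fill_conv {c : Cmd} {T : ℕ} {l t : List (ℕ × ℝ)} (hl : HoldsList s l)
    (hc : Runs x c s fun k s' => k = T ∧ HoldsTable s' t)
    (h : ∀ a ∈ [aCode, vLo, vHi], c.writesNat a = false) (h' : c.writesReal rCoeff = false) :
    Runs x (.seq c convCmd) s fun k s' => k ≤ l.length * (5 * t.length + 4) + 4 + T ∧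
      HoldsList s' (convList l t) := by
  rw [runs_seq]
  refine hc.imp fun k s' hk hf => ?_
  refine (runs_convCmd (hl.congr (hf.1 _ (h _ (by simp))) (hf.1 _ (h _ (by simp))) ?_) hk.2).mono
    fun k' s'' hk' => ⟨by omega, hk'.2⟩
  exact Memory.entry_congr (hf.1 _ (h _ (by simp))) (hf.2 _ h')

/-- 84 = 5 · 16 + 4 is the cost per entry of the product with a table of length 16. The constant 44
collects the 4 further steps of the product, 33 for the table, and at most 7 tests and assignments.
-/
theorem runs_expandStepCmd {t : Fin d} {R : PauliString n} {z : RExp} {w : ℝ} {j : Fin n}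
    {l : List (ℕ × ℝ)}
    (hz : ∀ s, z.eval x s = w) (ht : s.nat vLayer 0 = t) (hR : HoldsString s R)
    (hpow : HoldsPow n s) (hj : s.nat aSup (s.nat vU 0) = j) (hl : HoldsList s l) :
    Runs x (expandStepCmd z) s fun k s' => k ≤ l.length * 84 + 44 ∧
      HoldsList s' (expandStep (x.circuit t).partner R ((x.circuit t).pairWeight w R)
        (idleWeight R) l j) := by
  simp only [expandStepCmd, runs_seq, runs_assign]
  set p := (x.circuit t).partner with hp
  have hpart : ∀ (s : Memory), s.nat vLayer 0 = t → s.nat vI 0 = j →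
      (NExp.partner (.var vLayer) (.var vI)).eval x s = p j := by
    intro s h1 h2
    simp only [NExp.eval, NExp.eval_var, h1, h2]
    rw [dif_pos ⟨t.2, j.2⟩]
  set s1 := (s.setN vI 0 (NExp.eval x s (.read aSup (.var vU)))) with hs1
  have hI1 : s1.nat vI 0 = j := by simp [hs1, NExp.eval, ← hj]
  rw [hpart s1 (by simpa [hs1] using ht) hI1]
  set s2 := s1.setN vP 0 (p j) with hs2
  have hI : s2.nat vI 0 = j := by simpa [hs2] using hI1
  have hP : s2.nat vP 0 = p j := by simp [hs2]
  have hL : s2.nat vLayer 0 = t := by simpa [hs2, hs1] using ht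
  have hR2 : HoldsString s2 R := by simpa [HoldsString, hs2, hs1] using hR
  have hpow2 : HoldsPow n s2 := by simpa [HoldsPow, hs2, hs1] using hpow
  have hl2 : HoldsList s2 l := hl.congr (by simp [hs2, hs1]) (by simp [hs2, hs1])
    (by simp [hs2, hs1])
  have wN : ∀ es, ∀ a ∈ [aCode, vLo, vHi], (fillTable 0 es).writesNat a = false := by
    intro es a ha
    refine fillTable_writesNat _ _ _ ?_ ?_ <;> rintro rfl <;> simp at ha
  have wR : ∀ es, (fillTable 0 es).writesReal rCoeff = false := fun es =>
    fillTable_writesReal _ _ _ (by decide)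
  unfold expandStep
  by_cases h1 : j < p j
  · rw [runs_ite_of_pos (by simp only [Test.holds, NExp.eval_var, hI, hP]; exact h1), if_pos h1]
    refine (runs_fill_conv hl2 (runs_pairTable hz hL hI hP hR2 hpow2) (wN _) (wR _)).mono
      fun k s' h => ⟨?_, h.2⟩
    have := h.1
    simp only [pairList, List.length_map, List.length_range] at this
    omega
  · rw [runs_ite_of_neg (by simp only [Test.holds, NExp.eval_var, hI, hP]; exact h1), if_neg h1]
    by_cases h2 : p j < j
    · rw [runs_ite_of_pos (by simp only [Test.holds, NExp.eval_var, hI, hP]; exact h2), if_pos h2]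
      have h3 : (NExp.read aStr (.var vP)).eval x s2 = R (p j) := by
        simp only [NExp.eval, NExp.eval_var, hP, hR2 (p j)]
      by_cases h4 : R (p j) = 0
      · rw [runs_ite_of_pos (by simp only [Test.holds, h3, h4]; simp [NExp.eval]), if_pos h4]
        -- A gate is stored at the smaller qubit of its pair, so `vI` and `vP` are exchanged before
        -- the table is written.
        simp only [runs_seq, runs_assign, NExp.eval_var, hP]
        set s3 := s2.setN vI 0 (p j) with hs3
        have e : (NExp.read aSup (.var vU)).eval x s3 = p (p j) := by
          rw [hp, Layer.partner_partner, ← hj]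
          simp [NExp.eval, hs3, hs2, hs1]
        rw [e]
        set s4 := s3.setN vP 0 (p (p j)) with hs4
        have := runs_fill_conv (x := x) (s := s4) (l := l) (hl2.congr (by simp [hs4, hs3])
          (by simp [hs4, hs3]) (by simp [hs4, hs3]))
          (runs_pairTable (t := t) (i := p j) (R := R) hz (by simpa [hs4, hs3] using hL)
            (by simp [hs4, hs3]) (by simp [hs4, hp]) (by simpa [HoldsString, hs4, hs3] using hR2)
            (by simpa [HoldsPow, hs4, hs3] using hpow2)) (wN _) (wR _)
        rw [runs_seq] at this
        refine this.mono fun k s' h => h.mono fun k' s'' h => ⟨?_, ?_⟩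
        · have := h.1
          simp only [pairList, List.length_map, List.length_range] at this
          omega
        · have h5 := h.2
          rwa [show (x.circuit t).partner (p j) = j from Layer.partner_partner _ j] at h5
      · rw [runs_ite_of_neg, if_neg h4]
        · rw [runs_skip]
          exact ⟨by omega, hl2⟩
        · have h5 : (R (p j) : ℕ) ≠ 0 := fun h => h4 (Fin.ext h)
          have h6 : ¬ (NExp.read aStr (.var vP)).eval x s2 < 1 := by rw [h3]; omega
          exact h6
    · rw [runs_ite_of_neg (by simp only [Test.holds, NExp.eval_var, hI, hP]; exact h2), if_neg h2]
      refine (runs_fill_conv hl2 (runs_idleTable hI hR2 hpow2) (wN _) (wR _)).mono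
        fun k s' h => ⟨?_, h.2⟩
      have := h.1
      simp only [idleList, List.length_map, List.length_range] at this
      omega

/-- The list grows by a factor of at most 16 with each letter, so the costs are dominated by a
geometric series and the last letter decides. -/
theorem runs_expandCmd {t : Fin d} {R : PauliString n} {z : RExp} {w : ℝ} {sup : List (Fin n)}
    (hz : ∀ s, z.eval x s = w) (ht : s.nat vLayer 0 = t) (hR : Loaded s R sup)
    (hpow : HoldsPow n s) :
    Runs x (expandCmd z) s fun k s' => k ≤ 60 * 16 ^ sup.length ∧
      HoldsList s' ((x.circuit t).expand w R sup) := by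
  simp only [expandCmd, runs_seq, runs_assign, runs_setNat, runs_setReal]
  set s1 := ((((s.setN vLo 0 (NExp.eval x s (.const 0))).setN aCode _ _).setR rCoeff _ _).setN
    vHi 0 _).setN vU 0 _ with hs1
  have hw := expandStepCmd_writesNat z
  have hwl : ∀ a, a ∉ [5, 6, 7, 9, 10, 11, 12, 13, 14, 15, 16] →
      (Cmd.forLoop vU (.var vSup) (expandStepCmd z)).writesNat a = false := by
    intro a ha
    simp only [List.mem_cons, List.not_mem_nil, not_or] at ha
    have := hw a (by simp [ha])
    simp [Cmd.forLoop, Cmd.writesNat, this, ha]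
  set step := expandStep (x.circuit t).partner R ((x.circuit t).pairWeight w R) (idleWeight R)
  have := Runs.forLoop (x := x) (v := vU) (e := .var vSup) (c := expandStepCmd z) (s := s1)
    0 sup.length (fun j s' => HoldsList s' ((sup.take j).foldl step [(0, 1)]))
    (fun i => 84 * 16 ^ i + 44) (by simp [hs1, NExp.eval]) (hw _ (by decide)) ?_ ?_ ?_ ?_
  · refine this.mono fun k s' h => ⟨?_, ?_⟩
    · have h1 : ∀ m : ℕ, ∑ i ∈ Finset.range m, (84 * 16 ^ i + 44 + 2) + 6 ≤ 60 * 16 ^ m := by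
        intro m
        induction m with
        | zero => simp
        | succ m ih =>
          rw [Finset.sum_range_succ, pow_succ]
          have := Nat.one_le_pow m 16 (by norm_num)
          omega
      have := h1 sup.length
      have := h.1
      omega
    · have := h.2.2
      rwa [List.take_length] at this
  · refine ⟨?_, ?_⟩
    · simp [hs1, NExp.eval]
    · intro i hi
      obtain rfl : i = 0 := by simpa using hi
      simp [hs1, NExp.eval, RExp.eval, Memory.entry]
  · intro s' hf
    rw [NExp.eval_var, hf.1 vSup (hwl _ (by decide)), zero_add, ← hR.card]
    simp [hs1]
  · intro i s' v h
    simpa [HoldsList] using h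
  · intro i s' hi hf hv h
    have hj : s'.nat aSup (s'.nat vU 0) = sup[i] := by
      have h3 := hR.seg i (by simpa using hi)
      rw [hv, hf.1 aSup (hwl _ (by decide))]
      simpa [hs1] using h3
    have hR' : HoldsString s' R := by
      intro j
      rw [hf.1 aStr (hwl _ (by decide))]
      simpa [hs1] using hR.string j
    have hpow' : HoldsPow n s' := by
      intro j hj
      rw [hf.1 aPow (hwl _ (by decide))]
      simpa [hs1] using hpow j hj
    have ht' : s'.nat vLayer 0 = t := by
      rw [hf.1 vLayer (hwl _ (by decide))]
      simpa [hs1] using ht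
    rw [List.take_add_one, List.getElem?_eq_getElem hi, List.foldl_append]
    refine (runs_expandStepCmd hz ht' hR' hpow' hj h).mono fun k s'' hk => ⟨?_, hk.2⟩
    have h3 : ((sup.take i).foldl step [(0, 1)]).length ≤ 16 ^ i := by
      refine (length_foldl_expandStep_le _ _ _ _ _ _).trans ?_
      rw [List.length_take, min_eq_left hi.le]
      simp
    have := hk.1
    omega

end

end

noncomputable section

/-! ### Decoding of strings -/

/-- The number of the string to be loaded. -/
@[simp] abbrev vCode : ℕ := 17
@[simp] abbrev vJ : ℕ := 18
@[simp] abbrev vK : ℕ := 19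

/-- Write the letter `a` on qubit `vK`. -/
def letterCmd (a : ℕ) : Cmd :=
  .seq (.setNat aStr (.var vK) (.const a))
    (.assign vCode (.sub (.var vCode) (.mulConst a (.read aPow (.var vK)))))

/-- Read off the letter on the qubit `n - 1 - vJ`. -/
def loadBody : Cmd :=
  .seq (.assign vK (.sub (.sub .numQubits (.const 1)) (.var vJ))) <|
  .ite (.natLt (.var vCode) (.read aPow (.var vK))) (letterCmd 0) <|
  .seq (.setNat aSup (.var vSup) (.var vK)) <|
  .seq (.assign vSup (.add (.var vSup) (.const 1))) <|
  .ite (.natLt (.var vCode) (.mulConst 2 (.read aPow (.var vK)))) (letterCmd 1) <|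
  .ite (.natLt (.var vCode) (.mulConst 3 (.read aPow (.var vK)))) (letterCmd 2) (letterCmd 3)

/-- Make the string with number `vCode` the present string. -/
def loadCmd : Cmd :=
  .seq (.assign vSup (.const 0)) <| .seq (.assign vJ (.const 0)) <|
    .forLoop vJ .numQubits loadBody

section

variable {n d : ℕ} {x : Input n d} {s : Memory}

/-- The positions of the letters of a Pauli string, in decreasing order. -/
def PauliString.supp (R : PauliString n) : List (Fin n) :=
  (List.finRange n).reverse.filter fun j => R j ≠ 0

theorem Loaded.length_eq {R : PauliString n} {sup : List (Fin n)} (h : Loaded s R sup) :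
    sup.length = R.weight := by
  have h1 : sup.toFinset = Finset.univ.filter fun j => R j ≠ 0 := by
    ext j; simp [h.mem]
  rw [← List.toFinset_card_of_nodup h.nodup, h1]
  simp [PauliString.weight]

/-- What has been read off after `i` letters. -/
structure LoadInv (R : PauliString n) (i : ℕ) (s : Memory) : Prop where
  code : s.nat vCode 0 = ∑ j ∈ Finset.range (n - i), R.letter j * 4 ^ j
  str : ∀ j : Fin n, n - i ≤ j → s.nat aStr j = R j
  card : s.nat vSup 0 = (((List.finRange n).reverse.take i).filter fun j => R j ≠ 0).length
  seg : Seg (s.nat aSup) 0 ((((List.finRange n).reverse.take i).filter fun j => R j ≠ 0).map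
    fun j : Fin n => (j : ℕ))

/-- Digits are read from the top. The remaining code is less than 4 times the current power of four,
so comparisons with one, two and three times this power find the digit without a division. -/
theorem runs_loadBody {R : PauliString n} (hpow : HoldsPow n s) {i : ℕ} (hi : i < n)
    (hv : s.nat vJ 0 = i) (h : LoadInv R i s) :
    Runs x loadBody s fun k s' => k ≤ 8 ∧ LoadInv R (i + 1) s' := by
  simp only [loadBody, runs_seq, runs_assign]
  have e : (NExp.sub (.sub .numQubits (.const 1)) (.var vJ)).eval x s = n - 1 - i := by
    simp only [NExp.eval, NExp.eval_var, hv]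
  rw [e]
  set s1 := s.setN vK 0 (n - 1 - i) with hs1
  have hj : n - 1 - i < n := by omega
  set j : Fin n := ⟨n - 1 - i, hj⟩ with hjd
  have hc : s1.nat vCode 0 = ∑ l ∈ Finset.range (n - 1 - i), R.letter l * 4 ^ l +
      R j * 4 ^ (n - 1 - i) := by
    have := h.code
    rw [show n - i = n - 1 - i + 1 by omega, Finset.sum_range_succ] at this
    have h2 : R.letter (n - 1 - i) = R j := R.letter_fin j
    rw [h2] at this
    simpa [hs1] using this
  have hlt := sum_digits_lt R.letter R.letter_lt (n - 1 - i)
  have hrest : n - (i + 1) = n - 1 - i := by omega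
  rw [← hrest] at hc hlt
  set rest := ∑ l ∈ Finset.range (n - (i + 1)), R.letter l * 4 ^ l with hrd
  have hP : (NExp.read aPow (.var vK)).eval x s1 = 4 ^ (n - (i + 1)) := by
    have := hpow (n - 1 - i) hj.le
    simp only [NExp.eval, NExp.eval_var, hs1]
    simpa [hrest] using this
  have hcard := h.card
  have hseg := h.seg
  have htake : (List.finRange n).reverse.take (i + 1) =
      (List.finRange n).reverse.take i ++ [j] := by
    rw [List.take_add_one, List.getElem?_eq_getElem (by simpa using hi)]
    simp [hjd]
  set l := ((List.finRange n).reverse.take i).filter fun j => R j ≠ 0 with hld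
  have hmem : ∀ a : ℕ, (R j : ℕ) = a → ∀ s' : Memory, s'.nat vK 0 = n - 1 - i →
      s'.nat aPow = s.nat aPow → s'.nat vCode = s1.nat vCode → s'.nat aStr = s.nat aStr →
      (s'.nat vSup 0 = (((List.finRange n).reverse.take (i + 1)).filter
        fun j => R j ≠ 0).length) →
      Seg (s'.nat aSup) 0 ((((List.finRange n).reverse.take (i + 1)).filter fun j => R j ≠ 0).map
        fun j : Fin n => (j : ℕ)) →
      Runs x (letterCmd a) s' fun k s'' => k = 2 ∧ LoadInv R (i + 1) s'' := by
    intro a ha s' h1 h2 h3 h4 h5 h6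
    simp only [letterCmd, runs_seq, runs_setNat, runs_assign]
    refine ⟨trivial, ?_, ?_, ?_, ?_⟩
    · rw [← hrd]
      have h7 : s'.nat aPow (n - 1 - i) = 4 ^ (n - (i + 1)) := by
        rw [h2, hpow _ hj.le, hrest]
      have h8 : s'.nat vCode 0 = rest + a * 4 ^ (n - (i + 1)) := by rw [h3, hc, ha]
      simp only [vCode, aPow, vK] at h1 h7 h8
      simp [NExp.eval, h1, h7, h8]
    · intro j' hj'
      have h9 : (NExp.const a).eval x s' = R j := ha.symm
      rw [h9, NExp.eval_var, h1]
      rcases eq_or_ne j' j with rfl | hne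
      · simp [hjd]
      · have h10 : (j' : ℕ) ≠ n - 1 - i := fun h => hne (Fin.ext h)
        have h11 := h.str j' (by omega)
        simpa [h10, ← h4] using h11
    · simpa using h5
    · simpa using h6
  by_cases h0 : (R j : ℕ) = 0
  · have h00 : R j = 0 := Fin.ext h0
    have hl0 : (((List.finRange n).reverse.take (i + 1)).filter fun j => R j ≠ 0) = l := by
      rw [htake, List.filter_append]
      simp [h00, hld]
    rw [runs_ite_of_pos]
    · refine (hmem 0 h0 s1 ?_ ?_ rfl ?_ ?_ ?_).mono fun k s' h => ⟨by omega, h.2⟩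
      · simp [hs1]
      · simp [hs1]
      · simp [hs1]
      · rw [hl0]
        simpa [hs1] using hcard
      · rw [hl0]
        simpa [hs1] using hseg
    · rw [Test.holds, hP, NExp.eval_var, hc, h0]
      omega
  · have h00 : R j ≠ 0 := fun h => h0 (by rw [h]; rfl)
    have h1 : 1 ≤ (R j : ℕ) := Nat.pos_of_ne_zero h0
    have hle := Nat.mul_le_mul_right (4 ^ (n - (i + 1))) h1
    rw [runs_ite_of_neg (by rw [Test.holds, hP, NExp.eval_var, hc]; omega)]
    simp only [runs_seq, runs_setNat, runs_assign]
    set s3 := (s1.setN aSup _ _).setN vSup 0 _ with hs3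
    have hP3 : (NExp.read aPow (.var vK)).eval x s3 = 4 ^ (n - (i + 1)) := by
      rw [← hP]; simp [NExp.eval, hs3]
    have hc3 : s3.nat vCode 0 = rest + R j * 4 ^ (n - (i + 1)) := by
      rw [← hc]; simp [hs3]
    have g1 : s3.nat vK 0 = n - 1 - i := by simp [hs3, hs1]
    have g2 : s3.nat aPow = s.nat aPow := by simp [hs3, hs1]
    have g3 : s3.nat vCode = s1.nat vCode := by simp [hs3]
    have g4 : s3.nat aStr = s.nat aStr := by simp [hs3, hs1]
    have g5 : s3.nat vSup 0 = (((List.finRange n).reverse.take (i + 1)).filter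
        fun j => R j ≠ 0).length := by
      rw [htake, List.filter_append, List.length_append, ← hld, ← hcard]
      simp [hs3, hs1, h00, NExp.eval]
    have g6 : Seg (s3.nat aSup) 0 ((((List.finRange n).reverse.take (i + 1)).filter
        fun j => R j ≠ 0).map fun j : Fin n => (j : ℕ)) := by
      have : (((List.finRange n).reverse.take (i + 1)).filter fun j => R j ≠ 0) = l ++ [j] := by
        rw [htake, List.filter_append]
        simp [h00, hld]
      rw [this, List.map_append]
      simp only [vSup] at hcard
      refine hseg.append (fun m hm => ?_) ?_
      · rw [zero_add, List.length_map] at hm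
        have h7 : m ≠ l.length := hm.ne
        simp [hs3, hs1, hcard, h7]
      · simp [hs3, hs1, hcard, hjd]
    have hfin := fun a ha => hmem a ha s3 g1 g2 g3 g4 g5 g6
    have h3 : (R j : ℕ) = 1 ∨ (R j : ℕ) = 2 ∨ (R j : ℕ) = 3 := by omega
    rcases h3 with h3 | h3 | h3
    · rw [runs_ite_of_pos (by
        rw [Test.holds, NExp.eval_mulConst, hP3, NExp.eval_var, hc3, h3]; omega)]
      exact (hfin 1 h3).mono fun k s' h => ⟨by omega, h.2⟩
    · rw [runs_ite_of_neg (by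
        rw [Test.holds, NExp.eval_mulConst, hP3, NExp.eval_var, hc3, h3]; omega),
        runs_ite_of_pos (by
        rw [Test.holds, NExp.eval_mulConst, hP3, NExp.eval_var, hc3, h3]; omega)]
      exact (hfin 2 h3).mono fun k s' h => ⟨by omega, h.2⟩
    · rw [runs_ite_of_neg (by
        rw [Test.holds, NExp.eval_mulConst, hP3, NExp.eval_var, hc3, h3]; omega),
        runs_ite_of_neg (by
        rw [Test.holds, NExp.eval_mulConst, hP3, NExp.eval_var, hc3, h3]; omega)]
      exact (hfin 3 h3).mono fun k s' h => ⟨by omega, h.2⟩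

theorem runs_loadCmd {R : PauliString n} (hpow : HoldsPow n s) (hc : s.nat vCode 0 = R.code) :
    Runs x loadCmd s fun k s' => k ≤ 10 * n + 3 ∧ Loaded s' R R.supp := by
  simp only [loadCmd, runs_seq, runs_assign]
  set s1 := (s.setN vSup 0 _).setN vJ 0 _ with hs1
  have := Runs.forLoop (x := x) (v := vJ) (e := .numQubits) (c := loadBody) (s := s1)
    0 n (LoadInv R) (fun _ => 8) (by simp [hs1, NExp.eval]) rfl ?_ ?_ ?_ ?_
  · refine this.mono fun k s' h => ⟨?_, ?_⟩
    · have := h.1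
      rw [Finset.sum_const, Finset.card_range, smul_eq_mul] at this
      omega
    · obtain ⟨-, -, h1, h2, h3, h4⟩ := h
      have e : (List.finRange n).reverse.take n = (List.finRange n).reverse :=
        List.take_of_length_le (by simp)
      rw [e] at h3 h4
      refine ⟨fun j => h2 j (by simp), h3, h4, ?_, fun j => ?_⟩
      · exact (List.nodup_reverse.2 (List.nodup_finRange n)).filter _
      · simp [PauliString.supp]
  · refine ⟨?_, fun j hj => absurd j.2 (by omega), ?_, ?_⟩
    · rw [Nat.sub_zero, ← R.code_eq, ← hc]
      simp [hs1]
    · simp [hs1, NExp.eval]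
    · simpa using Seg.nil _ _
  · intro t _
    simp [NExp.eval]
  · intro i t w h
    exact ⟨by simpa using h.code, by simpa using h.str, by simpa using h.card, by simpa using h.seg⟩
  · intro i t hi hf hv h
    refine runs_loadBody ?_ hi (by omega) h
    intro j hj
    rw [hf.1 aPow (by decide)]
    simpa [hs1] using hpow j hj

end

end

noncomputable section

/-! ### Lists of Pauli paths -/

/-- The string with a given number. -/
def decode {n : ℕ} : ℕ → PauliString n := Function.invFun PauliString.code

@[simp] theorem decode_code {n : ℕ} (Q : PauliString n) : decode Q.code = Q :=
  Function.leftInverse_invFun PauliString.code_injective Q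

/-- End points of Pauli paths: number of the string, amplitude, remaining budget. -/
abbrev PathList : Type := List (ℕ × ℝ × ℕ)

/-- Numbers that stand for Pauli strings. -/
def PathList.Valid (n : ℕ) (l : PathList) : Prop := ∀ e ∈ l, ∃ Q : PauliString n, Q.code = e.1

/-- The sum over the paths of the exponential of the budget. -/
def PathList.size (l : PathList) : ℕ := (l.map fun e => 16 ^ e.2.2).sum

section

variable {n d : ℕ}

/-- The continuations of a path through a layer. -/
def Layer.extendPath (L : Layer n) (q : ℝ) (e : ℕ × ℝ × ℕ) : PathList :=
  if (decode e.1 : PauliString n).weight ≤ e.2.2 then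
    (L.expand 1 (decode e.1) (decode e.1 : PauliString n).supp).map fun y =>
      (y.1, e.2.1 * q ^ (decode e.1 : PauliString n).weight * y.2,
        e.2.2 - (decode e.1 : PauliString n).weight)
  else []

/-- The continuations of a list of paths through a layer. -/
def Layer.extendPaths (q : ℝ) (l : PathList) (L : Layer n) : PathList :=
  l.flatMap (L.extendPath q)

theorem PauliString.supp_nodup (R : PauliString n) : R.supp.Nodup :=
  (List.nodup_reverse.2 (List.nodup_finRange n)).filter _

theorem PauliString.mem_supp (R : PauliString n) (j : Fin n) : j ∈ R.supp ↔ R j ≠ 0 := by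
  simp [PauliString.supp]

theorem PauliString.length_supp (R : PauliString n) : R.supp.length = R.weight := by
  have h1 : R.supp.toFinset = Finset.univ.filter fun j => R j ≠ 0 := by
    ext j; simp [R.mem_supp]
  rw [← List.toFinset_card_of_nodup R.supp_nodup, h1]
  simp [PauliString.weight]

theorem PathList.size_append (l l' : PathList) : (l ++ l').size = l.size + l'.size := by
  simp [PathList.size]

theorem PathList.size_cons (e : ℕ × ℝ × ℕ) (l : PathList) :
    PathList.size (e :: l) = 16 ^ e.2.2 + PathList.size l := by
  simp [PathList.size]

/-- A string of weight k has at most 16^k successors, and each of them has k less of the budget, so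
the share 16^budget of a path bounds that of its successors. Hence the number of paths is bounded
independently of the depth. -/
theorem Layer.size_extendPath_le (L : Layer n) (q : ℝ) (e : ℕ × ℝ × ℕ) :
    (L.extendPath q e).size ≤ 16 ^ e.2.2 := by
  unfold Layer.extendPath
  split_ifs with h
  · rw [PathList.size, List.map_map]
    simp only [Function.comp_def, List.map_const', List.sum_replicate, smul_eq_mul]
    refine (Nat.mul_le_mul_right _ (L.length_expand_le 1)).trans ?_
    rw [PauliString.length_supp, ← pow_add, Nat.add_sub_cancel' h]
  · simp [PathList.size]

theorem Layer.size_extendPaths_le (L : Layer n) (q : ℝ) (l : PathList) :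
    (Layer.extendPaths q l L).size ≤ l.size := by
  induction l with
  | nil => simp [Layer.extendPaths, PathList.size]
  | cons e l ih =>
    have : Layer.extendPaths q (e :: l) L = L.extendPath q e ++ Layer.extendPaths q l L := by
      simp [Layer.extendPaths]
    rw [this, PathList.size_append, PathList.size_cons]
    exact Nat.add_le_add (L.size_extendPath_le q e) ih

theorem Layer.valid_extendPaths (L : Layer n) (q : ℝ) (l : PathList) :
    (Layer.extendPaths q l L).Valid n := by
  intro e he
  simp only [Layer.extendPaths, List.mem_flatMap, Layer.extendPath] at he
  obtain ⟨e', -, he⟩ := he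
  split_ifs at he
  · obtain ⟨y, hy, rfl⟩ := List.mem_map.1 he
    exact L.exists_code_of_mem_expand 1 (PauliString.supp_nodup _) (PauliString.mem_supp _) hy
  · simp at he

theorem size_foldl_extendPaths_le (q : ℝ) (ls : List (Layer n)) (l : PathList) :
    (ls.foldl (Layer.extendPaths q) l).size ≤ l.size := by
  induction ls generalizing l with
  | nil => rfl
  | cons L ls ih => exact (ih _).trans (L.size_extendPaths_le q l)

theorem valid_foldl_extendPaths (q : ℝ) (ls : List (Layer n)) (l : PathList) (hl : l.Valid n) :
    PathList.Valid n (ls.foldl (Layer.extendPaths q) l) := by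
  induction ls generalizing l with
  | nil => exact hl
  | cons L ls ih => exact ih _ (L.valid_extendPaths q l)

/-- The contribution of a list of paths. -/
def PathList.total (q : ℝ) (r : PauliString n → ℝ) (ls : List (Layer n)) (l : PathList) : ℝ :=
  (l.map fun e => e.2.1 * budgetVal q r (ls.map (Layer.data .uniform)) e.2.2 (decode e.1)).sum

/-- The list is built with damping 1: for uniform noise the factor q^weight is charged when a path
leaves a string, as in the recursion of `budgetVal`. -/
theorem Layer.total_extendPath (L : Layer n) (q : ℝ) (r : PauliString n → ℝ) (ls : List (Layer n))
    (e : ℕ × ℝ × ℕ) : (L.extendPath q e).total q r ls =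
      e.2.1 * budgetVal q r ((L :: ls).map (Layer.data .uniform)) e.2.2 (decode e.1) := by
  set R : PauliString n := decode e.1 with hR
  have h := L.sum_expand 1 R.supp_nodup R.mem_supp fun c =>
    budgetVal q r (ls.map (Layer.data .uniform)) (e.2.2 - R.weight) (decode c)
  simp only [decode_code, one_pow, one_mul] at h
  simp only [Layer.extendPath, List.map_cons, budgetVal, ← hR]
  split_ifs with hw
  · rw [PathList.total, List.map_map]
    change _ = e.2.1 * (q ^ R.weight * ∑ R', heis L.unitary R R' * _)
    rw [← h, ← mul_assoc, ← List.sum_map_mul_left]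
    congr 1
    refine List.map_congr_left fun y _ => ?_
    simp only [Function.comp]
    ring
  · simp [PathList.total]

theorem total_extendPaths (q : ℝ) (r : PauliString n → ℝ) (L : Layer n) (ls : List (Layer n))
    (l : PathList) : (Layer.extendPaths q l L).total q r ls = l.total q r (L :: ls) := by
  induction l with
  | nil => simp [Layer.extendPaths, PathList.total]
  | cons e l ih =>
    have h1 : Layer.extendPaths q (e :: l) L = L.extendPath q e ++ Layer.extendPaths q l L := by
      simp [Layer.extendPaths]
    have h2 : ∀ l l' : PathList, PathList.total q r ls (l ++ l') =
        l.total q r ls + l'.total q r ls := by simp [PathList.total]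
    rw [h1, h2, ih, L.total_extendPath]
    simp [PathList.total]

theorem total_foldl_extendPaths (q : ℝ) (r : PauliString n → ℝ) (ls : List (Layer n))
    (l : PathList) : (ls.foldl (Layer.extendPaths q) l).total q r [] = l.total q r ls := by
  induction ls generalizing l with
  | nil => rfl
  | cons L ls ih => rw [List.foldl_cons, ih, total_extendPaths]

/-- The extension is used against the direction of `heis`: R is expanded, the string Q before the
layer is found, and the weight of R is charged to the budget. -/
theorem Layer.exists_mem_extendPaths (L : Layer n) (q : ℝ) {l : PathList} {Q R : PauliString n}
    {a : ℝ} {b : ℕ} (h : L.Compatible Q R) (hR : (R.code, a, b) ∈ l) (hb : R.weight ≤ b) :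
    ∃ a', (Q.code, a', b - R.weight) ∈ Layer.extendPaths q l L := by
  obtain ⟨a', ha'⟩ := L.mem_expand_of_compatible 1 R.supp_nodup R.mem_supp h
  refine ⟨a * q ^ R.weight * a', List.mem_flatMap.2 ⟨_, hR, ?_⟩⟩
  simp only [Layer.extendPath, decode_code, if_pos hb]
  exact List.mem_map.2 ⟨_, ha', rfl⟩

/-! ### One layer of the propagation -/

/-- Arrays of the list of paths. -/
@[simp] abbrev bCode : ℕ := 20
@[simp] abbrev bBud : ℕ := 21
@[simp] abbrev rAmp : ℕ := 3
/-- The powers of the noise factor. -/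
@[simp] abbrev rPow : ℕ := 4
@[simp] abbrev vBLo : ℕ := 22
@[simp] abbrev vBHi : ℕ := 23
@[simp] abbrev vBH : ℕ := 24
@[simp] abbrev vBE : ℕ := 25
@[simp] abbrev vBC : ℕ := 26

/-- Append a path. -/
def pushCmd (c b : NExp) (a : RExp) : Cmd :=
  .seq (.setReal rAmp (.var vBHi) a) <| .seq (.setNat bCode (.var vBHi) c) <|
  .seq (.setNat bBud (.var vBHi) b) <| .assign vBHi (.add (.var vBHi) (.const 1))

/-- Append the continuations of the path `vBE`. -/
def extendBody : Cmd :=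
  .seq (.assign vCode (.read bCode (.var vBE))) <| .seq loadCmd <|
  .ite (.natLt (.read bBud (.var vBE)) (.var vSup)) .skip <|
  .seq (expandCmd (.const 1)) <| .seq (.assign vBC (.var vLo)) <|
  .forLoop vBC (.var vHi) <|
    pushCmd (.read aCode (.var vBC)) (.sub (.read bBud (.var vBE)) (.var vSup))
      (.mul (.mul (.read rAmp (.var vBE)) (.read rPow (.var vSup))) (.read rCoeff (.var vBC)))

/-- Propagate the list of paths through the layer `vLayer`. -/
def extendCmd : Cmd :=
  .seq (.assign vBH (.var vBHi)) <| .seq (.assign vBE (.var vBLo)) <|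
  .seq (.forLoop vBE (.var vBH) extendBody) <| .assign vBLo (.var vBH)

/-- The path number `i`. -/
def Memory.path (s : Memory) (i : ℕ) : ℕ × ℝ × ℕ := (s.nat bCode i, s.real rAmp i, s.nat bBud i)

/-- The memory contains the list of paths `l`. -/
def HoldsPaths (s : Memory) (l : PathList) : Prop :=
  s.nat vBHi 0 = s.nat vBLo 0 + l.length ∧ Seg s.path (s.nat vBLo 0) l

/-- The memory contains the powers of the noise factor. -/
def HoldsNoise (n : ℕ) (q : ℝ) (s : Memory) : Prop := ∀ j ≤ n, s.real rPow j = q ^ j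

theorem Memory.path_congr {s s' : Memory} (h : s'.nat bCode = s.nat bCode)
    (h' : s'.real rAmp = s.real rAmp) (h'' : s'.nat bBud = s.nat bBud) : s'.path = s.path := by
  funext j; simp only [Memory.path, h, h', h'']

@[simp] theorem Memory.path_setN (s : Memory) {a : ℕ} (i v : ℕ) (h : bCode ≠ a) (h' : bBud ≠ a) :
    (s.setN a i v).path = s.path :=
  Memory.path_congr (Memory.setN_nat_of_ne _ _ _ h) rfl (Memory.setN_nat_of_ne _ _ _ h')

variable {x : Input n d} {s : Memory}

/-- The components are evaluated one after the other, after the earlier ones have been written; `hc`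
and `hb` say that these writes do not change the values of the later ones. -/
theorem runs_pushCmd {c b : NExp} {a : RExp} {lo : ℕ} {l : PathList} (e : ℕ × ℝ × ℕ)
    (hHi : s.nat vBHi 0 = lo + l.length) (hl : Seg s.path lo l)
    (ha : a.eval x s = e.2.1)
    (hc : ∀ t, t.nat = s.nat → c.eval x t = e.1)
    (hb : ∀ t : Memory, (∀ i, bCode ≠ i → t.nat i = s.nat i) → b.eval x t = e.2.2) :
    Runs x (pushCmd c b a) s fun k s' => k = 4 ∧ s'.nat vBHi 0 = lo + (l ++ [e]).length ∧
      Seg s'.path lo (l ++ [e]) ∧ ∀ i < lo + l.length, s'.path i = s.path i := by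
  simp only [pushCmd, runs_seq, runs_setNat, runs_setReal, runs_assign]
  rw [ha]
  set s1 := s.setR rAmp _ e.2.1 with hs1
  rw [hc s1 rfl]
  set s2 := s1.setN bCode _ e.1 with hs2
  rw [hb s2 fun i hi => by simp [hs2, hs1, hi.symm]]
  have hHi' : s.nat 23 0 = lo + l.length := hHi
  have hpath : ∀ i < lo + l.length, ((s2.setN bBud ((NExp.var vBHi).eval x s2) e.2.2).setN vBHi 0
      ((NExp.add (.var vBHi) (.const 1)).eval x
        (s2.setN bBud ((NExp.var vBHi).eval x s2) e.2.2))).path i = s.path i := by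
    intro i hi
    rw [Memory.path_setN _ _ _ (by decide) (by decide)]
    simp [Memory.path, hs2, hs1, hHi', hi.ne]
  refine ⟨trivial, ?_, hl.append hpath ?_, hpath⟩
  · simp [NExp.eval, hs2, hs1, hHi', add_assoc]
  · rw [Memory.path_setN _ _ _ (by decide) (by decide)]
    simp [Memory.path, hs2, hs1, hHi']

theorem pushCmd_writesNat (c b : NExp) (a : RExp) (i : ℕ) (hi : i ∉ [20, 21, 23]) :
    (pushCmd c b a).writesNat i = false := by
  simp only [List.mem_cons, List.not_mem_nil, not_or] at hi
  simp [pushCmd, Cmd.writesNat, Cmd.assign, hi]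

theorem expandCmd_writesNat (z : RExp) (a : ℕ)
    (ha : a ∉ [5, 6, 7, 9, 10, 11, 12, 13, 14, 15, 16]) : (expandCmd z).writesNat a = false := by
  simp only [List.mem_cons, List.not_mem_nil, not_or] at ha
  have := expandStepCmd_writesNat z a (by simp [ha])
  simp [expandCmd, Cmd.forLoop, Cmd.writesNat, Cmd.assign, this, ha]

theorem expandCmd_writesReal (z : RExp) (a : ℕ) (ha : a ∉ [1, 2]) :
    (expandCmd z).writesReal a = false := by
  have := expandStepCmd_writesReal z a ha
  simp only [List.mem_cons, List.not_mem_nil, not_or] at ha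
  simp [expandCmd, Cmd.forLoop, Cmd.writesReal, Cmd.assign, this, ha]

theorem loadCmd_writesNat (a : ℕ) (ha : a ∉ [1, 2, 3, 17, 18, 19]) :
    loadCmd.writesNat a = false := by
  simp only [List.mem_cons, List.not_mem_nil, not_or] at ha
  simp [loadCmd, loadBody, letterCmd, Cmd.forLoop, Cmd.writesNat, Cmd.assign, ha]

theorem extendBody_writesNat (a : ℕ) (ha : a ∉ [1, 2, 3, 5, 6, 7, 9, 10, 11, 12, 13, 14, 15, 16,
    17, 18, 19, 20, 21, 23, 26]) : extendBody.writesNat a = false := by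
  simp only [List.mem_cons, List.not_mem_nil, not_or] at ha
  simp [extendBody, Cmd.forLoop, Cmd.writesNat, Cmd.assign, ha, expandCmd_writesNat,
    loadCmd_writesNat, pushCmd_writesNat]

theorem extendBody_writesReal (a : ℕ) (ha : a ∉ [1, 2, 3]) : extendBody.writesReal a = false := by
  simp only [List.mem_cons, List.not_mem_nil, not_or] at ha
  simp [extendBody, Cmd.forLoop, Cmd.writesReal, Cmd.assign, ha, expandCmd_writesReal, pushCmd,
    loadCmd, loadBody, letterCmd]

theorem Loaded.congr {s s' : Memory} {R : PauliString n} {sup : List (Fin n)} (h : Loaded s R sup)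
    (h1 : s'.nat aStr = s.nat aStr) (h2 : s'.nat aSup = s.nat aSup)
    (h3 : s'.nat vSup = s.nat vSup) : Loaded s' R sup :=
  ⟨by rw [HoldsString, h1]; exact h.string, by rw [h3]; exact h.card, by rw [h2]; exact h.seg,
    h.nodup, h.mem⟩

/-- The expansion costs O(16^weight), within 16^budget if the path can afford its string; otherwise
the path is dropped. Decoding costs O(n), whence the factor linear in n. -/
theorem runs_extendBody {t : Fin d} {q : ℝ} {lo : ℕ} {l : PathList} {e : ℕ × ℝ × ℕ}
    (ht : s.nat vLayer 0 = t) (hpow : HoldsPow n s) (hq : HoldsNoise n q s)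
    (hHi : s.nat vBHi 0 = lo + l.length) (hl : Seg s.path lo l)
    (hlt : s.nat vBE 0 < lo) (he : s.path (s.nat vBE 0) = e)
    (hval : ∃ Q : PauliString n, Q.code = e.1) :
    Runs x extendBody s fun k s' => k ≤ (10 * n + 75) * 16 ^ e.2.2 ∧
      s'.nat vBHi 0 = lo + (l ++ (x.circuit t).extendPath q e).length ∧
      Seg s'.path lo (l ++ (x.circuit t).extendPath q e) ∧ ∀ i < lo, s'.path i = s.path i := by
  obtain ⟨R, hR⟩ := hval
  have he1 : s.nat bCode (s.nat vBE 0) = R.code := by rw [hR, ← he]; rfl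
  simp only [extendBody, runs_seq, runs_assign]
  have hc : (NExp.read bCode (.var vBE)).eval x s = R.code := he1
  rw [hc]
  refine (runs_loadCmd (R := R) (by simpa [HoldsPow] using hpow) (by simp)).imp
    fun k1 s1 ⟨hk1, hL⟩ hf1 => ?_
  have hpath1 : s1.path = s.path := by
    rw [Memory.path_congr (hf1.1 _ rfl) (hf1.2 _ rfl) (hf1.1 _ rfl)]
    exact Memory.path_setN _ _ _ (by decide) (by decide)
  have hBE1 : s1.nat vBE 0 = s.nat vBE 0 := by rw [hf1.1 _ rfl]; simp
  have hBHi1 : s1.nat vBHi 0 = lo + l.length := by rw [hf1.1 _ rfl, ← hHi]; simp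
  have hdec : (decode e.1 : PauliString n) = R := by rw [← hR, decode_code]
  have hsup : s1.nat vSup 0 = R.weight := by rw [hL.card, R.length_supp]
  have hbud : (NExp.read bBud (.var vBE)).eval x s1 = e.2.2 := by
    have : (s1.path (s1.nat vBE 0)).2.2 = e.2.2 := by rw [hpath1, hBE1, he]
    exact this
  have h16 := Nat.one_le_pow e.2.2 16 (by norm_num)
  have hn : 10 * n ≤ 10 * n * 16 ^ e.2.2 := Nat.le_mul_of_pos_right _ h16
  by_cases hw : R.weight ≤ e.2.2
  · rw [runs_ite_of_neg (by rw [Test.holds, hbud, NExp.eval_var, hsup]; omega)]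
    simp only [runs_seq, runs_assign]
    have hpow1 : HoldsPow n s1 := by
      intro j hj
      rw [hf1.1 _ rfl]
      simpa using hpow j hj
    refine (runs_expandCmd (t := t) (w := 1) (fun s => by simp [RExp.eval])
      (by rw [hf1.1 _ rfl]; simpa using ht) hL hpow1).imp fun k2 s2 ⟨hk2, hHi2, hs2⟩ hf2 => ?_
    set M := (x.circuit t).expand 1 R R.supp with hM
    have hMlen : M.length ≤ 16 ^ R.weight := by
      rw [← R.length_supp]; exact Layer.length_expand_le _ _
    have hN2 : ∀ a, a ∉ [5, 6, 7, 9, 10, 11, 12, 13, 14, 15, 16] → s2.nat a = s1.nat a :=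
      fun a ha => hf2.1 a (expandCmd_writesNat _ a ha)
    have hpath2 : s2.path = s.path := by
      rw [Memory.path_congr (hN2 _ (by decide)) (hf2.2 _ (expandCmd_writesReal _ _ (by decide)))
        (hN2 _ (by decide)), hpath1]
    set s3 := s2.setN vBC 0 ((NExp.var vLo).eval x s2) with hs3
    set body := pushCmd (.read aCode (.var vBC)) (.sub (.read bBud (.var vBE)) (.var vSup))
      (.mul (.mul (.read rAmp (.var vBE)) (.read rPow (.var vSup))) (.read rCoeff (.var vBC)))
      with hbody
    have hwb : ∀ a, a ∉ [20, 21, 23, 26] →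
        (Cmd.forLoop vBC (.var vHi) body).writesNat a = false := by
      intro a ha
      simp only [List.mem_cons, List.not_mem_nil, not_or] at ha
      simp [Cmd.forLoop, Cmd.writesNat, hbody, pushCmd_writesNat, ha]
    have hwr : ∀ a, a ∉ [3] → (Cmd.forLoop vBC (.var vHi) body).writesReal a = false := by
      intro a ha
      simp only [List.mem_cons, List.not_mem_nil, not_or] at ha
      simp [Cmd.forLoop, Cmd.writesReal, hbody, pushCmd, Cmd.assign, ha]
    have hl3 : Seg s3.path lo l := by
      rw [hs3, Memory.path_setN _ _ _ (by decide) (by decide), hpath2]; exact hl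
    set f : ℕ × ℝ → ℕ × ℝ × ℕ := fun y => (y.1, e.2.1 * q ^ R.weight * y.2, e.2.2 - R.weight)
      with hf
    have := Runs.forLoop (x := x) (v := vBC) (e := .var vHi) (c := body) (s := s3)
      (s2.nat vLo 0) M.length
      (fun j s' => s'.nat vBHi 0 = lo + (l ++ (M.take j).map f).length ∧
        Seg s'.path lo (l ++ (M.take j).map f) ∧ ∀ i < lo, s'.path i = s.path i) (fun _ => 4)
      (by simp [hs3]) (by simp [hbody, pushCmd_writesNat]) ?_ ?_ ?_ ?_
    · refine this.mono fun k s' ⟨hk, _, h⟩ => ⟨?_, ?_⟩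
      · rw [Finset.sum_const, Finset.card_range, smul_eq_mul] at hk
        rw [R.length_supp] at hk2
        have h5 : 16 ^ R.weight ≤ 16 ^ e.2.2 := Nat.pow_le_pow_right (by norm_num) hw
        rw [add_mul]
        omega
      · rw [List.take_length] at h
        rw [Layer.extendPath, hdec, if_pos hw]
        exact h
    · rw [List.take_zero, List.map_nil, List.append_nil]
      refine ⟨?_, hl3, ?_⟩
      · rw [← hBHi1, ← hN2 vBHi (by decide)]
        simp [hs3]
      · intro i _
        rw [hs3, Memory.path_setN _ _ _ (by decide) (by decide), hpath2]
    · intro s' hf'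
      rw [NExp.eval_var, hf'.1 vHi (hwb _ (by decide)), ← hHi2]
      simp [hs3]
    · intro i s' w h
      rw [Memory.path_setN _ _ _ (by decide) (by decide)]
      simpa using h
    · intro i s' hi hf' hv ⟨h1, h2, h3⟩
      have hN' : ∀ a, a ∉ [20, 21, 23, 26] → s'.nat a = s3.nat a :=
        fun a ha => hf'.1 a (hwb a ha)
      have hR' : ∀ a, a ∉ [3] → s'.real a = s3.real a := fun a ha => hf'.2 a (hwr a ha)
      have hBE' : s'.nat vBE 0 = s.nat vBE 0 := by
        rw [hN' _ (by decide), ← hBE1, ← hN2 vBE (by decide)]; simp [hs3]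
      have hent : (s'.nat aCode (s'.nat vBC 0), s'.real rCoeff (s'.nat vBC 0)) = M[i] := by
        rw [hN' aCode (by decide), hR' rCoeff (by decide), hv]
        have := hs2 i hi
        simp [hs3, ← this, Memory.entry]
      have hsup' : s'.nat vSup 0 = R.weight := by
        rw [hN' _ (by decide), ← hsup, ← hN2 vSup (by decide)]; simp [hs3]
      have hpe : s'.path (s'.nat vBE 0) = e := by rw [hBE', h3 _ hlt, he]
      have hnoise : s'.real rPow (s'.nat vSup 0) = q ^ R.weight := by
        rw [hsup', hR' rPow (by decide), ← hq _ R.weight_le]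
        have e1 := hf2.2 rPow (expandCmd_writesReal _ _ (by decide))
        have e2 := hf1.2 rPow rfl
        have e3 : s3.real rPow = s2.real rPow := rfl
        rw [e3, e1, e2]; simp
      have e1 : M.take (i + 1) = M.take i ++ [M[i]] := by
        rw [List.take_add_one, List.getElem?_eq_getElem hi]; simp
      rw [e1, List.map_append, ← List.append_assoc]
      refine (runs_pushCmd (f M[i]) h1 h2 ?_ ?_ ?_).mono
        fun k s'' h => ⟨h.1.le, h.2.1, h.2.2.1, fun i hi => ?_⟩
      · have g1 : s'.real rAmp (s'.nat vBE 0) = e.2.1 := by rw [← hpe]; rfl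
        have g2 : s'.real rCoeff (s'.nat vBC 0) = M[i].2 := by rw [← hent]
        simp only [RExp.eval, NExp.eval_var, g1, g2, hnoise, hf]
      · intro t' ht'
        have g2 : s'.nat aCode (s'.nat vBC 0) = M[i].1 := by rw [← hent]
        simp only [NExp.eval, NExp.eval_var, ht', g2, hf]
      · intro t' ht'
        have g1 : s'.nat bBud (s'.nat vBE 0) = e.2.2 := by rw [← hpe]; rfl
        simp only [NExp.eval, NExp.eval_var, ht' bBud (by decide), ht' vBE (by decide),
          ht' vSup (by decide), g1, hsup', hf]
      · rw [h.2.2.2 i (by omega), h3 i hi]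
  · rw [runs_ite_of_pos (by rw [Test.holds, hbud, NExp.eval_var, hsup]; omega), runs_skip,
      Layer.extendPath, hdec, if_neg hw, List.append_nil]
    refine ⟨?_, hBHi1, ?_, fun i _ => by rw [hpath1]⟩
    · rw [add_mul]; omega
    · rw [hpath1]; exact hl

theorem extendCmd_writesNat (a : ℕ) (ha : a ∉ [1, 2, 3, 5, 6, 7, 9, 10, 11, 12, 13, 14, 15, 16,
    17, 18, 19, 20, 21, 22, 23, 24, 25, 26]) : extendCmd.writesNat a = false := by
  simp only [List.mem_cons, List.not_mem_nil, not_or] at ha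
  simp [extendCmd, Cmd.forLoop, Cmd.writesNat, Cmd.assign, ha, extendBody_writesNat]

theorem extendCmd_writesReal (a : ℕ) (ha : a ∉ [1, 2, 3]) : extendCmd.writesReal a = false := by
  have := extendBody_writesReal a ha
  simp [extendCmd, Cmd.forLoop, Cmd.writesReal, Cmd.assign, this]

/-- Continuations are appended behind the old paths. The time spent on a path is proportional to its
share in `PathList.size`, so the layer costs O(n · size). -/
theorem runs_extendCmd {t : Fin d} {q : ℝ} {l : PathList}
    (ht : s.nat vLayer 0 = t) (hpow : HoldsPow n s) (hq : HoldsNoise n q s)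
    (hl : HoldsPaths s l) (hval : l.Valid n) :
    Runs x extendCmd s fun k s' => k ≤ (10 * n + 77) * l.size + 4 ∧
      HoldsPaths s' (Layer.extendPaths q l (x.circuit t)) := by
  simp only [extendCmd, runs_seq, runs_assign, NExp.eval_var]
  obtain ⟨hHi, hl⟩ := hl
  set lo := s.nat vBLo 0 with hlo
  set s1 := (s.setN vBH 0 _).setN vBE 0 _ with hs1
  have hw : ∀ a, a ∉ [1, 2, 3, 5, 6, 7, 9, 10, 11, 12, 13, 14, 15, 16,
    17, 18, 19, 20, 21, 23, 25, 26] →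
      (Cmd.forLoop vBE (.var vBH) extendBody).writesNat a = false := by
    intro a ha
    simp only [List.mem_cons, List.not_mem_nil, not_or] at ha
    simp [Cmd.forLoop, Cmd.writesNat, ha, extendBody_writesNat]
  have := Runs.forLoop (x := x) (v := vBE) (e := .var vBH) (c := extendBody) (s := s1)
    lo l.length (fun j s' =>
      s'.nat vBHi 0 = lo + l.length + (Layer.extendPaths q (l.take j) (x.circuit t)).length ∧
      Seg s'.path (lo + l.length) (Layer.extendPaths q (l.take j) (x.circuit t)) ∧
      ∀ i < lo + l.length, s'.path i = s.path i)
    (fun i => (10 * n + 75) * 16 ^ (l.getD i (0, 0, 0)).2.2)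
    (by simpa [hs1] using hlo.symm) (extendBody_writesNat _ (by decide)) ?_ ?_ ?_ ?_
  · refine this.imp fun k s' ⟨hk, _, h1, h2, _⟩ hf => ⟨?_, ?_⟩
    · have h3 : ∀ l : PathList, ∑ i ∈ Finset.range l.length,
          ((10 * n + 75) * 16 ^ (l.getD i (0, 0, 0)).2.2 + 2) ≤ (10 * n + 77) * l.size := by
        intro l
        induction l with
        | nil => simp
        | cons e l ih =>
          rw [List.length_cons, Finset.sum_range_succ', PathList.size_cons]
          have h16 := Nat.one_le_pow e.2.2 16 (by norm_num)
          simp only [List.getD_cons_succ, List.getD_cons_zero]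
          nlinarith
      have := h3 l
      omega
    · rw [List.take_length] at h1 h2
      have hH : s'.nat vBH 0 = lo + l.length := by
        rw [hf.1 vBH (hw _ (by decide)), ← hHi]
        simp [hs1]
      refine ⟨?_, ?_⟩
      · simp at hH h1 ⊢
        omega
      · rw [Memory.path_setN _ _ _ (by decide) (by decide)]
        simpa [hH] using h2
  · refine ⟨?_, ?_, ?_⟩
    · simpa [hs1, Layer.extendPaths] using hHi
    · simpa [Layer.extendPaths] using Seg.nil _ _
    · intro i _
      rw [hs1, Memory.path_setN _ _ _ (by decide) (by decide),
        Memory.path_setN _ _ _ (by decide) (by decide)]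
  · intro s' hf
    rw [NExp.eval_var, hf.1 vBH (hw _ (by decide)), ← hHi]
    simp [hs1]
  · intro i s' w h
    rw [Memory.path_setN _ _ _ (by decide) (by decide)]
    simpa using h
  · intro i s' hi hf hv ⟨h1, h2, h3⟩
    have e1 : l.take (i + 1) = l.take i ++ [l[i]] := by
      rw [List.take_add_one, List.getElem?_eq_getElem hi]; simp
    have e2 : Layer.extendPaths q (l.take (i + 1)) (x.circuit t) =
        Layer.extendPaths q (l.take i) (x.circuit t) ++ (x.circuit t).extendPath q l[i] := by
      rw [e1, Layer.extendPaths, Layer.extendPaths, List.flatMap_append]; simp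
    have e3 : l.getD i (0, 0, 0) = l[i] := by simp [List.getD, hi]
    rw [e2, e3]
    refine (runs_extendBody (t := t) (q := q) (e := l[i]) ?_ ?_ ?_ h1 h2 (by omega) ?_ ?_).mono
      fun k s'' h => ⟨h.1, h.2.1, h.2.2.1, fun i hi => (h.2.2.2 i hi).trans (h3 i hi)⟩
    · rw [hf.1 vLayer (hw _ (by decide)), ← ht]; simp [hs1]
    · intro j hj
      rw [hf.1 aPow (hw _ (by decide)), ← hpow j hj]; simp [hs1]
    · intro j hj
      have : (Cmd.forLoop vBE (.var vBH) extendBody).writesReal rPow = false := by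
        simp [Cmd.forLoop, Cmd.writesReal, extendBody_writesReal]
      rw [hf.2 rPow this, ← hq j hj]; simp [hs1]
    · rw [hv, h3 _ (by omega), hl i hi]
    · exact hval _ (List.getElem_mem hi)

end

end

noncomputable section

/-! ### Simulation with a budget -/

/-- Least exponents, and the present power. -/
@[simp] abbrev vT : ℕ := 27
@[simp] abbrev vL : ℕ := 28
@[simp] abbrev rX : ℕ := 5

/-- Compute the powers of four and of the noise factor. -/
def setupCmd : Cmd :=
  .seq (.setNat aPow (.const 0) (.const 1)) <| .seq (.setReal rPow (.const 0) (.const 1)) <|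
  .seq (.assign vJ (.const 0)) <| .forLoop vJ .numQubits <|
    .seq (.setNat aPow (.add (.var vJ) (.const 1)) (.mulConst 4 (.read aPow (.var vJ)))) <|
      .setReal rPow (.add (.var vJ) (.const 1)) (.mul (.read rPow (.var vJ)) .damping)

/-- Find the least exponent `v` such that `a` times this power of the noise factor is at most
`e`. -/
def exponentCmd (v : ℕ) (a e : RExp) : Cmd :=
  .seq (.setReal rX (.const 0) a) <| .seq (.assign v (.const 0)) <|
  .while (.realLt e (.read rX (.const 0))) <|
    .seq (.setReal rX (.const 0) (.mul (.read rX (.const 0)) .damping))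
      (.assign v (.add (.var v) (.const 1)))

/-- Propagate the list of paths through all layers. -/
def propagateCmd : Cmd :=
  .seq (.assign vLayer (.const 0)) <| .forLoop vLayer .depth extendCmd

/-- Add up the contributions of the paths. -/
def readoutCmd : Cmd :=
  .seq (.assign vBE (.var vBLo)) <| .forLoop vBE (.var vBHi) <|
    .seq (.assign vCode (.read bCode (.var vBE))) <| .seq loadCmd <|
    .ite (.natLt (.read bBud (.var vBE)) (.var vSup)) .skip <|
    .setReal rOut (.const 0) (.add (.read rOut (.const 0))
      (.mul (.read rAmp (.var vBE)) (.mul (.read rPow (.var vSup)) (.stateCoeff aStr))))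

/-- The simulation, where `seed` lists the Pauli strings of the observable. -/
def simulateCmd (seed : Cmd) : Cmd :=
  .seq (exponentCmd vT (.const 1) .accuracy) <|
  .ite (.natLt (.add .depth (.const 1)) (.var vT))
    (.seq setupCmd <| .seq
      (exponentCmd vL .damping (.mul .accuracy (.sub (.const 1) .damping))) <|
      .seq seed <| .seq propagateCmd readoutCmd)
    (.setReal rOut (.const 0) (.obsCoeff aStr))

section

variable {n d : ℕ} {x : Input n d} {s : Memory}

theorem runs_setupCmd : Runs x setupCmd s fun k s' => k ≤ 4 * n + 4 ∧ HoldsPow n s' ∧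
    HoldsNoise n x.damping s' := by
  simp only [setupCmd, runs_seq, runs_assign, runs_setNat, runs_setReal]
  set s1 := ((s.setN aPow _ _).setR rPow _ _).setN vJ 0 _ with hs1
  refine (Runs.forLoop (x := x) (s := s1) 0 n (fun i s' => (∀ j ≤ i, s'.nat aPow j = 4 ^ j) ∧
    ∀ j ≤ i, s'.real rPow j = x.damping ^ j) (fun _ => 2) (by simp [hs1, NExp.eval]) rfl ?_ ?_ ?_
    ?_).mono ?_
  · constructor <;> intro j hj
    · obtain rfl : j = 0 := by omega
      simp [hs1, NExp.eval]
    · obtain rfl : j = 0 := by omega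
      simp [hs1, RExp.eval, NExp.eval]
  · intro t _
    simp [NExp.eval]
  · intro i t w h
    simpa using h
  · intro i t hi _ hv ⟨h1, h2⟩
    rw [zero_add] at hv
    simp only [runs_seq, runs_setNat, runs_setReal]
    have hv' : t.nat 18 0 = i := hv
    refine ⟨by norm_num, fun j hj => ?_, fun j hj => ?_⟩
    · rcases Nat.lt_or_ge i j with h | h
      · obtain rfl : j = i + 1 := by omega
        have := h1 i le_rfl
        simp only [aPow] at this
        simp [NExp.eval, hv', this, pow_succ, mul_comm]
      · have := h1 j h
        have hne : j ≠ i + 1 := by omega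
        simp only [aPow] at this
        simp [NExp.eval, hv', this, hne]
    · rcases Nat.lt_or_ge i j with h | h
      · obtain rfl : j = i + 1 := by omega
        have := h2 i le_rfl
        simp only [rPow] at this
        simp [NExp.eval, RExp.eval, hv', this, pow_succ]
      · have := h2 j h
        have hne : j ≠ i + 1 := by omega
        simp only [rPow] at this
        simp [NExp.eval, hv', this, hne]
  · intro k s' ⟨hk, _, h1, h2⟩
    rw [Finset.sum_const, Finset.card_range, smul_eq_mul] at hk
    exact ⟨by omega, h1, h2⟩

theorem runs_exponentCmd {v : ℕ} {a e : RExp} {m : ℕ} {A E : ℝ} (ha : a.eval x s = A)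
    (he : ∀ t, e.eval x t = E) (hm : A * x.damping ^ m ≤ E)
    (hlt : ∀ i < m, E < A * x.damping ^ i) :
    Runs x (exponentCmd v a e) s fun k s' => k ≤ 3 * m + 3 ∧ s'.nat v 0 = m := by
  simp only [exponentCmd, runs_seq, runs_assign, runs_setReal]
  set s1 := (s.setR rX _ _).setN v 0 _ with hs1
  refine (Runs.while (x := x) (s := s1) m (fun i s' => s'.nat v 0 = i ∧
    s'.real rX 0 = A * x.damping ^ i) (fun _ => 2) ?_ ?_ ?_).mono ?_
  · exact ⟨by simp [hs1, NExp.eval], by simp [hs1, NExp.eval, ha]⟩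
  · intro i t hi _ ⟨h1, h2⟩
    have h2' : t.real 5 0 = A * x.damping ^ i := h2
    refine ⟨?_, ?_⟩
    · rw [Test.holds, he]
      simpa [RExp.eval, NExp.eval, h2'] using hlt i hi
    · simp only [runs_seq, runs_assign, runs_setReal]
      refine ⟨by norm_num, by simp [NExp.eval, h1], ?_⟩
      simp [RExp.eval, NExp.eval, h2', pow_succ, mul_assoc]
  · intro t _ ⟨_, h2⟩
    have h2' : t.real 5 0 = A * x.damping ^ m := h2
    rw [Test.holds, he]
    simpa [RExp.eval, NExp.eval, h2'] using hm
  · intro k s' ⟨hk, h1, _⟩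
    rw [Finset.sum_const, Finset.card_range, smul_eq_mul] at hk
    exact ⟨by omega, h1⟩

/-- The size does not grow from layer to layer, so the bound for the first layer serves for all of
them. -/
theorem runs_propagateCmd {q : ℝ} {l : PathList} (hpow : HoldsPow n s) (hq : HoldsNoise n q s)
    (hl : HoldsPaths s l) (hval : l.Valid n) :
    Runs x propagateCmd s fun k s' => k ≤ d * ((10 * n + 77) * l.size + 6) + 2 ∧
      HoldsPaths s' ((List.ofFn x.circuit).foldl (Layer.extendPaths q) l) := by
  simp only [propagateCmd, runs_seq, runs_assign]
  set s1 := s.setN vLayer 0 _ with hs1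
  have hw : ∀ a, a ∉ [1, 2, 3, 5, 6, 7, 8, 9, 10, 11, 12, 13, 14, 15, 16,
    17, 18, 19, 20, 21, 22, 23, 24, 25, 26] →
      (Cmd.forLoop vLayer .depth extendCmd).writesNat a = false := by
    intro a ha
    simp only [List.mem_cons, List.not_mem_nil, not_or] at ha
    simp [Cmd.forLoop, Cmd.writesNat, ha, extendCmd_writesNat]
  have hwr : (Cmd.forLoop vLayer .depth extendCmd).writesReal rPow = false := by
    simp [Cmd.forLoop, Cmd.writesReal, extendCmd_writesReal]
  refine (Runs.forLoop (x := x) (s := s1) 0 d (fun i s' => HoldsPaths s'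
    (((List.ofFn x.circuit).take i).foldl (Layer.extendPaths q) l))
    (fun _ => (10 * n + 77) * l.size + 4) (by simp [hs1, NExp.eval])
    (extendCmd_writesNat _ (by decide)) ?_ ?_ ?_ ?_).mono ?_
  · simpa [HoldsPaths, hs1] using hl
  · intro t _
    simp [NExp.eval]
  · intro i t w h
    simpa [HoldsPaths] using h
  · intro i t hi hf hv h
    rw [zero_add] at hv
    have e1 : (List.ofFn x.circuit).take (i + 1) =
        (List.ofFn x.circuit).take i ++ [x.circuit ⟨i, hi⟩] := by
      rw [List.take_add_one, List.getElem?_eq_getElem (by simpa using hi)]; simp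
    rw [e1, List.foldl_append]
    refine (runs_extendCmd (t := ⟨i, hi⟩) (q := q) hv ?_ ?_ h ?_).mono
      fun k s' h' => ⟨h'.1.trans ?_, h'.2⟩
    · intro j hj
      rw [hf.1 aPow (hw _ (by decide)), ← hpow j hj]; simp [hs1]
    · intro j hj
      rw [hf.2 rPow hwr, ← hq j hj]; simp [hs1]
    · exact valid_foldl_extendPaths q _ l hval
    · exact Nat.add_le_add_right (Nat.mul_le_mul_left _ (size_foldl_extendPaths_le q _ l)) _
  · intro k s' ⟨hk, _, h⟩
    rw [Finset.sum_const, Finset.card_range, smul_eq_mul] at hk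
    rw [List.take_of_length_le (by simp)] at h
    refine ⟨?_, h⟩
    have e : (10 * n + 77) * l.size + 4 + 2 = (10 * n + 77) * l.size + 6 := by ring
    rw [e] at hk
    omega

theorem readPauli_of_holdsString {s : Memory} {R : PauliString n} (h : HoldsString s R) :
    readPauli n (s.nat aStr) = R := by
  funext j
  rw [readPauli, h j]
  exact Fin.ext (Nat.mod_eq_of_lt (R j).2)

theorem PathList.length_le_size (l : PathList) : l.length ≤ l.size := by
  induction l with
  | nil => simp [PathList.size]
  | cons e l ih =>
    rw [List.length_cons, PathList.size_cons]
    have := Nat.one_le_pow e.2.2 16 (by norm_num)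
    omega

theorem runs_readoutCmd {q : ℝ} {l : PathList} (hpow : HoldsPow n s) (hq : HoldsNoise n q s)
    (hl : HoldsPaths s l) (hval : l.Valid n) :
    Runs x readoutCmd s fun k s' => k ≤ (10 * n + 8) * l.size + 2 ∧
      s'.real rOut 0 = s.real rOut 0 + l.total q x.stateCoeff [] := by
  simp only [readoutCmd, runs_seq, runs_assign]
  set s1 := s.setN vBE 0 _ with hs1
  obtain ⟨hHi, hl⟩ := hl
  refine (Runs.forLoop (x := x) (s := s1) (s.nat vBLo 0) l.length (fun i s' => s'.real rOut 0 =
    s.real rOut 0 + PathList.total q x.stateCoeff [] (l.take i)) (fun _ => 10 * n + 6)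
    (by simp [hs1]) rfl ?_ ?_ ?_ ?_).mono ?_
  · simp [hs1, PathList.total]
  · intro t hf
    rw [NExp.eval_var, hf.1 _ rfl, ← hHi]
    simp [hs1]
  · intro i t w h
    simpa using h
  · intro i t hi hf hv h
    simp only [runs_seq, runs_assign]
    have hpath : t.path = s.path := by
      rw [Memory.path_congr (hf.1 _ rfl) (hf.2 _ rfl) (hf.1 _ rfl), hs1,
        Memory.path_setN _ _ _ (by decide) (by decide)]
    have he : t.path (t.nat vBE 0) = l[i] := by rw [hpath, hv, hl i hi]
    obtain ⟨R, hR⟩ := hval _ (List.getElem_mem hi)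
    have hc : (NExp.read bCode (.var vBE)).eval x t = R.code := by rw [hR, ← he]; rfl
    rw [hc]
    have hpow1 : HoldsPow n (t.setN vCode 0 R.code) := by
      intro j hj
      have := hf.1 aPow rfl
      simp only [aPow] at this
      simpa [this, hs1] using hpow j hj
    refine (runs_loadCmd (R := R) hpow1 (by simp)).imp fun k1 s2 ⟨hk1, hL⟩ hf2 => ?_
    have hpath2 : s2.path = t.path := by
      rw [Memory.path_congr (hf2.1 _ rfl) (hf2.2 _ rfl) (hf2.1 _ rfl)]
      exact Memory.path_setN _ _ _ (by decide) (by decide)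
    have hBE : s2.nat vBE 0 = t.nat vBE 0 := by rw [hf2.1 _ rfl]; simp
    have he2 : s2.path (s2.nat vBE 0) = l[i] := by rw [hpath2, hBE, he]
    have hbud : (NExp.read bBud (.var vBE)).eval x s2 = l[i].2.2 := by rw [← he2]; rfl
    have hamp : s2.real rAmp (s2.nat vBE 0) = l[i].2.1 := by rw [← he2]; rfl
    have hsup : s2.nat vSup 0 = R.weight := by rw [hL.card, R.length_supp]
    have hout : s2.real rOut 0 = t.real rOut 0 := by rw [hf2.2 _ rfl]; rfl
    have hnoise : s2.real rPow R.weight = q ^ R.weight := by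
      rw [hf2.2 _ rfl, ← hq _ R.weight_le]
      have := hf.2 rPow rfl
      rw [Memory.setN_real, this, hs1]; rfl
    have e1 : l.take (i + 1) = l.take i ++ [l[i]] := by
      rw [List.take_add_one, List.getElem?_eq_getElem hi]; simp
    have e2 : PathList.total q x.stateCoeff [] (l.take (i + 1)) =
        PathList.total q x.stateCoeff [] (l.take i) +
          l[i].2.1 * if R.weight ≤ l[i].2.2 then q ^ R.weight * x.stateCoeff R else 0 := by
      rw [e1, PathList.total, PathList.total, List.map_append, List.sum_append, List.map_singleton,
        List.sum_singleton, ← hR, decode_code, List.map_nil, budgetVal]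
    rw [e2, ← add_assoc, ← h, ← hout]
    by_cases hw : R.weight ≤ l[i].2.2
    · rw [runs_ite_of_neg (by rw [Test.holds, hbud, NExp.eval_var, hsup]; omega), runs_setReal,
        if_pos hw]
      refine ⟨by omega, ?_⟩
      have e3 : (RExp.stateCoeff aStr).eval x s2 = x.stateCoeff R := by
        rw [RExp.eval, readPauli_of_holdsString hL.string]
      simp only [Memory.setR_real_self]
      simp only [RExp.eval, NExp.eval_var, hamp, hsup, hnoise] at e3 ⊢
      simp [NExp.eval, e3]
    · rw [runs_ite_of_pos (by rw [Test.holds, hbud, NExp.eval_var, hsup]; omega), runs_skip,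
        if_neg hw, mul_zero, add_zero]
      exact ⟨by omega, rfl⟩
  · intro k s' ⟨hk, _, h⟩
    rw [Finset.sum_const, Finset.card_range, smul_eq_mul] at hk
    rw [List.take_length] at h
    refine ⟨?_, h⟩
    have := Nat.mul_le_mul_left (10 * n + 8) l.length_le_size
    have e : l.length * (10 * n + 6 + 2) = (10 * n + 8) * l.length := by ring
    rw [e] at hk
    omega

/-- The memory at the beginning. -/
def Memory.init : Memory := ⟨fun _ _ => 0, fun _ _ => 0⟩

/-- The branch for circuits so deep that the identity string suffices: the array `aStr` is still
zero and therefore encodes the identity, whose coefficient is the output. -/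
theorem runs_simulateCmd_of_le {seed : Cmd} {m : ℕ} (hm : x.damping ^ m ≤ x.accuracy)
    (hlt : ∀ i < m, x.accuracy < x.damping ^ i) (hmd : m ≤ d + 1) :
    Runs x (simulateCmd seed) .init fun k s' => k ≤ 3 * m + 5 ∧
      s'.real rOut 0 = x.obsCoeff 0 := by
  rw [simulateCmd, runs_seq]
  refine (runs_exponentCmd (m := m) (A := 1) (E := x.accuracy) (by simp [RExp.eval])
    (fun t => rfl) (by simpa using hm) (by simpa using hlt)).imp fun k s ⟨hk, h1⟩ hf => ?_
  rw [runs_ite_of_neg (by rw [Test.holds, NExp.eval_var, h1]; simp only [NExp.eval]; omega),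
    runs_setReal]
  refine ⟨by omega, ?_⟩
  have h2 : readPauli n (s.nat aStr) = 0 := by
    refine readPauli_of_holdsString fun j => ?_
    rw [hf.1 _ rfl]
    rfl
  simp only [aStr] at h2
  simp [NExp.eval, RExp.eval, h2]

/-- The seed is a parameter, to be used once for listed terms and once for arbitrary observables. It
has to leave a list of paths with total V; extending through the layers preserves this total, and
the read-out adds it up. The seed may rely on most arrays being zero, since the preparation touches
only four arrays of natural numbers. -/
theorem runs_simulateCmd {seed : Cmd} {m ℓ Ts S : ℕ} {V : ℝ} (hm : x.damping ^ m ≤ x.accuracy)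
    (hlt : ∀ i < m, x.accuracy < x.damping ^ i) (hmd : d + 1 < m)
    (hl : x.damping * x.damping ^ ℓ ≤ x.accuracy * (1 - x.damping))
    (hllt : ∀ i < ℓ, x.accuracy * (1 - x.damping) < x.damping * x.damping ^ i)
    (hw : seed.writesNat aPow = false) (hw' : seed.writesReal rPow = false)
    (hw'' : seed.writesReal rOut = false)
    (hseed : ∀ s : Memory, HoldsPow n s → HoldsNoise n x.damping s → s.nat vL 0 = ℓ →
      (∀ a, a ∉ [4, 18, 27, 28] → s.nat a = fun _ => 0) →
      Runs x seed s fun k s' => k ≤ Ts ∧ ∃ l, HoldsPaths s' l ∧ l.Valid n ∧ l.size ≤ S ∧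
        l.total x.damping x.stateCoeff (List.ofFn x.circuit) = V) :
    Runs x (simulateCmd seed) .init fun k s' =>
      k ≤ 3 * m + 3 * ℓ + 4 * n + Ts + (d + 1) * ((10 * n + 77) * S + 6) + 20 ∧
      s'.real rOut 0 = V := by
  rw [simulateCmd, runs_seq]
  refine (runs_exponentCmd (m := m) (A := 1) (E := x.accuracy) (by simp [RExp.eval])
    (fun t => rfl) (by simpa using hm) (by simpa using hlt)).imp fun k1 s1 ⟨hk1, h1⟩ hf1 => ?_
  rw [runs_ite_of_pos (by rw [Test.holds, NExp.eval_var, h1]; simp only [NExp.eval]; omega)]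
  simp only [runs_seq]
  refine runs_setupCmd.imp fun k2 s2 ⟨hk2, hp2, hq2⟩ hf2 => ?_
  refine (runs_exponentCmd (m := ℓ) (A := x.damping) (E := x.accuracy * (1 - x.damping))
    (by simp [RExp.eval]) (fun t => by simp [RExp.eval]) hl hllt).imp
    fun k3 s3 ⟨hk3, h3⟩ hf3 => ?_
  have hp3 : HoldsPow n s3 := by rw [HoldsPow, hf3.1 aPow rfl]; exact hp2
  have hq3 : HoldsNoise n x.damping s3 := by rw [HoldsNoise, hf3.2 rPow rfl]; exact hq2
  have hz : ∀ a, a ∉ [4, 18, 27, 28] → s3.nat a = fun _ => 0 := by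
    intro a ha
    simp only [List.mem_cons, List.not_mem_nil, not_or] at ha
    rw [hf3.1 a (by simp [exponentCmd, Cmd.assign, Cmd.writesNat, ha]),
      hf2.1 a (by simp [setupCmd, Cmd.forLoop, Cmd.assign, Cmd.writesNat, ha]),
      hf1.1 a (by simp [exponentCmd, Cmd.assign, Cmd.writesNat, ha])]
    rfl
  refine (hseed s3 hp3 hq3 h3 hz).imp fun k4 s4 ⟨hk4, l, hl4, hv4, hS, hV⟩ hf4 => ?_
  have hp4 : HoldsPow n s4 := by rw [HoldsPow, hf4.1 aPow hw]; exact hp3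
  have hq4 : HoldsNoise n x.damping s4 := by rw [HoldsNoise, hf4.2 rPow hw']; exact hq3
  refine (runs_propagateCmd hp4 hq4 hl4 hv4).imp fun k5 s5 ⟨hk5, hl5⟩ hf5 => ?_
  have hp5 : HoldsPow n s5 := by
    rw [HoldsPow, hf5.1 aPow]; exacts [hp4, by
      simp [propagateCmd, Cmd.forLoop, Cmd.assign, Cmd.writesNat, extendCmd_writesNat]]
  have hwr : ∀ a, a ∉ [1, 2, 3] → propagateCmd.writesReal a = false := fun a ha => by
      simp [propagateCmd, Cmd.forLoop, Cmd.assign, Cmd.writesReal, extendCmd_writesReal a ha]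
  have hq5 : HoldsNoise n x.damping s5 := by
    rw [HoldsNoise, hf5.2 rPow (hwr _ (by decide))]; exact hq4
  refine (runs_readoutCmd hp5 hq5 hl5 (valid_foldl_extendPaths _ _ _ hv4)).mono
    fun k6 s6 ⟨hk6, h6⟩ => ⟨?_, ?_⟩
  · have e1 := size_foldl_extendPaths_le x.damping (List.ofFn x.circuit) l
    have e2 : (10 * n + 8) * PathList.size ((List.ofFn x.circuit).foldl
        (Layer.extendPaths x.damping) l) ≤ (10 * n + 77) * S :=
      Nat.mul_le_mul (by omega) (e1.trans hS)
    have e3 : d * ((10 * n + 77) * l.size + 6) ≤ d * ((10 * n + 77) * S + 6) :=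
      Nat.mul_le_mul_left _ (Nat.add_le_add_right (Nat.mul_le_mul_left _ hS) _)
    rw [add_mul (d : ℕ) 1]
    omega
  · rw [h6, total_foldl_extendPaths, hV, hf5.2 rOut (hwr _ (by decide)), hf4.2 rOut hw'',
      hf3.2 rOut rfl, hf2.2 rOut rfl, hf1.2 rOut rfl]
    simp [Memory.init]

end

end

noncomputable section

/-! ### Observables given by a list of terms -/

@[simp] abbrev vM : ℕ := 29
@[simp] abbrev vN : ℕ := 30

/-- Turn the Pauli string of the term `vM` into a number. -/
def termCodeCmd : Cmd :=
  .seq (.assign vN (.const 0)) <| .seq (.assign vJ (.const 0)) <| .forLoop vJ .numQubits <|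
    .assign vN (.add (.mulConst 4 (.var vN))
      (.termLetter (.var vM) (.sub (.sub .numQubits (.const 1)) (.var vJ))))

/-- List the terms of the observable. -/
def seedTermsCmd : Cmd :=
  .seq (.assign vM (.const 0)) <| .forLoop vM .numTerms <|
    .seq termCodeCmd <| pushCmd (.var vN) (.var vL) (.termCoeff (.var vM))

section

variable {n d : ℕ} {x : Input n d} {s : Memory}

/-- Horner's scheme from the highest qubit downwards: after i rounds the number encodes the top i
letters. -/
theorem runs_termCodeCmd {k : ℕ} (hk : k < x.terms.length) (hM : s.nat vM 0 = k) :
    Runs x termCodeCmd s fun k' s' => k' ≤ 3 * n + 3 ∧ s'.nat vN 0 = (x.terms[k]).1.code := by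
  set R := (x.terms[k]).1 with hR
  simp only [termCodeCmd, runs_seq, runs_assign]
  set s1 := (s.setN vN 0 _).setN vJ 0 _ with hs1
  refine (Runs.forLoop (x := x) (s := s1) 0 n (fun i s' => s'.nat vN 0 =
    ∑ j ∈ Finset.range i, R.letter (n - i + j) * 4 ^ j) (fun _ => 1) (by simp [hs1, NExp.eval])
    rfl ?_ ?_ ?_ ?_).mono ?_
  · simp [hs1, NExp.eval]
  · intro t _
    simp [NExp.eval]
  · intro i t w h
    simpa using h
  · intro i t hi hf hv h
    rw [zero_add] at hv
    rw [runs_assign]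
    refine ⟨le_rfl, ?_⟩
    have hM' : t.nat vM 0 = k := by rw [hf.1 _ rfl, ← hM]; simp [hs1]
    have e : (NExp.termLetter (.var vM) (.sub (.sub .numQubits (.const 1)) (.var vJ))).eval x t =
        R.letter (n - 1 - i) := by
      have h2 : n - 1 - i < n := by omega
      simp only [NExp.eval, NExp.eval_var, hM', hv, PauliString.letter]
      rw [dif_pos ⟨hk, h2⟩, dif_pos h2]
      rfl
    have e2 : (NExp.add (.mulConst 4 (.var vN)) (.termLetter (.var vM)
        (.sub (.sub .numQubits (.const 1)) (.var vJ)))).eval x t =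
        4 * t.nat vN 0 + R.letter (n - 1 - i) := by
      rw [← e]
      simp only [NExp.eval, NExp.eval_mulConst, NExp.eval_var]
    rw [e2, h, Finset.sum_range_succ', Finset.mul_sum]
    simp only [Memory.setN_nat_self, Function.update_self]
    congr 1
    · refine Finset.sum_congr rfl fun j _ => ?_
      rw [show n - (i + 1) + (j + 1) = n - i + j by omega, pow_succ]
      ring
    · rw [show n - (i + 1) + 0 = n - 1 - i by omega]
      simp
  · intro k' s' ⟨hk', _, h⟩
    rw [Finset.sum_const, Finset.card_range, smul_eq_mul] at hk'
    refine ⟨by omega, ?_⟩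
    rw [h, R.code_eq, Nat.sub_self]
    simp

/-- The terms of the observable as a list of paths. -/
def termPaths (terms : List (PauliString n × ℝ)) (ℓ : ℕ) : PathList :=
  terms.map fun p => (p.1.code, p.2, ℓ)

theorem runs_seedTermsCmd {ℓ : ℕ} (hL : s.nat vL 0 = ℓ) (hlo : s.nat vBLo 0 = 0)
    (hhi : s.nat vBHi 0 = 0) :
    Runs x seedTermsCmd s fun k s' => k ≤ x.terms.length * (3 * n + 9) + 2 ∧
      HoldsPaths s' (termPaths x.terms ℓ) := by
  simp only [seedTermsCmd, runs_seq, runs_assign]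
  set s1 := s.setN vM 0 _ with hs1
  refine (Runs.forLoop (x := x) (s := s1) 0 x.terms.length (fun i s' => s'.nat vBHi 0 =
    0 + (termPaths (x.terms.take i) ℓ).length ∧ Seg s'.path 0 (termPaths (x.terms.take i) ℓ))
    (fun _ => 3 * n + 7) (by simp [hs1, NExp.eval]) rfl ?_ ?_ ?_ ?_).imp ?_
  · refine ⟨?_, ?_⟩
    · simpa [hs1, termPaths] using hhi
    · simpa [termPaths] using Seg.nil _ _
  · intro t _
    simp [NExp.eval]
  · intro i t w h
    rw [Memory.path_setN _ _ _ (by decide) (by decide)]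
    simpa using h
  · intro i t hi hf hv ⟨h1, h2⟩
    rw [zero_add] at hv
    rw [runs_seq]
    refine (runs_termCodeCmd hi hv).imp fun k1 t1 ⟨hk1, ht1⟩ hf1 => ?_
    have e1 : termPaths (x.terms.take (i + 1)) ℓ = termPaths (x.terms.take i) ℓ ++
        [((x.terms[i]).1.code, (x.terms[i]).2, ℓ)] := by
      rw [List.take_add_one, List.getElem?_eq_getElem hi, termPaths, termPaths, List.map_append]
      simp
    rw [e1]
    have hM : t1.nat vM 0 = i := by rw [hf1.1 _ rfl, hv]
    have hL1 : t1.nat vL 0 = ℓ := by rw [hf1.1 _ rfl, hf.1 _ rfl, ← hL]; simp [hs1]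
    refine (runs_pushCmd _ (by rw [hf1.1 _ rfl, h1]) ?_ ?_ ?_ ?_).mono
      fun k s' h => ⟨by omega, h.2.1, h.2.2.1⟩
    · rw [Memory.path_congr (hf1.1 _ rfl) (hf1.2 _ rfl) (hf1.1 _ rfl)]
      exact h2
    · simp only [RExp.eval, NExp.eval_var, hM]
      rw [dif_pos hi]
      rfl
    · intro t2 ht2
      rw [NExp.eval_var, ht2, ht1]
    · intro t2 ht2
      rw [NExp.eval_var, ht2 _ (by decide), hL1]
  · intro k s' ⟨hk, _, h1, h2⟩ hf
    rw [Finset.sum_const, Finset.card_range, smul_eq_mul] at hk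
    rw [List.take_length] at h1 h2
    have hlo' : s'.nat vBLo 0 = 0 := by rw [hf.1 _ rfl]; simpa [hs1] using hlo
    refine ⟨by rw [show 3 * n + 9 = 3 * n + 7 + 2 by ring]; omega, ?_, ?_⟩
    · rw [hlo', h1]
    · rwa [hlo']

theorem valid_termPaths (terms : List (PauliString n × ℝ)) (ℓ : ℕ) :
    (termPaths terms ℓ).Valid n := by
  intro e he
  obtain ⟨p, -, rfl⟩ := List.mem_map.1 he
  exact ⟨p.1, rfl⟩

theorem size_termPaths (terms : List (PauliString n × ℝ)) (ℓ : ℕ) :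
    (termPaths terms ℓ).size = terms.length * 16 ^ ℓ := by
  simp [termPaths, PathList.size, Function.comp_def]

/-- Both sides are additive in the list, so a string may occur in several terms. -/
theorem total_termPaths (q : ℝ) (r : PauliString n → ℝ) (ls : List (Layer n))
    {terms : List (PauliString n × ℝ)} {O : Op n}
    (hO : O = (terms.map fun p => (p.2 : ℂ) • p.1.op).sum) (ℓ : ℕ) :
    (termPaths terms ℓ).total q r ls = ∑ Q, (pauliCoeff O Q).re *
      budgetVal q r (ls.map (Layer.data .uniform)) ℓ Q := by
  subst hO
  induction terms with
  | nil => simp [termPaths, PathList.total, pauliCoeff]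
  | cons p terms ih =>
    have h1 : termPaths (p :: terms) ℓ = (p.1.code, p.2, ℓ) :: termPaths terms ℓ := rfl
    have h2 : ∀ Q, (pauliCoeff (((p :: terms).map fun p => (p.2 : ℂ) • p.1.op).sum) Q).re =
        (if p.1 = Q then p.2 else 0) +
          (pauliCoeff ((terms.map fun p => (p.2 : ℂ) • p.1.op).sum) Q).re := by
      intro Q
      have h3 : ∀ A B : Op n, pauliCoeff (A + B) Q = pauliCoeff A Q + pauliCoeff B Q := by
        intro A B
        simp [pauliCoeff, Matrix.mul_add, add_div]
      rw [List.map_cons, List.sum_cons, h3, pauliCoeff_smul, pauliCoeff_op]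
      split_ifs <;> simp
    simp only [h2, add_mul, Finset.sum_add_distrib, ← ih, h1]
    simp [PathList.total]

end

end

noncomputable section

/-! ### Estimates for the parameters of the simulation -/

/-- The noise rate that enters the running time. -/
def rate (γ : ℝ) : ℝ := min γ (1 / 2)

/-- The exponent of the inverse accuracy. -/
def rateExponent (γ : ℝ) : ℝ := Real.log (1 / rate γ) / rate γ ^ 2

section

variable {γ ε : ℝ}

theorem rate_pos (hγ : 0 < γ) : 0 < rate γ := lt_min hγ (by norm_num)

theorem rate_le_half (γ : ℝ) : rate γ ≤ 1 / 2 := min_le_right _ _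

theorem half_le_log (hγ : 0 < γ) : 1 / 2 ≤ Real.log (1 / rate γ) := by
  have h1 : (2 : ℝ) ≤ 1 / rate γ := by
    rw [le_div_iff₀ (rate_pos hγ)]
    linarith [rate_le_half γ]
  have := Real.log_le_log (by norm_num) h1
  linarith [Real.log_two_gt_d9]

/-- Because γ₀ ≤ 1/2 ≤ log(1/γ₀), the quantity log(1/γ₀)/γ₀² dominates 1/γ₀. This is what the
minimum in `rate` is for. -/
theorem one_div_rate_le (hγ : 0 < γ) : 1 / rate γ ≤ rateExponent γ := by
  have h0 := rate_pos hγ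
  rw [rateExponent, div_le_div_iff₀ h0 (by positivity)]
  nlinarith [half_le_log hγ, rate_le_half γ]

theorem rateExponent_pos (hγ : 0 < γ) : 0 < rateExponent γ :=
  (one_div_pos.2 (rate_pos hγ)).trans_le (one_div_rate_le hγ)

theorem log_div_rate (hγ : 0 < γ) :
    Real.log (1 / rate γ) / rate γ = rate γ * rateExponent γ := by
  have := (rate_pos hγ).ne'
  rw [rateExponent]
  field_simp

theorem exists_exponent {q : ℝ} (h1 : q < 1) {a τ : ℝ} (ha : 0 < a) (hτ : 0 < τ) :
    ∃ m : ℕ, a * q ^ m ≤ τ ∧ ∀ i < m, τ < a * q ^ i := by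
  have h : ∃ m : ℕ, a * q ^ m ≤ τ := by
    obtain ⟨m, hm⟩ := exists_pow_lt_of_lt_one (div_pos hτ ha) h1
    refine ⟨m, ?_⟩
    rw [lt_div_iff₀ ha] at hm
    linarith
  classical
  exact ⟨Nat.find h, Nat.find_spec h, fun i hi => not_le.1 (Nat.find_min h hi)⟩

theorem lt_log_of_lt_exp_pow (hε : 0 < ε) {m : ℕ} (h : ε < Real.exp (-γ) ^ m) :
    γ * m < Real.log (1 / ε) := by
  rw [← Real.exp_nat_mul] at h
  have := (Real.log_lt_iff_lt_exp hε).2 h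
  rw [one_div, Real.log_inv]
  linarith

theorem one_sub_exp_ge (hγ : 0 < γ) : rate γ / 2 ≤ 1 - Real.exp (-γ) := by
  have h0 := rate_pos hγ
  have h1 : Real.exp (-γ) ≤ Real.exp (-rate γ) := Real.exp_le_exp.2 (neg_le_neg (min_le_left _ _))
  have h2 : Real.exp (-rate γ) ≤ 1 / (1 + rate γ) := by
    rw [Real.exp_neg, ← one_div]
    exact one_div_le_one_div_of_le (by linarith) (by linarith [Real.add_one_le_exp (rate γ)])
  have h3 : 1 / (1 + rate γ) ≤ 1 - rate γ / 2 := by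
    rw [div_le_iff₀ (by linarith)]
    nlinarith [rate_le_half γ]
  linarith

theorem exponent_le (hγ : 0 < γ) (hε : 0 < ε) (hε1 : ε ≤ 1) {m : ℕ}
    (hm : ∀ i < m, ε < Real.exp (-γ) ^ i) :
    (m : ℝ) ≤ Real.log (1 / ε) * rateExponent γ + 1 := by
  have hl : 0 ≤ Real.log (1 / ε) := Real.log_nonneg ((one_le_div hε).2 hε1)
  cases m with
  | zero =>
    have := mul_nonneg hl (rateExponent_pos hγ).le
    push_cast; linarith
  | succ m =>
    have h1 := lt_log_of_lt_exp_pow hε (hm m (Nat.lt_succ_self m))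
    have h2 : rate γ * m ≤ Real.log (1 / ε) :=
      (mul_le_mul_of_nonneg_right (min_le_left _ _) (Nat.cast_nonneg m)).trans h1.le
    have h3 : (m : ℝ) ≤ Real.log (1 / ε) * (1 / rate γ) := by
      rw [mul_one_div, le_div_iff₀ (rate_pos hγ)]; linarith
    have h4 := mul_le_mul_of_nonneg_left (one_div_rate_le hγ) hl
    push_cast; linarith

theorem depth_le (hε : 0 < ε) {d : ℕ} (h : ε < Real.exp (-γ) ^ (d + 1)) :
    ((d : ℝ) + 1) * rate γ ≤ Real.log (1 / ε) := by
  have h1 := lt_log_of_lt_exp_pow hε h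
  push_cast at h1
  have h2 : rate γ * ((d : ℝ) + 1) ≤ γ * (d + 1) :=
    mul_le_mul_of_nonneg_right (min_le_left _ _) (by positivity)
  linarith

/-- For ℓ > 0, the last failed test gives q^ℓ > ε(1 - q) ≥ εγ₀/2, so γ₀ℓ < log(1/ε) + log(1/γ₀) +
log 2. The term log 2 < 1 is covered by two more copies of log(1/γ₀) ≥ 1/2. -/
theorem budget_le (hγ : 0 < γ) (hε : 0 < ε) (hε1 : ε ≤ 1) {ℓ : ℕ}
    (h : ∀ i < ℓ, ε * (1 - Real.exp (-γ)) < Real.exp (-γ) * Real.exp (-γ) ^ i) :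
    (ℓ : ℝ) * rate γ ≤ Real.log (1 / ε) + 3 * Real.log (1 / rate γ) := by
  have hl : 0 ≤ Real.log (1 / ε) := Real.log_nonneg ((one_le_div hε).2 hε1)
  have hG := half_le_log hγ
  have h0 := rate_pos hγ
  cases ℓ with
  | zero => push_cast; linarith
  | succ m =>
    have h1 := h m (Nat.lt_succ_self m)
    rw [← pow_succ'] at h1
    have h5 := one_sub_exp_ge hγ
    have h2 := lt_log_of_lt_exp_pow (by positivity) ((mul_le_mul_of_nonneg_left h5 hε.le).trans_lt h1)
    have h3 : Real.log (1 / (ε * (rate γ / 2))) =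
        Real.log (1 / ε) + Real.log (1 / rate γ) + Real.log 2 := by
      rw [one_div, one_div, one_div, Real.log_inv, Real.log_inv, Real.log_inv,
        Real.log_mul hε.ne' (by positivity), Real.log_div h0.ne' (by norm_num)]
      ring
    have h4 : rate γ * ((m + 1 : ℕ) : ℝ) ≤ γ * ((m + 1 : ℕ) : ℝ) :=
      mul_le_mul_of_nonneg_right (min_le_left _ _) (by positivity)
    have := Real.log_two_lt_d9
    linarith

/-- Paths are listed only if (d + 1)γ₀ ≤ log(1/ε). Then γ₀ ≤ log(1/ε), so the term log(1/γ₀)/γ₀ of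
the budget is absorbed in log(1/ε)·log(1/γ₀)/γ₀². Without this, ε close to 1 would leave a power of
1/γ₀ that no power of 1/ε controls. -/
theorem budget_le_of_depth (hγ : 0 < γ) {d ℓ : ℕ}
    (hd : ((d : ℝ) + 1) * rate γ ≤ Real.log (1 / ε))
    (hl : (ℓ : ℝ) * rate γ ≤ Real.log (1 / ε) + 3 * Real.log (1 / rate γ)) :
    1 ≤ Real.log (1 / ε) * rateExponent γ ∧
    ((d : ℝ) + 1) ≤ Real.log (1 / ε) * rateExponent γ ∧
    (ℓ : ℝ) ≤ 4 * (Real.log (1 / ε) * rateExponent γ) := by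
  have h0 := rate_pos hγ
  have hd0 : (0 : ℝ) ≤ d := Nat.cast_nonneg d
  have hlam : rate γ ≤ Real.log (1 / ε) := by nlinarith
  have h1 := one_div_rate_le hγ
  have h2 : Real.log (1 / ε) / rate γ ≤ Real.log (1 / ε) * rateExponent γ := by
    rw [div_eq_mul_one_div]
    exact mul_le_mul_of_nonneg_left h1 (h0.le.trans hlam)
  have h3 : (d : ℝ) + 1 ≤ Real.log (1 / ε) / rate γ := by rwa [le_div_iff₀ h0]
  have h4 : Real.log (1 / rate γ) / rate γ ≤ Real.log (1 / ε) * rateExponent γ := by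
    rw [log_div_rate hγ]
    exact mul_le_mul_of_nonneg_right hlam (rateExponent_pos hγ).le
  have h5 : (ℓ : ℝ) ≤ Real.log (1 / ε) / rate γ + 3 * (Real.log (1 / rate γ) / rate γ) := by
    rw [← mul_div_assoc, ← add_div]
    rwa [le_div_iff₀ h0]
  refine ⟨by linarith, by linarith, by linarith⟩

end

theorem sixteen_pow_le_exp {ℓ : ℕ} {y : ℝ} (h : (ℓ : ℝ) ≤ 4 * y) :
    (16 : ℝ) ^ ℓ ≤ Real.exp (12 * y) := by
  have h3 : (16 : ℝ) ≤ Real.exp 3 := by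
    have h := Real.exp_one_gt_d9
    have e : Real.exp 3 = Real.exp 1 ^ 3 := by rw [← Real.exp_nat_mul]; norm_num
    rw [e]
    calc (16 : ℝ) ≤ 2.7 ^ 3 := by norm_num
      _ ≤ _ := pow_le_pow_left₀ (by norm_num) (by linarith) 3
  calc (16 : ℝ) ^ ℓ ≤ Real.exp 3 ^ ℓ := pow_le_pow_left₀ (by norm_num) h3 ℓ
    _ = Real.exp (ℓ * 3) := (Real.exp_nat_mul _ _).symm
    _ ≤ _ := Real.exp_le_exp.2 (by linarith)

/-! ### Correctness of the simulation -/

section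

variable {Ω : Type*} [MeasurableSpace Ω] {n d : ℕ} {μ : Measure Ω} [IsProbabilityMeasure μ]
  {C : Ω → Circuit n d}

/-- A program that halts with the value of `g` simulates the ensemble. -/
theorem simulates_of_runs {N : NoiseModel} {prog : Cmd}
    (hC : Measurable fun ω => (C ω).layers N) {ρ O : Op n} (hρ : IsState ρ) (hO : O.IsHermitian)
    (hdis : HasSpatialDisorder N μ C ∨ HasSpatialDisorderOn N μ C ρ) {γ ε T : ℝ} (hε : 0 ≤ ε)
    {terms : List (PauliString n × ℝ)}
    (g : (Fin d → Op n × (Fin n → Bool)) → (PauliString n → ℝ) → PauliString n → ℝ)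
    (hlin : ∀ c r Q, g c r Q = ∑ R, r R * g c (Pi.single R 1) Q)
    (hmeas : ∀ r Q, Measurable fun c => g c r Q)
    (hcov : ∀ P c r Q, g (conjLayers P c) r Q = P.sign Q * g c (fun R => P.sign R * r R) Q)
    (hbound : ∀ ω r Q, (Real.exp (-γ) ^ Q.weight * exactVal (Real.exp (-γ)) r
      (List.ofFn ((C ω).layers N)) Q - g ((C ω).layers N) r Q) ^ 2 ≤ ε ^ 2 * normSq r)
    (hrun : ∀ ω, Runs (mkInput (C ω) γ ε ρ O terms) prog .init fun k s' => (k : ℝ) ≤ T ∧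
      s'.real rOut 0 = ∑ Q, (pauliCoeff O Q).re *
        g ((C ω).layers N) (fun P => (ρ * P.op).trace.re) Q) :
    Simulates prog N μ C γ ε ρ O terms T := by
  obtain ⟨h1, h2⟩ := eLpNorm_sum_le_of_disorder hC hρ hO hdis hε g hlin hmeas hcov hbound
  refine ⟨_, h1, fun ω => ?_, h2⟩
  obtain ⟨k, s', h3, h4, h5⟩ := hrun ω
  exact ⟨k, h4, s', h3, h5⟩

theorem ofFn_layers (N : NoiseModel) (C : Circuit n d) :
    List.ofFn (C.layers N) = (List.ofFn C).map (Layer.data N) := by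
  rw [List.map_ofFn]; rfl

/-- Two ways to reach the accuracy: budget zero, if the depth damps every other string, or a budget
b whose geometric tail q^(b+1)/(1 - q) is at most ε. -/
theorem simulates_of_budget {prog : Cmd}
    (hC : Measurable fun ω => (C ω).layers .uniform) {ρ O : Op n} (hρ : IsState ρ)
    (hO : O.IsHermitian)
    (hdis : HasSpatialDisorder .uniform μ C ∨ HasSpatialDisorderOn .uniform μ C ρ) {γ ε T : ℝ}
    (hγ : 0 < γ) (hε : 0 < ε) {terms : List (PauliString n × ℝ)} {b : ℕ}
    (hb : b = 0 ∧ Real.exp (-γ) ^ (d + 1) ≤ ε ∨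
      Real.exp (-γ) * Real.exp (-γ) ^ b ≤ ε * (1 - Real.exp (-γ)))
    (hrun : ∀ ω, Runs (mkInput (C ω) γ ε ρ O terms) prog .init fun k s' => (k : ℝ) ≤ T ∧
      s'.real rOut 0 = ∑ Q, (pauliCoeff O Q).re * budgetVal (Real.exp (-γ))
        (fun P => (ρ * P.op).trace.re) ((List.ofFn (C ω)).map (Layer.data .uniform)) b Q) :
    Simulates prog .uniform μ C γ ε ρ O terms T := by
  have hq0 := Real.exp_pos (-γ)
  have hq1 : Real.exp (-γ) < 1 := by rw [Real.exp_lt_one_iff]; linarith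
  refine simulates_of_runs hC hρ hO hdis hε.le
    (fun c r Q => budgetVal (Real.exp (-γ)) r (List.ofFn c) b Q)
    (fun c r Q => budgetVal_eq_sum _ _ _ _ _) (fun r Q => measurable_budgetVal _ _ _ _)
    (fun P c r Q => by rw [ofFn_conjLayers, budgetVal_conj]) ?_
    (fun ω => by simp only [ofFn_layers]; exact hrun ω)
  intro ω r Q
  rw [ofFn_layers]
  rcases hb with ⟨rfl, hb⟩ | hb
  · refine (sq_budget_error_zero_le hq0.le hq1.le r _ Q).trans ?_
    rw [List.length_ofFn]
    exact mul_le_mul_of_nonneg_right (pow_le_pow_left₀ (by positivity) hb 2) (normSq_nonneg r)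
  · refine (sq_budget_error_le hq0.le hq1 r _ b Q).trans ?_
    refine mul_le_mul_of_nonneg_right (pow_le_pow_left₀ ?_ ?_ 2) (normSq_nonneg r)
    · exact div_nonneg (by positivity) (by linarith)
    · rw [div_le_iff₀ (by linarith), pow_succ']
      exact hb

theorem sum_budgetVal_zero (c : PauliString n → ℝ) (q : ℝ) (r : PauliString n → ℝ)
    (ls : List (Layer n)) :
    ∑ Q, c Q * budgetVal q r (ls.map (Layer.data .uniform)) 0 Q = c 0 * r 0 := by
  rw [Finset.sum_eq_single 0, budgetVal_zero]
  · intro Q _ hQ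
    rw [budgetVal_of_lt, mul_zero]
    exact Nat.pos_of_ne_zero fun h => hQ (PauliString.weight_eq_zero.1 h)
  · simp

/-- Running time of the simulation, given the number of paths and the time for the list of the
strings of the observable. -/
theorem simulates_simulateCmd {seed : Cmd}
    (hC : Measurable fun ω => (C ω).layers .uniform) {ρ O : Op n} (hρ : IsState ρ)
    (hO : O.IsHermitian)
    (hdis : HasSpatialDisorder .uniform μ C ∨ HasSpatialDisorderOn .uniform μ C ρ) {γ ε : ℝ}
    (hγ : 0 < γ) (hε : 0 < ε) (hε1 : ε ≤ 1) {terms : List (PauliString n × ℝ)} {A κ : ℝ}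
    (hn : 0 < n) (hA : (n : ℝ) ≤ A) (hκ : 0 ≤ κ)
    (hw : seed.writesNat aPow = false) (hw' : seed.writesReal rPow = false)
    (hw'' : seed.writesReal rOut = false)
    (hseed : ∀ ω (ℓ : ℕ), ((d : ℝ) + 1) * rate γ ≤ Real.log (1 / ε) →
      (ℓ : ℝ) * rate γ ≤ Real.log (1 / ε) + 3 * Real.log (1 / rate γ) → ∃ Ts S : ℕ,
      (Ts : ℝ) ≤ A * Real.exp (κ * (Real.log (1 / ε) * rateExponent γ)) ∧
      (n * S : ℝ) ≤ A * Real.exp (κ * (Real.log (1 / ε) * rateExponent γ)) ∧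
      ∀ s : Memory, HoldsPow n s → HoldsNoise n (Real.exp (-γ)) s → s.nat vL 0 = ℓ →
      (∀ a, a ∉ [4, 18, 27, 28] → s.nat a = fun _ => 0) →
      Runs (mkInput (C ω) γ ε ρ O terms) seed s fun k s' => k ≤ Ts ∧ ∃ l, HoldsPaths s' l ∧
        l.Valid n ∧ l.size ≤ S ∧
        l.total (Real.exp (-γ)) (fun P => (ρ * P.op).trace.re) (List.ofFn (C ω)) =
          ∑ Q, (pauliCoeff O Q).re * budgetVal (Real.exp (-γ))
            (fun P => (ρ * P.op).trace.re) ((List.ofFn (C ω)).map (Layer.data .uniform)) ℓ Q) :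
    Simulates (simulateCmd seed) .uniform μ C γ ε ρ O terms
      (150 * A * (1 / ε) ^ ((κ + 1) * rateExponent γ)) := by
  have hq0 := Real.exp_pos (-γ)
  have hq1 : Real.exp (-γ) < 1 := by rw [Real.exp_lt_one_iff]; linarith
  have hn1 : (1 : ℝ) ≤ n := by exact_mod_cast hn
  have hl0 : 0 ≤ Real.log (1 / ε) := Real.log_nonneg ((one_le_div hε).2 hε1)
  obtain ⟨m, hm, hmlt⟩ := exists_exponent hq1 one_pos hε
  simp only [one_mul] at hm hmlt
  have hmle := exponent_le hγ hε hε1 hmlt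
  set y := Real.log (1 / ε) * rateExponent γ with hy
  have hy0 : 0 ≤ y := mul_nonneg hl0 (rateExponent_pos hγ).le
  have hT : (1 / ε) ^ ((κ + 1) * rateExponent γ) = Real.exp (κ * y) * Real.exp y := by
    rw [Real.rpow_def_of_pos (one_div_pos.2 hε), ← Real.exp_add, hy]
    congr 1; ring
  have hey : y + 1 ≤ Real.exp y := Real.add_one_le_exp y
  have hek : 1 ≤ Real.exp (κ * y) := Real.one_le_exp (mul_nonneg hκ hy0)
  rw [hT]
  by_cases hmd : m ≤ d + 1
  -- The depth alone suffices: the output is the coefficient of the identity, and the time is that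
  -- of the search for m.
  · refine simulates_of_budget (b := 0) hC hρ hO hdis hγ hε (Or.inl ⟨rfl, ?_⟩) fun ω => ?_
    · exact (pow_le_pow_of_le_one hq0.le hq1.le hmd).trans hm
    · refine (runs_simulateCmd_of_le (m := m) hm hmlt hmd).mono fun k s' ⟨hk, h⟩ => ⟨?_, ?_⟩
      · have hk' : (k : ℝ) ≤ 3 * m + 5 := by exact_mod_cast hk
        have h1 : 1 * 1 * Real.exp y ≤ A * Real.exp (κ * y) * Real.exp y := by gcongr <;> linarith
        nlinarith
      · rw [h, sum_budgetVal_zero (fun Q => (pauliCoeff O Q).re)]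
        have : (ρ * (0 : PauliString n).op).trace = 1 := by
          rw [PauliString.op_zero, mul_one, hρ.2]
        rw [this]
        simp [mkInput]
  · have hεd : ε < Real.exp (-γ) ^ (d + 1) := hmlt _ (by omega)
    have hd := depth_le hε hεd
    obtain ⟨ℓ, hℓ, hℓlt⟩ := exists_exponent hq1 hq0 (mul_pos hε (sub_pos.2 hq1))
    have hb := budget_le hγ hε hε1 hℓlt
    refine simulates_of_budget (b := ℓ) hC hρ hO hdis hγ hε (Or.inr hℓ) fun ω => ?_
    obtain ⟨Ts, S, hTs, hS, hrun⟩ := hseed ω ℓ hd hb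
    refine (runs_simulateCmd (x := mkInput (C ω) γ ε ρ O terms) hm hmlt (by omega) hℓ hℓlt hw hw'
      hw'' hrun).mono fun k s' ⟨hk, h⟩ => ⟨?_, h⟩
    obtain ⟨hy1, hdy, hly⟩ := budget_le_of_depth hγ hd hb
    rw [← hy] at hy1 hdy hly
    have hk' : (k : ℝ) ≤ 3 * m + 3 * ℓ + 4 * n + Ts + (d + 1) * ((10 * n + 77) * S + 6) + 20 := by
      exact_mod_cast hk
    set X := A * Real.exp (κ * y) with hX
    have hAX : A ≤ X := le_mul_of_one_le_right (by linarith) hek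
    have hX1 : 1 ≤ X := by linarith
    have h1 : (10 * n + 77) * (S : ℝ) ≤ 87 * X := by nlinarith [(Nat.cast_nonneg S : (0 : ℝ) ≤ S)]
    have h2 : ((d : ℝ) + 1) * ((10 * n + 77) * S + 6) ≤ y * (93 * X) :=
      mul_le_mul hdy (by linarith) (by positivity) hy0
    have h3 : y * X ≤ X * Real.exp y := by rw [mul_comm]; gcongr; linarith
    have h4 : X ≤ X * Real.exp y := le_mul_of_one_le_right (by linarith) (by linarith)
    have h5 : y ≤ X * Real.exp y := by nlinarith
    -- Every term is a multiple of X · exp y, by m ≤ y + 1, ℓ ≤ 4y, and 93 X for each of the d + 1 ≤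
    -- y rounds; the coefficients sum to 136.
    have e : 150 * A * (Real.exp (κ * y) * Real.exp y) = 150 * (X * Real.exp y) := by
      rw [hX]; ring
    rw [e]
    linarith

/-- Uniform noise, the observable is given as a sum of Pauli operators. -/
theorem simulates_terms
    (hC : Measurable fun ω => (C ω).layers .uniform) {ρ O : Op n} (hρ : IsState ρ)
    (hO : O.IsHermitian)
    (hdis : HasSpatialDisorder .uniform μ C ∨ HasSpatialDisorderOn .uniform μ C ρ) {γ ε : ℝ}
    (hγ : 0 < γ) (hε : 0 < ε) (hε1 : ε ≤ 1) {terms : List (PauliString n × ℝ)}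
    (hterms : O = (terms.map fun p => (p.2 : ℂ) • p.1.op).sum) (hn : 0 < n) :
    Simulates (simulateCmd seedTermsCmd) .uniform μ C γ ε ρ O terms
      (150 * (14 * ((n : ℝ) + terms.length) ^ 2) * (1 / ε) ^ ((12 + 1) * rateExponent γ)) := by
  have hn1 : (1 : ℝ) ≤ n := by exact_mod_cast hn
  have hM : (0 : ℝ) ≤ terms.length := Nat.cast_nonneg _
  refine simulates_simulateCmd hC hρ hO hdis hγ hε hε1 hn (by nlinarith) (by norm_num)
    rfl rfl rfl ?_
  intro ω ℓ hd hb
  obtain ⟨hy1, -, hly⟩ := budget_le_of_depth hγ hd hb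
  set y := Real.log (1 / ε) * rateExponent γ with hy
  have h16 := sixteen_pow_le_exp hly
  have h1 : 1 ≤ Real.exp (12 * y) := Real.one_le_exp (by linarith)
  refine ⟨terms.length * (3 * n + 9) + 2, terms.length * 16 ^ ℓ, ?_, ?_, ?_⟩
  · push_cast
    refine le_trans ?_ (le_mul_of_one_le_right (by positivity) h1)
    nlinarith
  · push_cast
    rw [← mul_assoc]
    refine mul_le_mul ?_ h16 (by positivity) (by positivity)
    nlinarith
  · intro s _ _ hL hz
    refine (runs_seedTermsCmd hL (by rw [hz _ (by decide)]) (by rw [hz _ (by decide)])).mono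
      fun k s' ⟨hk, h⟩ => ⟨hk, _, h, valid_termPaths _ _, (size_termPaths _ _).le,
        total_termPaths _ _ _ hterms _⟩

end

end

noncomputable section

/-! ### The lowest letter of a Pauli string -/

section

variable {n : ℕ}

namespace PauliString

theorem exists_lim (R : PauliString n) : ∃ j, j = n ∨ R.letter j ≠ 0 := ⟨n, Or.inl rfl⟩

open Classical in
/-- The position of the lowest letter that is not the identity, or `n`. -/
def lim (R : PauliString n) : ℕ := Nat.find R.exists_lim

/-- Remove the lowest letter. -/
def removeLow (R : PauliString n) : PauliString n := fun j => if (j : ℕ) ≤ R.lim then 0 else R j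

variable {R : PauliString n}

theorem letter_eq_zero {j : Fin n} : R.letter j = 0 ↔ R j = 0 := by
  rw [R.letter_fin, Fin.ext_iff]; rfl

theorem lim_le (R : PauliString n) : R.lim ≤ n := by
  classical
  exact Nat.find_min' _ (Or.inl rfl)

theorem apply_of_lt_lim {j : Fin n} (h : (j : ℕ) < R.lim) : R j = 0 := by
  classical
  have := Nat.find_min R.exists_lim h
  push Not at this
  exact letter_eq_zero.1 this.2

theorem letter_lim_ne_zero (h : R.lim < n) : R.letter R.lim ≠ 0 := by
  classical
  rcases Nat.find_spec R.exists_lim with h1 | h1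
  · exact absurd h1 h.ne
  · exact h1

theorem lim_eq {p : Fin n} (hp : R p ≠ 0) (h : ∀ j < p, R j = 0) : R.lim = p := by
  rcases lt_trichotomy R.lim p with h1 | h1 | h1
  · have h2 : R.lim < n := h1.trans p.2
    exact absurd (h ⟨R.lim, h2⟩ h1) fun h3 => letter_lim_ne_zero h2 (letter_eq_zero (j := ⟨_, h2⟩).2 h3)
  · exact h1
  · exact absurd (apply_of_lt_lim h1) hp

theorem lim_zero : (0 : PauliString n).lim = n := by
  refine le_antisymm (lim_le _) (not_lt.1 fun h => letter_lim_ne_zero h ?_)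
  exact letter_eq_zero (j := ⟨_, h⟩).2 rfl

theorem lim_lt (h : R ≠ 0) : R.lim < n := by
  by_contra h1
  exact h (funext fun j => apply_of_lt_lim (j.2.trans_le (not_lt.1 h1)))

variable {p : Fin n} {a : Fin 4}

/-- A child of R arises by one new letter below the lowest letter of R, and `removeLow` undoes this.
So the strings form a tree rooted at the identity, in which every other string has exactly one
parent. -/
theorem lim_update (hp : (p : ℕ) < R.lim) (ha : a ≠ 0) : lim (Function.update R p a) = p := by
  refine lim_eq (by simpa using ha) fun j hj => ?_
  rw [Function.update_of_ne hj.ne]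
  exact apply_of_lt_lim (lt_trans hj hp)

theorem weight_update (hp : (p : ℕ) < R.lim) (ha : a ≠ 0) : weight (Function.update R p a) = R.weight + 1 := by
  have h : (Finset.univ.filter fun j => Function.update R p a j ≠ 0) =
      insert p (Finset.univ.filter fun j => R j ≠ 0) := by
    ext j
    rcases eq_or_ne j p with rfl | h
    · simp [ha]
    · simp [h]
  rw [weight, weight, h, Finset.card_insert_of_notMem]
  simp [apply_of_lt_lim hp]

theorem code_update (hp : (p : ℕ) < R.lim) : code (Function.update R p a) = R.code + a * 4 ^ (p : ℕ) := by
  rw [code, code, ← Finset.add_sum_erase _ _ (Finset.mem_univ p),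
    ← Finset.add_sum_erase _ _ (Finset.mem_univ p), apply_of_lt_lim hp]
  simp only [Function.update_self, Fin.val_zero, zero_mul, zero_add]
  rw [add_comm]
  congr 1
  refine Finset.sum_congr rfl fun j hj => ?_
  rw [Function.update_of_ne (Finset.ne_of_mem_erase hj)]

theorem removeLow_update (hp : (p : ℕ) < R.lim) (ha : a ≠ 0) : removeLow (Function.update R p a) = R := by
  funext j
  rw [removeLow, lim_update hp ha]
  split_ifs with h
  · exact (apply_of_lt_lim (h.trans_lt hp)).symm
  · rw [Function.update_of_ne]
    rintro rfl
    exact h le_rfl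

theorem update_removeLow (h : R.lim < n) :
    Function.update R.removeLow ⟨R.lim, h⟩ (R ⟨R.lim, h⟩) = R := by
  funext j
  rcases eq_or_ne j ⟨R.lim, h⟩ with rfl | hj
  · simp
  · rw [Function.update_of_ne hj, removeLow]
    split_ifs with h1
    · refine (apply_of_lt_lim (lt_of_le_of_ne h1 fun h2 => hj (Fin.ext h2))).symm
    · rfl

theorem lt_lim_removeLow (h : R.lim < n) : R.lim < R.removeLow.lim := by
  by_contra h1
  have h2 : R.removeLow.lim < n := (not_lt.1 h1).trans_lt h
  refine letter_lim_ne_zero h2 (letter_eq_zero (j := ⟨_, h2⟩).2 ?_)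
  simp [removeLow, not_lt.1 h1]

theorem apply_lim_ne_zero (h : R.lim < n) : R ⟨R.lim, h⟩ ≠ 0 := fun h1 =>
  letter_lim_ne_zero h (letter_eq_zero (j := ⟨_, h⟩).2 h1)

theorem weight_removeLow (h : R.lim < n) : R.removeLow.weight + 1 = R.weight := by
  have := weight_update (lt_lim_removeLow h) (apply_lim_ne_zero h) (p := ⟨R.lim, h⟩)
  rw [update_removeLow] at this
  exact this.symm

end PauliString

end

/-! ### The number of Pauli strings of small weight -/

/-- The sum of `D` to the weight, over the strings on `m` qubits of weight at most `k`. -/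
def stringCount (D : ℕ) : ℕ → ℕ → ℕ
  | 0, _ => 1
  | k + 1, m => 1 + 3 * D * ∑ p ∈ Finset.range m, stringCount D k p

theorem sum_range_choose_succ (m j : ℕ) :
    ∑ p ∈ Finset.range m, p.choose j = m.choose (j + 1) := by
  induction m with
  | zero => simp
  | succ m ih => rw [Finset.sum_range_succ, ih, Nat.choose_succ_succ' m j, add_comm]

/-- There are 3^j · C(m, j) strings of weight j. In the recursion p is the position of the next
lowest letter, and the hockey-stick identity performs the sum over p. -/
theorem stringCount_eq (D k m : ℕ) :
    stringCount D k m = ∑ j ∈ Finset.range (k + 1), (3 * D) ^ j * m.choose j := by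
  induction k generalizing m with
  | zero => simp [stringCount]
  | succ k ih =>
    rw [stringCount, Finset.sum_range_succ']
    simp only [ih, pow_zero, Nat.choose_zero_right, mul_one]
    rw [add_comm, Finset.sum_comm, Finset.mul_sum]
    congr 1
    refine Finset.sum_congr rfl fun j _ => ?_
    rw [← Finset.mul_sum, sum_range_choose_succ, pow_succ]
    ring

/-- Since C(n, j) ≤ n^j / j! and n^j ≤ n^k, the sum is bounded by the exponential series. The
constant is independent of k, so the weight cutoff enters through n^k only. -/
theorem stringCount_le (D k : ℕ) {n : ℕ} (hn : 0 < n) :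
    (stringCount D k n : ℝ) ≤ Real.exp (3 * D) * (n : ℝ) ^ k := by
  have hn1 : (1 : ℝ) ≤ n := by exact_mod_cast hn
  rw [stringCount_eq]
  push_cast
  refine le_trans ?_ (mul_le_mul_of_nonneg_right
    (Real.sum_le_exp_of_nonneg (by positivity) (k + 1)) (by positivity))
  rw [Finset.sum_mul]
  refine Finset.sum_le_sum fun j hj => ?_
  rw [div_mul_eq_mul_div, mul_div_assoc]
  refine mul_le_mul_of_nonneg_left ((Nat.choose_le_pow_div j n).trans ?_) (by positivity)
  have h := pow_le_pow_right₀ hn1 (Nat.lt_succ_iff.1 (Finset.mem_range.1 hj))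
  gcongr

theorem stringCount_pos (D k m : ℕ) : 1 ≤ stringCount D k m := by
  cases k <;> simp [stringCount]

/-! ### Enumeration of the Pauli strings of small weight -/

@[simp] abbrev cPar : ℕ := 31
@[simp] abbrev cLim : ℕ := 32
@[simp] abbrev cLet : ℕ := 33
@[simp] abbrev cCode : ℕ := 34
@[simp] abbrev cRem : ℕ := 35
@[simp] abbrev vHead : ℕ := 36
@[simp] abbrev vTail : ℕ := 37
@[simp] abbrev vCP : ℕ := 38
@[simp] abbrev vCE : ℕ := 39

/-- Append the string `vHead` with the letter `a` added on qubit `vCP`. -/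
def childCmd (a : ℕ) : Cmd :=
  .seq (.setNat cPar (.var vTail) (.var vHead)) <| .seq (.setNat cLim (.var vTail) (.var vCP)) <|
  .seq (.setNat cLet (.var vTail) (.const a)) <|
  .seq (.setNat cCode (.var vTail)
    (.add (.read cCode (.var vHead)) (.mulConst a (.read aPow (.var vCP))))) <|
  .seq (.setNat cRem (.var vTail) (.sub (.read cRem (.var vHead)) (.const 1))) <|
    .assign vTail (.add (.var vTail) (.const 1))

/-- Append the strings that have one letter more than the string `vHead`. -/
def childrenCmd : Cmd :=
  .seq (.ite (.natLt (.const 0) (.read cRem (.var vHead)))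
    (.seq (.assign vCP (.const 0)) <| .seq (.assign vCE (.read cLim (.var vHead))) <|
      .forLoop vCP (.var vCE) <|
      .seq (childCmd 1) (.seq (childCmd 2) (childCmd 3)))
    .skip) <|
  .assign vHead (.add (.var vHead) (.const 1))

/-- List the strings of weight at most `vL`. -/
def enumerateCmd : Cmd :=
  .seq (.setNat cLim (.const 0) .numQubits) <| .seq (.setNat cRem (.const 0) (.var vL)) <|
  .seq (.setNat cCode (.const 0) (.const 0)) <| .seq (.assign vHead (.const 0)) <|
  .seq (.assign vTail (.const 1)) <| .while (.natLt (.var vHead) (.var vTail)) childrenCmd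

/-- The memory contains a tree of Pauli strings, where the parent of a string is obtained by
removing the lowest letter. -/
structure HoldsTree {n : ℕ} (w : ℕ) (s : Memory) (m : ℕ) (S : ℕ → PauliString n) : Prop where
  root : S 0 = 0
  code : ∀ i < m, s.nat cCode i = (S i).code
  rem : ∀ i < m, s.nat cRem i + (S i).weight = w
  lim : ∀ i < m, s.nat cLim i = (S i).lim
  parent_lt : ∀ i, 0 < i → i < m → s.nat cPar i < i
  lim_lt : ∀ i, 0 < i → i < m → (S i).lim < n
  letter : ∀ i, 0 < i → i < m → s.nat cLet i = (S i).letter (S i).lim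
  parent : ∀ i, 0 < i → i < m → S (s.nat cPar i) = (S i).removeLow

section

variable {n d : ℕ} {x : Input n d} {s : Memory}

/-- Rule for a loop with a bound for the time that is left. -/
theorem Runs.whileVariant {b : Test} {c : Cmd} (I : ℕ → Memory → Prop) {v : ℕ} (h0 : I v s)
    (hstep : ∀ v t, Frame c s t → I v t → b.holds x t →
      Runs x c t fun k t' => ∃ v', k + 1 + v' ≤ v ∧ I v' t') :
    Runs x (.while b c) s fun k t => k ≤ v + 1 ∧ ∃ v', I v' t ∧ ¬ b.holds x t := by
  have key : ∀ v t, Frame c s t → I v t → Runs x (.while b c) t fun k t =>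
      k ≤ v + 1 ∧ ∃ v', I v' t ∧ ¬ b.holds x t := by
    intro v
    induction v using Nat.strong_induction_on with
    | _ v ih =>
      intro t hf h
      by_cases hb : b.holds x t
      · obtain ⟨k, t', hx, v', hk, h'⟩ := hstep v t hf h hb
        obtain ⟨k', t'', hx', hk', h''⟩ := ih v' (by omega) t' (hf.trans hx.frame) h'
        exact ⟨_, _, Exec.whileTrue hb hx hx', by omega, h''⟩
      · exact ⟨1, t, Exec.whileFalse hb, by omega, v, h, hb⟩
  exact key v s (Frame.refl _ _) h0

theorem HoldsTree.append {w m i : ℕ} {S : ℕ → PauliString n} {p : Fin n} {a : Fin 4}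
    {s' : Memory} (h : HoldsTree w s m S) (hi : i < m) (hlim : (p : ℕ) < (S i).lim)
    (hw : (S i).weight < w) (ha : a ≠ 0)
    (h1 : s'.nat cPar = Function.update (s.nat cPar) m i)
    (h2 : s'.nat cLim = Function.update (s.nat cLim) m p)
    (h3 : s'.nat cLet = Function.update (s.nat cLet) m a)
    (h4 : s'.nat cCode = Function.update (s.nat cCode) m ((S i).code + a * 4 ^ (p : ℕ)))
    (h5 : s'.nat cRem = Function.update (s.nat cRem) m (s.nat cRem i - 1)) :
    HoldsTree w s' (m + 1) (Function.update S m (Function.update (S i) p a)) := by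
  have hl := PauliString.lim_update hlim ha
  have hm : 0 < m := by omega
  constructor
  · rw [Function.update_of_ne hm.ne, h.root]
  · intro j hj
    rw [h4]
    rcases eq_or_ne j m with rfl | hne
    · simp only [Function.update_self, PauliString.code_update hlim]
    · rw [Function.update_of_ne hne, Function.update_of_ne hne, h.code j (by omega)]
  · intro j hj
    rw [h5]
    rcases eq_or_ne j m with rfl | hne
    · simp only [Function.update_self, PauliString.weight_update hlim ha]
      have := h.rem i hi
      omega
    · rw [Function.update_of_ne hne, Function.update_of_ne hne, h.rem j (by omega)]
  · intro j hj
    rw [h2]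
    rcases eq_or_ne j m with rfl | hne
    · simp only [Function.update_self, hl]
    · rw [Function.update_of_ne hne, Function.update_of_ne hne, h.lim j (by omega)]
  · intro j hj0 hj
    rw [h1]
    rcases eq_or_ne j m with rfl | hne
    · simpa only [Function.update_self] using hi
    · rw [Function.update_of_ne hne]
      exact h.parent_lt j hj0 (by omega)
  · intro j hj0 hj
    rcases eq_or_ne j m with rfl | hne
    · simp only [Function.update_self, hl, p.2]
    · rw [Function.update_of_ne hne]
      exact h.lim_lt j hj0 (by omega)
  · intro j hj0 hj
    rw [h3]
    rcases eq_or_ne j m with rfl | hne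
    · simp only [Function.update_self, hl, PauliString.letter_fin]
    · rw [Function.update_of_ne hne, Function.update_of_ne hne, h.letter j hj0 (by omega)]
  · intro j hj0 hj
    rw [h1]
    rcases eq_or_ne j m with rfl | hne
    · simp only [Function.update_self, PauliString.removeLow_update hlim ha]
      rw [Function.update_of_ne hi.ne]
    · have := h.parent_lt j hj0 (by omega)
      rw [Function.update_of_ne hne, Function.update_of_ne hne,
        Function.update_of_ne (by omega), h.parent j hj0 (by omega)]

theorem runs_childCmd {w m i : ℕ} {S : ℕ → PauliString n} {p : Fin n} {a : Fin 4}
    (hpow : HoldsPow n s) (h : HoldsTree w s m S) (hi : i < m) (hhead : s.nat vHead 0 = i)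
    (htail : s.nat vTail 0 = m) (hp : s.nat vCP 0 = p) (hlim : (p : ℕ) < (S i).lim)
    (hw : (S i).weight < w) (ha : a ≠ 0) :
    Runs x (childCmd a) s fun k s' => k = 6 ∧ s'.nat vTail 0 = m + 1 ∧
      HoldsTree w s' (m + 1) (Function.update S m (Function.update (S i) p a)) := by
  have hhead' : s.nat 36 0 = i := hhead
  have htail' : s.nat 37 0 = m := htail
  have hp' : s.nat 38 0 = p := hp
  have hc : s.nat 34 i = (S i).code := h.code i hi
  have hP : s.nat 4 p = 4 ^ (p : ℕ) := hpow p p.2.le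
  have hne : i ≠ m := hi.ne
  simp only [childCmd, runs_seq, runs_setNat, runs_assign]
  refine ⟨trivial, ?_, h.append hi hlim hw ha ?_ ?_ ?_ ?_ ?_⟩ <;>
    simp [NExp.eval, hhead', htail', hp', hc, hP]

/-- The strings in cells `lo, …, hi - 1` and all their descendants, counted with weights. -/
def descendants (D w : ℕ) (S : ℕ → PauliString n) (lo hi : ℕ) : ℕ :=
  ∑ i ∈ Finset.Ico lo hi, D ^ (S i).weight * stringCount D (w - (S i).weight) (S i).lim

theorem descendants_congr {D w lo hi : ℕ} {S S' : ℕ → PauliString n}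
    (h : ∀ i, lo ≤ i → i < hi → S' i = S i) : descendants D w S' lo hi = descendants D w S lo hi := by
  refine Finset.sum_congr rfl fun i hi => ?_
  rw [Finset.mem_Ico] at hi
  rw [h i hi.1 hi.2]

theorem descendants_succ (D w lo : ℕ) {hi : ℕ} (h : lo ≤ hi) (S : ℕ → PauliString n) :
    descendants D w S lo (hi + 1) = descendants D w S lo hi +
      D ^ (S hi).weight * stringCount D (w - (S hi).weight) (S hi).lim :=
  Finset.sum_Ico_succ_top h _

theorem childCmd_writesNat (a b : ℕ) (hb : b ∉ [31, 32, 33, 34, 35, 37]) :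
    (childCmd a).writesNat b = false := by
  simp only [List.mem_cons, List.not_mem_nil, not_or] at hb
  simp [childCmd, Cmd.assign, Cmd.writesNat, hb]

/-- What holds after the children of the string `i` on the qubits below `j` have been added to
the `m` strings of `S₀`. -/
structure ChildInv (w m i : ℕ) (S₀ : ℕ → PauliString n) (j : ℕ) (s : Memory)
    (S : ℕ → PauliString n) : Prop where
  tail : s.nat vTail 0 = m + 3 * j
  tree : HoldsTree w s (m + 3 * j) S
  old : ∀ k < m, S k = S₀ k
  mem : ∀ p : Fin n, (p : ℕ) < j → ∀ a : Fin 4, a ≠ 0 →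
    ∃ k < m + 3 * j, S k = Function.update (S₀ i) p a
  count : ∀ D, descendants D w S m (m + 3 * j) = ∑ p ∈ Finset.range j,
    3 * D ^ ((S₀ i).weight + 1) * stringCount D (w - ((S₀ i).weight + 1)) p

theorem runs_childBody {w m i : ℕ} {S₀ S : ℕ → PauliString n} {p : Fin n}
    (hpow : HoldsPow n s) (h : ChildInv w m i S₀ p s S) (hi : i < m) (hhead : s.nat vHead 0 = i)
    (hp : s.nat vCP 0 = p) (hlim : (p : ℕ) < (S₀ i).lim) (hw : (S₀ i).weight < w) :
    Runs x (.seq (childCmd 1) (.seq (childCmd 2) (childCmd 3))) s fun k s' => k ≤ 18 ∧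
      ∃ S, ChildInv w m i S₀ (p + 1) s' S := by
  set T : Fin 4 → PauliString n := fun a => Function.update (S₀ i) p a with hT
  simp only [runs_seq]
  have hSi : S i = S₀ i := h.old i hi
  set M := m + 3 * (p : ℕ) with hM
  have hframe : ∀ (a : ℕ) {s s' : Memory}, Frame (childCmd a) s s' → HoldsPow n s →
      HoldsPow n s' ∧ s'.nat vHead = s.nat vHead ∧ s'.nat vCP = s.nat vCP := by
    intro a s s' hf hs
    have hw := fun b hb => hf.1 b (childCmd_writesNat a b hb)
    refine ⟨?_, hw _ (by decide), hw _ (by decide)⟩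
    rw [HoldsPow, hw aPow (by decide)]
    exact hs
  refine (runs_childCmd (p := p) (a := 1) hpow h.tree (i := i) (by omega) hhead h.tail hp
    (by rwa [hSi]) (by rwa [hSi]) (by decide)).imp fun k1 s1 ⟨hk1, ht1, h1⟩ hf1 => ?_
  obtain ⟨g1, g2, g3⟩ := hframe _ hf1 hpow
  rw [hSi] at h1
  set S1 := Function.update S M (T 1) with hS1
  have hS1i : S1 i = S₀ i := by rw [hS1, Function.update_of_ne (by omega), hSi]
  refine (runs_childCmd (p := p) (a := 2) g1 h1 (i := i) (by omega) (by rw [g2, hhead]) ht1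
    (by rw [g3, hp]) (by rwa [hS1i]) (by rwa [hS1i]) (by decide)).imp
    fun k2 s2 ⟨hk2, ht2, h2⟩ hf2 => ?_
  obtain ⟨g1', g2', g3'⟩ := hframe _ hf2 g1
  rw [hS1i] at h2
  set S2 := Function.update S1 (M + 1) (T 2) with hS2
  have hS2i : S2 i = S₀ i := by rw [hS2, Function.update_of_ne (by omega), hS1i]
  refine (runs_childCmd (p := p) (a := 3) g1' h2 (i := i) (by omega) (by rw [g2', g2, hhead]) ht2
    (by rw [g3', g3, hp]) (by rwa [hS2i]) (by rwa [hS2i]) (by decide)).imp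
    fun k3 s3 ⟨hk3, ht3, h3⟩ hf3 => ⟨by omega, ?_⟩
  rw [hS2i] at h3
  set S3 := Function.update S2 (M + 1 + 1) (T 3) with hS3
  have hold : ∀ k < M, S3 k = S k := by
    intro k hk
    rw [hS3, Function.update_of_ne (by omega), hS2, Function.update_of_ne (by omega), hS1,
      Function.update_of_ne (by omega)]
  have e3 : S3 (M + 1 + 1) = T 3 := Function.update_self ..
  have e2 : S3 (M + 1) = T 2 := by
    rw [hS3, Function.update_of_ne (by omega), hS2, Function.update_self]
  have e1 : S3 M = T 1 := by
    rw [hS3, Function.update_of_ne (by omega), hS2, Function.update_of_ne (by omega), hS1,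
      Function.update_self]
  have eM : m + 3 * ((p : ℕ) + 1) = M + 1 + 1 + 1 := by omega
  refine ⟨S3, by rw [eM]; exact ht3, by rw [eM]; exact h3, fun k hk => ?_, ?_, fun D => ?_⟩
  · rw [hold k (by omega), h.old k hk]
  · intro p' hp' a ha
    rw [eM]
    rcases Nat.lt_succ_iff_lt_or_eq.1 hp' with h4 | h4
    · obtain ⟨k, hk, hk'⟩ := h.mem p' h4 a ha
      exact ⟨k, by omega, by rw [hold k hk, hk']⟩
    · obtain rfl : p' = p := Fin.ext h4
      have h5 : a = 1 ∨ a = 2 ∨ a = 3 := by omega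
      rcases h5 with rfl | rfl | rfl
      · exact ⟨M, by omega, e1⟩
      · exact ⟨M + 1, by omega, e2⟩
      · exact ⟨M + 1 + 1, by omega, e3⟩
  · have hterm : ∀ a : Fin 4, a ≠ 0 → D ^ PauliString.weight (T a) *
          stringCount D (w - PauliString.weight (T a)) (PauliString.lim (T a)) =
        D ^ ((S₀ i).weight + 1) * stringCount D (w - ((S₀ i).weight + 1)) p := by
      intro a ha
      rw [hT, PauliString.weight_update hlim ha, PauliString.lim_update hlim ha]
    rw [eM, descendants_succ _ _ _ (by omega), descendants_succ _ _ _ (by omega),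
      descendants_succ _ _ _ (by omega), e1, e2, e3, hterm 1 (by decide), hterm 2 (by decide),
      hterm 3 (by decide), Finset.sum_range_succ, ← h.count D,
      descendants_congr (S := S) fun k _ hk => hold k hk]
    ring

theorem HoldsTree.setN {w m : ℕ} {S : ℕ → PauliString n} (ht : HoldsTree w s m S) {a i v : ℕ}
    (ha : a ∉ [31, 32, 33, 34, 35]) : HoldsTree w (s.setN a i v) m S := by
  simp only [List.mem_cons, List.not_mem_nil, not_or] at ha
  obtain ⟨h1, h2, h3, h4, h5, -⟩ := ha
  constructor
  · exact ht.root
  · rw [Memory.setN_nat_of_ne _ _ _ (Ne.symm h4)]; exact ht.code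
  · rw [Memory.setN_nat_of_ne _ _ _ (Ne.symm h5)]; exact ht.rem
  · rw [Memory.setN_nat_of_ne _ _ _ (Ne.symm h2)]; exact ht.lim
  · rw [Memory.setN_nat_of_ne _ _ _ (Ne.symm h1)]; exact ht.parent_lt
  · exact ht.lim_lt
  · rw [Memory.setN_nat_of_ne _ _ _ (Ne.symm h3)]; exact ht.letter
  · rw [Memory.setN_nat_of_ne _ _ _ (Ne.symm h1)]; exact ht.parent

theorem ChildInv.setN {w m i : ℕ} {S₀ S : ℕ → PauliString n} {j : ℕ} (h : ChildInv w m i S₀ j s S)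
    {a l v : ℕ} (ha : a ∉ [31, 32, 33, 34, 35, 37]) : ChildInv w m i S₀ j (s.setN a l v) S := by
  simp only [List.mem_cons, List.not_mem_nil, not_or] at ha
  exact ⟨by rw [Memory.setN_nat_of_ne _ _ _ (Ne.symm ha.2.2.2.2.2.1)]; exact h.tail,
    h.tree.setN (by simp [ha]), h.old, h.mem, h.count⟩

/-- What holds while the strings are being listed: `h` of the `m` strings have been dealt with. -/
structure EnumInv (w h m : ℕ) (s : Memory) (S : ℕ → PauliString n) : Prop where
  head : s.nat vHead 0 = h
  tail : s.nat vTail 0 = m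
  le : h ≤ m
  tree : HoldsTree w s m S
  mem : ∀ i < h, (S i).weight < w → ∀ p : Fin n, (p : ℕ) < (S i).lim → ∀ a : Fin 4, a ≠ 0 →
    ∃ k < m, S k = Function.update (S i) p a
  count : ∀ D, ∑ i ∈ Finset.range h, D ^ (S i).weight + descendants D w S h m = stringCount D w n

/-- The conserved count at D = 1: a finished string counts once, and a waiting string is at least
one of its own descendants. -/
theorem EnumInv.le_stringCount {w h m : ℕ} {S : ℕ → PauliString n} (hI : EnumInv w h m s S) :
    m ≤ stringCount 1 w n := by
  have h1 := hI.count 1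
  have h2 : m - h ≤ descendants 1 w S h m := by
    have : ∑ i ∈ Finset.Ico h m, 1 ≤ descendants 1 w S h m := by
      refine Finset.sum_le_sum fun i _ => ?_
      rw [one_pow, one_mul]
      exact stringCount_pos _ _ _
    simpa using this
  have h3 : ∑ i ∈ Finset.range h, 1 ^ (S i).weight = h := by simp
  rw [h3] at h1
  have := hI.le
  omega

/-- Handling a string leaves the count unchanged for every D, by the recursion of `stringCount`: the
string itself, plus three letters on each qubit below its lowest letter. At full weight there are no
children, and `stringCount` is 1. -/
theorem runs_childrenCmd {w h m : ℕ} {S : ℕ → PauliString n} (hpow : HoldsPow n s)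
    (hI : EnumInv w h m s S) (hm : h < m) :
    Runs x childrenCmd s fun k s' => ∃ (m' : ℕ) (S' : ℕ → PauliString n),
      k ≤ 7 * (m' - m) + 5 ∧ m ≤ m' ∧
      EnumInv w (h + 1) m' s' S' := by
  have hrem : (NExp.read cRem (.var vHead)).eval x s + (S h).weight = w := by
    rw [NExp.eval, NExp.eval_var, hI.head]
    exact hI.tree.rem h hm
  have hlim : s.nat cLim (s.nat vHead 0) = (S h).lim := by
    rw [hI.head]; exact hI.tree.lim h hm
  have hcount : ∀ D, D ^ (S h).weight * stringCount D (w - (S h).weight) (S h).lim +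
      descendants D w S (h + 1) m = descendants D w S h m := fun D => by
    rw [descendants, descendants, Finset.sum_eq_sum_Ico_succ_bot hm]
  simp only [childrenCmd, runs_seq, runs_assign]
  by_cases hw : (S h).weight < w
  · rw [runs_ite_of_pos (by simp only [Test.holds, NExp.eval] at hrem ⊢; omega)]
    simp only [runs_seq, runs_assign]
    set body : Cmd := .seq (childCmd 1) (.seq (childCmd 2) (childCmd 3)) with hbody
    have hwb : ∀ a, a ∉ [31, 32, 33, 34, 35, 37] → body.writesNat a = false := by
      intro a ha
      simp [hbody, Cmd.writesNat, childCmd_writesNat _ a ha]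
    have hloop : ∀ a, a ∉ [31, 32, 33, 34, 35, 37, 38] →
        (Cmd.forLoop vCP (.var vCE) body).writesNat a = false := by
      intro a ha
      simp only [List.mem_cons, List.not_mem_nil, not_or] at ha
      simp [Cmd.forLoop, Cmd.writesNat, hwb, ha]
    set s1 := (s.setN vCP 0 _).setN vCE 0 _ with hs1
    have hCE : s1.nat vCE 0 = (S h).lim := by
      rw [← hlim]; simp [hs1, NExp.eval]
    have := Runs.forLoop (x := x) (v := vCP) (e := .var vCE) (c := body) (s := s1)
      0 (S h).lim (fun j t => ∃ S', ChildInv w m h S j t S')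
      (fun _ => 18) (by simp [hs1, NExp.eval]) (hwb _ (by decide)) ?_ ?_ ?_ ?_
    · refine this.imp fun k t ⟨hk, _, S', hS'⟩ hf => ?_
      rw [Finset.sum_const, Finset.card_range, smul_eq_mul] at hk
      have hold := hS'.old
      refine ⟨m + 3 * (S h).lim, S', by omega, by omega, ?_⟩
      have hh : t.nat vHead 0 = h := by
        rw [hf.1 vHead (hloop _ (by decide)), ← hI.head]; simp [hs1]
      refine ⟨by simp only [vHead] at hh; simp [NExp.eval, hh], by simpa using hS'.tail, by omega,
        hS'.tree.setN (by decide), ?_, fun D => ?_⟩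
      · intro i hi hiw p hp a ha
        rcases Nat.lt_succ_iff_lt_or_eq.1 hi with h1 | rfl
        · rw [hold i (by omega)] at hiw hp ⊢
          obtain ⟨k, hk, hk'⟩ := hI.mem i h1 hiw p hp a ha
          exact ⟨k, by omega, by rw [hold k hk, hk']⟩
        · rw [hold i hm] at hiw hp ⊢
          exact hS'.mem p hp a ha
      · have e1 : ∑ i ∈ Finset.range (h + 1), D ^ (S' i).weight =
            ∑ i ∈ Finset.range h, D ^ (S i).weight + D ^ (S h).weight := by
          rw [Finset.sum_range_succ, hold h hm]
          congr 1
          refine Finset.sum_congr rfl fun i hi => ?_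
          rw [hold i (by have := Finset.mem_range.1 hi; omega)]
        have e2 : descendants D w S' (h + 1) (m + 3 * (S h).lim) =
            descendants D w S (h + 1) m + descendants D w S' m (m + 3 * (S h).lim) := by
          rw [← descendants_congr (S := S) (S' := S') fun k _ hk => hold k hk]
          exact (Finset.sum_Ico_consecutive _ (by omega) (by omega)).symm
        have e3 : stringCount D (w - (S h).weight) (S h).lim = 1 + 3 * D *
            ∑ p ∈ Finset.range (S h).lim, stringCount D (w - ((S h).weight + 1)) p := by
          rw [show w - (S h).weight = w - ((S h).weight + 1) + 1 by omega, stringCount]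
        rw [e1, e2, hS'.count D, ← hI.count D, ← hcount D, e3, mul_add, mul_one, ← Finset.mul_sum,
          pow_succ]
        ring
    · refine ⟨S, ChildInv.setN (ChildInv.setN ⟨by simpa using hI.tail, by simpa using hI.tree,
        fun _ _ => rfl, fun p hp => absurd hp (by omega), fun D => by simp [descendants]⟩
          (by decide)) (by decide)⟩
    · intro t hf
      rw [NExp.eval_var, hf.1 vCE (hloop _ (by decide)), hCE, zero_add]
    · intro i t v ⟨S', h1⟩
      exact ⟨S', h1.setN (by decide)⟩
    · intro i t hi hf hv ⟨S', h1⟩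
      rw [zero_add] at hv
      have hpow' : HoldsPow n t := by
        intro j hj
        rw [hf.1 aPow (hloop _ (by decide))]
        simpa [hs1] using hpow j hj
      have hh : t.nat vHead 0 = h := by
        rw [hf.1 vHead (hloop _ (by decide)), ← hI.head]; simp [hs1]
      have hin : i < n := hi.trans_le (S h).lim_le
      exact runs_childBody (p := ⟨i, hin⟩) hpow' h1 hm hh hv hi hw
  · rw [runs_ite_of_neg (by simp only [Test.holds, NExp.eval] at hrem ⊢; omega), runs_skip]
    refine ⟨m, S, by omega, le_rfl, ?_⟩
    have hw0 : w - (S h).weight = 0 := by omega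
    have hh := hI.head
    refine ⟨by simp only [vHead] at hh; simp [NExp.eval, hh], by simpa using hI.tail, by omega, ?_,
      ?_, fun D => ?_⟩
    · exact hI.tree.setN (by decide)
    · intro i hi hiw p hp a ha
      rcases Nat.lt_succ_iff_lt_or_eq.1 hi with h1 | rfl
      · exact hI.mem i h1 hiw p hp a ha
      · exact absurd hiw hw
    · rw [← hI.count D, ← hcount D, Finset.sum_range_succ, hw0, stringCount]
      ring

theorem childrenCmd_writesNat (a : ℕ) (ha : a ∉ [31, 32, 33, 34, 35, 36, 37, 38, 39]) :
    childrenCmd.writesNat a = false := by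
  simp only [List.mem_cons, List.not_mem_nil, not_or] at ha
  simp [childrenCmd, Cmd.forLoop, Cmd.assign, Cmd.writesNat, childCmd_writesNat, ha]

theorem enumerateCmd_writesNat (a : ℕ) (ha : a ∉ [31, 32, 33, 34, 35, 36, 37, 38, 39]) :
    enumerateCmd.writesNat a = false := by
  have h := childrenCmd_writesNat a ha
  simp only [List.mem_cons, List.not_mem_nil, not_or] at ha
  simp [enumerateCmd, Cmd.assign, Cmd.writesNat, h, ha]

theorem enumerateCmd_writesReal (a : ℕ) : enumerateCmd.writesReal a = false := rfl

/-- The memory contains all strings of weight at most `w`. -/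
structure Enumerates {n : ℕ} (w m : ℕ) (s : Memory) (S : ℕ → PauliString n) : Prop where
  tail : s.nat vTail 0 = m
  tree : HoldsTree w s m S
  mem : ∀ Q : PauliString n, Q.weight ≤ w → ∃ i < m, S i = Q
  count : ∀ D, ∑ i ∈ Finset.range m, D ^ (S i).weight = stringCount D w n

/-- Induction on the weight: `Q.removeLow` is in the list, and when the queue is exhausted all its
children are, Q among them. The count follows because the waiting part is empty. -/
theorem EnumInv.enumerates {w m : ℕ} {S : ℕ → PauliString n} (hI : EnumInv w m m s S)
    (hm : 0 < m) : Enumerates w m s S := by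
  refine ⟨hI.tail, hI.tree, ?_, fun D => ?_⟩
  · have key : ∀ k (Q : PauliString n), Q.weight = k → k ≤ w → ∃ i < m, S i = Q := by
      intro k
      induction k with
      | zero =>
        intro Q hQ _
        exact ⟨0, hm, by rw [hI.tree.root, PauliString.weight_eq_zero.1 hQ]⟩
      | succ k ih =>
        intro Q hQ hk
        have hQ0 : Q ≠ 0 := fun h => by
          rw [PauliString.weight_eq_zero.2 h] at hQ; omega
        have hl := PauliString.lim_lt hQ0
        have hw := PauliString.weight_removeLow hl
        obtain ⟨i, hi, hS⟩ := ih Q.removeLow (by omega) (by omega)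
        obtain ⟨j, hj, hj'⟩ := hI.mem i hi (by rw [hS]; omega) ⟨Q.lim, hl⟩
          (by rw [hS]; exact PauliString.lt_lim_removeLow hl) _ (PauliString.apply_lim_ne_zero hl)
        exact ⟨j, hj, by rw [hj', hS, PauliString.update_removeLow]⟩
    exact fun Q hQ => key _ Q rfl hQ
  · rw [← hI.count D]
    simp [descendants]

/-- The potential 6(T - head) + 7(T - tail), where T bounds the number of strings, pays 6 steps for
each handled string (with the test of the loop) and 7 for each new one. -/
theorem runs_enumerateCmd {w : ℕ} (hpow : HoldsPow n s) (hL : s.nat vL 0 = w) :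
    Runs x enumerateCmd s fun k s' => k ≤ 13 * stringCount 1 w n + 6 ∧
      ∃ (m : ℕ) (S : ℕ → PauliString n), m ≤ stringCount 1 w n ∧ Enumerates w m s' S := by
  simp only [enumerateCmd, runs_seq, runs_setNat, runs_assign, NExp.eval]
  set s1 := ((((s.setN cLim 0 _).setN cRem 0 _).setN cCode 0 _).setN vHead 0 _).setN vTail 0 _
    with hs1
  set T := stringCount 1 w n with hT
  have h0 : EnumInv w 0 1 s1 (fun _ => (0 : PauliString n)) := by
    have hz : PauliString.weight (0 : PauliString n) = 0 := PauliString.weight_eq_zero.2 rfl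
    have hL' : s.nat 28 0 = w := hL
    refine ⟨by simp [hs1], by simp [hs1], by omega, ?_, by simp, ?_⟩
    · constructor
      · rfl
      · intro i hi
        obtain rfl : i = 0 := by omega
        simp [hs1, PauliString.code]
      · intro i hi
        obtain rfl : i = 0 := by omega
        simp [hs1, hz, hL']
      · intro i hi
        obtain rfl : i = 0 := by omega
        simp [hs1, PauliString.lim_zero]
      all_goals intro i hi hi'; omega
    · intro D
      simp [descendants, hz, PauliString.lim_zero]
  have hone : ∀ {h m : ℕ} {t : Memory} {S : ℕ → PauliString n}, EnumInv w h m t S → m ≤ T :=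
    fun h => h.le_stringCount
  refine (Runs.whileVariant (x := x) (s := s1) (b := .natLt (.var vHead) (.var vTail))
    (c := childrenCmd) (v := 13 * T) (fun v t => ∃ (h m : ℕ) (S : ℕ → PauliString n),
      0 < m ∧ EnumInv w h m t S ∧ 6 * (T - h) + 7 * (T - m) ≤ v) ?_ ?_).mono ?_
  · exact ⟨0, 1, _, by omega, h0, by omega⟩
  · intro v t hf ⟨h, m, S, hm0, hI, hv⟩ hb
    have hm : h < m := by
      rw [Test.holds, NExp.eval_var, NExp.eval_var, hI.head, hI.tail] at hb
      exact hb
    have hpow' : HoldsPow n t := by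
      intro j hj
      rw [hf.1 aPow (by simp [childrenCmd_writesNat])]
      simpa [hs1] using hpow j hj
    refine (runs_childrenCmd hpow' hI hm).mono fun k t' ⟨m', S', hk, hmm, hI'⟩ => ?_
    have h1 := hone hI
    have h2 := hone hI'
    exact ⟨6 * (T - (h + 1)) + 7 * (T - m'), by omega, h + 1, m', S', by omega, hI', le_rfl⟩
  · intro k t ⟨hk, v, ⟨h, m, S, hm0, hI, _⟩, hb⟩
    have hm : ¬ h < m := by
      rw [Test.holds, NExp.eval_var, NExp.eval_var, hI.head, hI.tail] at hb
      exact hb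
    obtain rfl : h = m := by have := hI.le; omega
    exact ⟨by omega, h, S, hone hI, hI.enumerates hm0⟩

end

end

noncomputable section

/-! ### Loops over the strings of small weight -/

@[simp] abbrev vTE : ℕ := 40
@[simp] abbrev vTI : ℕ := 41

/-- Make the string number `vTE` the present string, provided that no letter is present. -/
def treeLoadCmd : Cmd :=
  .seq (.assign vSup (.const 0)) <| .while (.natLt (.const 0) (.var vTE)) <|
    .seq (.setNat aSup (.var vSup) (.read cLim (.var vTE))) <|
    .seq (.assign vSup (.add (.var vSup) (.const 1))) <|
    .seq (.setNat aStr (.read cLim (.var vTE)) (.read cLet (.var vTE))) <|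
    .assign vTE (.read cPar (.var vTE))

/-- Remove all letters of the present string. -/
def unloadCmd : Cmd :=
  .seq (.assign vU (.const 0)) <| .forLoop vU (.var vSup) <|
    .setNat aStr (.read aSup (.var vU)) (.const 0)

/-- Run `c` for each of the strings. -/
def forTreeCmd (c : Cmd) : Cmd :=
  .seq (.assign vTI (.const 0)) <| .forLoop vTI (.var vTail) <|
    .seq (.assign vTE (.var vTI)) <| .seq treeLoadCmd <| .seq c unloadCmd

section

variable {n d : ℕ} {x : Input n d} {s : Memory}

/-- What has been read off, when the letters of the string `W` are still missing. -/
structure TreeLoadInv (R W : PauliString n) (sup : List (Fin n)) (s : Memory) : Prop where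
  card : s.nat vSup 0 = sup.length
  seg : Seg (s.nat aSup) 0 (sup.map fun j : Fin n => (j : ℕ))
  nodup : sup.Nodup
  mem : ∀ q, q ∈ sup ↔ R q ≠ 0 ∧ (q : ℕ) < W.lim
  rest : ∀ q : Fin n, W.lim ≤ q → W q = R q
  str : ∀ q : Fin n, s.nat aStr q = if (q : ℕ) < W.lim then (R q : ℕ) else 0
  zero : ∀ c, n ≤ c → s.nat aStr c = 0

theorem TreeLoadInv.step {R W : PauliString n} {sup : List (Fin n)} (h : TreeLoadInv R W sup s)
    (hW : W.lim < n) {s' : Memory} (h1 : s'.nat vSup 0 = sup.length + 1)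
    (h2 : s'.nat aSup = Function.update (s.nat aSup) sup.length W.lim)
    (h3 : s'.nat aStr = Function.update (s.nat aStr) W.lim (W.letter W.lim)) :
    TreeLoadInv R W.removeLow (sup ++ [⟨W.lim, hW⟩]) s' := by
  have hlt := PauliString.lt_lim_removeLow hW
  have hRW : R ⟨W.lim, hW⟩ = W ⟨W.lim, hW⟩ := (h.rest ⟨W.lim, hW⟩ le_rfl).symm
  have hne : R ⟨W.lim, hW⟩ ≠ 0 := by rw [hRW]; exact PauliString.apply_lim_ne_zero hW
  have hbetween : ∀ q : Fin n, W.lim < q → (q : ℕ) < W.removeLow.lim → R q = 0 := by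
    intro q hq hq'
    rw [← h.rest q hq.le]
    have := PauliString.apply_of_lt_lim hq'
    rwa [PauliString.removeLow, if_neg (by omega)] at this
  refine ⟨by simpa using h1, ?_, ?_, ?_, ?_, ?_, ?_⟩
  · rw [List.map_append]
    refine h.seg.append (fun i hi => ?_) ?_
    · rw [h2, Function.update_of_ne]
      rw [zero_add, List.length_map] at hi
      exact hi.ne
    · rw [h2, zero_add, List.length_map, Function.update_self]
  · refine List.nodup_append.2 ⟨h.nodup, List.nodup_singleton _, ?_⟩
    intro a ha b hb
    rw [List.mem_singleton] at hb
    rintro rfl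
    rw [hb] at ha
    exact absurd ((h.mem _).1 ha).2 (lt_irrefl _)
  · intro q
    rw [List.mem_append, List.mem_singleton, h.mem]
    constructor
    · rintro (⟨h4, h5⟩ | rfl)
      · exact ⟨h4, h5.trans hlt⟩
      · exact ⟨hne, hlt⟩
    · rintro ⟨h4, h5⟩
      rcases lt_trichotomy (q : ℕ) W.lim with h6 | h6 | h6
      · exact Or.inl ⟨h4, h6⟩
      · exact Or.inr (Fin.ext h6)
      · exact absurd (hbetween q h6 h5) h4
  · intro q hq
    rw [PauliString.removeLow, if_neg (by omega)]
    exact h.rest q (by omega)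
  · intro q
    rw [h3]
    rcases eq_or_ne (q : ℕ) W.lim with h6 | h6
    · obtain rfl : q = ⟨W.lim, hW⟩ := Fin.ext h6
      simp only [Function.update_self, hlt, if_true, hRW]
      exact PauliString.letter_fin W ⟨W.lim, hW⟩
    · rw [Function.update_of_ne h6, h.str q]
      rcases lt_or_gt_of_ne h6 with h7 | h7
      · rw [if_pos h7, if_pos (h7.trans hlt)]
      · rw [if_neg h7.not_gt]
        split_ifs with h8
        · rw [hbetween q h7 h8]; rfl
        · rfl
  · intro c hc
    rw [h3, Function.update_of_ne (by omega)]
    exact h.zero c hc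

/-- Following the parents strips the letters from below, so loading takes time proportional to the
weight, in contrast to `loadCmd`, which takes time proportional to n. This keeps a factor n out of
the bound for gate-based noise; it requires an empty string array at the start. -/
theorem runs_treeLoadCmd {w m i : ℕ} {S : ℕ → PauliString n} (hclean : s.nat aStr = fun _ => 0)
    (htree : HoldsTree w s m S) (hi : i < m) (hTE : s.nat vTE 0 = i) :
    Runs x treeLoadCmd s fun k s' => k ≤ 5 * (S i).weight + 2 ∧
      (∃ sup, Loaded s' (S i) sup) ∧ ∀ c, n ≤ c → s'.nat aStr c = 0 := by
  simp only [treeLoadCmd, runs_seq, runs_assign, NExp.eval]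
  set s1 := s.setN vSup 0 0 with hs1
  set R := S i with hR
  have := Runs.while (x := x) (b := .natLt (.const 0) (.var vTE)) (s := s1)
    (c := .seq (.setNat aSup (.var vSup) (.read cLim (.var vTE))) <|
    .seq (.assign vSup (.add (.var vSup) (.const 1))) <|
    .seq (.setNat aStr (.read cLim (.var vTE)) (.read cLet (.var vTE))) <|
    .assign vTE (.read cPar (.var vTE))) R.weight
    (fun j t => t.nat vTE 0 < m ∧ (S (t.nat vTE 0)).weight + j = R.weight ∧
      ∃ sup, TreeLoadInv R (S (t.nat vTE 0)) sup t) (fun _ => 4) ?_ ?_ ?_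
  · refine this.mono fun k t ⟨hk, hlt, hw, sup, h⟩ => ?_
    have hW : S (t.nat vTE 0) = 0 := PauliString.weight_eq_zero.1 (by omega)
    rw [hW] at h
    rw [Finset.sum_const, Finset.card_range, smul_eq_mul] at hk
    refine ⟨by omega, ⟨sup, ?_⟩, h.zero⟩
    refine ⟨fun j => ?_, h.card, h.seg, h.nodup, fun j => ?_⟩
    · rw [h.str j, PauliString.lim_zero, if_pos j.2]
    · rw [h.mem, PauliString.lim_zero]
      simp
  · have h1 : s1.nat vTE 0 = i := by simpa [hs1] using hTE
    rw [h1]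
    refine ⟨hi, by rw [hR, Nat.add_zero], [], ?_⟩
    have hcl : s1.nat aStr = fun _ => 0 := by simpa [hs1] using hclean
    refine ⟨by simp [hs1], by simpa using Seg.nil _ _, List.nodup_nil, ?_, fun _ _ => rfl, ?_, ?_⟩
    · intro q
      simp only [List.not_mem_nil, false_iff, not_and, not_lt]
      intro h2
      by_contra h3
      exact h2 (PauliString.apply_of_lt_lim (not_le.1 h3))
    · intro q
      rw [hcl]
      split_ifs with h2
      · have h3 := PauliString.apply_of_lt_lim h2
        rw [← hR] at h3
        rw [h3]; rfl
      · rfl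
    · intro c _
      rw [hcl]
  · intro j t hj hf ⟨hlt, hw, sup, h⟩
    have ht : ∀ a ∈ [31, 32, 33], t.nat a = s.nat a := by
      intro a ha
      rw [hf.1 a (by
        simp only [List.mem_cons, List.not_mem_nil, or_false] at ha
        rcases ha with rfl | rfl | rfl <;> rfl)]
      simp only [List.mem_cons, List.not_mem_nil, or_false] at ha
      rcases ha with rfl | rfl | rfl <;> simp [hs1]
    set e := t.nat vTE 0 with he
    have he0 : 0 < e := by
      by_contra h0
      rw [show e = 0 by omega, htree.root, PauliString.weight_eq_zero.2 rfl] at hw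
      omega
    have hW := htree.lim_lt e he0 hlt
    have hlim : t.nat cLim e = (S e).lim := by rw [ht _ (by simp), htree.lim e hlt]
    have hlet : t.nat cLet e = (S e).letter (S e).lim := by
      rw [ht _ (by simp), htree.letter e he0 hlt]
    have hpar : S (t.nat cPar e) = (S e).removeLow := by
      rw [ht _ (by simp), htree.parent e he0 hlt]
    have hparlt : t.nat cPar e < e := by
      rw [ht _ (by simp)]; exact htree.parent_lt e he0 hlt
    refine ⟨he0, ?_⟩
    simp only [runs_seq, runs_setNat, runs_assign, NExp.eval, NExp.eval_var]
    have hcard := h.card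
    have he' : t.nat 40 0 = e := he.symm
    have hlim' : t.nat 32 e = (S e).lim := hlim
    have hlet' : t.nat 33 e = (S e).letter (S e).lim := hlet
    have hcard' : t.nat 3 0 = sup.length := hcard
    refine ⟨by norm_num, ?_⟩
    set t' := (((t.setN aSup _ _).setN vSup 0 _).setN aStr _ _).setN vTE 0 _ with ht'
    have hTE' : t'.nat vTE 0 = t.nat cPar e := by simp [ht', he']
    rw [hTE', hpar]
    refine ⟨by omega, ?_, _, h.step hW ?_ ?_ ?_⟩
    · have := PauliString.weight_removeLow hW
      omega
    · simp [ht', hcard']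
    · simp [ht', hcard', he', hlim']
    · simp [ht', he', hlim', hlet']
  · intro t _ ⟨hlt, hw, _⟩
    have hW : (S (t.nat vTE 0)).weight = 0 := by omega
    rw [Test.holds, NExp.eval_var, NExp.eval, not_lt]
    by_contra h0
    have h1 := htree.lim_lt _ (not_le.1 h0) hlt
    have := PauliString.weight_removeLow h1
    omega

/-- Only the recorded positions are erased, again in time proportional to the weight, which restores
the empty array that `treeLoadCmd` needs. -/
theorem runs_unloadCmd {R : PauliString n} {sup : List (Fin n)} (h : Loaded s R sup)
    (hz : ∀ c, n ≤ c → s.nat aStr c = 0) :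
    Runs x unloadCmd s fun k s' => k ≤ 3 * sup.length + 2 ∧ s'.nat aStr = fun _ => 0 := by
  simp only [unloadCmd, runs_seq, runs_assign, NExp.eval]
  set s1 := s.setN vU 0 0 with hs1
  refine (Runs.forLoop (x := x) (s := s1) 0 sup.length
    (fun j t => ∀ c, t.nat aStr c = 0 ∨ t.nat aStr c = s.nat aStr c ∧
      ∀ q ∈ sup.take j, (q : ℕ) ≠ c) (fun _ => 1) (by simp [hs1]) rfl ?_ ?_ ?_ ?_).mono ?_
  · intro c
    exact Or.inr ⟨by simp [hs1], by simp⟩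
  · intro t hf
    rw [NExp.eval_var, hf.1 _ rfl, zero_add, ← h.card]
    simp [hs1]
  · intro i t v ht
    simpa using ht
  · intro i t hi hf hv ht
    rw [zero_add] at hv
    rw [runs_setNat]
    refine ⟨le_rfl, fun c => ?_⟩
    have e1 : (NExp.read aSup (.var vU)).eval x t = sup[i] := by
      have h1 := h.seg i (by simpa using hi)
      rw [NExp.eval, NExp.eval_var, hv, hf.1 _ rfl]
      simpa [hs1] using h1
    rw [e1, Memory.setN_nat_self]
    rcases eq_or_ne c sup[i] with h2 | h2
    · left
      simp [h2, NExp.eval]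
    · rw [Function.update_of_ne h2]
      refine (ht c).imp id fun h3 => ⟨h3.1, fun q hq => ?_⟩
      rw [List.take_add_one, List.getElem?_eq_getElem hi] at hq
      rcases List.mem_append.1 hq with h4 | h4
      · exact h3.2 q h4
      · simp only [Option.toList_some, List.mem_singleton] at h4
        rw [h4]; exact h2.symm
  · intro k t ⟨hk, _, ht⟩
    rw [Finset.sum_const, Finset.card_range, smul_eq_mul] at hk
    refine ⟨by omega, funext fun c => ?_⟩
    rcases ht c with h1 | ⟨h1, h2⟩
    · exact h1
    · rw [List.take_length] at h2
      rw [h1]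
      by_cases hc : c < n
      · have h3 : (⟨c, hc⟩ : Fin n) ∉ sup := fun h4 => h2 _ h4 rfl
        rw [h.mem, not_not] at h3
        have := h.string ⟨c, hc⟩
        rw [h3] at this
        exact this
      · exact hz c (not_lt.1 hc)

theorem forTreeCmd_writesNat (c : Cmd) (a : ℕ) (ha : a ∉ [1, 2, 3, 9, 40, 41])
    (hc : c.writesNat a = false) : (forTreeCmd c).writesNat a = false := by
  simp only [List.mem_cons, List.not_mem_nil, not_or] at ha
  simp [forTreeCmd, treeLoadCmd, unloadCmd, Cmd.forLoop, Cmd.assign, Cmd.writesNat, hc, ha]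

theorem forTreeCmd_writesReal (c : Cmd) (a : ℕ) : (forTreeCmd c).writesReal a = c.writesReal a := by
  simp [forTreeCmd, treeLoadCmd, unloadCmd, Cmd.forLoop, Cmd.assign, Cmd.writesReal]

theorem HoldsTree.congr {w m : ℕ} {S : ℕ → PauliString n} {s' : Memory} (h : HoldsTree w s m S)
    (hs : ∀ a ∈ [31, 32, 33, 34, 35], s'.nat a = s.nat a) : HoldsTree w s' m S := by
  constructor
  · exact h.root
  · rw [hs cCode (by simp)]; exact h.code
  · rw [hs cRem (by simp)]; exact h.rem
  · rw [hs cLim (by simp)]; exact h.lim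
  · rw [hs cPar (by simp)]; exact h.parent_lt
  · exact h.lim_lt
  · rw [hs cLet (by simp)]; exact h.letter
  · rw [hs cPar (by simp)]; exact h.parent

/-- Rule for loops over all strings. -/
theorem runs_forTreeCmd {c : Cmd} {w m : ℕ} {S : ℕ → PauliString n}
    (I : ℕ → Memory → Prop) (T : ℕ → ℕ) (hclean : s.nat aStr = fun _ => 0)
    (htree : HoldsTree w s m S) (htail : s.nat vTail 0 = m)
    (hc : ∀ a ∈ [1, 2, 3, 31, 32, 33, 34, 35, 37, 41], c.writesNat a = false)
    (hI : ∀ i t t', t'.real = t.real → (∀ a, a ∉ [1, 2, 3, 9, 40, 41] → t'.nat a = t.nat a) →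
      I i t → I i t')
    (h0 : I 0 s)
    (hbody : ∀ i t sup, i < m → Frame (forTreeCmd c) s t → t.nat vTI 0 = i →
      Loaded t (S i) sup → I i t → Runs x c t fun k t' => k ≤ T i ∧ I (i + 1) t') :
    Runs x (forTreeCmd c) s fun k t => k ≤ ∑ i ∈ Finset.range m, (T i + 8 * (S i).weight + 7) + 2 ∧
      t.nat aStr = (fun _ => 0) ∧ I m t := by
  have hwn : ∀ a, (forTreeCmd c).writesNat a = false → c.writesNat a = false := by
    intro a ha
    simp only [forTreeCmd, Cmd.forLoop, Cmd.writesNat, Bool.or_eq_false_iff] at ha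
    exact ha.2.1.2.2.1
  have hcn : ∀ a ∈ [31, 32, 33, 34, 35, 37], (forTreeCmd c).writesNat a = false := by
    intro a ha
    refine forTreeCmd_writesNat c a ?_ (hc a ?_) <;>
      (simp only [List.mem_cons, List.not_mem_nil, or_false] at ha
       rcases ha with rfl | rfl | rfl | rfl | rfl | rfl <;> decide)
  rw [forTreeCmd, runs_seq, runs_assign]
  have hs1 : Frame (forTreeCmd c) s (s.setN vTI 0 ((NExp.const 0).eval x s)) := by
    refine ⟨fun a ha => Memory.setN_nat_of_ne _ _ _ ?_, fun _ _ => rfl⟩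
    rintro rfl
    simp [forTreeCmd, Cmd.assign, Cmd.writesNat] at ha
  set s1 := s.setN vTI 0 ((NExp.const 0).eval x s) with hs1'
  refine (Runs.forLoop (x := x) (s := s1) 0 m
    (fun i t => t.nat aStr = (fun _ => 0) ∧ I i t) (fun i => T i + 8 * (S i).weight + 5)
    (by simp [hs1', NExp.eval]) ?_ ⟨?_, ?_⟩ ?_ ?_ ?_).mono ?_
  · simp [Cmd.writesNat, treeLoadCmd, unloadCmd, Cmd.forLoop, Cmd.assign, hc 41]
  · simpa [hs1'] using hclean
  · exact hI 0 s _ rfl (fun a ha => Memory.setN_nat_of_ne _ _ _ (by rintro rfl; simp at ha)) h0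
  · intro t hf
    have h1 : (Cmd.forLoop vTI (.var vTail) (.seq (.assign vTE (.var vTI)) <|
        .seq treeLoadCmd <| .seq c unloadCmd)).writesNat vTail = false := by
      have := hcn 37 (by simp)
      rw [forTreeCmd, Cmd.writesNat, Bool.or_eq_false_iff] at this
      exact this.2
    rw [NExp.eval_var, hf.1 _ h1, zero_add, ← htail]
    simp [hs1']
  · intro i t v ⟨h1, h2⟩
    refine ⟨by simpa using h1, ?_⟩
    exact hI i t _ rfl (fun a ha => Memory.setN_nat_of_ne _ _ _ (by rintro rfl; simp at ha)) h2
  · intro i t hi hf hv ⟨hz, hIt⟩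
    have hft : Frame (forTreeCmd c) s t := by
      refine hs1.trans (hf.mono ?_ ?_) <;> intro a ha
      · rw [forTreeCmd, Cmd.writesNat, Bool.or_eq_false_iff] at ha
        exact ha.2
      · rw [forTreeCmd, Cmd.writesReal, Bool.or_eq_false_iff] at ha
        exact ha.2
    rw [zero_add] at hv
    rw [runs_seq, runs_assign, NExp.eval_var, hv]
    set t1 := t.setN vTE 0 i with ht1
    have htree1 : HoldsTree w t1 m S := htree.congr fun a ha => by
      rw [ht1, Memory.setN_nat_of_ne _ _ _ (by rintro rfl; simp at ha)]
      refine hft.1 a (hcn a ?_)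
      simp only [List.mem_cons, List.not_mem_nil, or_false] at ha ⊢
      tauto
    rw [runs_seq]
    refine (runs_treeLoadCmd (by simpa [ht1] using hz) htree1 hi (by simp [ht1])).imp ?_
    intro k t2 ⟨hk, ⟨sup, hL⟩, hz2⟩ hf2
    have hn2 : ∀ a, a ∉ [1, 2, 3, 9, 40, 41] → t2.nat a = t.nat a := by
      intro a ha
      simp only [List.mem_cons, List.not_mem_nil, not_or] at ha
      rw [hf2.1 a (by simp [treeLoadCmd, Cmd.assign, Cmd.writesNat, ha]), ht1,
        Memory.setN_nat_of_ne _ _ _ (by simp [ha])]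
    have hr2 : t2.real = t.real := funext fun a => hf2.2 a rfl
    have hfr2 : Frame (forTreeCmd c) s t2 := by
      refine hft.trans ⟨fun a ha => hn2 a fun h => ?_, fun a _ => by rw [hr2]⟩
      simp only [List.mem_cons, List.not_mem_nil, or_false] at h
      rcases h with rfl | rfl | rfl | rfl | rfl | rfl <;>
        simp [forTreeCmd, treeLoadCmd, unloadCmd, Cmd.forLoop, Cmd.assign, Cmd.writesNat] at ha
    rw [runs_seq]
    refine (hbody i t2 sup hi hfr2 ?_ hL (hI i t t2 hr2 hn2 hIt)).imp ?_
    · rw [hf2.1 41 rfl, ht1, Memory.setN_nat_of_ne _ _ _ (by decide)]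
      exact hv
    intro k' t3 ⟨hk', hI3⟩ hf3
    have hL3 : Loaded t3 (S i) sup := hL.congr (hf3.1 1 (hc _ (by simp)))
      (hf3.1 2 (hc _ (by simp))) (hf3.1 3 (hc _ (by simp)))
    refine (runs_unloadCmd hL3 fun c hc' => ?_).imp ?_
    · rw [hf3.1 1 (hc _ (by simp))]; exact hz2 c hc'
    intro k'' t4 ⟨hk'', hz4⟩ hf4
    rw [hL.length_eq] at hk''
    refine ⟨by omega, hz4, hI _ t3 t4 (funext fun a => hf4.2 a rfl) (fun a ha => hf4.1 a ?_) hI3⟩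
    simp only [List.mem_cons, List.not_mem_nil, not_or] at ha
    simp [unloadCmd, Cmd.forLoop, Cmd.assign, Cmd.writesNat, ha]
  · intro k t ⟨hk, _, hz, hIt⟩
    refine ⟨?_, hz, hIt⟩
    have : ∑ i ∈ Finset.range m, (T i + 8 * (S i).weight + 7) =
      ∑ i ∈ Finset.range m, (T i + 8 * (S i).weight + 5 + 2) := rfl
    omega

end

end

noncomputable section

/-! ### Propagation of the strings of small weight -/

@[simp] abbrev vTau : ℕ := 42
@[simp] abbrev vQ : ℕ := 43
@[simp] abbrev vOff : ℕ := 44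
@[simp] abbrev rW : ℕ := 6
@[simp] abbrev rAcc : ℕ := 7

/-- Find the least weight up to which strings have to be kept. -/
def cutoffCmd : Cmd :=
  .seq (.setReal rX (.const 0) .damping) <| .seq (.assign vL (.const 0)) <|
  .while (.realLt (.const 0) (.mul (.cast (.sub .numQubits (.var vL)))
    (.sub (.mul (.mul (.read rX (.const 0)) (.read rX (.const 0))) (.cast (.add .depth (.const 1))))
      (.mul .accuracy .accuracy)))) <|
    .seq (.setReal rX (.const 0) (.mul (.read rX (.const 0)) .damping))
      (.assign vL (.add (.var vL) (.const 1)))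

/-- Store the coefficient of the present string in the state. -/
def initBody : Cmd := .setReal rW (.add (.read cCode (.var vTI)) (.var vOff)) (.stateCoeff aStr)

/-- Compute the coefficient of the present string before a layer. -/
def layerBody : Cmd :=
  .seq (expandCmd .damping) <| .seq (.setReal rAcc (.const 0) (.const 0)) <|
  .seq (.assign vQ (.var vLo)) <| .seq (.forLoop vQ (.var vHi)
    (.setReal rAcc (.const 0) (.add (.read rAcc (.const 0)) (.mul (.read rCoeff (.var vQ))
      (.read rW (.add (.read aCode (.var vQ)) (.var vOff))))))) <|
  .setReal rW (.add (.read cCode (.var vTI)) (.add (.var vOff) (.read aPow .numQubits)))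
    (.read rAcc (.const 0))

/-- Pass to the next layer. -/
def layerCmd : Cmd :=
  .seq (.assign vLayer (.sub (.sub .depth (.const 1)) (.var vTau))) <|
  .seq (forTreeCmd layerBody) (.assign vOff (.add (.var vOff) (.read aPow .numQubits)))

/-- Pass through all layers. -/
def layersCmd : Cmd := .seq (.assign vTau (.const 0)) (.forLoop vTau .depth layerCmd)

/-- Add the contribution of the present string to the output, and erase it. -/
def outBody : Cmd :=
  .seq (.setReal rOut (.const 0) (.add (.read rOut (.const 0)) (.mul (.obsCoeff aStr)
    (.mul (.read rPow (.var vSup)) (.read rW (.add (.read cCode (.var vTI)) (.var vOff)))))))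
  (.setReal rW (.add (.read cCode (.var vTI)) (.var vOff)) (.const 0))

/-- The simulation that keeps the strings of small weight. -/
def cutSimulateCmd : Cmd :=
  .seq cutoffCmd <| .ite (.natLt (.const 0) (.var vL))
    (.seq setupCmd <| .seq enumerateCmd <| .seq (forTreeCmd initBody) <|
      .seq layersCmd (forTreeCmd outBody))
    (.setReal rOut (.const 0) (.obsCoeff aStr))

section

variable {n d : ℕ} {x : Input n d} {s : Memory}

theorem PauliString.code_lt (Q : PauliString n) : Q.code < 4 ^ n := by
  rw [Q.code_eq]; exact sum_digits_lt _ Q.letter_lt n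

/-- The test is a product: the factor n - `vL` vanishes at n, and the other factor compares
q^(2(vL+1))(d + 1) with ε². One comparison thus implements both stopping rules and needs no square
root. -/
theorem runs_cutoffCmd {w : ℕ} (hwn : w ≤ n)
    (hw : w = n ∨ (x.damping * x.damping ^ w) ^ 2 * (d + 1) ≤ x.accuracy ^ 2)
    (hlt : ∀ i < w, x.accuracy ^ 2 < (x.damping * x.damping ^ i) ^ 2 * (d + 1)) :
    Runs x cutoffCmd s fun k s' => k ≤ 3 * w + 3 ∧ s'.nat vL 0 = w := by
  simp only [cutoffCmd, runs_seq, runs_assign, runs_setReal]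
  set s1 := (s.setR rX _ _).setN vL 0 _ with hs1
  have hb : ∀ i t, i ≤ n → t.nat vL 0 = i → t.real rX 0 = x.damping * x.damping ^ i →
      ((Test.realLt (.const 0) (.mul (.cast (.sub .numQubits (.var vL)))
        (.sub (.mul (.mul (.read rX (.const 0)) (.read rX (.const 0)))
          (.cast (.add .depth (.const 1)))) (.mul .accuracy .accuracy)))).holds x t ↔
      0 < ((n - i : ℕ) : ℝ) * ((x.damping * x.damping ^ i) ^ 2 * (d + 1) - x.accuracy ^ 2)) := by
    intro i t _ h1 h2
    simp only [Test.holds, RExp.eval, NExp.eval, NExp.eval_var, h1, h2]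
    push_cast
    rw [sq, sq]
  refine (Runs.while (x := x) (s := s1) w (fun i s' => s'.nat vL 0 = i ∧
    s'.real rX 0 = x.damping * x.damping ^ i) (fun _ => 2) ?_ ?_ ?_).mono ?_
  · exact ⟨by simp [hs1, NExp.eval], by simp [hs1, NExp.eval, RExp.eval]⟩
  · intro i t hi _ ⟨h1, h2⟩
    have h2' : t.real 5 0 = x.damping * x.damping ^ i := h2
    refine ⟨?_, ?_⟩
    · rw [hb i t (by omega) h1 h2]
      exact mul_pos (Nat.cast_pos.2 (by omega)) (sub_pos.2 (hlt i hi))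
    · simp only [runs_seq, runs_assign, runs_setReal]
      refine ⟨by norm_num, by simp [NExp.eval, h1], ?_⟩
      simp [RExp.eval, NExp.eval, h2', pow_succ, mul_assoc]
  · intro t _ ⟨h1, h2⟩
    rw [hb w t hwn h1 h2, not_lt]
    rcases hw with h | h
    · simp [h]
    · exact mul_nonpos_of_nonneg_of_nonpos (Nat.cast_nonneg _) (sub_nonpos.2 h)
  · intro k s' ⟨hk, h1, _⟩
    rw [Finset.sum_const, Finset.card_range, smul_eq_mul] at hk
    exact ⟨by omega, h1⟩

/-- A loop over all strings that stores a number for each of them. -/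
theorem runs_forTreeCmd_fill {c : Cmd} {w m off : ℕ} {S : ℕ → PauliString n}
    (F : PauliString n → ℝ) (T : ℕ → ℕ) (hclean : s.nat aStr = fun _ => 0)
    (he : Enumerates w m s S)
    (hc : ∀ a ∈ [1, 2, 3, 31, 32, 33, 34, 35, 37, 41], c.writesNat a = false)
    (hbody : ∀ t R sup, Frame (forTreeCmd c) s t → t.nat cCode (t.nat vTI 0) = R.code →
      Loaded t R sup → (∀ a < off, t.real rW a = s.real rW a) →
      Runs x c t fun k t' => k ≤ T R.weight ∧
        t'.real rW = Function.update (t.real rW) (R.code + off) (F R))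
    (hz : ∀ a, off ≤ a → s.real rW a = 0) :
    Runs x (forTreeCmd c) s fun k t =>
      k ≤ ∑ i ∈ Finset.range m, (T (S i).weight + 8 * (S i).weight + 7) + 2 ∧
      t.nat aStr = (fun _ => 0) ∧
      (∀ Q : PauliString n, t.real rW (Q.code + off) = if Q.weight ≤ w then F Q else 0) ∧
      ∀ a, off + 4 ^ n ≤ a → t.real rW a = 0 := by
  have hcode : ∀ t, Frame (forTreeCmd c) s t → t.nat cCode = s.nat cCode := fun t hf =>
    hf.1 _ (forTreeCmd_writesNat c _ (by decide) (hc _ (by simp)))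
  refine (runs_forTreeCmd (x := x) (fun i t =>
    (∀ i' < i, t.real rW ((S i').code + off) = F (S i')) ∧
    ∀ a, (∀ i' < i, a ≠ (S i').code + off) → t.real rW a = s.real rW a)
    (fun i => T (S i).weight) hclean he.tree he.tail hc ?_ ⟨?_, ?_⟩ ?_).mono ?_
  · intro i t t' hr _ h
    rwa [hr]
  · intro i' hi'; omega
  · intro _ _; rfl
  · intro i t sup hi hf hv hL ⟨h1, h2⟩
    refine (hbody t (S i) sup hf ?_ hL ?_).mono fun k t' ⟨hk, ht'⟩ => ⟨hk, ?_, ?_⟩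
    · rw [hcode t hf, hv, he.tree.code i hi]
    · intro a ha
      exact h2 a fun i' _ => by omega
    · intro i' hi'
      rw [ht']
      -- Should a string be listed twice, the same value is written again.
      by_cases hS : S i' = S i
      · rw [hS, Function.update_self]
      · rw [Function.update_of_ne fun h => hS (PauliString.code_injective (by omega))]
        exact h1 i' (lt_of_le_of_ne (by omega) fun h => hS (by rw [h]))
    · intro a ha
      rw [ht', Function.update_of_ne (ha i (by omega))]
      exact h2 a fun i' hi' => ha i' (by omega)
  · intro k t ⟨hk, hz', h1, h2⟩
    refine ⟨hk, hz', fun Q => ?_, fun a ha => ?_⟩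
    · split_ifs with hQ
      · obtain ⟨i, hi, rfl⟩ := he.mem Q hQ
        exact h1 i hi
      · rw [h2, hz _ (by omega)]
        intro i hi h
        have h3 : Q = S i := PauliString.code_injective (by omega)
        have := he.tree.rem i hi
        rw [h3] at hQ
        omega
    · rw [h2, hz a ((Nat.le_add_right _ _).trans ha)]
      intro i _ h
      have := (S i).code_lt
      omega

theorem runs_initCmd {w m : ℕ} {S : ℕ → PauliString n} (hclean : s.nat aStr = fun _ => 0)
    (he : Enumerates w m s S) (hoff : s.nat vOff 0 = 0) (hz : s.real rW = fun _ => 0) :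
    Runs x (forTreeCmd initBody) s fun k t =>
      k ≤ ∑ i ∈ Finset.range m, (1 + 8 * (S i).weight + 7) + 2 ∧ t.nat aStr = (fun _ => 0) ∧
      (∀ Q : PauliString n,
        t.real rW (Q.code + 0) = if Q.weight ≤ w then x.stateCoeff Q else 0) ∧
      ∀ a, 0 + 4 ^ n ≤ a → t.real rW a = 0 := by
  refine runs_forTreeCmd_fill (x := x) x.stateCoeff (fun _ => 1) hclean he ?_ ?_ ?_
  · intro a _; rfl
  · intro t R sup hf hR hL _
    rw [initBody, runs_setReal]
    have e1 : (NExp.add (.read cCode (.var vTI)) (.var vOff)).eval x t = R.code + 0 := by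
      have h : t.nat vOff = s.nat vOff := hf.1 _ (forTreeCmd_writesNat _ _ (by decide) rfl)
      simp only [NExp.eval, NExp.eval_var, hR, h, hoff]
    rw [e1, RExp.eval, readPauli_of_holdsString hL.string]
    exact ⟨le_rfl, by simp⟩
  · intro a _; rw [hz]

theorem layerBody_writesNat (a : ℕ) (ha : a ∉ [5, 6, 7, 9, 10, 11, 12, 13, 14, 15, 16, 43]) :
    layerBody.writesNat a = false := by
  simp only [List.mem_cons, List.not_mem_nil, not_or] at ha
  simp [layerBody, Cmd.forLoop, Cmd.assign, Cmd.writesNat, expandCmd_writesNat, ha]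

theorem layerBody_writesReal (a : ℕ) (ha : a ∉ [1, 2, 6, 7]) : layerBody.writesReal a = false := by
  simp only [List.mem_cons, List.not_mem_nil, not_or] at ha
  simp [layerBody, Cmd.forLoop, Cmd.assign, Cmd.writesReal, expandCmd_writesReal, ha]

/-- One row of the layer matrix times the table of the previous round. The gate noise is already
part of the weights of the list, which is built with the damping factor in place of 1. -/
theorem runs_layerBody {τ : Fin d} {R : PauliString n} {sup : List (Fin n)} {off : ℕ}
    (hlayer : s.nat vLayer 0 = τ) (hR : s.nat cCode (s.nat vTI 0) = R.code) (hL : Loaded s R sup)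
    (hpow : HoldsPow n s) (hoff : s.nat vOff 0 = off) {v : PauliString n → ℝ}
    (hv : ∀ Q : PauliString n, s.real rW (Q.code + off) = v Q) :
    Runs x layerBody s fun k s' => k ≤ 67 * 16 ^ R.weight ∧
      s'.real rW = Function.update (s.real rW) (R.code + (off + 4 ^ n))
        (∑ Q, heis (x.circuit τ).unitary R Q * (x.damping ^ Q.weightOn
          (NoiseModel.gateBased.noisyQubits (x.circuit τ)) * v Q)) := by
  simp only [layerBody, runs_seq, runs_setReal, runs_assign]
  refine (runs_expandCmd (w := x.damping) (fun _ => rfl) hlayer hL hpow).imp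
    fun k1 s1 ⟨hk1, hHi, hl⟩ hf1 => ?_
  set l := (x.circuit τ).expand x.damping R sup with hl'
  have hlen : l.length ≤ 16 ^ R.weight := by
    rw [← hL.length_eq]; exact (x.circuit τ).length_expand_le _
  have hone := Nat.one_le_pow R.weight 16 (by norm_num)
  rw [hL.length_eq] at hk1
  have hn1 : ∀ a, a ∉ [5, 6, 7, 9, 10, 11, 12, 13, 14, 15, 16] → s1.nat a = s.nat a :=
    fun a ha => hf1.1 a (expandCmd_writesNat _ a ha)
  have hW1 : s1.real rW = s.real rW := hf1.2 _ (expandCmd_writesReal _ _ (by decide))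
  set s2 := (s1.setR rAcc _ _).setN vQ 0 _ with hs2
  refine (Runs.forLoop (x := x) (s := s2) (s1.nat vLo 0) l.length (fun i t =>
    t.real rAcc 0 = ((l.take i).map fun y => y.2 * s.real rW (y.1 + off)).sum) (fun _ => 1)
    (by simp [hs2]) rfl ?_ ?_ ?_ ?_).imp ?_
  · simp [hs2, NExp.eval, RExp.eval]
  · intro t hf
    rw [NExp.eval_var, hf.1 _ rfl, ← hHi]
    simp [hs2]
  · intro i t w h
    simpa using h
  · intro i t hi hf hv h
    rw [runs_setReal]
    refine ⟨le_rfl, ?_⟩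
    have e1 : t.nat aCode (s1.nat vLo 0 + i) = l[i].1 := by
      rw [← hl i hi, hf.1 _ rfl]; simp [hs2, Memory.entry]
    have e2 : t.real rCoeff (s1.nat vLo 0 + i) = l[i].2 := by
      rw [← hl i hi, hf.2 _ rfl]; simp [hs2, Memory.entry]
    have e3 : t.real rW = s.real rW := by
      rw [← hW1, hf.2 _ rfl]; simp [hs2]
    have e4 : t.nat vOff 0 = off := by
      rw [← hoff, ← hn1 _ (by decide), hf.1 _ rfl]; simp [hs2]
    rw [List.take_add_one, List.getElem?_eq_getElem hi, List.map_append, List.sum_append, ← h]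
    simp only [Memory.setR_real_self, RExp.eval, NExp.eval, NExp.eval_var, hv, e1, e2, e3, e4,
      Function.update_self]
    simp
  · intro k t ⟨hk, _, h⟩ hf
    rw [Finset.sum_const, Finset.card_range, smul_eq_mul] at hk
    rw [List.take_length, (x.circuit τ).sum_expand x.damping hL.nodup hL.mem
      fun c => s.real rW (c + off)] at h
    refine ⟨by omega, ?_⟩
    have e3 : t.real rW = s.real rW := by rw [← hW1, hf.2 _ rfl]; simp [hs2]
    have e4 : ∀ a, a ∉ [5, 6, 7, 9, 10, 11, 12, 13, 14, 15, 16, 43] → t.nat a = s.nat a := by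
      intro a ha
      simp only [List.mem_cons, List.not_mem_nil, not_or] at ha
      rw [← hn1 a (by simp [ha]), hf.1 a (by simp [Cmd.forLoop, Cmd.writesNat, ha]), hs2,
        Memory.setN_nat_of_ne _ _ _ (by simp [ha]), Memory.setR_nat]
    have e5 : (NExp.add (.read cCode (.var vTI)) (.add (.var vOff) (.read aPow .numQubits))).eval
        x t = R.code + (off + 4 ^ n) := by
      simp only [NExp.eval, NExp.eval_var]
      rw [e4 cCode (by decide), e4 vTI (by decide), e4 vOff (by decide), e4 aPow (by decide), hR,
        hoff, hpow n le_rfl]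
    rw [e5, Memory.setR_real_self, e3]
    congr 1
    have e6 : (RExp.read rAcc (.const 0)).eval x t = t.real rAcc 0 := rfl
    rw [e6, h]
    simp only [hv]

/-- Codes are below 4^n, so shifting the offset by 4^n gives each layer a fresh block of cells. The
old values stay readable, and strings above the cutoff are read as the initial zero, which is
exactly the truncation in `cutVal`. -/
theorem runs_layerCmd {w m off : ℕ} {τ : Fin d} {S : ℕ → PauliString n}
    (hclean : s.nat aStr = fun _ => 0) (he : Enumerates w m s S) (hpow : HoldsPow n s)
    (htau : d - 1 - s.nat vTau 0 = τ) (hoff : s.nat vOff 0 = off) {v : PauliString n → ℝ}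
    (hv : ∀ Q : PauliString n, s.real rW (Q.code + off) = v Q)
    (hz : ∀ a, off + 4 ^ n ≤ a → s.real rW a = 0) :
    Runs x layerCmd s fun k t =>
      k ≤ ∑ i ∈ Finset.range m, (67 * 16 ^ (S i).weight + 8 * (S i).weight + 7) + 4 ∧
      t.nat aStr = (fun _ => 0) ∧ t.nat vOff 0 = off + 4 ^ n ∧
      (∀ Q : PauliString n, t.real rW (Q.code + (off + 4 ^ n)) = if Q.weight ≤ w then
        ∑ R, heis (x.circuit τ).unitary Q R * (x.damping ^ R.weightOn
          (NoiseModel.gateBased.noisyQubits (x.circuit τ)) * v R) else 0) ∧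
      ∀ a, off + 4 ^ n + 4 ^ n ≤ a → t.real rW a = 0 := by
  simp only [layerCmd, runs_seq, runs_assign]
  set s1 := s.setN vLayer 0 _ with hs1
  have h1 : ∀ a, a ≠ 8 → s1.nat a = s.nat a := fun a ha => Memory.setN_nat_of_ne _ _ _ ha
  have hlayer : s1.nat vLayer 0 = τ := by
    rw [hs1, ← htau]; simp [NExp.eval]
  have hw : ∀ a, a ∉ [1, 2, 3, 5, 6, 7, 9, 10, 11, 12, 13, 14, 15, 16, 40, 41, 43] →
      (forTreeCmd layerBody).writesNat a = false := by
    intro a ha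
    simp only [List.mem_cons, List.not_mem_nil, not_or] at ha
    exact forTreeCmd_writesNat _ a (by simp [ha]) (layerBody_writesNat a (by simp [ha]))
  refine (runs_forTreeCmd_fill (x := x) (s := s1) (off := off + 4 ^ n)
    (fun Q => ∑ R, heis (x.circuit τ).unitary Q R * (x.damping ^ R.weightOn
      (NoiseModel.gateBased.noisyQubits (x.circuit τ)) * v R))
    (fun k => 67 * 16 ^ k) (by rw [h1 _ (by decide)]; exact hclean)
    (⟨by rw [h1 _ (by decide)]; exact he.tail, he.tree.congr fun a ha => h1 a ?_, he.mem,
      he.count⟩ : Enumerates w m s1 S) ?_ (fun t R sup hf hR hL ht =>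
      runs_layerBody (τ := τ) (v := v) ?_ hR hL ?_ (off := off) ?_ ?_) hz).imp ?_
  · rintro rfl; simp at ha
  · intro a ha
    refine layerBody_writesNat a fun h => ?_
    simp only [List.mem_cons, List.not_mem_nil, or_false] at ha h
    omega
  · rw [hf.1 _ (hw _ (by decide)), hlayer]
  · rw [HoldsPow, hf.1 _ (hw _ (by decide)), h1 _ (by decide)]
    exact hpow
  · rw [hf.1 _ (hw _ (by decide)), h1 _ (by decide), hoff]
  · intro Q
    rw [ht _ (by have := Q.code_lt; omega)]
    exact hv Q
  · intro k t ⟨hk, hc, h2, h3⟩ hf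
    have e1 : t.nat vOff 0 = off := by rw [hf.1 _ (hw _ (by decide)), h1 _ (by decide), hoff]
    have e2 : t.nat aPow n = 4 ^ n := by
      rw [hf.1 _ (hw _ (by decide)), h1 _ (by decide)]; exact hpow n le_rfl
    refine ⟨by omega, ?_, ?_, h2, h3⟩
    · rw [Memory.setN_nat_of_ne _ _ _ (by decide)]; exact hc
    · simp only [NExp.eval, NExp.eval_var, e1, e2]
      simp

/-- An entry is erased once it has been added, so the output plus the contribution of what is left
in the table is invariant. A repeated string would then add zero, and distinctness of the listed
strings is not needed. -/
theorem runs_outCmd {w m off : ℕ} {S : ℕ → PauliString n} {q : ℝ}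
    (hclean : s.nat aStr = fun _ => 0) (he : Enumerates w m s S) (hq : HoldsNoise n q s)
    (hoff : s.nat vOff 0 = off) {v : PauliString n → ℝ}
    (hv : ∀ Q : PauliString n, s.real rW (Q.code + off) = v Q) (hvw : ∀ Q, w < Q.weight → v Q = 0) :
    Runs x (forTreeCmd outBody) s fun k t =>
      k ≤ ∑ i ∈ Finset.range m, (2 + 8 * (S i).weight + 7) + 2 ∧
      t.real rOut 0 = s.real rOut 0 + ∑ Q, x.obsCoeff Q * (q ^ Q.weight * v Q) := by
  have hw : ∀ a, a ∉ [1, 2, 3, 9, 40, 41] → (forTreeCmd outBody).writesNat a = false :=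
    fun a ha => forTreeCmd_writesNat _ a ha rfl
  refine (runs_forTreeCmd (x := x) (fun i t =>
    t.real rOut 0 + ∑ Q, x.obsCoeff Q * (q ^ Q.weight * t.real rW (Q.code + off)) =
      s.real rOut 0 + ∑ Q, x.obsCoeff Q * (q ^ Q.weight * v Q) ∧
    ∀ Q : PauliString n, ((∃ i' < i, S i' = Q) ∨ w < Q.weight) → t.real rW (Q.code + off) = 0)
    (fun _ => 2) hclean he.tree he.tail (fun _ _ => rfl) ?_ ⟨?_, ?_⟩ ?_).mono ?_
  · intro i t t' hr _ h
    rwa [hr]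
  · simp only [hv]
  · rintro Q (⟨i', hi', _⟩ | h)
    · omega
    · rw [hv, hvw Q h]
  · intro i t sup hi hf hvTI hL ⟨h1, h2⟩
    simp only [outBody, runs_seq, runs_setReal]
    have e1 : t.nat cCode (t.nat vTI 0) + t.nat vOff 0 = (S i).code + off := by
      rw [hf.1 cCode (hw _ (by decide)), hf.1 vOff (hw _ (by decide)), hvTI, he.tree.code i hi, hoff]
    have e2 : t.real rPow (t.nat vSup 0) = q ^ (S i).weight := by
      rw [hL.card, hL.length_eq, hf.2 rPow (by rw [forTreeCmd_writesReal]; rfl)]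
      exact hq _ (S i).weight_le
    have e3 := readPauli_of_holdsString hL.string
    simp only [RExp.eval, NExp.eval, NExp.eval_var, Memory.setR_nat, e1, e2, e3]
    set a0 := (S i).code + off with ha0
    refine ⟨by norm_num, ?_, ?_⟩
    · rw [← h1]
      simp only [Memory.setR_real_self, Memory.setR_real_of_ne _ _ _ (show rOut ≠ rW by decide),
        Memory.setR_real_of_ne _ _ _ (show rW ≠ rOut by decide), Function.update_self]
      rw [add_assoc]
      congr 1
      have e4 : ∀ Q : PauliString n, x.obsCoeff Q * (q ^ Q.weight * t.real rW (Q.code + off)) =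
          (if Q = S i then x.obsCoeff (S i) * (q ^ (S i).weight * t.real rW a0) else 0) +
          x.obsCoeff Q * (q ^ Q.weight * Function.update (t.real rW) a0 ((0 : ℚ) : ℝ)
            (Q.code + off)) := by
        intro Q
        by_cases hQ : Q = S i
        · rw [if_pos hQ, hQ, ← ha0, Function.update_self]
          simp
        · rw [if_neg hQ, Function.update_of_ne, zero_add]
          intro h
          exact hQ (PauliString.code_injective (by omega))
      rw [Finset.sum_congr rfl fun Q _ => e4 Q, Finset.sum_add_distrib]
      simp
    · intro Q hQ
      simp only [Memory.setR_real_self, Memory.setR_real_of_ne _ _ _ (show rW ≠ rOut by decide)]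
      by_cases h : Q = S i
      · rw [h, ← ha0, Function.update_self]; simp
      · rw [Function.update_of_ne fun h' => h (PauliString.code_injective (by omega))]
        refine h2 Q (hQ.imp ?_ id)
        rintro ⟨i', hi', rfl⟩
        exact ⟨i', lt_of_le_of_ne (by omega) fun h' => h (by rw [h']), rfl⟩
  · intro k t ⟨hk, _, h1, h2⟩
    refine ⟨hk, ?_⟩
    rw [← h1, Finset.sum_eq_zero, add_zero]
    intro Q _
    rw [h2 Q, mul_zero, mul_zero]
    by_cases h : w < Q.weight
    · exact Or.inr h
    · exact Or.inl (he.mem Q (by omega))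

end

end

/-! ### The complete program for gate-based noise -/

noncomputable section

section

variable {n d : ℕ} {x : Input n d} {s : Memory}

theorem cutVal_of_lt (q : ℝ) (r : PauliString n → ℝ) {m : ℕ} (ls : List (Op n × (Fin n → Bool)))
    {Q : PauliString n} (h : m < Q.weight) : cutVal q r m ls Q = 0 := by
  cases ls <;> simp [cutVal, h.not_ge]

/-- The time per string is O(16^weight), so the conserved count is taken at D = 16; the overhead is
covered by 8k + 7 ≤ 15 · 16^k. -/
theorem Enumerates.sum_le {w m : ℕ} {S : ℕ → PauliString n} (he : Enumerates w m s S) {a b : ℕ}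
    (T : ℕ → ℕ) (hT : ∀ k, T k ≤ a * 16 ^ k) (hb : b = a + 15) :
    ∑ i ∈ Finset.range m, (T (S i).weight + 8 * (S i).weight + 7) ≤ b * stringCount 16 w n := by
  rw [← he.count, Finset.mul_sum, hb]
  refine Finset.sum_le_sum fun i _ => ?_
  have h1 : ∀ k, 8 * k + 7 ≤ 15 * 16 ^ k := by
    intro k
    induction k with
    | zero => norm_num
    | succ k ih => rw [pow_succ]; omega
  rw [add_mul]
  have := h1 (S i).weight
  have := hT (S i).weight
  omega

theorem Enumerates.congr {w m : ℕ} {S : ℕ → PauliString n} {s' : Memory} (h : Enumerates w m s S)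
    (hs : ∀ a ∈ [31, 32, 33, 34, 35, 37], s'.nat a = s.nat a) : Enumerates w m s' S := by
  refine ⟨by rw [hs vTail (by simp)]; exact h.tail, h.tree.congr fun a ha => hs a ?_, h.mem, h.count⟩
  simp only [List.mem_cons, List.not_mem_nil, or_false] at ha ⊢
  tauto

theorem layerCmd_writesNat (a : ℕ)
    (ha : a ∉ [1, 2, 3, 5, 6, 7, 8, 9, 10, 11, 12, 13, 14, 15, 16, 40, 41, 43, 44]) :
    layerCmd.writesNat a = false := by
  simp only [List.mem_cons, List.not_mem_nil, not_or] at ha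
  have := forTreeCmd_writesNat layerBody a (by simp [ha]) (layerBody_writesNat a (by simp [ha]))
  simp [layerCmd, Cmd.assign, Cmd.writesNat, this, ha]

theorem layerCmd_writesReal (a : ℕ) (ha : a ∉ [1, 2, 6, 7]) : layerCmd.writesReal a = false := by
  have := layerBody_writesReal a ha
  simp [layerCmd, Cmd.assign, Cmd.writesReal, forTreeCmd_writesReal, this]

/-- The layers are visited from the state towards the observable: after i rounds the table holds the
truncated values for the last i entries of the list, the layers that are applied first. -/
theorem runs_layersCmd {w m : ℕ} {S : ℕ → PauliString n}
    (hclean : s.nat aStr = fun _ => 0) (he : Enumerates w m s S) (hpow : HoldsPow n s)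
    (hoff : s.nat vOff 0 = 0)
    (hv : ∀ Q : PauliString n,
      s.real rW (Q.code + 0) = if Q.weight ≤ w then x.stateCoeff Q else 0)
    (hz : ∀ a, 0 + 4 ^ n ≤ a → s.real rW a = 0) :
    Runs x layersCmd s fun k t =>
      k ≤ d * (82 * stringCount 16 w n + 6) + 2 ∧ t.nat aStr = (fun _ => 0) ∧
      ∃ off, t.nat vOff 0 = off ∧ ∀ Q : PauliString n, t.real rW (Q.code + off) =
        cutVal x.damping x.stateCoeff w
          ((List.ofFn x.circuit).map (Layer.data .gateBased)) Q := by
  simp only [layersCmd, runs_seq, runs_assign]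
  set s1 := s.setN vTau 0 _ with hs1
  have hw : ∀ a, a ∉ [1, 2, 3, 5, 6, 7, 8, 9, 10, 11, 12, 13, 14, 15, 16, 40, 41, 42, 43, 44] →
      (Cmd.forLoop vTau .depth layerCmd).writesNat a = false := by
    intro a ha
    simp only [List.mem_cons, List.not_mem_nil, not_or] at ha
    simp [Cmd.forLoop, Cmd.writesNat, ha, layerCmd_writesNat]
  refine (Runs.forLoop (x := x) (s := s1) 0 d (fun i t => t.nat aStr = (fun _ => 0) ∧
    ∃ off, t.nat vOff 0 = off ∧ (∀ a, off + 4 ^ n ≤ a → t.real rW a = 0) ∧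
    ∀ Q : PauliString n, t.real rW (Q.code + off) = cutVal x.damping x.stateCoeff w
      (((List.ofFn x.circuit).drop (d - i)).map (Layer.data .gateBased)) Q)
    (fun _ => 82 * stringCount 16 w n + 4) (by simp [hs1, NExp.eval])
    (layerCmd_writesNat _ (by decide)) ⟨?_, 0, ?_, ?_, ?_⟩ ?_ ?_ ?_).mono ?_
  · simpa [hs1] using hclean
  · simpa [hs1] using hoff
  · exact hz
  · intro Q
    rw [List.drop_of_length_le (by simp), List.map_nil, cutVal]
    exact hv Q
  · intro t _
    simp [NExp.eval]
  · intro i t v h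
    simpa using h
  · intro i t hi hf hvT ⟨h1, off, h2, h3, h4⟩
    rw [zero_add] at hvT
    have h5 : ∀ a, a ∉ [1, 2, 3, 5, 6, 7, 8, 9, 10, 11, 12, 13, 14, 15, 16, 40, 41, 42, 43, 44] →
        t.nat a = s.nat a := by
      intro a ha
      rw [hf.1 a (hw a ha), hs1, Memory.setN_nat_of_ne]
      rintro rfl
      simp at ha
    have het : Enumerates w m t S := he.congr fun a ha => h5 a (by
      simp only [List.mem_cons, List.not_mem_nil, or_false] at ha ⊢; omega)
    refine (runs_layerCmd (τ := ⟨d - 1 - i, by omega⟩) h1 het ?_ (by rw [hvT]) h2 h4 h3).mono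
      fun k t' ⟨hk, g1, g2, g3, g4⟩ => ⟨hk.trans ?_, g1, _, g2, g4, fun Q => ?_⟩
    · rw [HoldsPow, h5 _ (by decide)]; exact hpow
    · exact Nat.add_le_add_right (het.sum_le (a := 67) (fun k => 67 * 16 ^ k)
        (fun _ => le_rfl) rfl) _
    · have e : (List.ofFn x.circuit).drop (d - (i + 1)) =
          x.circuit ⟨d - 1 - i, by omega⟩ :: (List.ofFn x.circuit).drop (d - i) := by
        rw [List.drop_eq_getElem_cons (by simp; omega)]
        simp only [List.getElem_ofFn]
        rw [show d - (i + 1) + 1 = d - i by omega]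
        congr 3
        omega
      rw [g3, e, List.map_cons, cutVal]
      rfl
  · intro k t ⟨hk, _, h1, off, h2, _, h4⟩
    rw [Finset.sum_const, Finset.card_range, smul_eq_mul] at hk
    rw [Nat.sub_self, List.drop_zero] at h4
    refine ⟨?_, h1, off, h2, h4⟩
    have e : 82 * stringCount 16 w n + 4 + 2 = 82 * stringCount 16 w n + 6 := by ring
    rw [e] at hk
    omega

theorem runs_cutSimulateCmd {w : ℕ} (hw0 : 0 < w) (hwn : w ≤ n)
    (hw : w = n ∨ (x.damping * x.damping ^ w) ^ 2 * (d + 1) ≤ x.accuracy ^ 2)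
    (hlt : ∀ i < w, x.accuracy ^ 2 < (x.damping * x.damping ^ i) ^ 2 * (d + 1)) :
    Runs x cutSimulateCmd .init fun k s' =>
      k ≤ 7 * n + 30 + (d + 1) * (82 * stringCount 16 w n + 6) ∧
      s'.real rOut 0 = ∑ Q, x.obsCoeff Q * (x.damping ^ Q.weight *
        cutVal x.damping x.stateCoeff w
          ((List.ofFn x.circuit).map (Layer.data .gateBased)) Q) := by
  rw [cutSimulateCmd, runs_seq]
  refine (runs_cutoffCmd hwn hw hlt).imp fun k1 s1 ⟨hk1, h1⟩ hf1 => ?_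
  rw [runs_ite_of_pos (by rw [Test.holds, NExp.eval_var, h1]; exact hw0), runs_seq]
  refine runs_setupCmd.imp fun k2 s2 ⟨hk2, hp2, hq2⟩ hf2 => ?_
  rw [runs_seq]
  have h2 : s2.nat vL 0 = w := by rw [hf2.1 _ rfl, h1]
  refine (runs_enumerateCmd hp2 h2).imp fun k3 s3 ⟨hk3, m, S, hm, he3⟩ hf3 => ?_
  have hz : ∀ a, a ∉ [4, 18, 28, 31, 32, 33, 34, 35, 36, 37, 38, 39] →
      s3.nat a = fun _ => 0 := by
    intro a ha
    simp only [List.mem_cons, List.not_mem_nil, not_or] at ha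
    rw [hf3.1 a (enumerateCmd_writesNat a (by simp [ha])),
      hf2.1 a (by simp [setupCmd, Cmd.forLoop, Cmd.assign, Cmd.writesNat, ha]),
      hf1.1 a (by simp [cutoffCmd, Cmd.assign, Cmd.writesNat, ha])]
    rfl
  have hzr : ∀ a, a ∉ [4, 5] → s3.real a = fun _ => 0 := by
    intro a ha
    simp only [List.mem_cons, List.not_mem_nil, not_or] at ha
    rw [hf3.2 a (enumerateCmd_writesReal a),
      hf2.2 a (by simp [setupCmd, Cmd.forLoop, Cmd.assign, Cmd.writesReal, ha]),
      hf1.2 a (by simp [cutoffCmd, Cmd.assign, Cmd.writesReal, ha])]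
    rfl
  have hp3 : HoldsPow n s3 := by rw [HoldsPow, hf3.1 _ (enumerateCmd_writesNat _ (by decide))]; exact hp2
  have hq3 : HoldsNoise n x.damping s3 := by rw [HoldsNoise, hf3.2 _ (enumerateCmd_writesReal _)]; exact hq2
  rw [runs_seq]
  refine (runs_initCmd (hz _ (by decide)) he3 (by rw [hz _ (by decide)])
    (hzr _ (by decide))).imp fun k4 s4 ⟨hk4, hc4, hv4, hz4⟩ hf4 => ?_
  have hn4 : ∀ a, a ∉ [1, 2, 3, 9, 40, 41] → s4.nat a = s3.nat a := fun a ha =>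
    hf4.1 a (forTreeCmd_writesNat _ a ha rfl)
  have hr4 : ∀ a, a ≠ 6 → s4.real a = s3.real a := fun a ha => hf4.2 a (by
    rw [forTreeCmd_writesReal]; simp [initBody, Cmd.writesReal, ha])
  have he4 : Enumerates w m s4 S := he3.congr fun a ha => hn4 a (by
    simp only [List.mem_cons, List.not_mem_nil, or_false] at ha ⊢; omega)
  have hp4 : HoldsPow n s4 := by rw [HoldsPow, hn4 _ (by decide)]; exact hp3
  have hsum4 := he4.sum_le (a := 1) (fun _ => 1) (fun k => by simpa using Nat.one_le_pow k 16 (by norm_num)) rfl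
  have hsum6 := he4.sum_le (a := 2) (fun _ => 2) (fun k => by simpa using Nat.one_le_pow k 16 (by norm_num)) rfl
  have h1m : stringCount 1 w n ≤ stringCount 16 w n := by
    rw [← he4.count, ← he4.count]
    exact Finset.sum_le_sum fun i _ => Nat.pow_le_pow_left (by norm_num) _
  rw [runs_seq]
  refine (runs_layersCmd hc4 he4 hp4 (by rw [hn4 _ (by decide), hz _ (by decide)]) hv4 hz4).imp
    fun k5 s5 ⟨hk5, hc5, off, hoff, hv5⟩ hf5 => ?_
  have he5 : Enumerates w m s5 S := he4.congr fun a ha => hf5.1 a (by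
    simp only [List.mem_cons, List.not_mem_nil, or_false] at ha
    have h41 : a ≠ 42 := by omega
    have := layerCmd_writesNat a (by
      simp only [List.mem_cons, List.not_mem_nil, or_false]; omega)
    simp [layersCmd, Cmd.forLoop, Cmd.assign, Cmd.writesNat, this, h41])
  have hr5 : ∀ a, a ∉ [1, 2, 6, 7] → s5.real a = s3.real a := fun a ha => by
    rw [hf5.2 a (by simp [layersCmd, Cmd.forLoop, Cmd.assign, Cmd.writesReal,
      layerCmd_writesReal a ha]), hr4 a (by rintro rfl; simp at ha)]
  refine (runs_outCmd (q := x.damping) hc5 he5 ?_ hoff hv5 fun Q hQ => cutVal_of_lt _ _ _ hQ).mono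
    fun k6 s6 ⟨hk6, h6⟩ => ⟨?_, ?_⟩
  · rw [HoldsNoise, hr5 _ (by decide)]; exact hq3
  · rw [add_mul (d : ℕ) 1]
    omega
  · rw [h6, hr5 _ (by decide), hzr _ (by decide), zero_add]

/-- With cutoff zero only the identity survives, and the program stops after constantly many steps,
before any setup linear in n. This is needed since the exponent of n in the bound may then be zero.
-/
theorem runs_cutSimulateCmd_zero (hn : 0 < n)
    (hw : (x.damping * x.damping ^ 0) ^ 2 * (d + 1) ≤ x.accuracy ^ 2) :
    Runs x cutSimulateCmd .init fun k s' => k ≤ 5 ∧ s'.real rOut 0 = x.obsCoeff 0 := by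
  rw [cutSimulateCmd, runs_seq]
  refine (runs_cutoffCmd (w := 0) hn.le (Or.inr hw) (by simp)).imp fun k s ⟨hk, h1⟩ hf => ?_
  rw [runs_ite_of_neg (by rw [Test.holds, NExp.eval_var, h1]; exact lt_irrefl _), runs_setReal]
  refine ⟨by omega, ?_⟩
  have h2 : readPauli n (s.nat aStr) = 0 := by
    refine readPauli_of_holdsString fun j => ?_
    rw [hf.1 _ rfl]
    rfl
  simp only [aStr] at h2
  simp [NExp.eval, RExp.eval, h2]

theorem sq_cut_error_le {q : ℝ} (h0 : 0 ≤ q) (h1 : q ≤ 1) (m : ℕ) (r : PauliString n → ℝ)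
    (ls : List (Layer n)) (Q : PauliString n) :
    (q ^ Q.weight * exactVal q r (ls.map (Layer.data .gateBased)) Q -
      q ^ Q.weight * cutVal q r m (ls.map (Layer.data .gateBased)) Q) ^ 2 ≤
      (q * q ^ m) ^ 2 * (ls.length + 1) * normSq r := by
  have h := sq_sum_cut_error_le h0 h1 m r ls (Pi.single Q 1)
  have e1 : normSq (Pi.single Q 1 : PauliString n → ℝ) = 1 := by
    rw [normSq, Finset.sum_eq_single Q (fun R _ hR => by simp [hR]) (by simp)]
    simp
  rw [Finset.sum_eq_single Q (fun R _ hR => by simp [hR]) (by simp), e1, Pi.single_eq_same] at h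
  rw [← mul_sub, ← pow_succ']
  simpa using h

end

/-! ### Error and running time for gate-based noise -/

section

variable {Ω : Type*} [MeasurableSpace Ω] {n d : ℕ} {μ : Measure Ω} [IsProbabilityMeasure μ]
  {C : Ω → Circuit n d}

/-- Taking roots and logarithms gives the strict inequality w < (1/γ) log(√(d+1)/ε); strictness is
what yields the - 1 after rounding up. -/
theorem weight_le_ceil {γ ε : ℝ} (hγ : 0 < γ) (hε : 0 < ε) {w : ℕ}
    (h : ε ^ 2 < (Real.exp (-γ) ^ w) ^ 2 * (d + 1)) :
    w ≤ ⌈1 / γ * Real.log (Real.sqrt (d + 1) / ε)⌉₊ - 1 := by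
  have hs : 0 < Real.sqrt ((d : ℝ) + 1) := Real.sqrt_pos.2 (by positivity)
  have h1 : ε < Real.exp (-γ) ^ w * Real.sqrt (d + 1) := by
    refine lt_of_pow_lt_pow_left₀ 2 (by positivity) ?_
    rw [mul_pow, Real.sq_sqrt (by positivity)]
    exact h
  have h2 : Real.exp (γ * w) < Real.sqrt (d + 1) / ε := by
    rw [lt_div_iff₀ hε]
    rw [← Real.exp_nat_mul] at h1
    calc Real.exp (γ * w) * ε < Real.exp (γ * w) * (Real.exp (w * -γ) * Real.sqrt (d + 1)) := by
          gcongr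
      _ = Real.sqrt (d + 1) := by
          rw [← mul_assoc, ← Real.exp_add, show γ * w + w * -γ = 0 by ring, Real.exp_zero, one_mul]
  have h3 := (Real.lt_log_iff_exp_lt (by positivity)).2 h2
  have h4 : (w : ℝ) < 1 / γ * Real.log (Real.sqrt (d + 1) / ε) := by
    rw [one_div, ← div_eq_inv_mul, lt_div_iff₀ hγ]
    linarith
  exact Nat.le_sub_one_of_lt (Nat.lt_ceil.2 h4)

/-- Gate-based noise. -/
theorem simulates_gateBased
    (hC : Measurable fun ω => (C ω).layers .gateBased) {ρ O : Op n} (hρ : IsState ρ)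
    (hO : O.IsHermitian)
    (hdis : HasSpatialDisorder .gateBased μ C ∨ HasSpatialDisorderOn .gateBased μ C ρ) {γ ε : ℝ}
    (hγ : 0 < γ) (hε : 0 < ε) (hn : 0 < n) :
    Simulates cutSimulateCmd .gateBased μ C γ ε ρ O []
      (125 * Real.exp 48 * ((d + 1 : ℝ) *
        (n : ℝ) ^ (⌈1 / γ * Real.log (Real.sqrt (d + 1) / ε)⌉₊ - 1))) := by
  have hq0 := Real.exp_pos (-γ)
  have hq1 : Real.exp (-γ) < 1 := by rw [Real.exp_lt_one_iff]; linarith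
  have hn1 : (1 : ℝ) ≤ n := by exact_mod_cast hn
  have hd1 : (1 : ℝ) ≤ d + 1 := by linarith [(Nat.cast_nonneg d : (0 : ℝ) ≤ d)]
  have hE : 1 ≤ Real.exp 48 := Real.one_le_exp (by norm_num)
  set q := Real.exp (-γ) with hq
  obtain ⟨w, hwn, hw, hlt⟩ : ∃ w ≤ n, (w = n ∨ (q * q ^ w) ^ 2 * (d + 1) ≤ ε ^ 2) ∧
      ∀ i < w, ε ^ 2 < (q * q ^ i) ^ 2 * (d + 1) := by
    classical
    have h : ∃ w, w = n ∨ (q * q ^ w) ^ 2 * ((d : ℝ) + 1) ≤ ε ^ 2 := ⟨n, Or.inl rfl⟩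
    exact ⟨Nat.find h, Nat.find_le (Or.inl rfl), Nat.find_spec h, fun i hi =>
      not_le.1 fun h' => Nat.find_min h hi (Or.inr h')⟩
  refine simulates_of_runs hC hρ hO hdis hε.le
    (fun c r Q => q ^ Q.weight * cutVal q r w (List.ofFn c) Q) (fun c r Q => ?_)
    (fun r Q => (measurable_cutVal _ _ _ _).const_mul _) (fun P c r Q => ?_) ?_ fun ω => ?_
  · rw [cutVal_eq_sum, Finset.mul_sum]
    exact Finset.sum_congr rfl fun R _ => by ring
  · rw [ofFn_conjLayers, cutVal_conj]; ring
  · intro ω r Q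
    rcases hw with rfl | hw
    · rw [exactVal_eq_cutVal q r le_rfl, sub_self]
      simpa using mul_nonneg (sq_nonneg ε) (normSq_nonneg r)
    · rw [ofFn_layers]
      refine (sq_cut_error_le hq0.le hq1.le w r _ Q).trans ?_
      rw [List.length_ofFn]
      exact mul_le_mul_of_nonneg_right hw (normSq_nonneg r)
  · simp only [ofFn_layers]
    rcases Nat.eq_zero_or_pos w with rfl | hw0
    · refine (runs_cutSimulateCmd_zero hn ?_).mono fun k s' ⟨hk, h⟩ => ⟨?_, ?_⟩
      · exact hw.resolve_left hn.ne
      · have hk' : (k : ℝ) ≤ 5 := by exact_mod_cast hk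
        have h1 : 1 * (1 * 1) ≤ Real.exp 48 * ((d + 1 : ℝ) *
            (n : ℝ) ^ (⌈1 / γ * Real.log (Real.sqrt (d + 1) / ε)⌉₊ - 1)) := by
          gcongr
          exact one_le_pow₀ hn1
        linarith
      · rw [h, Finset.sum_eq_single 0, cutVal_zero]
        · have : (ρ * (0 : PauliString n).op).trace = 1 := by
            rw [PauliString.op_zero, mul_one, hρ.2]
          rw [this]
          simp [mkInput, PauliString.weight]
        · intro Q _ hQ
          rw [cutVal_of_lt, mul_zero, mul_zero]
          exact Nat.pos_of_ne_zero fun h => hQ (PauliString.weight_eq_zero.1 h)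
        · simp
    · refine (runs_cutSimulateCmd (x := mkInput (C ω) γ ε ρ O []) hw0 hwn hw hlt).mono
        fun k s' ⟨hk, h⟩ => ⟨?_, h⟩
      have hk' : (k : ℝ) ≤ 7 * n + 30 + (d + 1) * (82 * stringCount 16 w n + 6) := by
        exact_mod_cast hk
      have hS := stringCount_le 16 w hn
      norm_num at hS
      have hwe : w ≤ ⌈1 / γ * Real.log (Real.sqrt (d + 1) / ε)⌉₊ - 1 := by
        refine weight_le_ceil hγ hε ?_
        -- Minimality of the cutoff: the test at w - 1, where the damping is q^w, has failed.
        have := hlt (w - 1) (by omega)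
        rwa [← pow_succ', Nat.sub_add_cancel hw0] at this
      have hpow : (n : ℝ) ^ w ≤ _ := pow_le_pow_right₀ hn1 hwe
      set X := (n : ℝ) ^ (⌈1 / γ * Real.log (Real.sqrt (d + 1) / ε)⌉₊ - 1) with hX
      -- Here w ≥ 1, so the setup time, linear in n, is covered by n^w.
      have hnX : (n : ℝ) ≤ X := (le_self_pow₀ hn1 (by omega)).trans hpow
      have hEX : (n : ℝ) ^ w * Real.exp 48 ≤ X * Real.exp 48 := by gcongr
      have h1 : X ≤ X * Real.exp 48 := le_mul_of_one_le_right (by linarith) hE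
      set Y := X * Real.exp 48 with hY
      have h2 : (d + 1 : ℝ) * (82 * stringCount 16 w n + 6) ≤ (d + 1) * (88 * Y) := by
        refine mul_le_mul_of_nonneg_left ?_ (by linarith)
        linarith
      have h3 : Y ≤ (d + 1) * Y := le_mul_of_one_le_left (by linarith) hd1
      have e : 125 * Real.exp 48 * ((d + 1 : ℝ) * X) = 125 * ((d + 1) * Y) := by rw [hY]; ring
      rw [e]
      linarith

end

end

noncomputable section

/-! ### Observables without a list of terms -/

@[simp] abbrev vEll : ℕ := 45
@[simp] abbrev vMul : ℕ := 46
@[simp] abbrev aMark : ℕ := 47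
@[simp] abbrev vFin : ℕ := 48
@[simp] abbrev vFinHi : ℕ := 49

/-- Move the budget to `vEll`, and divide it by the number of positions of a path. -/
def divideCmd : Cmd :=
  .seq (.assign vEll (.var vL)) <| .seq (.assign vL (.const 0)) <|
  .seq (.assign vMul (.add .depth (.const 1))) <|
  .while (.not (.natLt (.var vEll) (.var vMul))) <|
    .seq (.assign vL (.add (.var vL) (.const 1)))
      (.assign vMul (.add (.var vMul) (.add .depth (.const 1))))

/-- Append all strings of small weight to the list of paths. -/
def pushLightCmd : Cmd :=
  .seq (.assign vTI (.const 0)) <| .forLoop vTI (.var vTail) <|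
    pushCmd (.read cCode (.var vTI)) (.var vEll) (.const 0)

/-- Start paths in all strings of small weight at all positions. -/
def lightCmd : Cmd :=
  .seq pushLightCmd <| .seq (.assign vTau (.const 0)) <| .forLoop vTau .depth <|
    .seq (.assign vLayer (.sub (.sub .depth (.const 1)) (.var vTau))) <|
    .seq extendCmd pushLightCmd

/-- Append the end point of the path `vFin`, with amplitude zero if it has appeared before. -/
def restartBody : Cmd :=
  .seq (.assign vCode (.read bCode (.var vFin))) <| .seq loadCmd <|
  .seq (pushCmd (.read bCode (.var vFin)) (.var vEll)
    (.mul (.sub (.const 1) (.cast (.read aMark (.read bCode (.var vFin))))) (.obsCoeff aStr))) <|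
  .setNat aMark (.read bCode (.var vFin)) (.const 1)

/-- Start new paths in the end points of the paths. -/
def restartCmd : Cmd :=
  .seq (.assign vFin (.var vBLo)) <| .seq (.assign vFinHi (.var vBHi)) <|
  .seq (.assign vBLo (.var vBHi)) <| .forLoop vFin (.var vFinHi) restartBody

/-- List the strings of the observable that can contribute. -/
def seedCmd : Cmd := .seq divideCmd <| .seq enumerateCmd <| .seq lightCmd restartCmd

section

variable {n d : ℕ}

/-- Paths that start in given strings at all positions. -/
def backPaths (q : ℝ) (l : PathList) : List (Layer n) → PathList
  | [] => l
  | L :: ls => Layer.extendPaths q (backPaths q l ls) L ++ l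

/-- Extending does not increase the size, and the starting list is added once at each of the
`ls.length + 1` positions. -/
theorem size_backPaths_le (q : ℝ) (l : PathList) (ls : List (Layer n)) :
    (backPaths q l ls).size ≤ (ls.length + 1) * l.size := by
  induction ls with
  | nil => simp [backPaths]
  | cons L ls ih =>
    rw [backPaths, PathList.size_append, List.length_cons, add_mul, one_mul]
    exact Nat.add_le_add_right ((L.size_extendPaths_le q _).trans ih) _

theorem valid_backPaths (q : ℝ) {l : PathList} (hl : l.Valid n) (ls : List (Layer n)) :
    (backPaths q l ls).Valid n := by
  induction ls with
  | nil => exact hl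
  | cons L ls ih =>
    intro e he
    rcases List.mem_append.1 he with h | h
    · exact L.valid_extendPaths q _ e h
    · exact hl e h

/-- Pigeonhole: a path with total weight below (w + 1) times the number of positions has a string of
weight at most w. Walking from Q, each heavy string uses at least w + 1 of the budget, so the
hypothesis persists until a light string is met, where a listed path starts. The inequality in the
conclusion says that on the way back this path has spent, before Q, no more than b leaves beside Q;
so it can always afford the next extension. -/
theorem exists_mem_backPaths {q : ℝ} {l : PathList} {w ℓ : ℕ}
    (hl : ∀ Q : PauliString n, Q.weight ≤ w → ∃ a, (Q.code, a, ℓ) ∈ l) {p : ℝ}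
    {r : PauliString n → ℝ} (ls : List (Layer n)) {b : ℕ} {Q : PauliString n}
    (hb : b ≤ ℓ) (hbw : b < (w + 1) * (ls.length + 1))
    (h : budgetVal p r (ls.map (Layer.data .uniform)) b Q ≠ 0) :
    ∃ a b', (Q.code, a, b') ∈ backPaths q l ls ∧ ℓ + Q.weight ≤ b' + b := by
  have hQ : Q.weight ≤ b := by
    by_contra h1
    exact h (budgetVal_of_lt _ _ _ (not_le.1 h1))
  have hlight : Q.weight ≤ w → ∃ a b', (Q.code, a, b') ∈ l ∧ ℓ + Q.weight ≤ b' + b := by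
    intro h1
    obtain ⟨a, ha⟩ := hl Q h1
    exact ⟨a, ℓ, ha, by omega⟩
  induction ls generalizing b Q with
  | nil =>
    refine hlight ?_
    simp at hbw
    omega
  | cons L ls ih =>
    rcases Nat.lt_or_ge w Q.weight with h1 | h1
    · simp only [List.map_cons, budgetVal, if_pos hQ] at h
      obtain ⟨R, -, hR⟩ := Finset.exists_ne_zero_of_sum_ne_zero (right_ne_zero_of_mul h)
      have hR' := right_ne_zero_of_mul hR
      have hcomp := L.compatible_of_heis_ne_zero (left_ne_zero_of_mul hR)
      rw [List.length_cons, mul_add, mul_one] at hbw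
      have hRb : R.weight ≤ b - Q.weight := by
        by_contra h2
        exact hR' (budgetVal_of_lt _ _ _ (not_le.1 h2))
      obtain ⟨a, b', h2, h3⟩ := ih (b := b - Q.weight) (by omega) (by omega) hR' hRb fun h4 => by
        obtain ⟨a, ha⟩ := hl R h4
        exact ⟨a, ℓ, ha, by omega⟩
      obtain ⟨a', h4⟩ := L.exists_mem_extendPaths q hcomp h2 (by omega)
      exact ⟨a', _, List.mem_append_left _ h4, by omega⟩
    · obtain ⟨a, b', h2, h3⟩ := hlight h1
      exact ⟨a, b', List.mem_append_right _ h2, h3⟩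

variable {x : Input n d} {s : Memory}

theorem runs_divideCmd {ℓ : ℕ} (hL : s.nat vL 0 = ℓ) :
    Runs x divideCmd s fun k s' => k ≤ 3 * ℓ + 4 ∧ s'.nat vL 0 = ℓ / (d + 1) ∧
      s'.nat vEll 0 = ℓ := by
  simp only [divideCmd, runs_seq, runs_assign, NExp.eval, NExp.eval_var, hL]
  set s1 := ((s.setN vEll 0 ℓ).setN vL 0 0).setN vMul 0 (d + 1) with hs1
  have hE : s1.nat vEll 0 = ℓ := by simp [hs1]
  refine (Runs.while (x := x) (s := s1) (ℓ / (d + 1)) (fun i t => t.nat vL 0 = i ∧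
    t.nat vMul 0 = (i + 1) * (d + 1)) (fun _ => 2) (by simp [hs1]) ?_ ?_).imp ?_
  · intro i t hi hf ⟨h1, h2⟩
    have h3 := (Nat.le_div_iff_mul_le (Nat.succ_pos d)).1 (Nat.succ_le_of_lt hi)
    refine ⟨?_, ?_⟩
    · rw [Test.holds, Test.holds, NExp.eval_var, NExp.eval_var, hf.1 _ rfl, hE, h2]
      exact not_lt.2 h3
    · simp only [runs_seq, runs_assign]
      refine ⟨by norm_num, by simp [NExp.eval, h1], ?_⟩
      have h2' : t.nat 46 0 = (i + 1) * (d + 1) := h2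
      simp [NExp.eval, h2']
      ring
  · intro t hf ⟨h1, h2⟩
    rw [Test.holds, Test.holds, NExp.eval_var, NExp.eval_var, hf.1 _ rfl, hE, h2, not_not]
    exact Nat.lt_mul_of_div_lt (Nat.lt_succ_self _) (Nat.succ_pos d)
  · intro k t ⟨hk, h1, _⟩ hf
    rw [Finset.sum_const, Finset.card_range, smul_eq_mul] at hk
    have := Nat.div_le_self ℓ (d + 1)
    exact ⟨by omega, h1, by rw [hf.1 _ rfl, hE]⟩

/-- The strings of small weight as a list of paths. -/
def lightPaths (m ℓ : ℕ) (S : ℕ → PauliString n) : PathList :=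
  (List.range m).map fun i => ((S i).code, 0, ℓ)

theorem size_lightPaths (m ℓ : ℕ) (S : ℕ → PauliString n) :
    (lightPaths m ℓ S).size = m * 16 ^ ℓ := by
  simp [lightPaths, PathList.size, Function.comp_def]

theorem valid_lightPaths (m ℓ : ℕ) (S : ℕ → PauliString n) : (lightPaths m ℓ S).Valid n := by
  intro e he
  obtain ⟨i, -, rfl⟩ := List.mem_map.1 he
  exact ⟨S i, rfl⟩

theorem pushLightCmd_writesNat (a : ℕ) (ha : a ∉ [20, 21, 23, 41]) :
    pushLightCmd.writesNat a = false := by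
  simp only [List.mem_cons, List.not_mem_nil, not_or] at ha
  simp [pushLightCmd, Cmd.forLoop, Cmd.assign, Cmd.writesNat, pushCmd_writesNat, ha]

theorem runs_pushLightCmd {w m ℓ : ℕ} {S : ℕ → PauliString n} {l : PathList}
    (he : Enumerates w m s S) (hL : s.nat vEll 0 = ℓ) (hl : HoldsPaths s l) :
    Runs x pushLightCmd s fun k s' => k ≤ 6 * m + 2 ∧ HoldsPaths s' (l ++ lightPaths m ℓ S) := by
  simp only [pushLightCmd, runs_seq, runs_assign]
  obtain ⟨hHi, hl⟩ := hl
  set lo := s.nat vBLo 0 with hlo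
  set s1 := s.setN vTI 0 _ with hs1
  have h1 : ∀ a, a ≠ 41 → s1.nat a = s.nat a := fun a ha => Memory.setN_nat_of_ne _ _ _ ha
  refine (Runs.forLoop (x := x) (s := s1) 0 m (fun i t =>
    t.nat vBHi 0 = lo + (l ++ lightPaths i ℓ S).length ∧ Seg t.path lo (l ++ lightPaths i ℓ S))
    (fun _ => 4) (by simp [hs1, NExp.eval]) rfl ⟨?_, ?_⟩ ?_ ?_ ?_).imp ?_
  · rw [h1 _ (by decide), hHi]; simp [lightPaths]
  · rw [hs1, Memory.path_setN _ _ _ (by decide) (by decide)]; simpa [lightPaths] using hl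
  · intro t hf
    rw [NExp.eval_var, hf.1 _ rfl, h1 _ (by decide), he.tail, zero_add]
  · intro i t v h
    rw [Memory.path_setN _ _ _ (by decide) (by decide)]
    simpa using h
  · intro i t hi hf hv ⟨h2, h3⟩
    rw [zero_add] at hv
    have e1 : lightPaths (i + 1) ℓ S = lightPaths i ℓ S ++ [((S i).code, 0, ℓ)] := by
      simp [lightPaths, List.range_succ]
    rw [e1, ← List.append_assoc]
    refine (runs_pushCmd _ h2 h3 (by simp [RExp.eval]) ?_ ?_).mono
      fun k t' h => ⟨h.1.le, h.2.1, h.2.2.1⟩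
    · intro t' ht'
      rw [NExp.eval, NExp.eval_var, ht', hv, hf.1 _ rfl, h1 _ (by decide), he.tree.code i hi]
    · intro t' ht'
      rw [NExp.eval_var, ht' _ (by decide), hf.1 _ rfl, h1 _ (by decide), hL]
  · intro k t ⟨hk, _, h2, h3⟩ hf
    rw [Finset.sum_const, Finset.card_range, smul_eq_mul] at hk
    have h4 : t.nat vBLo 0 = lo := by rw [hf.1 _ rfl, h1 _ (by decide)]
    exact ⟨by omega, by rw [h4, h2], by rw [h4]; exact h3⟩

/-- The layers are taken from the state towards the observable. In each round the paths found so far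
are extended through one layer, and the light strings are added at the new position. -/
theorem runs_lightCmd {w m ℓ : ℕ} {S : ℕ → PauliString n} {q : ℝ}
    (he : Enumerates w m s S) (hL : s.nat vEll 0 = ℓ) (hl : HoldsPaths s [])
    (hpow : HoldsPow n s) (hq : HoldsNoise n q s) :
    Runs x lightCmd s fun k s' =>
      k ≤ (d + 1) * ((10 * n + 77) * ((d + 1) * (m * 16 ^ ℓ)) + 6 * m + 9) + 4 ∧
      HoldsPaths s' (backPaths q (lightPaths m ℓ S) (List.ofFn x.circuit)) := by
  rw [lightCmd, runs_seq]
  refine (runs_pushLightCmd he hL hl).imp fun k1 s1 ⟨hk1, hl1⟩ hf1 => ?_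
  rw [List.nil_append] at hl1
  have h1 : ∀ a, a ∉ [20, 21, 23, 41] → s1.nat a = s.nat a := fun a ha =>
    hf1.1 a (pushLightCmd_writesNat a ha)
  simp only [runs_seq, runs_assign]
  set s2 := s1.setN vTau 0 _ with hs2
  set body : Cmd := .seq (.assign vLayer (.sub (.sub .depth (.const 1)) (.var vTau))) <|
    .seq extendCmd pushLightCmd with hbody
  have hw : ∀ a, a ∉ [1, 2, 3, 5, 6, 7, 8, 9, 10, 11, 12, 13, 14, 15, 16, 17, 18, 19, 20, 21, 22,
      23, 24, 25, 26, 41] → body.writesNat a = false := by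
    intro a ha
    simp only [List.mem_cons, List.not_mem_nil, not_or] at ha
    simp [hbody, Cmd.assign, Cmd.writesNat, extendCmd_writesNat, pushLightCmd_writesNat, ha]
  have hwr : body.writesReal rPow = false := by
    simp [hbody, Cmd.assign, Cmd.writesReal, extendCmd_writesReal, pushLightCmd, Cmd.forLoop,
      pushCmd]
  refine (Runs.forLoop (x := x) (s := s2) 0 d (fun i t => HoldsPaths t
    (backPaths q (lightPaths m ℓ S) ((List.ofFn x.circuit).drop (d - i))))
    (fun _ => (10 * n + 77) * ((d + 1) * (m * 16 ^ ℓ)) + 6 * m + 7) (by simp [hs2, NExp.eval])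
    (hw _ (by decide)) ?_ ?_ ?_ ?_).mono ?_
  · rw [List.drop_of_length_le (by simp), backPaths]
    simpa [hs2, HoldsPaths] using hl1
  · intro t _
    simp [NExp.eval]
  · intro i t v h
    simpa [HoldsPaths] using h
  · intro i t hi hf hvT h
    rw [zero_add] at hvT
    have h2 : ∀ a, a ∉ [1, 2, 3, 5, 6, 7, 8, 9, 10, 11, 12, 13, 14, 15, 16, 17, 18, 19, 20, 21, 22,
        23, 24, 25, 26, 41, 42] → t.nat a = s.nat a := by
      intro a ha
      simp only [List.mem_cons, List.not_mem_nil, not_or] at ha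
      rw [hf.1 a (by simp [Cmd.forLoop, Cmd.writesNat, hw, ha]), hs2,
        Memory.setN_nat_of_ne _ _ _ (by simp [ha]), h1 a (by simp [ha])]
    have hr : t.real rPow = s.real rPow := by
      rw [hf.2 _ (by simpa [Cmd.forLoop, Cmd.writesReal] using hwr), hs2, Memory.setN_real,
        hf1.2 _ rfl]
    rw [hbody, runs_seq, runs_assign]
    set t1 := t.setN vLayer 0 _ with ht1
    have h3 : ∀ a, a ≠ 8 → t1.nat a = t.nat a := fun a ha => Memory.setN_nat_of_ne _ _ _ ha
    set l := backPaths q (lightPaths m ℓ S) ((List.ofFn x.circuit).drop (d - i)) with hl'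
    have hsize : l.size ≤ (d + 1) * (m * 16 ^ ℓ) := by
      rw [← size_lightPaths m ℓ S]
      refine (size_backPaths_le q _ _).trans (Nat.mul_le_mul_right _ ?_)
      simp
    rw [runs_seq]
    refine (runs_extendCmd (t := ⟨d - 1 - i, by omega⟩) (q := q) (l := l) ?_ ?_ ?_ ?_
      (valid_backPaths q (valid_lightPaths m ℓ S) _)).imp fun k2 t2 ⟨hk2, hl2⟩ hf2 => ?_
    · simp only [ht1, NExp.eval, NExp.eval_var, hvT]; simp
    · rw [HoldsPow, h3 _ (by decide), h2 _ (by decide)]; exact hpow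
    · rw [HoldsNoise, ht1, Memory.setN_real, hr]; exact hq
    · simpa [ht1, HoldsPaths] using h
    have h4 : ∀ a ∈ [31, 32, 33, 34, 35, 37, 45], t2.nat a = s.nat a := by
      intro a ha
      simp only [List.mem_cons, List.not_mem_nil, or_false] at ha
      rw [hf2.1 a (extendCmd_writesNat a (by
          simp only [List.mem_cons, List.not_mem_nil, or_false]; omega)),
        h3 a (by omega), h2 a (by
          simp only [List.mem_cons, List.not_mem_nil, or_false]; omega)]
    refine (runs_pushLightCmd (ℓ := ℓ) (he.congr fun a ha => h4 a ?_) (by rw [h4 _ (by simp)]; exact hL)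
      hl2).mono fun k3 t3 ⟨hk3, hl3⟩ => ⟨?_, ?_⟩
    · simp only [List.mem_cons, List.not_mem_nil, or_false] at ha ⊢; omega
    · have := Nat.mul_le_mul_left (10 * n + 77) hsize
      omega
    · have e : (List.ofFn x.circuit).drop (d - (i + 1)) =
          x.circuit ⟨d - 1 - i, by omega⟩ :: (List.ofFn x.circuit).drop (d - i) := by
        rw [List.drop_eq_getElem_cons (by simp; omega)]
        simp only [List.getElem_ofFn]
        rw [show d - (i + 1) + 1 = d - i by omega]
        congr 3
        omega
      rw [e, backPaths]
      exact hl3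
  · intro k t ⟨hk, _, h⟩
    rw [Finset.sum_const, Finset.card_range, smul_eq_mul] at hk
    rw [Nat.sub_self, List.drop_zero] at h
    refine ⟨?_, h⟩
    rw [add_mul d 1]
    have e : ∀ a, d * (a + 7 + 2) = d * (a + 9) := fun a => rfl
    rw [e] at hk
    omega

end

end

/-! ### Candidate strings of an arbitrary observable -/

noncomputable section

section

variable {n d : ℕ} {x : Input n d} {s : Memory}

open Classical in
-- The end points are the candidates for strings of the observable. A string can be reached by
-- several paths: its first occurrence gets its coefficient in O and marks its code, later ones get
-- amplitude 0. Thus each string counts once, without any search in the list.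
theorem runs_restartCmd {ℓ : ℕ} {l : PathList} (hpow : HoldsPow n s) (hL : s.nat vEll 0 = ℓ)
    (hl : HoldsPaths s l) (hval : l.Valid n) (hmark : s.nat aMark = fun _ => 0)
    (v : PauliString n → ℝ) :
    Runs x restartCmd s fun k s' => k ≤ (10 * n + 11) * l.length + 4 ∧
      ∃ l' : PathList, HoldsPaths s' l' ∧ l'.Valid n ∧ l'.size = l.length * 16 ^ ℓ ∧
        (∀ e ∈ l', e.2.2 = ℓ) ∧ (l'.map fun e => e.2.1 * v (decode e.1)).sum =
          ∑ Q, if Q.code ∈ l.map Prod.fst then x.obsCoeff Q * v Q else 0 := by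
  simp only [restartCmd, runs_seq, runs_assign]
  obtain ⟨hHi, hl⟩ := hl
  set lo := s.nat vBLo 0 with hlo
  set s1 := ((s.setN vFin 0 _).setN vFinHi 0 _).setN vBLo 0 _ with hs1
  have h1 : ∀ a, a ≠ 22 → a ≠ 48 → a ≠ 49 → s1.nat a = s.nat a := by
    intro a h h' h''
    simp [hs1, h, h', h'']
  have hp1 : s1.path = s.path := by
    rw [hs1, Memory.path_setN _ _ _ (by decide) (by decide),
      Memory.path_setN _ _ _ (by decide) (by decide),
      Memory.path_setN _ _ _ (by decide) (by decide)]
  have hFinHi : s1.nat vFinHi 0 = lo + l.length := by rw [← hHi]; simp [hs1]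
  have hBLo : s1.nat vBLo 0 = lo + l.length := by rw [← hHi]; simp [hs1]
  refine (Runs.forLoop (x := x) (s := s1) lo l.length (fun i t =>
    (∀ j < lo + l.length, t.path j = s.path j) ∧
    (t.nat aMark = fun c => if c ∈ (l.take i).map Prod.fst then 1 else 0) ∧
    ∃ l' : PathList, t.nat vBHi 0 = lo + l.length + l'.length ∧ Seg t.path (lo + l.length) l' ∧
      l'.Valid n ∧ l'.size = i * 16 ^ ℓ ∧ (∀ e ∈ l', e.2.2 = ℓ) ∧
      (l'.map fun e => e.2.1 * v (decode e.1)).sum =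
        ∑ Q, if Q.code ∈ (l.take i).map Prod.fst then x.obsCoeff Q * v Q else 0)
    (fun _ => 10 * n + 9) (by simp [hs1, hlo]) rfl ⟨?_, ?_, [], ?_, ?_, ?_, ?_, ?_, ?_⟩ ?_ ?_
    ?_).imp ?_
  · intro j _; rw [hp1]
  · rw [h1 _ (by decide) (by decide) (by decide), hmark]; simp
  · rw [h1 _ (by decide) (by decide) (by decide), hHi]; simp
  · exact Seg.nil _ _
  · intro e he; simp at he
  · simp [PathList.size]
  · intro e he; simp at he
  · simp
  · intro t hf
    rw [NExp.eval_var, hf.1 _ rfl, hFinHi]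
  · intro i t w h
    rw [Memory.path_setN _ _ _ (by decide) (by decide)]
    simpa using h
  · intro i t hi hf hv ⟨h2, h3, l', h4, h5, h6, h7, h8, h9⟩
    obtain ⟨R, hR⟩ := hval _ (List.getElem_mem hi)
    have hcode : t.nat bCode (lo + i) = R.code := by
      rw [hR, ← hl i hi]
      exact congrArg Prod.fst (h2 (lo + i) (by omega))
    simp only [restartBody, runs_seq, runs_assign]
    have e1 : (NExp.read bCode (.var vFin)).eval x t = R.code := by
      rw [NExp.eval, NExp.eval_var, hv, hcode]
    rw [e1]
    have hp : HoldsPow n (t.setN vCode 0 R.code) := by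
      rw [HoldsPow, Memory.setN_nat_of_ne _ _ _ (by decide), hf.1 _ rfl,
        h1 _ (by decide) (by decide) (by decide)]
      exact hpow
    refine (runs_loadCmd (R := R) hp (by simp)).imp fun k1 t1 ⟨hk1, hL1⟩ hf1 => ?_
    have g1 : ∀ a, a ∉ [1, 2, 3, 17, 18, 19] → t1.nat a = t.nat a := by
      intro a ha
      rw [hf1.1 a (loadCmd_writesNat a ha), Memory.setN_nat_of_ne]
      rintro rfl
      simp at ha
    have gp : t1.path = t.path :=
      Memory.path_congr (g1 _ (by decide)) (hf1.2 _ rfl) (g1 _ (by decide))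
    have e2 : ∀ t' : Memory, t'.nat = t1.nat → (NExp.read bCode (.var vFin)).eval x t' = R.code := by
      intro t' ht'
      rw [NExp.eval, NExp.eval_var, ht', g1 _ (by decide), g1 _ (by decide), hv, hcode]
    have hEll : t1.nat vEll 0 = ℓ := by
      rw [g1 _ (by decide), hf.1 _ rfl, h1 _ (by decide) (by decide) (by decide), hL]
    set a : ℝ := (1 - ((if R.code ∈ (l.take i).map Prod.fst then 1 else 0 : ℕ) : ℝ)) *
      x.obsCoeff R with ha
    refine (runs_pushCmd (lo := lo + l.length) (l := l') (R.code, a, ℓ) (by rw [g1 _ (by decide), h4]) (by rw [gp]; exact h5)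
      ?_ e2 ?_).imp fun k2 t2 ⟨hk2, k3, k4, k5⟩ hf2 => ?_
    · have e3 : t1.nat aMark ((NExp.read bCode (.var vFin)).eval x t1) =
          if R.code ∈ (l.take i).map Prod.fst then 1 else 0 := by
        rw [e2 t1 rfl, g1 _ (by decide), h3]
      simp only [RExp.eval]
      rw [NExp.eval, e3, readPauli_of_holdsString hL1.string, ha]
      simp
    · intro t' ht'
      rw [NExp.eval_var, ht' _ (by decide), hEll]
    have k5' : ∀ j < lo + l.length, t2.path j = s.path j := fun j hj => by
      rw [k5 j (by omega), gp, h2 j hj]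
    have e4 : (NExp.read bCode (.var vFin)).eval x t2 = R.code := by
      rw [NExp.eval, NExp.eval_var, hf2.1 vFin rfl, g1 _ (by decide), hv, hR, ← hl i hi]
      exact congrArg Prod.fst (k5' (lo + i) (by omega))
    rw [runs_setNat, e4, Memory.path_setN _ _ _ (by decide) (by decide)]
    have e5 : (l.take (i + 1)).map Prod.fst = (l.take i).map Prod.fst ++ [R.code] := by
      rw [List.take_add_one, List.getElem?_eq_getElem hi, List.map_append, hR]; rfl
    refine ⟨by omega, k5', ?_, l' ++ [(R.code, a, ℓ)], ?_, k4, ?_, ?_, ?_, ?_⟩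
    · rw [Memory.setN_nat_self, hf2.1 aMark rfl, g1 _ (by decide), h3, e5]
      funext c
      rcases eq_or_ne c R.code with rfl | hc
      · simp [NExp.eval]
      · simp [hc]
    · rw [Memory.setN_nat_of_ne _ _ _ (by decide), k3]
    · intro e he
      rcases List.mem_append.1 he with h | h
      · exact h6 e h
      · rw [List.mem_singleton.1 h]; exact ⟨R, rfl⟩
    · rw [PathList.size_append, h7]; simp [PathList.size]; ring
    · intro e he
      rcases List.mem_append.1 he with h | h
      · exact h8 e h
      · rw [List.mem_singleton.1 h]
    · rw [List.map_append, List.sum_append, h9, e5]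
      have e6 : ∀ Q : PauliString n, (if Q.code ∈ (l.take i).map Prod.fst ++ [R.code] then
          x.obsCoeff Q * v Q else 0) = (if Q.code ∈ (l.take i).map Prod.fst then
          x.obsCoeff Q * v Q else 0) + if Q = R then a * v R else 0 := by
        intro Q
        by_cases hQ : Q = R
        · subst hQ
          by_cases h : Q.code ∈ (l.take i).map Prod.fst
          · simp only [List.mem_append, h, true_or, if_true, ha]; simp
          · simp only [List.mem_append, h, if_false, ha]; simp
        · have : Q.code ≠ R.code := fun h => hQ (PauliString.code_injective h)
          simp [hQ, this]
      rw [Finset.sum_congr rfl fun Q _ => e6 Q, Finset.sum_add_distrib]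
      simp
  · intro k t ⟨hk, _, _, _, l', h4, h5, h6, h7, h8, h9⟩ hf
    rw [Finset.sum_const, Finset.card_range, smul_eq_mul] at hk
    rw [List.take_length] at h9
    have hlo' : t.nat vBLo 0 = lo + l.length := by rw [hf.1 _ rfl, hBLo]
    refine ⟨?_, l', ⟨by rw [hlo', h4], by rw [hlo']; exact h5⟩, h6, h7, h8, h9⟩
    rw [show l.length * (10 * n + 9 + 2) = (10 * n + 11) * l.length by ring] at hk
    omega

/-- By `exists_mem_backPaths`, strings outside the list have vanishing `budgetVal`, so restricting
the observable to the list changes nothing. The factor 16^ℓ occurs twice in the size: once for the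
paths towards the observable, and once for the new paths, which start with the full budget. -/
theorem runs_seedCmd {ℓ : ℕ} (hpow : HoldsPow n s) (hq : HoldsNoise n x.damping s)
    (hL : s.nat vL 0 = ℓ) (hz : ∀ a, a ∉ [4, 18, 27, 28] → s.nat a = fun _ => 0) :
    Runs x seedCmd s fun k s' =>
      k ≤ 140 * ((n + 1) * ((d + 1) * ((d + 1) * (stringCount 1 (ℓ / (d + 1)) n * 16 ^ ℓ)))) ∧
      ∃ l, HoldsPaths s' l ∧ l.Valid n ∧
        l.size ≤ (d + 1) * (stringCount 1 (ℓ / (d + 1)) n * 16 ^ ℓ) * 16 ^ ℓ ∧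
        l.total x.damping x.stateCoeff (List.ofFn x.circuit) = ∑ Q, x.obsCoeff Q *
          budgetVal x.damping x.stateCoeff
            ((List.ofFn x.circuit).map (Layer.data .uniform)) ℓ Q := by
  classical
  set w := ℓ / (d + 1) with hw
  set M := stringCount 1 w n with hM
  set v : PauliString n → ℝ := fun Q => budgetVal x.damping x.stateCoeff
    ((List.ofFn x.circuit).map (Layer.data .uniform)) ℓ Q with hv
  rw [seedCmd, runs_seq]
  refine (runs_divideCmd hL).imp fun k1 s1 ⟨hk1, hw1, hL1⟩ hf1 => ?_
  have g1 : ∀ a, a ∉ [28, 45, 46] → s1.nat a = s.nat a := by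
    intro a ha
    simp only [List.mem_cons, List.not_mem_nil, not_or] at ha
    exact hf1.1 a (by simp [divideCmd, Cmd.assign, Cmd.writesNat, ha])
  have hp1 : HoldsPow n s1 := by rw [HoldsPow, g1 _ (by decide)]; exact hpow
  rw [runs_seq]
  refine (runs_enumerateCmd hp1 hw1).imp fun k2 s2 ⟨hk2, m, S, hm, he⟩ hf2 => ?_
  have g2 : ∀ a, a ∉ [28, 31, 32, 33, 34, 35, 36, 37, 38, 39, 45, 46] → s2.nat a = s.nat a := by
    intro a ha
    simp only [List.mem_cons, List.not_mem_nil, not_or] at ha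
    rw [hf2.1 a (enumerateCmd_writesNat a (by simp [ha])), g1 a (by simp [ha])]
  have hp2 : HoldsPow n s2 := by rw [HoldsPow, g2 _ (by decide)]; exact hpow
  have hL2 : s2.nat vEll 0 = ℓ := by rw [hf2.1 _ (enumerateCmd_writesNat _ (by decide)), hL1]
  have hq2 : HoldsNoise n x.damping s2 := by
    rw [HoldsNoise, hf2.2 _ (enumerateCmd_writesReal _), hf1.2 _ rfl]; exact hq
  have hl2 : HoldsPaths s2 [] := by
    refine ⟨?_, Seg.nil _ _⟩
    rw [g2 _ (by decide), g2 _ (by decide), hz _ (by decide), hz _ (by decide)]; rfl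
  rw [runs_seq]
  refine (runs_lightCmd he hL2 hl2 hp2 hq2).imp fun k3 s3 ⟨hk3, hl3⟩ hf3 => ?_
  set l := backPaths x.damping (lightPaths m ℓ S) (List.ofFn x.circuit) with hl
  have hlen : l.length ≤ (d + 1) * (M * 16 ^ ℓ) := by
    refine l.length_le_size.trans ((size_backPaths_le _ _ _).trans ?_)
    rw [List.length_ofFn, size_lightPaths]
    exact Nat.mul_le_mul_left _ (Nat.mul_le_mul_right _ hm)
  have g3 : ∀ a, a ∉ [1, 2, 3, 5, 6, 7, 8, 9, 10, 11, 12, 13, 14, 15, 16, 17, 18, 19, 20, 21, 22,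
      23, 24, 25, 26, 41, 42] → s3.nat a = s2.nat a := by
    intro a ha
    simp only [List.mem_cons, List.not_mem_nil, not_or] at ha
    exact hf3.1 a (by
      simp [lightCmd, Cmd.forLoop, Cmd.assign, Cmd.writesNat, extendCmd_writesNat,
        pushLightCmd_writesNat, ha])
  refine (runs_restartCmd (ℓ := ℓ) (by rw [HoldsPow, g3 _ (by decide)]; exact hp2)
    (by rw [g3 _ (by decide), hL2]) hl3 (valid_backPaths _ (valid_lightPaths m ℓ S) _)
    (by rw [g3 _ (by decide), g2 _ (by decide), hz _ (by decide)]) v).mono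
    fun k4 s4 ⟨hk4, l', h1, h2, h3, h4, h5⟩ => ⟨?_, l', h1, h2, ?_, ?_⟩
  · have h16 : ℓ < 16 ^ ℓ := Nat.lt_pow_self (by norm_num)
    have hM1 : 1 ≤ M := stringCount_pos _ _ _
    have hmM : m ≤ M := hm
    have hk2' : k2 ≤ 13 * M + 6 := hk2
    have hd := Nat.mul_le_mul_right (16 ^ ℓ) hmM
    have h6 : M ≤ M * 16 ^ ℓ := Nat.le_mul_of_pos_right _ (by omega)
    have h7 : 16 ^ ℓ ≤ M * 16 ^ ℓ := Nat.le_mul_of_pos_left _ hM1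
    set X := M * 16 ^ ℓ with hX
    have h8 : X ≤ (d + 1) * X := Nat.le_mul_of_pos_left _ (Nat.succ_pos d)
    set Y := (d + 1) * X with hY
    have h9 : Y ≤ (d + 1) * Y := Nat.le_mul_of_pos_left _ (Nat.succ_pos d)
    set Z := (d + 1) * Y with hZ
    have h10 : (d + 1) * ((10 * n + 77) * ((d + 1) * (m * 16 ^ ℓ)) + 6 * m + 9) ≤
        (10 * n + 92) * Z := by
      have : (10 * n + 77) * ((d + 1) * (m * 16 ^ ℓ)) ≤ (10 * n + 77) * Y :=
        Nat.mul_le_mul_left _ (Nat.mul_le_mul_left _ hd)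
      have h13 : 6 * m + 9 ≤ 15 * Y := by omega
      calc _ ≤ (d + 1) * ((10 * n + 92) * Y) := Nat.mul_le_mul_left _ (by
            rw [show (10 * n + 92) * Y = (10 * n + 77) * Y + 15 * Y by ring, add_assoc]
            exact Nat.add_le_add this h13)
        _ = _ := by rw [hZ]; ring
    have h11 : (10 * n + 11) * l.length ≤ (10 * n + 11) * Z :=
      Nat.mul_le_mul_left _ (hlen.trans h9)
    have h12 : 140 * ((n + 1) * Z) =
        (10 * n + 92) * Z + (10 * n + 11) * Z + 120 * (n * Z) + 37 * Z := by ring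
    omega
  · rw [h3]; exact Nat.mul_le_mul_right _ hlen
  · have h6 : l'.total x.damping x.stateCoeff (List.ofFn x.circuit) =
        (l'.map fun e => e.2.1 * v (decode e.1)).sum := by
      rw [PathList.total]
      congr 1
      exact List.map_congr_left fun e he => by rw [h4 e he]
    rw [h6, h5]
    refine Finset.sum_congr rfl fun Q _ => ?_
    split_ifs with h
    · rfl
    -- A nonzero value would mean a path within the budget, hence a light string on it at position
    -- weight ℓ/(d + 1) or less, and Q would have been found.
    · have : v Q = 0 := by
        by_contra h7
        have hlight : ∀ Q : PauliString n, Q.weight ≤ w → ∃ a, (Q.code, a, ℓ) ∈ lightPaths m ℓ S := by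
          intro Q hQ
          obtain ⟨i, hi, rfl⟩ := he.mem Q hQ
          exact ⟨0, List.mem_map.2 ⟨i, List.mem_range.2 hi, rfl⟩⟩
        obtain ⟨a, b', h8, -⟩ := exists_mem_backPaths (q := x.damping) hlight
          (List.ofFn x.circuit) le_rfl (by
            rw [List.length_ofFn]
            exact Nat.lt_mul_of_div_lt (Nat.lt_succ_self _) (Nat.succ_pos d)) h7
        exact h (List.mem_map.2 ⟨_, h8, rfl⟩)
      change 0 = x.obsCoeff Q * v Q
      rw [this, mul_zero]

end

end

/-! ### Running time for uniform noise and arbitrary observables -/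

noncomputable section

theorem Simulates.mono {Ω : Type*} [MeasurableSpace Ω] {n d : ℕ} {μ : Measure Ω}
    {C : Ω → Circuit n d} {c : Cmd} {N : NoiseModel} {γ ε : ℝ} {ρ O : Op n}
    {terms : List (PauliString n × ℝ)} {T T' : ℝ} (h : Simulates c N μ C γ ε ρ O terms T)
    (hT : T ≤ T') : Simulates c N μ C γ ε ρ O terms T' := by
  obtain ⟨out, h1, h2, h3⟩ := h
  refine ⟨out, h1, fun ω => ?_, h3⟩
  obtain ⟨k, h4, h5⟩ := h2 ω
  exact ⟨k, h4.trans hT, h5⟩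

section

variable {Ω : Type*} [MeasurableSpace Ω] {n d : ℕ} {μ : Measure Ω} [IsProbabilityMeasure μ]
  {C : Ω → Circuit n d}

theorem one_le_log_div_rate {γ : ℝ} (hγ : 0 < γ) : 1 ≤ Real.log (1 / rate γ) / rate γ := by
  rw [le_div_iff₀ (rate_pos hγ), one_mul]
  exact (rate_le_half γ).trans (half_le_log hγ)

/-- The weight of the lightest string of a path. -/
theorem div_succ_le {γ ε : ℝ} (hγ : 0 < γ) {ℓ : ℕ} (d : ℕ)
    (h : (ℓ : ℝ) * rate γ ≤ Real.log (1 / ε) + 3 * Real.log (1 / rate γ)) :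
    ((ℓ / (d + 1) : ℕ) : ℝ) + 1 ≤
      4 * (Real.log (1 / rate γ) / rate γ) + Real.log (1 / ε) / (rate γ * (d + 1)) := by
  have h0 := rate_pos hγ
  have hd1 : (0 : ℝ) < d + 1 := by positivity
  have h1 : ((ℓ / (d + 1) : ℕ) : ℝ) ≤ ℓ / (d + 1) := by
    simpa using Nat.cast_div_le (α := ℝ) (m := ℓ) (n := d + 1)
  have hG := one_le_log_div_rate hγ
  have h2 : (ℓ : ℝ) ≤ Real.log (1 / ε) / rate γ + 3 * (Real.log (1 / rate γ) / rate γ) := by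
    rw [← mul_div_assoc, ← add_div, le_div_iff₀ h0]; exact h
  have h3 : (ℓ : ℝ) / (d + 1) ≤ Real.log (1 / ε) / (rate γ * (d + 1)) +
      3 * (Real.log (1 / rate γ) / rate γ) := by
    rw [div_le_iff₀ hd1, add_mul, ← div_div, div_mul_cancel₀ _ hd1.ne']
    have : (0 : ℝ) ≤ d := Nat.cast_nonneg d
    nlinarith
  linarith

/-- Uniform noise, any observable. -/
theorem simulates_seedCmd
    (hC : Measurable fun ω => (C ω).layers .uniform) {ρ O : Op n} (hρ : IsState ρ)
    (hO : O.IsHermitian)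
    (hdis : HasSpatialDisorder .uniform μ C ∨ HasSpatialDisorderOn .uniform μ C ρ) {γ ε : ℝ}
    (hγ : 0 < γ) (hε : 0 < ε) (hε1 : ε ≤ 1) (hn : 0 < n) :
    Simulates (simulateCmd seedCmd) .uniform μ C γ ε ρ O []
      (150 * (280 * Real.exp 3 * (n : ℝ) ^ (4 * (Real.log (1 / rate γ) / rate γ) +
        Real.log (1 / ε) / (rate γ * (d + 1)))) * (1 / ε) ^ ((25 + 1) * rateExponent γ)) := by
  have hn1 : (1 : ℝ) ≤ n := by exact_mod_cast hn
  have h0 := rate_pos hγ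
  have hl0 : 0 ≤ Real.log (1 / ε) := Real.log_nonneg ((one_le_div hε).2 hε1)
  have hG := one_le_log_div_rate hγ
  set p := 4 * (Real.log (1 / rate γ) / rate γ) + Real.log (1 / ε) / (rate γ * (d + 1)) with hp
  have hp1 : 1 ≤ p := by
    have : 0 ≤ Real.log (1 / ε) / (rate γ * (d + 1)) := by positivity
    linarith
  have hE : 1 ≤ Real.exp 3 := Real.one_le_exp (by norm_num)
  have hnp : (n : ℝ) ≤ (n : ℝ) ^ p := by
    simpa using Real.rpow_le_rpow_of_exponent_le hn1 hp1
  refine simulates_simulateCmd hC hρ hO hdis hγ hε hε1 hn ?_ (by norm_num) rfl rfl rfl ?_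
  · nlinarith
  intro ω ℓ hd hb
  obtain ⟨hy1, hdy, hly⟩ := budget_le_of_depth hγ hd hb
  set y := Real.log (1 / ε) * rateExponent γ with hy
  have h16 := sixteen_pow_le_exp hly
  set w := ℓ / (d + 1) with hw
  have hS : (n : ℝ) * stringCount 1 w n ≤ Real.exp 3 * (n : ℝ) ^ p := by
    have h1 := stringCount_le 1 w hn
    -- The factor n of the running time is absorbed here, whence the exponent w + 1.
    have h2 : (n : ℝ) ^ (w + 1) ≤ (n : ℝ) ^ p := by
      rw [← Real.rpow_natCast]
      refine Real.rpow_le_rpow_of_exponent_le hn1 ?_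
      push_cast
      exact div_succ_le hγ d hb
    calc (n : ℝ) * stringCount 1 w n ≤ n * (Real.exp (3 * (1 : ℕ)) * (n : ℝ) ^ w) := by gcongr
      _ = Real.exp 3 * (n : ℝ) ^ (w + 1) := by norm_num [pow_succ]; ring
      _ ≤ _ := by gcongr
  -- A factor d + 1 costs exp y, and each of the two factors 16^ℓ in the size costs exp(12 y):
  -- together the exponent 25.
  have hdE : (d : ℝ) + 1 ≤ Real.exp y := hdy.trans (by linarith [Real.add_one_le_exp y])
  refine ⟨140 * ((n + 1) * ((d + 1) * ((d + 1) * (stringCount 1 w n * 16 ^ ℓ)))),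
    (d + 1) * (stringCount 1 w n * 16 ^ ℓ) * 16 ^ ℓ, ?_, ?_, ?_⟩
  · push_cast
    calc (140 : ℝ) * ((n + 1) * ((d + 1) * ((d + 1) * (stringCount 1 w n * 16 ^ ℓ))))
        ≤ 140 * ((2 * n) * ((d + 1) * ((d + 1) * (stringCount 1 w n * 16 ^ ℓ)))) := by
          gcongr; linarith
      _ = 280 * (n * stringCount 1 w n) * ((d + 1) * (d + 1) * 16 ^ ℓ) := by ring
      _ ≤ 280 * (Real.exp 3 * (n : ℝ) ^ p) * (Real.exp y * Real.exp y * Real.exp (12 * y)) := by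
          gcongr
      _ ≤ 280 * (Real.exp 3 * (n : ℝ) ^ p) * Real.exp (25 * y) := by
          rw [← Real.exp_add, ← Real.exp_add]
          gcongr
          linarith
      _ = _ := by ring
  · push_cast
    calc (n : ℝ) * ((d + 1) * (stringCount 1 w n * 16 ^ ℓ) * 16 ^ ℓ)
        = (n * stringCount 1 w n) * ((d + 1) * 16 ^ ℓ * 16 ^ ℓ) := by ring
      _ ≤ (Real.exp 3 * (n : ℝ) ^ p) * (Real.exp y * Real.exp (12 * y) * Real.exp (12 * y)) := by
          gcongr
      _ = (Real.exp 3 * (n : ℝ) ^ p) * Real.exp (25 * y) := by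
          rw [← Real.exp_add, ← Real.exp_add]; congr 2; ring
      _ ≤ _ := by
          gcongr
          have : 0 < (n : ℝ) ^ p := by positivity
          linarith
  · intro s hpow hq hL hz
    exact (runs_seedCmd (x := mkInput (C ω) γ ε ρ O []) hpow hq hL hz).mono
      fun k s' ⟨hk, l, h⟩ => ⟨hk, l, h⟩

end

end

end NoisyCircuits

/-! ### The three algorithms with their constants -/

theorem mainTheorem11 :
    -- Uniform noise, the observable is given as a sum of Pauli operators.
    (∃ (prog : Cmd) (K : ℝ), ∀ (n d : ℕ), 0 < n →
      ∀ (Ω : Type*) [MeasurableSpace Ω] (μ : Measure Ω) [IsProbabilityMeasure μ]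
        (C : Ω → Circuit n d), Measurable (fun ω => (C ω).layers .uniform) →
      ∀ (ρ O : Op n), IsState ρ → O.IsHermitian →
      (HasSpatialDisorder .uniform μ C ∨ HasSpatialDisorderOn .uniform μ C ρ) →
      ∀ terms : List (PauliString n × ℝ), O = (terms.map fun p => (p.2 : ℂ) • p.1.op).sum →
      ∀ (γ ε : ℝ), 0 < γ → 0 < ε → ε ≤ 1 →
        Simulates prog .uniform μ C γ ε ρ O terms
          (K * ((n : ℝ) + terms.length) ^ K *
            (1 / ε) ^ (K * (Real.log (1 / min γ (1 / 2)) / min γ (1 / 2) ^ 2)))) ∧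
    -- Uniform noise, any observable.
    (∃ (prog : Cmd) (K : ℝ), ∀ (n d : ℕ), 0 < n →
      ∀ (Ω : Type*) [MeasurableSpace Ω] (μ : Measure Ω) [IsProbabilityMeasure μ]
        (C : Ω → Circuit n d), Measurable (fun ω => (C ω).layers .uniform) →
      ∀ (ρ O : Op n), IsState ρ → O.IsHermitian →
      (HasSpatialDisorder .uniform μ C ∨ HasSpatialDisorderOn .uniform μ C ρ) →
      ∀ (γ ε : ℝ), 0 < γ → 0 < ε → ε ≤ 1 →
        Simulates prog .uniform μ C γ ε ρ O []
          (K * (n : ℝ) ^ (K * (Real.log (1 / min γ (1 / 2)) / min γ (1 / 2)) +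
              K * (Real.log (1 / ε) / (min γ (1 / 2) * (d + 1)))) *
            (1 / ε) ^ (K * (Real.log (1 / min γ (1 / 2)) / min γ (1 / 2) ^ 2)))) ∧
    -- Gate-based noise, any observable.
    (∃ (prog : Cmd) (K : ℝ), ∀ (n d : ℕ), 0 < n →
      ∀ (Ω : Type*) [MeasurableSpace Ω] (μ : Measure Ω) [IsProbabilityMeasure μ]
        (C : Ω → Circuit n d), Measurable (fun ω => (C ω).layers .gateBased) →
      ∀ (ρ O : Op n), IsState ρ → O.IsHermitian →
      (HasSpatialDisorder .gateBased μ C ∨ HasSpatialDisorderOn .gateBased μ C ρ) →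
      ∀ (γ ε : ℝ), 0 < γ → 0 < ε →
        Simulates prog .gateBased μ C γ ε ρ O []
          (K * ((d + 1 : ℝ) *
            (n : ℝ) ^ (⌈1 / γ * Real.log (Real.sqrt (d + 1) / ε)⌉₊ - 1)))) := by
  -- One constant serves as factor and as exponent. For listed terms 2100 = 150 · 14 exceeds the
  -- exponents 2 and 13; for arbitrary observables 150 · 280 · e³ exceeds 4 and 26. Enlarging the
  -- exponents is harmless because all bases are at least 1.
  refine ⟨⟨simulateCmd seedTermsCmd, 2100, ?_⟩, ⟨simulateCmd seedCmd, 42000 * Real.exp 3, ?_⟩,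
    ⟨cutSimulateCmd, 125 * Real.exp 48, ?_⟩⟩
  · intro n d hn Ω _ μ _ C hC ρ O hρ hO hdis terms hterms γ ε hγ hε hε1
    refine (simulates_terms hC hρ hO hdis hγ hε hε1 hterms hn).mono ?_
    have h1 : (1 : ℝ) ≤ n + terms.length := by
      have : (1 : ℝ) ≤ n := by exact_mod_cast hn
      have : (0 : ℝ) ≤ terms.length := Nat.cast_nonneg _
      linarith
    rw [show (150 : ℝ) * (14 * ((n : ℝ) + terms.length) ^ 2) =
      2100 * ((n : ℝ) + terms.length) ^ (2 : ℝ) by rw [Real.rpow_two]; ring]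
    have h2 := rateExponent_pos hγ
    refine mul_le_mul (mul_le_mul_of_nonneg_left
      (Real.rpow_le_rpow_of_exponent_le h1 (by norm_num)) (by norm_num))
      (Real.rpow_le_rpow_of_exponent_le ((one_le_div hε).2 hε1)
        (mul_le_mul_of_nonneg_right (by norm_num) h2.le)) (by positivity) (by positivity)
  · intro n d hn Ω _ μ _ C hC ρ O hρ hO hdis γ ε hγ hε hε1
    refine (simulates_seedCmd hC hρ hO hdis hγ hε hε1 hn).mono ?_
    have hn1 : (1 : ℝ) ≤ n := by exact_mod_cast hn
    have hK : (42000 : ℝ) ≤ 42000 * Real.exp 3 :=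
      le_mul_of_one_le_right (by norm_num) (Real.one_le_exp (by norm_num))
    have h0 := rate_pos hγ
    have hl0 : 0 ≤ Real.log (1 / ε) := Real.log_nonneg ((one_le_div hε).2 hε1)
    have hG := one_le_log_div_rate hγ
    have h2 := rateExponent_pos hγ
    have hb : 0 ≤ Real.log (1 / ε) / (rate γ * (d + 1)) := by positivity
    rw [← mul_assoc, ← mul_assoc, show (150 : ℝ) * 280 = 42000 by norm_num]
    refine mul_le_mul (mul_le_mul_of_nonneg_left
      (Real.rpow_le_rpow_of_exponent_le hn1 (add_le_add ?_ ?_)) (by positivity))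
      (Real.rpow_le_rpow_of_exponent_le ((one_le_div hε).2 hε1)
        (mul_le_mul_of_nonneg_right (by linarith) h2.le)) (by positivity) (by positivity)
    · exact mul_le_mul_of_nonneg_right (by linarith) (by linarith)
    · exact le_mul_of_one_le_left hb (by linarith)
  · intro n d hn Ω _ μ _ C hC ρ O hρ hO hdis γ ε hγ hε
    exact simulates_gateBased hC hρ hO hdis hγ hε hn
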